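/- Conventions. All rings are commutative. A $\Lambda$-ring structure on a ring $B$ without additive torsion is a family of ring endomorphisms $\psi^n$ $(n\ge 1)$ with $\psi^1=\mathrm{id}$, $\psi^{m}\psi^{n}=\psi^{mn}$ and $\psi^p(b)\equiv b^p \bmod p$ for all primes $p$; a map of $\Lambda$-rings is a ring homomorphism commuting with all $\psi^n$; an element $x$ has rank $1$ if $\psi^n(x)=x^n$ for all $n$. Throughout, $q$ has rank $1$. The site and $\widehat{q\mathrm{DR}}$. Let $R\to A$ be a flat morphism of $\Lambda$-rings, with $R$ flat over $\mathbb Z$. Let $\widehat{\mathrm{Strat}}{}^q_{A/R}$ be the category of $(q-1)$-adically complete $\Lambda$-rings $B$ over $R[q]$ that are $(q-1)$-completely flat over $R[q]$ (that is, $q-1$ is a non-zero-divisor on $B$ and $B/(q-1)$ is flat over $R$; for $R$ Noetherian this is the same as $B$ being flat over $R[q]$), equipped with a map $A\to B/(q-1)$ over $R$ that admits a lift to a map of $\Lambda$-rings $A\to B$ over $R$; the lift is not part of the data, and morphisms are the maps of $\Lambda$-rings over $R[q]$ compatible with the maps from $A$ modulo $(q-1)$. Let $\widehat{q\mathrm{DR}}(A/R)$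 be the homotopy limit of the functor $B\mapsto B$ from $\widehat{\mathrm{Strat}}{}^q_{A/R}$ to cochain complexes of $R[\![q-1]\!]$-modules. The $q$-de Rham complex. Let $\Box\colon R[x_1,\dots,x_d]\to A$ be a framing, i.e. a formally étale map of $\Lambda$-rings over $R$, where the $x_i$ have rank $1$. Then $\Omega^1_{A/R}$ is free over $A$ on $dx_1,\dots,dx_d$. The endomorphisms $\gamma_i$ of $R[x_1,\dots,x_d][\![q-1]\!]$ given by $\gamma_i(x_j)=q^{\delta_{ij}}x_j$ extend uniquely to $R[\![q-1]\!]$-linear ring endomorphisms $\gamma_i$ of $A[\![q-1]\!]$ that are the identity modulo $(q-1)$. Put $$\nabla_q(f\,dx_I)=\sum_i \nabla_{q,i}(f)\,dx_i\wedge dx_I,\qquad \nabla_{q,i}(f)=\frac{\gamma_i(f)-f}{(q-1)x_i},$$ where, if $x_i$ is a zero-divisor in $A$, the quotient is read through the Taylor expansion: for the unique $R$-algebra map $\tau_i\colon A\to A[\![Y]\!]$ lifting the identity with $\tau_i(x_j)=x_j+\delta_{ij}Y$, and $\tau_i(a)=\sum_n \tau_{i,n}(a)Y^n$, one has $\gamma_i(a)=\sum_n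 \tau_{i,n}(a)x_i^n(q-1)^n$ and $\nabla_{q,i}(a)=\sum_{n\ge 0} \tau_{i,n+1}(a)x_i^{n}(q-1)^{n}$ for $a\in A$. Let $$\widehat{q\text{-}\Omega}{}^{\bullet}_{A/R,\Box}=\bigl(A[\![q-1]\!]\xrightarrow{\nabla_q}\Omega^1_{A/R}[\![q-1]\!]\xrightarrow{\nabla_q}\cdots\xrightarrow{\nabla_q}\Omega^d_{A/R}[\![q-1]\!]\bigr).$$ Write $\mathbf L\eta_{(q-1)}$ for the derived décalage, represented on a $(q-1)$-torsion-free complex $K$ by $(\eta_{(q-1)}K)^n=\{x\in (q-1)^nK^n : dx\in (q-1)^{n+1}K^{n+1}\}$. Proposition. Let $R$ be a $\Lambda$-ring that is flat over $\mathbb Z$, and let $A$ be a flat $\Lambda$-ring over $R$ that admits a framing. For every framing $\Box\colon R[x_1,\dots,x_d]\to A$ there is a zigzag of $R[\![q-1]\!]$-linear quasi-isomorphisms $$\widehat{q\mathrm{DR}}(A/R)\simeq\bigl(\Omega^*_{A/R}[\![q-1]\!],\,(q-1)\nabla_q\bigr)$$ which by décalage, and the isomorphism $\widehat{q\text{-}\Omega}{}^{\bullet}_{A/R,\Box}\cong\eta_{(q-1)}\bigl(\Omega^*_{A/R}[\![q-1]\!],(q-1)\nabla_q\bigr)$,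 $\omega\mapsto (q-1)^n\omega$ in degree $n$, gives a zigzag of $R[\![q-1]\!]$-linear quasi-isomorphisms $$\mathbf L\eta_{(q-1)}\widehat{q\mathrm{DR}}(A/R)\simeq\widehat{q\text{-}\Omega}{}^{\bullet}_{A/R,\Box}.$$ These zigzags can be chosen so that the isomorphisms in the derived category of $R$-modules that they induce by reduction modulo $(q-1)$, $$\widehat{q\mathrm{DR}}(A/R)\otimes^{\mathbf L}_{R[\![q-1]\!]}R\simeq(\Omega^*_{A/R},0),\qquad \bigl(\mathbf L\eta_{(q-1)}\widehat{q\mathrm{DR}}(A/R)\bigr)\otimes^{\mathbf L}_{R[\![q-1]\!]}R\simeq\Omega^{\bullet}_{A/R},$$ do not depend on the framing $\Box$. -/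

import Mathlib

open scoped PowerSeries TensorProduct
open CategoryTheory

universe u v w

noncomputable section

namespace QDeRham

/-- Adams operations: commuting ring endomorphisms `ψⁿ`, multiplicative in `n`, such that `ψᵖ` lifts
the Frobenius endomorphism for every prime `p`. On a ring without additive torsion this is the same
thing as a `Λ`-ring structure. All rings that carry this structure below are torsion-free: they
are flat over `ℤ`, or `(q - 1)`-complete with a `ℤ`-flat reduction modulo a non-zero-divisor `q - 1`. -/
class LambdaRing (A : Type u) [CommRing A] where
  psi : ℕ+ →* (A →+* A)
  frobenius_lift : ∀ p : ℕ+, (p : ℕ).Prime → ∀ a : A, ((p : ℕ) : A) ∣ psi p a - a ^ (p : ℕ)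

open LambdaRing (psi)

/-- Homomorphisms of `Λ`-rings. -/
def IsLambdaHom {A B : Type*} [CommRing A] [CommRing B] [LambdaRing A] [LambdaRing B]
    (f : A →+* B) : Prop := ∀ (n : ℕ+) (a : A), f (LambdaRing.psi n a) = LambdaRing.psi n (f a)

namespace LambdaRing
variable {σ R : Type*} [CommRing R] [LambdaRing R]

/-- The operation `ψⁿ` on `R[xᵢ]` for which the variables have rank one: `ψⁿ(xᵢ) = xᵢⁿ`. -/
def mvPolynomialPsi (σ R : Type*) [CommRing R] [LambdaRing R] (n : ℕ+) :
    MvPolynomial σ R →+* MvPolynomial σ R :=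
  MvPolynomial.eval₂Hom (MvPolynomial.C.comp (psi n)) fun i => MvPolynomial.X i ^ (n : ℕ)

/-- The `Λ`-ring `R[xᵢ]` with the variables of rank one. -/
instance (σ R : Type*) [CommRing R] [LambdaRing R] : LambdaRing (MvPolynomial σ R) where
  psi :=
    { toFun := mvPolynomialPsi σ R
      map_one' := by
        apply MvPolynomial.ringHom_ext <;> intro <;> simp [mvPolynomialPsi]
      map_mul' := fun m n => by
        apply MvPolynomial.ringHom_ext <;> intro <;> simp [mvPolynomialPsi, pow_mul] }
  frobenius_lift p hp f := by
    change ((p : ℕ) : MvPolynomial σ R) ∣ mvPolynomialPsi σ R p f - f ^ (p : ℕ)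
    induction f using MvPolynomial.induction_on with
    | C r =>
      obtain ⟨s, hs⟩ := frobenius_lift p hp r
      refine ⟨MvPolynomial.C s, ?_⟩
      simp only [mvPolynomialPsi, MvPolynomial.coe_eval₂Hom, MvPolynomial.eval₂_C,
        RingHom.comp_apply]
      rw [← map_pow, ← map_sub, hs]
      simp
    | add f g hf hg =>
      obtain ⟨r, hr⟩ := exists_add_pow_prime_eq hp f g
      rw [map_add, hr]
      have := dvd_sub (dvd_add hf hg) (dvd_mul_right ((p : ℕ) : MvPolynomial σ R) (f * g * r))
      convert this using 1
      ring
    | mul_X f i hf =>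
      have : mvPolynomialPsi σ R p (f * MvPolynomial.X i) - (f * MvPolynomial.X i) ^ (p : ℕ) =
          (mvPolynomialPsi σ R p f - f ^ (p : ℕ)) * MvPolynomial.X i ^ (p : ℕ) := by
        rw [map_mul, mul_pow, sub_mul]
        congr 2
        simp [mvPolynomialPsi]
      rw [this]
      exact hf.mul_right _
end LambdaRing

section Holim
variable {C : Type w} [Category.{v} C] {S : Type u} [CommRing S] (G : C ⥤ ModuleCat.{u} S)

/-- The cosimplicial replacement of a functor `G`: in level `n` it is the product of the modules
`G(cₙ)` over all chains `c₀ → ⋯ → cₙ` in `C`. -/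
def cosimplicialReplacement : CosimplicialObject (ModuleCat.{max u v w} S) where
  obj n := ModuleCat.of S ((σ : ComposableArrows C n.len) → G.obj (σ.obj (Fin.last _)))
  map {m n} θ := ModuleCat.ofHom (LinearMap.pi fun σ : ComposableArrows C n.len =>
    (G.map (σ.map (homOfLE (Fin.le_last (θ.toOrderHom (Fin.last m.len)))))).hom ∘ₗ
      LinearMap.proj (φ := fun τ : ComposableArrows C m.len => G.obj (τ.obj (Fin.last _)))
        (σ.whiskerLeft (SimplexCategory.toCat.map θ).toFunctor))
  map_id n := by
    ext f σ
    change (G.map (σ.map (𝟙 _))).hom (f σ) = f σ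
    simp
  map_comp {l m n} θ η := by
    ext f σ
    have key (i j k : Fin (n.len + 1)) (h₁ : i ⟶ j) (h₂ : j ⟶ k) (h₃ : i ⟶ k)
        (y : G.obj (σ.obj i)) : (G.map (σ.map h₃)).hom y =
          (G.map (σ.map h₂)).hom ((G.map (σ.map h₁)).hom y) := by
      rw [Subsingleton.elim h₃ (h₁ ≫ h₂)]
      simp
    exact key _ _ _ (homOfLE (η.toOrderHom.monotone
      (Fin.le_last (θ.toOrderHom (Fin.last l.len))))) _ _ _

/-- The homotopy limit of a diagram of modules, as the cochain complex of the cosimplicial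
replacement (the Bousfield–Kan formula). -/
def holim : CochainComplex (ModuleCat.{max u v w} S) ℕ :=
  (AlgebraicTopology.alternatingCofaceMapComplex _).obj (cosimplicialReplacement G)
end Holim

section Site
variable (R A : Type u) [CommRing R] [CommRing A] [Algebra R A] [LambdaRing R] [LambdaRing A]

/-- The completed `q`-stratifying site of `A` over `R`. We write `q = 1 + X`, so that
`R⟦q - 1⟧` is the ring `R⟦X⟧`. An object is a `Λ`-ring `B` over `R[q]`, where `q` has rank one,
which is `(q - 1)`-adically complete (so that it is an `R⟦q - 1⟧`-algebra in a unique way) and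
`(q - 1)`-completely flat over `R[q]`: the element `q - 1` is a non-zero-divisor on `B`, and
`B / (q - 1)` is flat over `R`. It comes with a map `A → B / (q - 1)` over `R` that lifts to some
map of `Λ`-rings `A → B` over `R`; the lift is not part of the data. -/
structure QStrat where
  carrier : Type u
  [commRing : CommRing carrier]
  [algebra : Algebra R⟦X⟧ carrier]
  [lambdaRing : LambdaRing carrier]
  psi_algebraMap_C (n : ℕ+) (r : R) : psi n (algebraMap R⟦X⟧ carrier (PowerSeries.C r)) =
    algebraMap R⟦X⟧ carrier (PowerSeries.C (psi n r))
  psi_q (n : ℕ+) : psi n (algebraMap R⟦X⟧ carrier (1 + PowerSeries.X)) =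
    algebraMap R⟦X⟧ carrier (1 + PowerSeries.X) ^ (n : ℕ)
  isAdicComplete : IsAdicComplete
    (Ideal.span {algebraMap R⟦X⟧ carrier PowerSeries.X}) carrier
  torsionFree (b : carrier) : algebraMap R⟦X⟧ carrier PowerSeries.X * b = 0 → b = 0
  flat : ((Ideal.Quotient.mk (Ideal.span {algebraMap R⟦X⟧ carrier PowerSeries.X})).comp
    ((algebraMap R⟦X⟧ carrier).comp (PowerSeries.C (R := R)))).Flat
  point : A →+* carrier ⧸ Ideal.span {algebraMap R⟦X⟧ carrier PowerSeries.X}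
  exists_lift : ∃ β : A →+* carrier, IsLambdaHom β ∧
    (∀ r : R, β (algebraMap R A r) = algebraMap R⟦X⟧ carrier (PowerSeries.C r)) ∧
    (Ideal.Quotient.mk _).comp β = point

namespace QStrat
variable {R A}
instance : CoeSort (QStrat R A) (Type u) := ⟨carrier⟩
instance (B : QStrat R A) : CommRing B := B.commRing
instance (B : QStrat R A) : Algebra R⟦X⟧ B := B.algebra
instance (B : QStrat R A) : LambdaRing B := B.lambdaRing

/-- A morphism is a map of `Λ`-rings over `R⟦q - 1⟧` such that the induced map
`B / (q - 1) → C / (q - 1)` is compatible with the maps from `A`. -/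
@[ext] structure Hom (B C : QStrat R A) where
  toAlgHom : B →ₐ[R⟦X⟧] C
  isLambdaHom : IsLambdaHom toAlgHom.toRingHom
  point_comp (a : A) (b : B) : Ideal.Quotient.mk _ b = B.point a →
    Ideal.Quotient.mk _ (toAlgHom b) = C.point a

instance : Category (QStrat R A) where
  Hom := Hom
  id B := ⟨AlgHom.id _ _, fun _ _ => rfl, fun _ _ h => h⟩
  comp f g := ⟨g.toAlgHom.comp f.toAlgHom,
    fun n a => (congrArg g.toAlgHom (f.isLambdaHom n a)).trans (g.isLambdaHom n _),
    fun a b h => g.point_comp a _ (f.point_comp a b h)⟩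

variable (R A) in
/-- The functor `B ↦ B` to modules over `R⟦q - 1⟧`. -/
def forget : QStrat R A ⥤ ModuleCat.{u} R⟦X⟧ where
  obj B := ModuleCat.of R⟦X⟧ B
  map f := ModuleCat.ofHom f.toAlgHom.toLinearMap
end QStrat

/-- The completed complex `q̂DR(A/R)`. -/
def qDR : CochainComplex (ModuleCat.{u + 1} R⟦X⟧) ℕ := holim (QStrat.forget R A)
end Site


namespace DeRham
open KaehlerDifferential ExteriorAlgebra
variable (R A : Type u) [CommRing R] [CommRing A] [Algebra R A]

/-- The algebra of differential forms of `A` over `R`. -/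
abbrev Ext : Type u := ExteriorAlgebra A (Ω[A⁄R])

/-- Pairs of forms, where `a` acts by `a • (w, v) = (a w, a v + d a ∧ w)`. -/
@[ext] structure Tw : Type u where
  fst : Ext R A
  snd : Ext R A

/-- The underlying additive group is that of the product. -/
def Tw.equiv : Tw R A ≃ Ext R A × Ext R A where
  toFun x := (x.fst, x.snd)
  invFun p := ⟨p.1, p.2⟩

instance : AddCommGroup (Tw R A) := (Tw.equiv R A).addCommGroup
instance : Module R (Tw R A) := (Tw.equiv R A).module R

@[simp] theorem Tw.add_fst (x y : Tw R A) : (x + y).1 = x.1 + y.1 := rfl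
@[simp] theorem Tw.add_snd (x y : Tw R A) : (x + y).2 = x.2 + y.2 := rfl
@[simp] theorem Tw.rsmul_fst (r : R) (x : Tw R A) : (r • x).1 = r • x.1 := rfl
@[simp] theorem Tw.rsmul_snd (r : R) (x : Tw R A) : (r • x).2 = r • x.2 := rfl
@[simp] theorem Tw.zero_fst : (0 : Tw R A).1 = 0 := rfl
@[simp] theorem Tw.zero_snd : (0 : Tw R A).2 = 0 := rfl

instance : SMul A (Tw R A) := ⟨fun a x => ⟨a • x.1, a • x.2 + ι A (D R A a) * x.1⟩⟩
@[simp] theorem Tw.smul_fst (a : A) (x : Tw R A) : (a • x).1 = a • x.1 := rfl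
@[simp] theorem Tw.smul_snd (a : A) (x : Tw R A) : (a • x).2 = a • x.2 + ι A (D R A a) * x.1 := rfl

instance : Module A (Tw R A) where
  one_smul x := by ext <;> simp [Tw.smul_fst, Tw.smul_snd]
  mul_smul a b x := by
    ext
    · simp [Tw.smul_fst, mul_smul]
    · simp [Tw.smul_fst, Tw.smul_snd, mul_smul, add_mul]; abel
  smul_zero a := by ext <;> simp [Tw.smul_fst, Tw.smul_snd, Tw.zero_fst, Tw.zero_snd]
  smul_add a x y := by
    ext
    · simp [Tw.smul_fst, Tw.add_fst]
    · simp [Tw.smul_snd, Tw.add_fst, Tw.add_snd, mul_add]; abel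
  add_smul a b x := by
    ext
    · simp [Tw.smul_fst, Tw.add_fst, add_smul]
    · simp [Tw.smul_snd, Tw.add_snd, add_smul, add_mul]; abel
  zero_smul x := by ext <;> simp [Tw.smul_fst, Tw.smul_snd, Tw.zero_fst, Tw.zero_snd]

instance : IsScalarTower R A (Tw R A) where
  smul_assoc r a x := by
    ext
    · simp [Tw.smul_fst, Tw.rsmul_fst]
    · simp [Tw.smul_snd, Tw.rsmul_snd, smul_add]

theorem ι_mul_ι_swap (x y : Ω[A⁄R]) : ι A x * ι A y = - (ι A y * ι A x) := by
  rw [eq_neg_iff_add_eq_zero]; exact ι_add_mul_swap x y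

/-- The derivation `b ↦ (d b, 0)`. -/
def twDer : Derivation R A (Tw R A) where
  toFun b := ⟨ι A (D R A b), 0⟩
  map_add' a b := by ext <;> simp [Tw.add_fst, Tw.add_snd]
  map_smul' r a := by ext <;> simp [Tw.rsmul_fst, Tw.rsmul_snd]
  map_one_eq_zero' := by ext <;> simp [Tw.zero_fst, Tw.zero_snd]
  leibniz' a b := by
    ext
    · simp [Tw.add_fst, Tw.smul_fst]
    · simp [Tw.add_snd, Tw.smul_snd]

/-- The `A`-linear map `ω ↦ (ω, dω)` on one-forms. -/
def twLin : Ω[A⁄R] →ₗ[A] Tw R A := (twDer R A).liftKaehlerDifferential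

theorem twLin_D (a : A) : twLin R A (D R A a) = ⟨ι A (D R A a), 0⟩ :=
  (twDer R A).liftKaehlerDifferential_comp_D a

theorem twLin_fst (w : Ω[A⁄R]) : (twLin R A w).1 = ι A w := by
  have hw : w ∈ Submodule.span A (Set.range (D R A)) := by
    rw [span_range_derivation]; trivial
  induction hw using Submodule.span_induction with
  | mem x hx => obtain ⟨a, rfl⟩ := hx; rw [twLin_D]
  | zero => simp [Tw.zero_fst]
  | add x y _ _ hx hy => simp [Tw.add_fst, hx, hy]
  | smul a x _ hx => simp [Tw.smul_fst, hx]

/-- The exterior derivative on one-forms. -/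
def d1 (w : Ω[A⁄R]) : Ext R A := (twLin R A w).2

theorem d1_add (v w : Ω[A⁄R]) : d1 R A (v + w) = d1 R A v + d1 R A w := by
  simp [d1, Tw.add_snd]
theorem d1_smul (a : A) (w : Ω[A⁄R]) : d1 R A (a • w) = a • d1 R A w + ι A (D R A a) * ι A w := by
  simp [d1, Tw.smul_snd, twLin_fst]
theorem d1_D (a : A) : d1 R A (D R A a) = 0 := by simp [d1, twLin_D]
theorem d1_zero : d1 R A 0 = 0 := by simp [d1, Tw.zero_snd]

theorem d1_comm (w v : Ω[A⁄R]) : d1 R A w * ι A v = ι A v * d1 R A w := by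
  have hw : w ∈ Submodule.span A (Set.range (D R A)) := by
    rw [span_range_derivation]; trivial
  induction hw using Submodule.span_induction with
  | mem x hx => obtain ⟨a, rfl⟩ := hx; simp [d1_D]
  | zero => simp [d1_zero]
  | add x y _ _ hx hy => simp [d1_add, add_mul, mul_add, hx, hy]
  | smul a x _ hx =>
    simp only [d1_smul, add_mul, mul_add, smul_mul_assoc, mul_smul_comm, hx]
    congr 1
    rw [mul_assoc, ι_mul_ι_swap R A x v, mul_neg, ← mul_assoc, ι_mul_ι_swap R A _ v, neg_mul,
      neg_neg, mul_assoc]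

theorem d1_mem (w : Ω[A⁄R]) : d1 R A w ∈ LinearMap.range (ι A : Ω[A⁄R] →ₗ[A] Ext R A) ^ 2 := by
  have hw : w ∈ Submodule.span A (Set.range (D R A)) := by
    rw [span_range_derivation]; trivial
  induction hw using Submodule.span_induction with
  | mem x hx => obtain ⟨a, rfl⟩ := hx; simp [d1_D]
  | zero => simp [d1_zero]
  | add x y _ _ hx hy => rw [d1_add]; exact add_mem hx hy
  | smul a x _ hx =>
    rw [d1_smul]
    refine add_mem (Submodule.smul_mem _ _ hx) ?_
    rw [pow_two]
    exact Submodule.mul_mem_mul ⟨_, rfl⟩ ⟨_, rfl⟩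

/-- The operator `(w, v) ↦ (x ∧ w, d x ∧ w - x ∧ v)`. -/
def twMul (x : Ω[A⁄R]) : Module.End A (Tw R A) where
  toFun p := ⟨ι A x * p.1, d1 R A x * p.1 - ι A x * p.2⟩
  map_add' p q := by
    ext
    · simp [Tw.add_fst, mul_add]
    · simp only [Tw.add_fst, Tw.add_snd, mul_add]; abel
  map_smul' a p := by
    ext
    · simp [Tw.smul_fst]
    · simp only [Tw.smul_fst, Tw.smul_snd, mul_add, RingHom.id_apply, mul_smul_comm,
        ← mul_assoc, ι_mul_ι_swap R A x (D R A a), smul_sub]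
      simp only [neg_mul]; abel

/-- Left exterior multiplication, linear for the twisted action. -/
def twMulLin : Ω[A⁄R] →ₗ[A] Module.End A (Tw R A) where
  toFun := twMul R A
  map_add' x y := by
    ext p
    · simp [twMul, Tw.add_fst, add_mul]
    · simp only [twMul, d1_add, map_add, add_mul, LinearMap.add_apply, Tw.add_snd]
      simp; abel
  map_smul' a x := by
    ext p
    · simp [twMul, Tw.smul_fst]
    · simp only [twMul, d1_smul, map_smul, add_mul, LinearMap.smul_apply, Tw.smul_snd,
        RingHom.id_apply]
      simp [smul_sub, mul_assoc]; abel

theorem twMulLin_sq (x : Ω[A⁄R]) : twMulLin R A x * twMulLin R A x = 0 := by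
  ext p
  · change ι A x * (ι A x * p.1) = 0
    rw [← mul_assoc, ι_sq_zero, zero_mul]
  · change d1 R A x * (ι A x * p.1) - ι A x * (d1 R A x * p.1 - ι A x * p.2) = 0
    rw [mul_sub, ← mul_assoc, ← mul_assoc, ← mul_assoc, ι_sq_zero, d1_comm]
    simp

/-- The algebra map sending a form `w` to an operator taking `(1, 0)` to `(w, d w)`. -/
def twAct : Ext R A →ₐ[A] Module.End A (Tw R A) :=
  ExteriorAlgebra.lift A ⟨twMulLin R A, twMulLin_sq R A⟩

/-- The exterior derivative on all differential forms. -/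
def extd (w : Ext R A) : Ext R A := (twAct R A w ⟨1, 0⟩).2

theorem twAct_ι_mul (x : Ω[A⁄R]) (w : Ext R A) (p : Tw R A) :
    twAct R A (ι A x * w) p = twMul R A x (twAct R A w p) := by
  rw [map_mul, twAct, lift_ι_apply]; rfl

theorem twAct_fst (w : Ext R A) : (twAct R A w ⟨1, 0⟩).1 = w := by
  induction w using CliffordAlgebra.left_induction with
  | algebraMap r =>
    rw [AlgHom.commutes]
    change r • (1 : Ext R A) = _
    rw [Algebra.algebraMap_eq_smul_one]
  | add x y hx hy => rw [map_add, LinearMap.add_apply, Tw.add_fst, hx, hy]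
  | ι_mul x m hx =>
    change (twAct R A (ι A m * x) _).1 = ι A m * x
    rw [twAct_ι_mul]
    change ι A m * _ = _
    rw [hx]

theorem extd_add (v w : Ext R A) : extd R A (v + w) = extd R A v + extd R A w := by
  simp [extd, Tw.add_snd]

theorem extd_smul (a : A) (w : Ext R A) :
    extd R A (a • w) = a • extd R A w + ι A (D R A a) * w := by
  rw [extd, map_smul, LinearMap.smul_apply, Tw.smul_snd, twAct_fst]; rfl

theorem extd_ι_mul (x : Ω[A⁄R]) (w : Ext R A) :
    extd R A (ι A x * w) = d1 R A x * w - ι A x * extd R A w := by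
  rw [extd, twAct_ι_mul]
  change d1 R A x * _ - ι A x * _ = _
  rw [twAct_fst]; rfl

theorem extd_one : extd R A 1 = 0 := by simp [extd]

theorem extd_rsmul (r : R) (w : Ext R A) : extd R A (r • w) = r • extd R A w := by
  rw [← algebraMap_smul A r w, extd_smul]; simp

theorem extd_mem (n : ℕ) {w : Ext R A} (hw : w ∈ ⋀[A]^n (Ω[A⁄R])) :
    extd R A w ∈ ⋀[A]^(n + 1) (Ω[A⁄R]) := by
  induction n generalizing w with
  | zero =>
    rw [exteriorPower, pow_zero] at hw
    obtain ⟨a, rfl⟩ := Submodule.mem_one.1 hw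
    rw [Algebra.algebraMap_eq_smul_one, extd_smul, extd_one, smul_zero, zero_add, mul_one,
      exteriorPower, zero_add, pow_one]
    exact ⟨_, rfl⟩
  | succ n ih =>
    rw [exteriorPower, pow_succ'] at hw
    induction hw using Submodule.mul_induction_on' with
    | mem_mul_mem x hx y hy =>
      obtain ⟨x, rfl⟩ := hx
      rw [extd_ι_mul, exteriorPower]
      refine sub_mem ?_ ?_
      · rw [show n + 1 + 1 = 2 + n by omega, pow_add]
        exact Submodule.mul_mem_mul (d1_mem R A x) hy
      · rw [pow_succ']
        exact Submodule.mul_mem_mul ⟨_, rfl⟩ (ih hy)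
    | add x _ y _ hx hy => rw [extd_add]; exact add_mem hx hy

/-- The de Rham differential `Ωⁿ → Ωⁿ⁺¹`. -/
def d (n : ℕ) : ⋀[A]^n (Ω[A⁄R]) →ₗ[R] ⋀[A]^(n + 1) (Ω[A⁄R]) where
  toFun w := ⟨extd R A w, extd_mem R A n w.2⟩
  map_add' _ _ := Subtype.ext (extd_add R A _ _)
  map_smul' r w := Subtype.ext (extd_rsmul R A r w)

theorem extd_extd_ι_mul (b : A) (w : Ext R A) :
    extd R A (ι A (D R A b) * w) = - (ι A (D R A b) * extd R A w) := by
  rw [extd_ι_mul, d1_D]; simp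

theorem extd_extd (w : Ext R A) : extd R A (extd R A w) = 0 := by
  have h0 : extd R A 0 = 0 := by simpa using extd_rsmul R A 0 0
  have hneg (w) : extd R A (-w) = - extd R A w := by simpa using extd_rsmul R A (-1) w
  have hA (a : A) (w : Ext R A) (hw : extd R A (extd R A w) = 0) :
      extd R A (extd R A (a • w)) = 0 := by
    rw [extd_smul, extd_add, extd_smul, hw, extd_extd_ι_mul]; simp
  induction w using CliffordAlgebra.left_induction with
  | algebraMap r =>
    change extd R A (extd R A (algebraMap A (Ext R A) r)) = 0
    rw [Algebra.algebraMap_eq_smul_one]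
    exact hA r 1 (by rw [extd_one, h0])
  | add x y hx hy => rw [extd_add, extd_add, hx, hy, add_zero]
  | ι_mul x m hx =>
    change extd R A (extd R A (ι A m * x)) = 0
    have hm : m ∈ Submodule.span A (Set.range (D R A)) := by
      rw [span_range_derivation]; trivial
    induction hm using Submodule.span_induction with
    | mem m hm =>
      obtain ⟨b, rfl⟩ := hm
      rw [extd_extd_ι_mul, hneg, extd_extd_ι_mul, hx]; simp
    | zero => simp [h0]
    | add y z _ _ hy hz => rw [map_add, add_mul, extd_add, extd_add, hy, hz, add_zero]
    | smul a y _ hy => rw [map_smul, smul_mul_assoc]; exact hA a _ hy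

theorem d_d (n : ℕ) (w : ⋀[A]^n (Ω[A⁄R])) : d R A (n + 1) (d R A n w) = 0 :=
  Subtype.ext (extd_extd R A w)

end DeRham

/-! ### Framings and the `q`-derivatives -/

open KaehlerDifferential ExteriorAlgebra

theorem isAdicComplete_span_X (A : Type u) [CommRing A] :
    IsAdicComplete (Ideal.span {(PowerSeries.X : A⟦X⟧)}) A⟦X⟧ where
  haus' f hf := by
    ext n
    have h := (hf (n + 1)).symm
    rw [SModEq.sub_mem, Ideal.span_singleton_pow, smul_eq_mul, Ideal.mul_top,
      Ideal.mem_span_singleton, PowerSeries.X_pow_dvd_iff] at h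
    simpa using h n (Nat.lt_succ_self n)
  prec' f hf := by
    refine ⟨PowerSeries.mk fun n => PowerSeries.coeff n (f (n + 1)), fun n => ?_⟩
    rw [SModEq.sub_mem, Ideal.span_singleton_pow, smul_eq_mul, Ideal.mul_top,
      Ideal.mem_span_singleton, PowerSeries.X_pow_dvd_iff]
    intro m hm
    have h := hf (show m + 1 ≤ n from hm)
    rw [SModEq.sub_mem, Ideal.span_singleton_pow, smul_eq_mul, Ideal.mul_top,
      Ideal.mem_span_singleton, PowerSeries.X_pow_dvd_iff] at h
    have h := h m (Nat.lt_succ_self m)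
    rw [map_sub, sub_eq_zero] at h ⊢
    simp [h]

theorem iInf_span_X_pow (A : Type u) [CommRing A] :
    ⨅ i, (Ideal.span {(PowerSeries.X : A⟦X⟧)}) ^ i = ⊥ := by
  rw [eq_bot_iff]
  intro f hf
  rw [Ideal.mem_iInf] at hf
  rw [Ideal.mem_bot]
  ext n
  have h := hf (n + 1)
  rw [Ideal.span_singleton_pow, Ideal.mem_span_singleton, PowerSeries.X_pow_dvd_iff] at h
  simpa using h n (Nat.lt_succ_self n)

theorem mk_span_X_eq_iff {A : Type u} [CommRing A] (f g : A⟦X⟧) :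
    Ideal.Quotient.mk (Ideal.span {(PowerSeries.X : A⟦X⟧)}) f = Ideal.Quotient.mk _ g ↔
      PowerSeries.constantCoeff f = PowerSeries.constantCoeff g := by
  rw [Ideal.Quotient.eq, Ideal.mem_span_singleton, PowerSeries.X_dvd_iff, map_sub, sub_eq_zero]


/-- A framing of `A` over `R`: a formally étale map of `Λ`-rings `□ : R[x₁, …, x_d] → A` over `R`,
where the `xᵢ` have rank one. -/
structure Framing (R A : Type u) [CommRing R] [CommRing A] [Algebra R A]
    [LambdaRing R] [LambdaRing A] where
  dim : ℕ
  box : MvPolynomial (Fin dim) R →ₐ[R] A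
  formallyEtale : box.toRingHom.FormallyEtale
  isLambdaHom : IsLambdaHom box.toRingHom

namespace Framing
variable {R A : Type u} [CommRing R] [CommRing A] [Algebra R A] [LambdaRing R] [LambdaRing A]
  (F : Framing R A)


/-- The image of the coordinate `xᵢ` in `A`. -/
abbrev x (i : Fin F.dim) : A := F.box (MvPolynomial.X i)

/-- Uniqueness of lifts along a formally étale map. -/
theorem hom_ext {B : Type u} [CommRing B] [Algebra R B] {f g : A →ₐ[R] B⟦X⟧}
    (hx : ∀ i, f (F.x i) = g (F.x i))
    (h0 : ∀ a, PowerSeries.constantCoeff (f a) = PowerSeries.constantCoeff (g a)) : f = g := by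
  let _ : Algebra (MvPolynomial (Fin F.dim) R) A := F.box.toRingHom.toAlgebra
  let _ : Algebra (MvPolynomial (Fin F.dim) R) B⟦X⟧ := (f.comp F.box).toRingHom.toAlgebra
  have hE : Algebra.FormallyEtale (MvPolynomial (Fin F.dim) R) A := F.formallyEtale
  have hfg : g.comp F.box = f.comp F.box := MvPolynomial.algHom_ext fun i => (hx i).symm
  let f' : A →ₐ[MvPolynomial (Fin F.dim) R] B⟦X⟧ := { f.toRingHom with commutes' := fun p => rfl }
  let g' : A →ₐ[MvPolynomial (Fin F.dim) R] B⟦X⟧ :=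
    { g.toRingHom with commutes' := fun p => congr($hfg p) }
  have key : f' = g' := Algebra.FormallyUnramified.ext_of_iInf _
    (iInf_span_X_pow B) fun a => (mk_span_X_eq_iff _ _).2 (h0 a)
  ext1 a
  exact congr($key a)

theorem exists_taylor (i : Fin F.dim) : ∃ τ : A →ₐ[R] A⟦X⟧,
    (∀ j, τ (F.x j) = PowerSeries.C (F.x j) + if j = i then PowerSeries.X else 0) ∧
    ∀ a, PowerSeries.constantCoeff (τ a) = a := by
  let φ : MvPolynomial (Fin F.dim) R →ₐ[R] A⟦X⟧ := MvPolynomial.aeval fun j =>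
    PowerSeries.C (F.x j) + if j = i then PowerSeries.X else 0
  let _ : Algebra (MvPolynomial (Fin F.dim) R) A := F.box.toRingHom.toAlgebra
  let _ : Algebra (MvPolynomial (Fin F.dim) R) A⟦X⟧ := φ.toRingHom.toAlgebra
  have hE : Algebra.FormallyEtale (MvPolynomial (Fin F.dim) R) A := F.formallyEtale
  have hφ : ∀ p, PowerSeries.constantCoeff (φ p) = F.box p := by
    intro p
    have : ((PowerSeries.constantCoeff (R := A)).comp φ.toRingHom) = F.box.toRingHom := by
      apply MvPolynomial.ringHom_ext
      · intro r; simp [φ, PowerSeries.algebraMap_apply]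
      · intro j; simp [φ]; split_ifs <;> simp
    exact congr($this p)
  have := isAdicComplete_span_X A
  let g : A →ₐ[MvPolynomial (Fin F.dim) R] A⟦X⟧ ⧸ Ideal.span {(PowerSeries.X : A⟦X⟧)} :=
    { (Ideal.Quotient.mk _).comp (PowerSeries.C (R := A)) with
      commutes' := fun p => by
        change Ideal.Quotient.mk _ (PowerSeries.C (F.box p)) = Ideal.Quotient.mk _ (φ p)
        rw [mk_span_X_eq_iff, hφ, PowerSeries.constantCoeff_C] }
  obtain ⟨τ, hτ⟩ := Algebra.FormallySmooth.exists_mkₐ_comp_eq_of_isAdicComplete g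
  have hτP : ∀ p, τ (F.box p) = φ p := fun p => τ.commutes p
  refine ⟨{ τ.toRingHom with commutes' := fun r => ?_ }, fun j => ?_, fun a => ?_⟩
  · have := hτP (algebraMap R _ r)
    rw [AlgHom.commutes, AlgHom.commutes] at this
    exact this
  · have := hτP (MvPolynomial.X j)
    simpa [φ] using this
  · have := congr($hτ a)
    have h2 := (mk_span_X_eq_iff (τ a) (PowerSeries.C a)).1 this
    simpa using h2


/-- The unique homomorphism `A → A⟦Y⟧` over `R` with `xⱼ ↦ xⱼ + δᵢⱼ Y` that lifts the identity. -/
def taylor (i : Fin F.dim) : A →ₐ[R] A⟦X⟧ := (F.exists_taylor i).choose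

theorem taylor_x (i j : Fin F.dim) :
    F.taylor i (F.x j) = PowerSeries.C (F.x j) + if j = i then PowerSeries.X else 0 :=
  (F.exists_taylor i).choose_spec.1 j

theorem constantCoeff_taylor (i : Fin F.dim) (a : A) :
    PowerSeries.constantCoeff (F.taylor i a) = a :=
  (F.exists_taylor i).choose_spec.2 a

/-- The homomorphism `γᵢ : A → A⟦q - 1⟧` over `R` with `γᵢ(xⱼ) = q^{δᵢⱼ} xⱼ` that is the identity
modulo `q - 1` (see `gamma_algebraMap`, `gamma_x`, `constantCoeff_gamma` and `gamma_unique`). -/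
def gamma (i : Fin F.dim) : A →+* A⟦X⟧ :=
  (PowerSeries.rescale (F.x i)).comp (F.taylor i).toRingHom

theorem gamma_algebraMap (i : Fin F.dim) (r : R) :
    F.gamma i (algebraMap R A r) = PowerSeries.C (algebraMap R A r) := by
  have : F.gamma i (algebraMap R A r) = PowerSeries.rescale (F.x i) (algebraMap R A⟦X⟧ r) :=
    congrArg (PowerSeries.rescale (F.x i)) ((F.taylor i).commutes r)
  rw [this, PowerSeries.algebraMap_apply]
  ext n
  rw [PowerSeries.coeff_rescale, PowerSeries.coeff_C]
  split_ifs with h <;> simp [h]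

theorem gamma_x (i j : Fin F.dim) :
    F.gamma i (F.x j) = (if j = i then 1 + PowerSeries.X else 1) * PowerSeries.C (F.x j) := by
  have : F.gamma i (F.x j) = PowerSeries.rescale (F.x i) (F.taylor i (F.x j)) := rfl
  rw [this, taylor_x]
  ext n
  rw [PowerSeries.coeff_rescale]
  split_ifs with h
  · subst h
    rcases n with _ | _ | n
    · simp
    · simp [add_mul, PowerSeries.coeff_X]
    · simp [add_mul, PowerSeries.coeff_X]
  · rcases n with _ | n <;> simp [PowerSeries.coeff_C]

theorem constantCoeff_gamma (i : Fin F.dim) (a : A) :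
    PowerSeries.constantCoeff (F.gamma i a) = a := by
  have : F.gamma i a = PowerSeries.rescale (F.x i) (F.taylor i a) := rfl
  rw [this, ← PowerSeries.coeff_zero_eq_constantCoeff_apply, PowerSeries.coeff_rescale]
  simp [constantCoeff_taylor]

/-- The coefficient of `Yⁿ` in the Taylor expansion. -/
def hasse (i : Fin F.dim) (n : ℕ) : Module.End R A :=
  (PowerSeries.coeff n).restrictScalars R ∘ₗ (F.taylor i).toLinearMap

/-- The coefficient of `(q - 1)ⁿ` in `(γᵢ(a) - a) / ((q - 1) xᵢ)`, see `gamma_sub`. -/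
def qDerCoeff (i : Fin F.dim) (n : ℕ) : Module.End R A :=
  LinearMap.mulLeft R (F.x i ^ n) ∘ₗ F.hasse i (n + 1)

theorem gamma_unique (i : Fin F.dim) (g : A →+* A⟦X⟧)
    (hR : ∀ r, g (algebraMap R A r) = PowerSeries.C (algebraMap R A r))
    (hx : ∀ j, g (F.x j) = (if j = i then 1 + PowerSeries.X else 1) * PowerSeries.C (F.x j))
    (h0 : ∀ a, PowerSeries.constantCoeff (g a) = a) : g = F.gamma i := by
  have hC (r : R) : algebraMap R A⟦X⟧ r = PowerSeries.C (algebraMap R A r) :=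
    PowerSeries.algebraMap_apply
  have := F.hom_ext (f := { g with commutes' := fun r => (hR r).trans (hC r).symm })
    (g :=
      { F.gamma i with commutes' := fun r => (F.gamma_algebraMap i r).trans (hC r).symm })
    (fun j => (hx j).trans (F.gamma_x i j).symm)
    (fun a => (h0 a).trans (F.constantCoeff_gamma i a).symm)
  exact congrArg AlgHom.toRingHom this

theorem gamma_sub (i : Fin F.dim) (a : A) :
    F.gamma i a - PowerSeries.C a =
      PowerSeries.X * PowerSeries.C (F.x i) * PowerSeries.mk fun n => F.qDerCoeff i n a := by
  have : F.gamma i a = PowerSeries.rescale (F.x i) (F.taylor i a) := rfl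
  rw [this]
  ext n
  rw [map_sub, PowerSeries.coeff_rescale, mul_assoc]
  rcases n with _ | n
  · simp [constantCoeff_taylor]
  · simp [PowerSeries.coeff_succ_X_mul, qDerCoeff, hasse, pow_succ]
    ring

/-- Exchange of the two variables. -/
def swap (A : Type u) [CommRing A] : A⟦X⟧⟦X⟧ →+* A⟦X⟧⟦X⟧ where
  toFun f := PowerSeries.mk fun m => PowerSeries.mk fun n =>
    PowerSeries.coeff m (PowerSeries.coeff n f)
  map_one' := by
    ext m n
    simp only [PowerSeries.coeff_mk, PowerSeries.coeff_one]
    split_ifs <;> simp_all [PowerSeries.coeff_one]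
  map_zero' := by ext; simp
  map_add' f g := by ext; simp
  map_mul' f g := by
    ext m n
    simp only [PowerSeries.coeff_mk, PowerSeries.coeff_mul, map_sum]
    rw [Finset.sum_comm]

theorem hasse_comm (i j : Fin F.dim) (m n : ℕ) (a : A) :
    F.hasse i m (F.hasse j n a) = F.hasse j n (F.hasse i m a) := by
  let f : A →ₐ[R] A⟦X⟧⟦X⟧ :=
    (PowerSeries.mapAlgHom (F.taylor i)).comp (F.taylor j)
  let g : A →ₐ[R] A⟦X⟧⟦X⟧ :=
    { (swap A).comp ((PowerSeries.mapAlgHom (F.taylor j)).comp (F.taylor i)).toRingHom with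
      commutes' := fun r => by
        change swap A ((PowerSeries.mapAlgHom (F.taylor j)).comp (F.taylor i) (algebraMap R A r)) = _
        rw [AlgHom.commutes, PowerSeries.algebraMap_apply]
        ext m n
        simp [swap, PowerSeries.algebraMap_apply, PowerSeries.coeff_C]
        split_ifs <;> simp_all [PowerSeries.coeff_C] }
  have hf (b : A) (m n : ℕ) : PowerSeries.coeff m (PowerSeries.coeff n (f b)) =
      F.hasse i m (F.hasse j n b) := by
    change PowerSeries.coeff m (PowerSeries.coeff n
      (PowerSeries.map (F.taylor i).toRingHom (F.taylor j b))) = _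
    rw [PowerSeries.coeff_map]
    rfl
  have hg (b : A) (m n : ℕ) : PowerSeries.coeff m (PowerSeries.coeff n (g b)) =
      F.hasse j n (F.hasse i m b) := by
    change PowerSeries.coeff m (PowerSeries.coeff n (swap A
      (PowerSeries.map (F.taylor j).toRingHom (F.taylor i b)))) = _
    simp [swap, hasse]
  have h0 (i : Fin F.dim) (b : A) : F.hasse i 0 b = b := by
    simpa [hasse] using F.constantCoeff_taylor i b
  have hx (i l : Fin F.dim) (n : ℕ) : F.hasse i n (F.x l) =
      if n = 0 then F.x l else if n = 1 then (if l = i then 1 else 0) else 0 := by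
    change PowerSeries.coeff n (F.taylor i (F.x l)) = _
    rw [taylor_x]
    rcases n with _ | _ | n <;> split_ifs <;> simp_all [PowerSeries.coeff_C, PowerSeries.coeff_X]
  have h1 (i : Fin F.dim) (n : ℕ) : F.hasse i n 1 = if n = 0 then 1 else 0 := by
    simp [hasse, PowerSeries.coeff_one]
  have hfg : f = g := by
    apply F.hom_ext
    · intro l
      ext n m
      rw [hf, hg, hx, hx]
      split_ifs <;> simp_all
    · intro b
      ext m
      simp only [← PowerSeries.coeff_zero_eq_constantCoeff_apply]
      rw [hf, hg, h0, h0]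
  rw [← hf, ← hg, hfg]

theorem hasse_x_mul {i j : Fin F.dim} (h : j ≠ i) (n k : ℕ) (a : A) :
    F.hasse i n (F.x j ^ k * a) = F.x j ^ k * F.hasse i n a := by
  change PowerSeries.coeff n (F.taylor i (F.x j ^ k * a)) = _
  rw [map_mul, map_pow, taylor_x, if_neg h, add_zero, ← map_pow, PowerSeries.coeff_C_mul]
  rfl

theorem qDerCoeff_comm {i j : Fin F.dim} (h : i ≠ j) (m n : ℕ) (a : A) :
    F.qDerCoeff i m (F.qDerCoeff j n a) = F.qDerCoeff j n (F.qDerCoeff i m a) := by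
  simp only [qDerCoeff, LinearMap.comp_apply, LinearMap.mulLeft_apply]
  rw [F.hasse_x_mul h.symm, F.hasse_x_mul h, F.hasse_comm]
  ring
end Framing


theorem sum_antidiagonal_triple {M : Type*} [AddCommMonoid M] (f : ℕ → ℕ → ℕ → M) (n : ℕ) :
    ∑ p ∈ Finset.HasAntidiagonal.antidiagonal n, ∑ r ∈ Finset.HasAntidiagonal.antidiagonal p.1, f r.1 r.2 p.2 =
      ∑ p ∈ Finset.HasAntidiagonal.antidiagonal n, ∑ r ∈ Finset.HasAntidiagonal.antidiagonal p.2, f p.1 r.1 r.2 := by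
  simp only [Finset.sum_sigma']
  apply Finset.sum_nbij' (fun ⟨⟨_i, j⟩, ⟨k, l⟩⟩ ↦ ⟨(k, l + j), (l, j)⟩)
    (fun ⟨⟨i, _j⟩, ⟨k, l⟩⟩ ↦ ⟨(i + k, l), (i, k)⟩)
  all_goals
    simp only [Finset.mem_sigma, Finset.HasAntidiagonal.mem_antidiagonal, Sigma.forall, Prod.forall]
    rintro a b c d ⟨h1, h2⟩
    try subst h1 h2
    simp_all [add_assoc]

/-- `∑ aₙ tⁿ ↦ ∑ₙ ∑ₖ Tₖ(aₙ) tⁿ⁺ᵏ`. -/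
def seriesOp {R A : Type u} [CommRing R] [CommRing A] [Algebra R A] (T : ℕ → Module.End R A) :
    A⟦X⟧ →ₗ[R⟦X⟧] A⟦X⟧ where
  toFun f := PowerSeries.mk fun n =>
    ∑ p ∈ Finset.HasAntidiagonal.antidiagonal n, T p.2 (PowerSeries.coeff p.1 f)
  map_add' f g := by ext; simp [Finset.sum_add_distrib]
  map_smul' s f := by
    ext n
    have hs (k : ℕ) : PowerSeries.coeff k (algebraMap R⟦X⟧ A⟦X⟧ s) =
        algebraMap R A (PowerSeries.coeff k s) := PowerSeries.coeff_map _ _ _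
    simp only [PowerSeries.coeff_mk, RingHom.id_apply, Algebra.smul_def s, hs, PowerSeries.coeff_mul,
      map_sum, Finset.mul_sum]
    rw [← sum_antidiagonal_triple (fun a b c => algebraMap R A (PowerSeries.coeff a s) *
      T c (PowerSeries.coeff b f))]
    simp only [← Algebra.smul_def, map_smul]

theorem seriesOp_comm {R A : Type u} [CommRing R] [CommRing A] [Algebra R A]
    {T U : ℕ → Module.End R A} (h : ∀ m n a, T m (U n a) = U n (T m a)) (f : A⟦X⟧) :
    seriesOp T (seriesOp U f) = seriesOp U (seriesOp T f) := by
  ext n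
  simp only [seriesOp, LinearMap.coe_mk, AddHom.coe_mk, PowerSeries.coeff_mk, map_sum]
  rw [sum_antidiagonal_triple (fun a b c => T c (U b (PowerSeries.coeff a f))),
    sum_antidiagonal_triple (fun a b c => U c (T b (PowerSeries.coeff a f)))]
  refine Finset.sum_congr rfl fun p _ => ?_
  rw [← Finset.Nat.sum_antidiagonal_swap]
  simp [h]


section Forms
variable (R A : Type u) [CommRing R] [CommRing A] [Algebra R A]

/-- The module `Ωⁿ_{A/R}` of differential forms. -/
abbrev Forms (n : ℕ) : Type u := ⋀[A]^n (Ω[A⁄R])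

/-- The module `Ωⁿ_{A/R}⟦q - 1⟧`, for `Ωⁿ_{A/R}` finite free over `A`. -/
def QForms (n : ℕ) : Type u := A⟦X⟧ ⊗[A] Forms R A n

instance (n : ℕ) : AddCommGroup (QForms R A n) :=
  inferInstanceAs (AddCommGroup (A⟦X⟧ ⊗[A] Forms R A n))
instance (n : ℕ) : Module A⟦X⟧ (QForms R A n) :=
  inferInstanceAs (Module A⟦X⟧ (A⟦X⟧ ⊗[A] Forms R A n))
instance (n : ℕ) : Module R⟦X⟧ (QForms R A n) := Module.compHom _ (algebraMap R⟦X⟧ A⟦X⟧)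
instance (n : ℕ) : IsScalarTower R⟦X⟧ A⟦X⟧ (QForms R A n) where
  smul_assoc s f x := by
    change (s • f) • x = algebraMap R⟦X⟧ A⟦X⟧ s • f • x
    rw [Algebra.smul_def, mul_smul]

variable {R A}

/-- The element `f ω` of `Ωⁿ_{A/R}⟦q - 1⟧`. -/
def qtmul {n : ℕ} (f : A⟦X⟧) : Forms R A n →+ QForms R A n :=
  (TensorProduct.mk A A⟦X⟧ (Forms R A n) f).toAddMonoidHom

theorem smul_qtmul {n : ℕ} (f g : A⟦X⟧) (ω : Forms R A n) : f • qtmul g ω = qtmul (f * g) ω :=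
  TensorProduct.smul_tmul' (R := A) f g ω

/-- Exterior multiplication `ω ∧ ·`. -/
def wedge (ω : Ω[A⁄R]) (n : ℕ) : Forms R A n →ₗ[A] Forms R A (n + 1) :=
  (LinearMap.mulLeft A (ι A ω)).restrict fun w hw => by
    rw [exteriorPower, pow_succ']
    exact Submodule.mul_mem_mul ⟨_, rfl⟩ hw

theorem wedge_ιMulti (ω : Ω[A⁄R]) (n : ℕ) (v : Fin n → Ω[A⁄R]) :
    wedge ω n (exteriorPower.ιMulti A n v) = exteriorPower.ιMulti A (n + 1) (Fin.cons ω v) := by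
  apply Subtype.ext
  change ι A ω * ExteriorAlgebra.ιMulti A n v = ExteriorAlgebra.ιMulti A (n + 1) (Fin.cons ω v)
  rw [ExteriorAlgebra.ιMulti_succ_apply]
  simp [Matrix.vecTail, Function.comp_def]

theorem wedge_wedge_swap (ω η : Ω[A⁄R]) (n : ℕ) (w : Forms R A n) :
    wedge ω (n + 1) (wedge η n w) = - wedge η (n + 1) (wedge ω n w) := by
  apply Subtype.ext
  change ι A ω * (ι A η * (w : ExteriorAlgebra A (Ω[A⁄R]))) = -(ι A η * (ι A ω * w))
  rw [← mul_assoc, ← mul_assoc, ← neg_mul]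
  congr 1
  rw [eq_neg_iff_add_eq_zero]
  exact ι_add_mul_swap ω η

theorem wedge_wedge_self (ω : Ω[A⁄R]) (n : ℕ) (w : Forms R A n) :
    wedge ω (n + 1) (wedge ω n w) = 0 := by
  apply Subtype.ext
  change ι A ω * (ι A ω * (w : ExteriorAlgebra A (Ω[A⁄R]))) = 0
  rw [← mul_assoc, ι_sq_zero, zero_mul]

/-- Exterior multiplication on `Ωⁿ_{A/R}⟦q - 1⟧`. -/
def qwedge (ω : Ω[A⁄R]) (n : ℕ) : QForms R A n →ₗ[A⟦X⟧] QForms R A (n + 1) :=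
  (wedge ω n).baseChange A⟦X⟧

theorem qwedge_qtmul (ω : Ω[A⁄R]) (n : ℕ) (f : A⟦X⟧) (w : Forms R A n) :
    qwedge ω n (qtmul f w) = qtmul f (wedge ω n w) :=
  LinearMap.baseChange_tmul _ _ _

end Forms

namespace Framing
variable {R A : Type u} [CommRing R] [CommRing A] [Algebra R A] [LambdaRing R] [LambdaRing A]
  (F : Framing R A)

/-- The basis `dx₁, …, dx_d` of `Ω¹_{A/R}`. -/
def basis : Module.Basis (Fin F.dim) A (Ω[A⁄R]) :=
  letI : Algebra (MvPolynomial (Fin F.dim) R) A := F.box.toRingHom.toAlgebra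
  haveI : IsScalarTower R (MvPolynomial (Fin F.dim) R) A :=
    IsScalarTower.of_algebraMap_eq fun r => (F.box.commutes r).symm
  haveI : Algebra.FormallyEtale (MvPolynomial (Fin F.dim) R) A := F.formallyEtale
  ((mvPolynomialBasis R (Fin F.dim)).baseChange A).map
    (tensorKaehlerEquivOfFormallyEtale R (MvPolynomial (Fin F.dim) R) A)

theorem basis_apply (i : Fin F.dim) : F.basis i = D R A (F.x i) := by
  let _ : Algebra (MvPolynomial (Fin F.dim) R) A := F.box.toRingHom.toAlgebra
  have : IsScalarTower R (MvPolynomial (Fin F.dim) R) A :=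
    IsScalarTower.of_algebraMap_eq fun r => (F.box.commutes r).symm
  have : Algebra.FormallyEtale (MvPolynomial (Fin F.dim) R) A := F.formallyEtale
  change tensorKaehlerEquivOfFormallyEtale R (MvPolynomial (Fin F.dim) R) A
    ((mvPolynomialBasis R (Fin F.dim)).baseChange A i) = _
  rw [Module.Basis.baseChange_apply, mvPolynomialBasis_apply, ← LinearEquiv.eq_symm_apply]
  exact (tensorKaehlerEquivOfFormallyEtale_symm_D_algebraMap R (MvPolynomial (Fin F.dim) R) A
    (MvPolynomial.X i)).symm

/-- The `A⟦q - 1⟧`-basis of `Ωⁿ_{A/R}⟦q - 1⟧` consisting of the forms `dx_I`. -/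
def formBasis (n : ℕ) : Module.Basis (Set.powersetCard (Fin F.dim) n) A⟦X⟧ (QForms R A n) :=
  (F.basis.exteriorPower n).baseChange A⟦X⟧

theorem formBasis_apply (n : ℕ) (I : Set.powersetCard (Fin F.dim) n) :
    F.formBasis n I = qtmul 1 (F.basis.exteriorPower n I) :=
  Module.Basis.baseChange_apply _ _ _

/-- The operator `∇_{q,i} f = (γᵢ(f) - f) / ((q - 1) xᵢ)` on `A⟦q - 1⟧`, where `γᵢ` is extended
`R⟦q - 1⟧`-linearly and `(q - 1)`-adically continuously. -/
def qDer (i : Fin F.dim) : A⟦X⟧ →ₗ[R⟦X⟧] A⟦X⟧ := seriesOp (F.qDerCoeff i)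

/-- The operator `f dx_I ↦ ∇_{q,i}(f) dx_I`. -/
def qDerForm (i : Fin F.dim) (n : ℕ) : QForms R A n →ₗ[R⟦X⟧] QForms R A n :=
  ((F.formBasis n).equivFun.symm.toLinearMap.restrictScalars R⟦X⟧) ∘ₗ
    (LinearMap.pi fun I => F.qDer i ∘ₗ LinearMap.proj I) ∘ₗ
      ((F.formBasis n).equivFun.toLinearMap.restrictScalars R⟦X⟧)

theorem qDerForm_basis (i : Fin F.dim) (n : ℕ) (f : A⟦X⟧) (I : Set.powersetCard (Fin F.dim) n) :
    F.qDerForm i n (qtmul f (F.basis.exteriorPower n I)) = qtmul (F.qDer i f) (F.basis.exteriorPower n I) := by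
  have h (g : A⟦X⟧) : qtmul g (F.basis.exteriorPower n I) = g • F.formBasis n I := by
    rw [formBasis_apply, smul_qtmul, mul_one]
  rw [h, h]
  have h2 (g : A⟦X⟧) : (F.formBasis n).equivFun (g • F.formBasis n I) = Pi.single I g := by
    ext1 J
    rw [map_smul, Pi.smul_apply, Module.Basis.equivFun_self, Pi.single_apply]
    by_cases hJ : J = I
    · simp [hJ]
    · simp [hJ, Ne.symm hJ]
  unfold qDerForm
  simp only [LinearMap.comp_apply, LinearMap.coe_restrictScalars, LinearEquiv.coe_coe]
  rw [LinearEquiv.symm_apply_eq, h2, h2]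
  ext1 J
  by_cases hJ : J = I
  · subst hJ; simp
  · simp [hJ]

/-- The operators `∇_{q,i}` treat all products of the `dx_j` as constants. -/
theorem qDerForm_ιMulti (i : Fin F.dim) (n : ℕ) (f : A⟦X⟧) (v : Fin n → Fin F.dim) :
    F.qDerForm i n (qtmul f (exteriorPower.ιMulti A n (F.basis ∘ v))) =
      qtmul (F.qDer i f) (exteriorPower.ιMulti A n (F.basis ∘ v)) := by
  by_cases hv : Function.Injective v
  · have hm : StrictMono (v ∘ Tuple.sort v) := (Tuple.monotone_sort v).strictMono_of_injective
      (hv.comp (Tuple.sort v).injective)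
    let e : Fin n ↪o Fin F.dim := OrderEmbedding.ofStrictMono _ hm
    let I := Set.powersetCard.ofFinEmbEquiv e
    have hI : F.basis.exteriorPower n I = exteriorPower.ιMulti A n ((F.basis ∘ v) ∘ Tuple.sort v) := by
      rw [exteriorPower.basis_apply, exteriorPower.ιMulti_family, Equiv.symm_apply_apply]
      rfl
    rw [AlternatingMap.map_perm] at hI
    have hI2 : exteriorPower.ιMulti A n (F.basis ∘ v) =
        (Equiv.Perm.sign (Tuple.sort v) : ℤ) • F.basis.exteriorPower n I := by
      rw [hI, Units.smul_def, smul_smul, ← Units.val_mul]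
      simp
    rw [hI2, map_zsmul, map_zsmul, map_zsmul, qDerForm_basis]
  · have : exteriorPower.ιMulti A n (F.basis ∘ v) = 0 :=
      AlternatingMap.map_eq_zero_of_not_injective _ _ fun h => hv h.of_comp
    simp [this]

/-- The `q`-connection `∇_q(f dx_I) = ∑ᵢ ∇_{q,i}(f) dxᵢ ∧ dx_I`. -/
def nablaQ (n : ℕ) : QForms R A n →ₗ[R⟦X⟧] QForms R A (n + 1) :=
  ∑ i, (qwedge (D R A (F.x i)) n).restrictScalars R⟦X⟧ ∘ₗ F.qDerForm i n

theorem ιMulti_cons (n : ℕ) (i : Fin F.dim) (v : Fin n → Fin F.dim) :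
    exteriorPower.ιMulti A (n + 1) (F.basis ∘ Fin.cons i v) =
      wedge (D R A (F.x i)) n (exteriorPower.ιMulti A n (F.basis ∘ v)) := by
  rw [wedge_ιMulti, ← basis_apply]
  congr 1
  ext j
  refine Fin.cases ?_ (fun j => ?_) j <;> simp

theorem nablaQ_ιMulti (n : ℕ) (f : A⟦X⟧) (v : Fin n → Fin F.dim) :
    F.nablaQ n (qtmul f (exteriorPower.ιMulti A n (F.basis ∘ v))) =
      ∑ i, qtmul (F.qDer i f) (exteriorPower.ιMulti A (n + 1) (F.basis ∘ Fin.cons i v)) := by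
  rw [nablaQ, LinearMap.sum_apply]
  refine Finset.sum_congr rfl fun i _ => ?_
  rw [LinearMap.comp_apply, qDerForm_ιMulti]
  change qwedge _ n _ = _
  rw [qwedge_qtmul, ιMulti_cons]

theorem qDer_comm {i j : Fin F.dim} (h : i ≠ j) (f : A⟦X⟧) :
    F.qDer i (F.qDer j f) = F.qDer j (F.qDer i f) :=
  seriesOp_comm (F.qDerCoeff_comm h) f

theorem qForms_induction {n : ℕ} {p : QForms R A n → Prop} (h0 : p 0)
    (hadd : ∀ x y, p x → p y → p (x + y))
    (h : ∀ f (v : Fin n → Fin F.dim), p (qtmul f (exteriorPower.ιMulti A n (F.basis ∘ v)))) (x) : p x := by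
  have hx : x = ∑ I, (F.formBasis n).repr x I • F.formBasis n I :=
    ((F.formBasis n).sum_repr x).symm
  rw [hx]
  refine Finset.sum_induction _ p hadd h0 fun I _ => ?_
  rw [formBasis_apply, smul_qtmul, mul_one, exteriorPower.basis_apply]
  exact h _ _

theorem nablaQ_nablaQ (n : ℕ) (x : QForms R A n) : F.nablaQ (n + 1) (F.nablaQ n x) = 0 := by
  induction x using F.qForms_induction with
  | h0 => simp
  | hadd x y hx hy => simp [hx, hy]
  | h f v =>
    rw [nablaQ_ιMulti, map_sum]
    simp only [nablaQ_ιMulti]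
    rw [← Finset.sum_product']
    simp only [ιMulti_cons]
    refine Finset.sum_involution (fun p _ => (p.2, p.1)) ?_ ?_ ?_ ?_
    · rintro ⟨i, j⟩ -
      rcases eq_or_ne i j with rfl | hij
      · simp [wedge_wedge_self]
      · simp only
        rw [wedge_wedge_swap, F.qDer_comm hij, map_neg, neg_add_cancel]
    · rintro ⟨i, j⟩ - h hij
      obtain rfl : j = i := congrArg Prod.fst hij
      exact h (by simp [wedge_wedge_self])
    · simp
    · simp

end Framing

/-! ### Reduction modulo `q - 1` and décalage -/

section Complexes

/-- The cochain complex with terms `M n` and differentials `d n`, in a larger universe. -/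
def moduleComplex {S : Type u} [CommRing S] (M : ℕ → Type u) [∀ n, AddCommGroup (M n)]
    [∀ n, Module S (M n)] (d : ∀ n, M n →ₗ[S] M (n + 1)) (hd : ∀ n x, d (n + 1) (d n x) = 0) :
    CochainComplex (ModuleCat.{u + 1} S) ℕ :=
  CochainComplex.of (fun n => ModuleCat.of S (ULift.{u + 1} (M n)))
    (fun n => ModuleCat.ofHom
      (ULift.moduleEquiv.symm.toLinearMap ∘ₗ d n ∘ₗ ULift.moduleEquiv.toLinearMap))
    (fun n => by ext x; simp [hd])

theorem moduleComplex_d {S : Type u} [CommRing S] (M : ℕ → Type u) [∀ n, AddCommGroup (M n)]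
    [∀ n, Module S (M n)] (d : ∀ n, M n →ₗ[S] M (n + 1)) (hd : ∀ n x, d (n + 1) (d n x) = 0)
    (n : ℕ) : (moduleComplex M d hd).d n (n + 1) = ModuleCat.ofHom
      (ULift.moduleEquiv.symm.toLinearMap ∘ₗ d n ∘ₗ ULift.moduleEquiv.toLinearMap) :=
  CochainComplex.of_d (fun n => ModuleCat.of S (ULift.{u + 1} (M n)))
    (fun n => ModuleCat.ofHom
      (ULift.moduleEquiv.symm.toLinearMap ∘ₗ d n ∘ₗ ULift.moduleEquiv.toLinearMap)) n

variable {R : Type u} [CommRing R]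

/-- All terms of the complex are without `(q - 1)`-torsion. -/
def TorsionFree (K : CochainComplex (ModuleCat.{v} R⟦X⟧) ℕ) : Prop :=
  ∀ (n : ℕ) (x : K.X n), (PowerSeries.X : R⟦X⟧) • x = 0 → x = 0

instance (f : R⟦X⟧ →+* R) : (ModuleCat.extendScalars.{u, u, u + 1} f).Additive :=
  (ModuleCat.extendRestrictScalarsAdj.{u + 1} f).left_adjoint_additive

/-- The functor `K ↦ K ⊗_{R⟦q - 1⟧} R`. On complexes without `(q - 1)`-torsion this is the derived
tensor product, because `R` is the quotient of `R⟦q - 1⟧` by the non-zero-divisor `q - 1`. -/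
def reduction : CochainComplex (ModuleCat.{u + 1} R⟦X⟧) ℕ ⥤ CochainComplex (ModuleCat.{u + 1} R) ℕ :=
  (ModuleCat.extendScalars.{u, u, u + 1} (PowerSeries.constantCoeff (R := R))).mapHomologicalComplex _

/-- The map `K ⊗_{R⟦q - 1⟧} R → N` given by `R⟦q - 1⟧`-linear maps `Kⁿ → Nⁿ`. -/
def reductionHom {K : CochainComplex (ModuleCat.{u + 1} R⟦X⟧) ℕ}
    {N : CochainComplex (ModuleCat.{u + 1} R) ℕ}
    (g : ∀ n, K.X n ⟶ (ModuleCat.restrictScalars PowerSeries.constantCoeff).obj (N.X n))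
    (hg : ∀ n, K.d n (n + 1) ≫ g (n + 1) =
      g n ≫ (ModuleCat.restrictScalars PowerSeries.constantCoeff).map (N.d n (n + 1))) :
    reduction.obj K ⟶ N where
  f n := ((ModuleCat.extendRestrictScalarsAdj.{u + 1} PowerSeries.constantCoeff).homEquiv
    (K.X n) (N.X n)).symm (g n)
  comm' i j hij := by
    obtain rfl : i + 1 = j := hij
    refine (Adjunction.homEquiv_naturality_right_symm _ _ _).symm.trans ?_
    rw [← hg]
    exact Adjunction.homEquiv_naturality_left_symm _ _ _

/-- The submodule `{x ∈ (q - 1)ⁿ Kⁿ | dx ∈ (q - 1)ⁿ⁺¹ Kⁿ⁺¹}` of `Kⁿ`. -/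
def etaSubmodule (K : CochainComplex (ModuleCat.{v} R⟦X⟧) ℕ) (n : ℕ) : Submodule R⟦X⟧ (K.X n) :=
  LinearMap.range (LinearMap.lsmul R⟦X⟧ (K.X n) (PowerSeries.X ^ n)) ⊓
    (LinearMap.range (LinearMap.lsmul R⟦X⟧ (K.X (n + 1)) (PowerSeries.X ^ (n + 1)))).comap
      (K.d n (n + 1)).hom

theorem d_d_apply (K : CochainComplex (ModuleCat.{v} R⟦X⟧) ℕ) (n : ℕ) (x : K.X n) :
    (K.d (n + 1) (n + 1 + 1)).hom ((K.d n (n + 1)).hom x) = 0 := by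
  rw [← LinearMap.comp_apply, ← ModuleCat.hom_comp, K.d_comp_d]
  rfl

theorem d_mem_etaSubmodule (K : CochainComplex (ModuleCat.{v} R⟦X⟧) ℕ) (n : ℕ) (x : K.X n)
    (hx : x ∈ etaSubmodule K n) : (K.d n (n + 1)).hom x ∈ etaSubmodule K (n + 1) :=
  ⟨hx.2, by rw [SetLike.mem_coe, Submodule.mem_comap, d_d_apply]; exact zero_mem _⟩

/-- The décalage `η_{(q - 1)} K`. On complexes without `(q - 1)`-torsion it represents the derived
décalage. -/
def eta (K : CochainComplex (ModuleCat.{v} R⟦X⟧) ℕ) : CochainComplex (ModuleCat.{v} R⟦X⟧) ℕ :=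
  CochainComplex.of (fun n => ModuleCat.of R⟦X⟧ (etaSubmodule K n))
    (fun n => ModuleCat.ofHom ((K.d n (n + 1)).hom.restrict (d_mem_etaSubmodule K n)))
    (fun n => by
      ext x
      exact d_d_apply K n x.1)

theorem eta_d (K : CochainComplex (ModuleCat.{v} R⟦X⟧) ℕ) (n : ℕ) :
    (eta K).d n (n + 1) =
      ModuleCat.ofHom ((K.d n (n + 1)).hom.restrict (d_mem_etaSubmodule K n)) :=
  CochainComplex.of_d (fun n => ModuleCat.of R⟦X⟧ (etaSubmodule K n))
    (fun n => ModuleCat.ofHom ((K.d n (n + 1)).hom.restrict (d_mem_etaSubmodule K n))) n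

theorem map_mem_etaSubmodule {K L : CochainComplex (ModuleCat.{v} R⟦X⟧) ℕ} (f : K ⟶ L) (n : ℕ)
    (x : K.X n) (hx : x ∈ etaSubmodule K n) : (f.f n).hom x ∈ etaSubmodule L n := by
  obtain ⟨⟨y, hy⟩, ⟨z, hz⟩⟩ := hx
  refine ⟨⟨(f.f n).hom y, ?_⟩, ⟨(f.f (n + 1)).hom z, ?_⟩⟩
  · rw [← hy]; simp
  · have := congr(($(f.comm n (n + 1))).hom x)
    simp only [ModuleCat.hom_comp, LinearMap.comp_apply] at this
    rw [this, ← hz]; simp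

/-- Functoriality of the décalage. -/
def etaMap {K L : CochainComplex (ModuleCat.{v} R⟦X⟧) ℕ} (f : K ⟶ L) : eta K ⟶ eta L :=
  CochainComplex.ofHom
    (fun n => ModuleCat.ofHom ((f.f n).hom.restrict (map_mem_etaSubmodule f n)))
    (fun n => by
      rw [eta_d, eta_d]
      ext x
      apply Subtype.ext
      have := congr(($(f.comm n (n + 1))).hom x.1)
      simp only [ModuleCat.hom_comp, LinearMap.comp_apply] at this
      exact this)

end Complexes

/-! ### The complexes in the comparison -/

section Canonical
variable (R A : Type u) [CommRing R] [CommRing A] [Algebra R A]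

/-- The de Rham complex `Ω^•_{A/R}`. -/
def deRham : CochainComplex (ModuleCat.{u + 1} R) ℕ :=
  moduleComplex (Forms R A) (DeRham.d R A) (DeRham.d_d R A)

/-- The complex `(Ω^*_{A/R}, 0)`. -/
def hodge : CochainComplex (ModuleCat.{u + 1} R) ℕ :=
  moduleComplex (Forms R A) (fun _ => 0) (fun _ _ => rfl)

/-- Reduction of forms modulo `q - 1`: the map `f ω ↦ f(0) ω`. -/
def evalForm (n : ℕ) : QForms R A n →+ Forms R A n :=
  (TensorProduct.lift ((LinearMap.lsmul A (Forms R A n)).comp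
    ((PowerSeries.coeff 0 : A⟦X⟧ →ₗ[A] A)))).toAddMonoidHom

variable {R A}

theorem evalForm_qtmul (n : ℕ) (f : A⟦X⟧) (ω : Forms R A n) :
    evalForm R A n (qtmul f ω) = PowerSeries.constantCoeff f • ω := by
  refine (TensorProduct.lift.tmul (f' := (LinearMap.lsmul A (Forms R A n)).comp
    ((PowerSeries.coeff 0 : A⟦X⟧ →ₗ[A] A))) f ω).trans ?_
  simp

theorem evalForm_smul (n : ℕ) (s : R⟦X⟧) (x : QForms R A n) :
    evalForm R A n (s • x) = PowerSeries.constantCoeff s • evalForm R A n x := by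
  have ind (p : QForms R A n → Prop) (h0 : p 0) (hadd : ∀ x y, p x → p y → p (x + y))
      (h : ∀ f ω, p (qtmul f ω)) (x) : p x := TensorProduct.induction_on x h0 h hadd
  have h (f : A⟦X⟧) (x : QForms R A n) :
      evalForm R A n (f • x) = PowerSeries.constantCoeff f • evalForm R A n x := by
    refine ind (fun x => evalForm R A n (f • x) =
      PowerSeries.constantCoeff f • evalForm R A n x) ?_ ?_ ?_ x
    · simp
    · intro x y hx hy
      rw [smul_add, map_add, map_add, smul_add, hx, hy]
    · intro g ω
      rw [smul_qtmul, evalForm_qtmul, evalForm_qtmul, map_mul, mul_smul]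
  rw [← algebraMap_smul A⟦X⟧ s x, h, ← algebraMap_smul A (PowerSeries.constantCoeff s)]
  congr 1

variable (R A) in
/-- The map `f ω ↦ f(0) ω` as a homomorphism of modules over `R⟦q - 1⟧`. -/
def evalULift (n : ℕ) : ModuleCat.of R⟦X⟧ (ULift.{u + 1} (QForms R A n)) ⟶
    (ModuleCat.restrictScalars PowerSeries.constantCoeff).obj
      (ModuleCat.of R (ULift.{u + 1} (Forms R A n))) :=
  ModuleCat.ofHom (Y := (ModuleCat.restrictScalars PowerSeries.constantCoeff).obj
      (ModuleCat.of R (ULift.{u + 1} (Forms R A n))))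
    { toFun := fun x => ULift.up (evalForm R A n x.down)
      map_add' := fun _ _ => ULift.down_injective (map_add (evalForm R A n) _ _)
      map_smul' := fun s x => ULift.down_injective (evalForm_smul n s x.down) }

end Canonical

namespace Framing
variable {R A : Type u} [CommRing R] [CommRing A] [Algebra R A] [LambdaRing R] [LambdaRing A]
  (F : Framing R A)

/-- The `q`-de Rham complex `q̂-Ω^•_{A/R,□} = (Ω^*_{A/R}⟦q - 1⟧, ∇_q)`. -/
def qOmega : CochainComplex (ModuleCat.{u + 1} R⟦X⟧) ℕ :=
  moduleComplex (QForms R A) F.nablaQ F.nablaQ_nablaQ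

/-- The complex `(Ω^*_{A/R}⟦q - 1⟧, (q - 1) ∇_q)`. -/
def qHodge : CochainComplex (ModuleCat.{u + 1} R⟦X⟧) ℕ :=
  moduleComplex (QForms R A) (fun n => (PowerSeries.X : R⟦X⟧) • F.nablaQ n)
    (fun n x => by simp [F.nablaQ_nablaQ])

theorem qHodge_d_apply (n : ℕ) (x : ULift.{u + 1} (QForms R A n)) :
    (F.qHodge.d n (n + 1)).hom x =
      ULift.up.{u + 1} ((PowerSeries.X : R⟦X⟧) • F.nablaQ n x.down) := by
  unfold qHodge
  rw [moduleComplex_d]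
  rfl

theorem qOmega_d_apply (n : ℕ) (x : ULift.{u + 1} (QForms R A n)) :
    (F.qOmega.d n (n + 1)).hom x = ULift.up.{u + 1} (F.nablaQ n x.down) := by
  unfold qOmega
  rw [moduleComplex_d]
  rfl

theorem qHodge_d_smul (n : ℕ) (x : ULift.{u + 1} (QForms R A n)) :
    (F.qHodge.d n (n + 1)).hom ((PowerSeries.X ^ n : R⟦X⟧) • x) =
      (PowerSeries.X ^ (n + 1) : R⟦X⟧) • ULift.up.{u + 1} (F.nablaQ n x.down) := by
  refine (F.qHodge_d_apply n _).trans (ULift.down_injective ?_)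
  change (PowerSeries.X : R⟦X⟧) • F.nablaQ n ((PowerSeries.X ^ n : R⟦X⟧) • x.down) =
    (PowerSeries.X ^ (n + 1) : R⟦X⟧) • F.nablaQ n x.down
  rw [map_smul, smul_smul, ← pow_succ']

/-- The identification `ω ↦ (q - 1)ⁿ ω` of `q̂-Ω^•_{A/R,□}` with the décalage of
`(Ω^*_{A/R}⟦q - 1⟧, (q - 1) ∇_q)`. -/
def toEta : F.qOmega ⟶ eta F.qHodge :=
  CochainComplex.ofHom
    (fun n => ModuleCat.ofHom ((LinearMap.lsmul R⟦X⟧ (ULift.{u + 1} (QForms R A n))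
      (PowerSeries.X ^ n)).codRestrict (etaSubmodule F.qHodge n) fun x =>
        ⟨⟨x, rfl⟩, ⟨ULift.up (F.nablaQ n x.down), (F.qHodge_d_smul n x).symm⟩⟩))
    (fun n => by
      rw [eta_d]
      ext x
      apply Subtype.ext
      refine (F.qHodge_d_smul n x).trans ?_
      exact congrArg (fun y : ULift.{u + 1} (QForms R A (n + 1)) =>
        (PowerSeries.X ^ (n + 1) : R⟦X⟧) • y) (F.qOmega_d_apply n x).symm)

theorem hasse_one_mul (i : Fin F.dim) (a b : A) :
    F.hasse i 1 (a * b) = a * F.hasse i 1 b + b * F.hasse i 1 a := by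
  change PowerSeries.coeff 1 (F.taylor i (a * b)) = a * PowerSeries.coeff 1 (F.taylor i b) +
    b * PowerSeries.coeff 1 (F.taylor i a)
  rw [map_mul, PowerSeries.coeff_mul, Finset.Nat.antidiagonal_succ]
  simp [constantCoeff_taylor, mul_comm]

theorem D_eq (a : A) : D R A a = ∑ i, F.hasse i 1 a • D R A (F.x i) := by
  let der (i : Fin F.dim) : Derivation R A A := Derivation.mk' (F.hasse i 1) fun a b => by
    simp only [smul_eq_mul]; exact F.hasse_one_mul i a b
  have hx (i j : Fin F.dim) : F.hasse i 1 (F.x j) = if j = i then 1 else 0 := by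
    change PowerSeries.coeff 1 (F.taylor i (F.x j)) = _
    rw [taylor_x]
    split_ifs <;> simp
  have key (i : Fin F.dim) : (der i).liftKaehlerDifferential = F.basis.coord i := by
    apply F.basis.ext
    intro j
    rw [F.basis.coord_apply, F.basis.repr_self, basis_apply,
      Derivation.liftKaehlerDifferential_comp_D, Finsupp.single_apply]
    exact hx i j
  rw [← F.basis.sum_repr (D R A a)]
  refine Finset.sum_congr rfl fun i _ => ?_
  rw [basis_apply, ← F.basis.coord_apply, ← key, Derivation.liftKaehlerDifferential_comp_D]
  rfl

theorem extd_ιMulti (n : ℕ) (v : Fin n → Fin F.dim) :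
    DeRham.extd R A (ExteriorAlgebra.ιMulti A n (F.basis ∘ v)) = 0 := by
  induction n with
  | zero => simp [DeRham.extd_one]
  | succ n ih =>
    rw [ExteriorAlgebra.ιMulti_succ_apply, Function.comp_apply, basis_apply,
      DeRham.extd_extd_ι_mul]
    have := ih (v ∘ Fin.succ)
    rw [← Function.comp_assoc] at this
    change -(ι A _ * DeRham.extd R A (ExteriorAlgebra.ιMulti A n ((F.basis ∘ v) ∘ Fin.succ))) = 0
    rw [this, mul_zero, neg_zero]

theorem constantCoeff_qDer (i : Fin F.dim) (f : A⟦X⟧) :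
    PowerSeries.constantCoeff (F.qDer i f) = F.hasse i 1 (PowerSeries.constantCoeff f) := by
  rw [← PowerSeries.coeff_zero_eq_constantCoeff_apply, qDer]
  simp [seriesOp, qDerCoeff]

/-- Modulo `q - 1`, the `q`-connection is the exterior derivative. -/
theorem evalForm_nablaQ (n : ℕ) (x : QForms R A n) :
    evalForm R A (n + 1) (F.nablaQ n x) = DeRham.d R A n (evalForm R A n x) := by
  induction x using F.qForms_induction with
  | h0 => simp
  | hadd x y hx hy => simp [hx, hy]
  | h f v =>
    rw [nablaQ_ιMulti, map_sum, evalForm_qtmul]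
    apply Subtype.ext
    change _ = DeRham.extd R A (PowerSeries.constantCoeff f • ExteriorAlgebra.ιMulti A n (F.basis ∘ v))
    rw [DeRham.extd_smul, extd_ιMulti, smul_zero, zero_add, D_eq, map_sum, Finset.sum_mul,
      AddSubmonoidClass.coe_finsetSum]
    refine Finset.sum_congr rfl fun i _ => ?_
    rw [evalForm_qtmul, constantCoeff_qDer, ιMulti_cons, map_smul, smul_mul_assoc]
    rfl

/-- The isomorphism of `(Ω^*_{A/R}⟦q - 1⟧, (q - 1) ∇_q) ⊗ R` with `(Ω^*_{A/R}, 0)`. -/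
def reduceHodge : reduction.obj F.qHodge ⟶ hodge R A :=
  reductionHom (K := F.qHodge) (N := hodge R A) (fun n => evalULift R A n)
    (fun n => by
      unfold hodge
      rw [moduleComplex_d]
      ext x
      apply ULift.down_injective
      refine (congrArg (fun y : ULift.{u + 1} (QForms R A (n + 1)) => evalForm R A (n + 1) y.down)
        (F.qHodge_d_apply n x)).trans ?_
      change evalForm R A (n + 1) ((PowerSeries.X : R⟦X⟧) • F.nablaQ n x.down) = 0
      rw [evalForm_smul]
      simp)

/-- The isomorphism of `q̂-Ω^•_{A/R,□} ⊗ R` with `Ω^•_{A/R}`. -/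
def reduceDeRham : reduction.obj F.qOmega ⟶ deRham R A :=
  reductionHom (K := F.qOmega) (N := deRham R A) (fun n => evalULift R A n)
    (fun n => by
      unfold deRham
      rw [moduleComplex_d]
      ext x
      apply ULift.down_injective
      refine (congrArg (fun y : ULift.{u + 1} (QForms R A (n + 1)) => evalForm R A (n + 1) y.down)
        (F.qOmega_d_apply n x)).trans ?_
      exact F.evalForm_nablaQ n x.down)

end Framing

section Comparison
variable {R A : Type u} [CommRing R] [CommRing A] [Algebra R A] [LambdaRing R] [LambdaRing A]

/-- All objects of the site are without `(q - 1)`-torsion, hence so is `q̂DR(A/R)`. -/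
theorem torsionFree_qDR : TorsionFree (qDR R A) := by
  intro n x hx
  refine funext fun σ => ?_
  have h : (PowerSeries.X : R⟦X⟧) •
      (show (σ.obj (Fin.last _) : QStrat R A) from x σ) = 0 := congrFun hx σ
  rw [Algebra.smul_def] at h
  exact (σ.obj (Fin.last _)).torsionFree _ h

variable (R) in
/-- The localization of the category of cochain complexes of `R`-modules at the
quasi-isomorphisms. -/
abbrev derivedQ := (HomologicalComplex.quasiIso (ModuleCat.{u + 1} R) (ComplexShape.up ℕ)).Q

/-- A zigzag `q̂DR(A/R) ← L → (Ω^*_{A/R}⟦q - 1⟧, (q - 1) ∇_q)` of quasi-isomorphisms, linear over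
`R⟦q - 1⟧`. The middle term is without `(q - 1)`-torsion, as are the outer ones, so that derived
décalage and derived reduction modulo `q - 1` are computed termwise on the whole zigzag. -/
structure Framing.Zigzag (F : Framing R A) where
  L : CochainComplex (ModuleCat.{u + 1} R⟦X⟧) ℕ
  torsionFree : TorsionFree L
  left : L ⟶ qDR R A
  right : L ⟶ F.qHodge
  quasiIso_left : QuasiIso left
  quasiIso_right : QuasiIso right
end Comparison

end QDeRham
end

open QDeRham

/-! Both sides are compared with a third complex that does not involve a framing: the Čech complex
`cech` of the site, whose cochains of degree `n` are the natural functions of `n + 1` lifts `A → B`.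
A framing guarantees that a family of `m + 1` lifts is classified by an object of the site
(`Framing.exists_universal_fin`), so that natural functions are the elements of that object. Two
double complexes have the Čech cochains as kernels of their rows. In `siteResolution` the entries
are functions of a chain of objects and of lifts to its first object: the rows are contracted by
putting the universal object in front of the chain, the columns by inserting a chosen lift, and what
remains of the columns is the homotopy limit. In `Framing.cechResolution` the entries are forms in a
further lift: the rows are exact by a `q`-Poincaré lemma, the columns are contracted by the usual
cone construction, and what remains is `(Ω^*⟦q - 1⟧, (q - 1)∇_q)`. A general argument on such double
complexes (`BiResolution.quasiIso_comparison`) turns each of them into a quasi-isomorphism out of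
the Čech complex.

The `q`-Poincaré lemma rests on the shape of the universal object. Since the framing is formally
étale, a second lift is the same as rank one elements `yᵢ` congruent to the coordinates `xᵢ` modulo
`q - 1`. In a `Λ`-ring the element `(y - x)/(q - 1)` has exterior powers, and these are the
`q`-divided powers `∏ (y - qʲ x)/(qʲ⁺¹ - 1)` (`IsQRing.exists_qDivided`). Conversely the ring of
functions on the points `qᵐ x` that are polynomial up to denominators from `ℤ[q]` is a `Λ`-ring,
free on such `q`-divided monomials (`qBasis`), and it yields the universal extension
(`QStrat.exists_qExtension`). The `q`-difference operator `dOp` is the coefficient of `ε` of the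
value at `xᵢ + (q - 1)ε`, where `ε² = xᵢ ε`; specialising `ε` to `xᵢ` shows that it is `(γᵢ -
1)/xᵢ`, without a division. On `A⟦q - 1⟧` it is `(q - 1)∇_{q,i}` (`Framing.dOp_hat`), and on
`q`-divided monomials it lowers one exponent (`Framing.dOp_qMon`). So integration is termwise modulo
`q - 1`, and completeness does the rest.

Independence of the framing comes from explicit cochains. A product of an element `a` with
difference quotients `(ℓₖ₊₁(bₖ) - ℓₖ(bₖ))/(q - 1)` is a cocycle modulo `q - 1`, and every framing
sends it to the form `a db_{n-1} ∧ ⋯ ∧ db_0` up to a fixed sign. Hence all comparison maps have a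
common section modulo `q - 1`. Since the target `(Ω^*, 0)` has no differential, they agree on
cocycles, and they agree in the derived category. The reduction of the décalage sees only cocycles
modulo `q - 1`, so the induced maps to the de Rham complex are even equal. -/

noncomputable section
namespace QDeRham

/-! ### Cohomology of complexes of modules in terms of elements -/

section Elementwise
variable {S : Type u} [CommRing S]

/-- Cochains that are coboundaries. -/
def IsBoundary (K : CochainComplex (ModuleCat.{v} S) ℕ) (n : ℕ) (x : K.X n) : Prop :=
  ∃ (i : ℕ) (w : K.X i), (K.d i n).hom w = x

theorem isBoundary_iff_prev (K : CochainComplex (ModuleCat.{v} S) ℕ) (n : ℕ) (x : K.X n) :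
    IsBoundary K n x ↔
      ∃ w : K.X ((ComplexShape.up ℕ).prev n), (K.d ((ComplexShape.up ℕ).prev n) n).hom w = x := by
  constructor
  · rintro ⟨i, w, rfl⟩
    by_cases h : (ComplexShape.up ℕ).Rel i n
    · obtain rfl := (ComplexShape.up ℕ).prev_eq' h
      exact ⟨w, rfl⟩
    · exact ⟨0, by rw [map_zero, K.shape _ _ h]; rfl⟩
  · rintro ⟨w, hw⟩
    exact ⟨_, w, hw⟩

theorem isBoundary_succ (K : CochainComplex (ModuleCat.{v} S) ℕ) (n : ℕ) (x : K.X (n + 1)) :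
    IsBoundary K (n + 1) x ↔ ∃ w : K.X n, (K.d n (n + 1)).hom w = x := by
  rw [isBoundary_iff_prev, CochainComplex.prev_nat_succ]

theorem isBoundary_zero (K : CochainComplex (ModuleCat.{v} S) ℕ) (x : K.X 0) :
    IsBoundary K 0 x ↔ x = 0 := by
  constructor
  · rintro ⟨i, w, rfl⟩
    rw [K.shape _ _ (by simp)]
    rfl
  · rintro rfl
    exact ⟨0, 0, map_zero _⟩

variable {K L : CochainComplex (ModuleCat.{v} S) ℕ}

theorem d_hom_d_hom (K : CochainComplex (ModuleCat.{v} S) ℕ) (i j k : ℕ) (x : K.X i) :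
    (K.d j k).hom ((K.d i j).hom x) = 0 := by
  rw [← LinearMap.comp_apply, ← ModuleCat.hom_comp, K.d_comp_d]
  rfl

theorem hom_comm_apply (f : K ⟶ L) (i j : ℕ) (x : K.X i) :
    (L.d i j).hom ((f.f i).hom x) = (f.f j).hom ((K.d i j).hom x) := by
  have := congr(($(f.comm i j)).hom x)
  exact this

theorem IsBoundary.map (f : K ⟶ L) {n : ℕ} {x : K.X n} (hx : IsBoundary K n x) :
    IsBoundary L n ((f.f n).hom x) := by
  obtain ⟨i, w, rfl⟩ := hx
  exact ⟨i, (f.f i).hom w, hom_comm_apply f i n w⟩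

theorem IsBoundary.d_eq_zero {n : ℕ} {x : K.X n} (hx : IsBoundary K n x) (j : ℕ) :
    (K.d n j).hom x = 0 := by
  obtain ⟨i, w, rfl⟩ := hx
  exact d_hom_d_hom K i n j w

theorem exists_cycles {n : ℕ} (x : K.X n) (hx : (K.d n (n + 1)).hom x = 0) :
    ∃ z : K.cycles n, (K.iCycles n).hom z = x := by
  have h : (K.sc n).g.hom x = 0 := by
    change (K.d n ((ComplexShape.up ℕ).next n)).hom x = 0
    rw [CochainComplex.next]
    exact hx
  refine ⟨(K.sc n).moduleCatCyclesIso.inv.hom ⟨x, h⟩, ?_⟩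
  have := congr(($((K.sc n).moduleCatCyclesIso_inv_iCycles)).hom ⟨x, h⟩)
  exact this

theorem d_iCycles_apply {n : ℕ} (z : K.cycles n) (j : ℕ) :
    (K.d n j).hom ((K.iCycles n).hom z) = 0 := by
  rw [← LinearMap.comp_apply, ← ModuleCat.hom_comp, K.iCycles_d]
  rfl

theorem iCycles_injective (n : ℕ) : Function.Injective (K.iCycles n).hom :=
  (ModuleCat.mono_iff_injective _).1 inferInstance

theorem homologyπ_eq_zero_iff {n : ℕ} (z : K.cycles n) :
    (K.homologyπ n).hom z = 0 ↔ IsBoundary K n ((K.iCycles n).hom z) := by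
  rw [isBoundary_iff_prev]
  have hex : (ShortComplex.mk _ _ (K.toCycles_comp_homologyπ
      ((ComplexShape.up ℕ).prev n) n)).Exact :=
    ShortComplex.exact_of_g_is_cokernel _ (K.homologyIsCokernel _ n rfl)
  rw [ShortComplex.moduleCat_exact_iff] at hex
  constructor
  · intro h
    obtain ⟨w, hw⟩ := hex z h
    refine ⟨w, ?_⟩
    rw [← hw]
    have := congr(($(K.toCycles_i ((ComplexShape.up ℕ).prev n) n)).hom w)
    exact this.symm
  · rintro ⟨w, hw⟩
    have h2 : (K.toCycles ((ComplexShape.up ℕ).prev n) n).hom w = z := by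
      apply iCycles_injective
      rw [← hw]
      have := congr(($(K.toCycles_i ((ComplexShape.up ℕ).prev n) n)).hom w)
      exact this
    rw [← h2]
    have := congr(($(K.toCycles_comp_homologyπ ((ComplexShape.up ℕ).prev n) n)).hom w)
    exact this

/-- The element-wise criterion for quasi-isomorphisms. -/
theorem quasiIso_iff_elementwise (f : K ⟶ L) : QuasiIso f ↔
    (∀ n (x : K.X n), (K.d n (n + 1)).hom x = 0 → IsBoundary L n ((f.f n).hom x) →
      IsBoundary K n x) ∧
    (∀ n (y : L.X n), (L.d n (n + 1)).hom y = 0 →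
      ∃ x : K.X n, (K.d n (n + 1)).hom x = 0 ∧ IsBoundary L n (y - (f.f n).hom x)) := by
  have hπ (M : CochainComplex (ModuleCat.{v} S) ℕ) (n : ℕ) :
      Function.Surjective (M.homologyπ n).hom := (ModuleCat.epi_iff_surjective _).1 inferInstance
  have hnat (n : ℕ) (z : K.cycles n) : (HomologicalComplex.homologyMap f n).hom
      ((K.homologyπ n).hom z) = (L.homologyπ n).hom ((HomologicalComplex.cyclesMap f n).hom z) := by
    have := congr(($(HomologicalComplex.homologyπ_naturality f n)).hom z)
    exact this
  have hcyc (n : ℕ) (z : K.cycles n) : (L.iCycles n).hom ((HomologicalComplex.cyclesMap f n).hom z)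
      = (f.f n).hom ((K.iCycles n).hom z) := by
    have := congr(($(HomologicalComplex.cyclesMap_i f n)).hom z)
    exact this
  have key (n : ℕ) : QuasiIsoAt f n ↔
      Function.Bijective (HomologicalComplex.homologyMap f n).hom := by
    rw [quasiIsoAt_iff_isIso_homologyMap]
    exact ConcreteCategory.isIso_iff_bijective _
  rw [quasiIso_iff]
  simp only [key]
  constructor
  · intro h
    refine ⟨fun n x hx hb => ?_, fun n y hy => ?_⟩
    · obtain ⟨z, rfl⟩ := exists_cycles x hx
      rw [← homologyπ_eq_zero_iff]
      apply (h n).1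
      rw [hnat, map_zero, homologyπ_eq_zero_iff, hcyc]
      exact hb
    · obtain ⟨z, rfl⟩ := exists_cycles y hy
      obtain ⟨c, hc⟩ := (h n).2 ((L.homologyπ n).hom z)
      obtain ⟨w, rfl⟩ := hπ K n c
      refine ⟨(K.iCycles n).hom w, d_iCycles_apply w _, ?_⟩
      rw [← hcyc, ← map_sub, ← homologyπ_eq_zero_iff, map_sub, ← hnat, hc, sub_self]
  · rintro ⟨h₁, h₂⟩ n
    constructor
    · rw [injective_iff_map_eq_zero]
      intro c hc
      obtain ⟨z, rfl⟩ := hπ K n c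
      rw [hnat, homologyπ_eq_zero_iff, hcyc] at hc
      rw [homologyπ_eq_zero_iff]
      exact h₁ n _ (d_iCycles_apply z _) hc
    · intro c
      obtain ⟨z, rfl⟩ := hπ L n c
      obtain ⟨x, hx, hb⟩ := h₂ n _ (d_iCycles_apply z (n + 1))
      obtain ⟨w, rfl⟩ := exists_cycles x hx
      refine ⟨(K.homologyπ n).hom w, ?_⟩
      rw [hnat, eq_comm, ← sub_eq_zero, ← map_sub, homologyπ_eq_zero_iff, map_sub, hcyc]
      exact hb

theorem IsBoundary.smul {n : ℕ} {x : K.X n} (s : S) (hx : IsBoundary K n x) :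
    IsBoundary K n (s • x) := by
  obtain ⟨i, w, rfl⟩ := hx
  exact ⟨i, s • w, map_smul _ _ _⟩

theorem IsBoundary.zero (n : ℕ) : IsBoundary K n 0 := ⟨n, 0, map_zero _⟩

theorem IsBoundary.add {n : ℕ} {x y : K.X n} (hx : IsBoundary K n x) (hy : IsBoundary K n y) :
    IsBoundary K n (x + y) := by
  rw [isBoundary_iff_prev] at *
  obtain ⟨v, rfl⟩ := hx
  obtain ⟨w, rfl⟩ := hy
  exact ⟨v + w, map_add _ _ _⟩

theorem IsBoundary.neg {n : ℕ} {x : K.X n} (hx : IsBoundary K n x) : IsBoundary K n (-x) := by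
  obtain ⟨i, w, rfl⟩ := hx
  exact ⟨i, -w, map_neg _ _⟩

theorem IsBoundary.sub {n : ℕ} {x y : K.X n} (hx : IsBoundary K n x) (hy : IsBoundary K n y) :
    IsBoundary K n (x - y) := by
  rw [sub_eq_add_neg]
  exact hx.add hy.neg

end Elementwise

end QDeRham
end

noncomputable section
namespace QDeRham

/-- The projection to a quotient module, as a morphism. -/
def quotHom {S : Type u} [Ring S] (V : ModuleCat.{v} S) (N : Submodule S V) :
    V ⟶ ModuleCat.of S (V ⧸ N) := ModuleCat.ofHom N.mkQ

theorem quotHom_apply_eq_zero_iff {S : Type u} [Ring S] (V : ModuleCat.{v} S) (N : Submodule S V)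
    (x : V) : (quotHom V N).hom x = 0 ↔ x ∈ N := Submodule.Quotient.mk_eq_zero N

/-! ### Reduction modulo `q - 1` of complexes without torsion -/

section Reduction
variable {R : Type u} [CommRing R]

/-- The class of a cochain in the reduction modulo `q - 1`. -/
def redMk (K : CochainComplex (ModuleCat.{u + 1} R⟦X⟧) ℕ) (n : ℕ) :
    K.X n →+ (reduction.obj K).X n :=
  (((ModuleCat.extendRestrictScalarsAdj.{u + 1} (PowerSeries.constantCoeff (R := R))).unit.app
    (K.X n)).hom).toAddMonoidHom

variable {K L : CochainComplex (ModuleCat.{u + 1} R⟦X⟧) ℕ}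

theorem redMk_smul (n : ℕ) (s : R⟦X⟧) (x : K.X n) :
    redMk K n (s • x) = PowerSeries.constantCoeff s • redMk K n x :=
  map_smul (((ModuleCat.extendRestrictScalarsAdj.{u + 1}
    (PowerSeries.constantCoeff (R := R))).unit.app (K.X n)).hom) s x

theorem redMk_X_smul (n : ℕ) (x : K.X n) :
    redMk K n ((PowerSeries.X : R⟦X⟧) • x) = 0 := by
  rw [redMk_smul]; simp

theorem reduction_d_redMk (i j : ℕ) (x : K.X i) :
    ((reduction.obj K).d i j).hom (redMk K i x) = redMk K j ((K.d i j).hom x) := rfl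

theorem reduction_map_redMk (f : K ⟶ L) (n : ℕ) (x : K.X n) :
    ((reduction.map f).f n).hom (redMk K n x) = redMk L n ((f.f n).hom x) := rfl

theorem reductionHom_redMk {N : CochainComplex (ModuleCat.{u + 1} R) ℕ}
    (g : ∀ n, K.X n ⟶ (ModuleCat.restrictScalars PowerSeries.constantCoeff).obj (N.X n))
    (hg : ∀ n, K.d n (n + 1) ≫ g (n + 1) =
      g n ≫ (ModuleCat.restrictScalars PowerSeries.constantCoeff).map (N.d n (n + 1)))
    (n : ℕ) (x : K.X n) :
    ((reductionHom g hg).f n).hom (redMk K n x) = (g n).hom x := by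
  have := ModuleCat.extendRestrictScalarsAdj_homEquiv_apply.{u + 1, u, u}
    (((ModuleCat.extendRestrictScalarsAdj.{u + 1} PowerSeries.constantCoeff).homEquiv
      (K.X n) (N.X n)).symm (g n)) x
  rw [Equiv.apply_symm_apply] at this
  exact this.symm

/-- The image is an `R`-submodule because scalars lift to constant series, and the projection to the
quotient by it vanishes on the generators of the extension of scalars. -/
theorem redMk_surjective (n : ℕ) : Function.Surjective (redMk K n) := by
  let N : Submodule R ((reduction.obj K).X n) :=
    { carrier := Set.range (redMk K n)
      add_mem' := by
        rintro _ _ ⟨x, rfl⟩ ⟨y, rfl⟩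
        exact ⟨x + y, map_add _ _ _⟩
      zero_mem' := ⟨0, map_zero _⟩
      smul_mem' := by
        rintro r _ ⟨x, rfl⟩
        exact ⟨PowerSeries.C r • x, by rw [redMk_smul]; simp⟩ }
  have h : quotHom _ N = 0 := by
    apply ModuleCat.ExtendScalars.hom_ext
    intro m
    have hm : redMk K n m ∈ N := ⟨m, rfl⟩
    exact (quotHom_apply_eq_zero_iff _ N _).2 hm
  intro y
  exact (quotHom_apply_eq_zero_iff _ N y).1 congr(($h).hom y)

/-- The quotient `Kⁿ/(q - 1)` is an `R`-module through the constant series, so by adjunction the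
projection of `Kⁿ` to it factors through the reduction. -/
theorem redMk_eq_zero_iff (n : ℕ) (x : K.X n) :
    redMk K n x = 0 ↔ ∃ y : K.X n, x = (PowerSeries.X : R⟦X⟧) • y := by
  constructor
  · intro hx
    let I : Submodule R⟦X⟧ (K.X n) :=
      LinearMap.range (LinearMap.lsmul R⟦X⟧ (K.X n) PowerSeries.X)
    let _ : Module R (K.X n ⧸ I) := Module.compHom _ (PowerSeries.C (R := R))
    have hs (r : R) (y : K.X n ⧸ I) : r • y = (PowerSeries.C r : R⟦X⟧) • y := rfl
    let g : K.X n ⟶ (ModuleCat.restrictScalars PowerSeries.constantCoeff).obj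
        (ModuleCat.of R (K.X n ⧸ I)) :=
      ModuleCat.ofHom (Y := (ModuleCat.restrictScalars PowerSeries.constantCoeff).obj
        (ModuleCat.of R (K.X n ⧸ I)))
        { toFun := fun y => I.mkQ y
          map_add' := fun _ _ => map_add I.mkQ _ _
          map_smul' := fun s y => by
            change I.mkQ (s • y) = (PowerSeries.C (PowerSeries.constantCoeff s) : R⟦X⟧) • I.mkQ y
            rw [← map_smul, ← sub_eq_zero, ← map_sub, ← sub_smul]
            have : PowerSeries.X ∣ s - PowerSeries.C (PowerSeries.constantCoeff s) := by
              rw [PowerSeries.X_dvd_iff]; simp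
            obtain ⟨t, ht⟩ := this
            rw [ht, mul_smul]
            exact (Submodule.Quotient.mk_eq_zero I).2 ⟨_, rfl⟩ }
    have := ModuleCat.extendRestrictScalarsAdj_homEquiv_apply.{u + 1, u, u}
      (((ModuleCat.extendRestrictScalarsAdj.{u + 1} PowerSeries.constantCoeff).homEquiv
        (K.X n) (ModuleCat.of R (K.X n ⧸ I))).symm g) x
    rw [Equiv.apply_symm_apply] at this
    have h2 : I.mkQ x = 0 := by
      refine Eq.trans this ?_
      refine Eq.trans (congrArg (((ModuleCat.extendRestrictScalarsAdj.{u + 1}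
        PowerSeries.constantCoeff).homEquiv
        (K.X n) (ModuleCat.of R (K.X n ⧸ I))).symm g).hom hx) ?_
      exact map_zero _
    obtain ⟨y, hy⟩ := (Submodule.Quotient.mk_eq_zero I).1 h2
    exact ⟨y, hy.symm⟩
  · rintro ⟨y, rfl⟩
    exact redMk_X_smul n y

theorem redMk_eq_iff (n : ℕ) (x y : K.X n) :
    redMk K n x = redMk K n y ↔ ∃ z : K.X n, x = y + (PowerSeries.X : R⟦X⟧) • z := by
  rw [← sub_eq_zero, ← map_sub, redMk_eq_zero_iff]
  exact exists_congr fun z => sub_eq_iff_eq_add'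

theorem TorsionFree.smul_cancel (hK : TorsionFree K) {n : ℕ} {x y : K.X n}
    (h : (PowerSeries.X : R⟦X⟧) • x = (PowerSeries.X : R⟦X⟧) • y) : x = y := by
  rw [← sub_eq_zero, ← smul_sub] at h
  exact sub_eq_zero.1 (hK n _ h)

theorem TorsionFree.pow_smul_cancel {K : CochainComplex (ModuleCat.{v} R⟦X⟧) ℕ}
    (hK : TorsionFree K) (m : ℕ) {n : ℕ} {x y : K.X n}
    (h : (PowerSeries.X ^ m : R⟦X⟧) • x = (PowerSeries.X ^ m : R⟦X⟧) • y) : x = y := by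
  rw [← sub_eq_zero, ← smul_sub] at h
  refine sub_eq_zero.1 ?_
  generalize x - y = z at h
  induction m with
  | zero => simpa using h
  | succ m ih =>
    rw [pow_succ', mul_smul] at h
    exact ih (hK n _ h)

theorem isBoundary_redMk (n : ℕ) (x : K.X n) :
    IsBoundary (reduction.obj K) n (redMk K n x) ↔
      ∃ y z, IsBoundary K n y ∧ x = y + (PowerSeries.X : R⟦X⟧) • z := by
  constructor
  · rintro ⟨i, w, hw⟩
    obtain ⟨w, rfl⟩ := redMk_surjective i w
    rw [reduction_d_redMk, eq_comm, redMk_eq_iff] at hw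
    obtain ⟨z, hz⟩ := hw
    exact ⟨_, z, ⟨i, w, rfl⟩, hz⟩
  · rintro ⟨y, z, ⟨i, w, rfl⟩, rfl⟩
    refine ⟨i, redMk K i w, ?_⟩
    rw [reduction_d_redMk, map_add, redMk_X_smul, add_zero]

/-- Reduction modulo `q - 1` preserves quasi-isomorphisms of complexes without torsion. -/
theorem quasiIso_reduction_map (f : K ⟶ L) (hK : TorsionFree K) (hL : TorsionFree L)
    (hf : QuasiIso f) : QuasiIso (reduction.map f) := by
  rw [quasiIso_iff_elementwise] at hf ⊢
  obtain ⟨inj, surj⟩ := hf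
  constructor
  -- This is a chase in the long exact sequences of multiplication by `q - 1` on `K` and `L`: `x'`
  -- represents the connecting image of `x`, and `w'` shows that its image in `L` bounds. So `x'`
  -- bounds in `K`, and `x` can be corrected by a multiple of `q - 1` to an honest cocycle.
  · intro n x hx hb
    obtain ⟨x, rfl⟩ := redMk_surjective n x
    rw [reduction_d_redMk, redMk_eq_zero_iff] at hx
    obtain ⟨x', hx'⟩ := hx
    rw [reduction_map_redMk, isBoundary_redMk] at hb
    obtain ⟨y, w', hy, hw'⟩ := hb
    have h1 : (f.f (n + 1)).hom x' = (L.d n (n + 1)).hom w' := by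
      apply hL.smul_cancel
      rw [← map_smul, ← hx', ← hom_comm_apply, hw', map_add, hy.d_eq_zero, zero_add, map_smul]
    have hdx' : (K.d (n + 1) (n + 1 + 1)).hom x' = 0 := by
      apply hK.smul_cancel
      rw [← map_smul, ← hx', d_hom_d_hom, smul_zero]
    obtain ⟨v, hv⟩ := (isBoundary_succ K n x').1 (inj (n + 1) x' hdx' ⟨n, w', h1.symm⟩)
    have hcl : (L.d n (n + 1)).hom (w' - (f.f n).hom v) = 0 := by
      rw [map_sub, hom_comm_apply, hv, h1, sub_self]
    obtain ⟨t, ht, hs⟩ := surj n _ hcl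
    have hclx : (K.d n (n + 1)).hom (x - (PowerSeries.X : R⟦X⟧) • (v + t)) = 0 := by
      rw [map_sub, map_smul, map_add, hv, ht, add_zero, hx', sub_self]
    have := inj n _ hclx (by
      have h3 := hy.add (hs.smul (PowerSeries.X : R⟦X⟧))
      convert h3 using 1
      rw [map_sub, map_smul, hw', map_add]
      simp only [smul_sub, smul_add]
      abel)
    rw [isBoundary_redMk]
    exact ⟨_, v + t, this, by abel⟩
  · intro n y hy
    obtain ⟨y, rfl⟩ := redMk_surjective n y
    rw [reduction_d_redMk, redMk_eq_zero_iff] at hy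
    obtain ⟨y', hy'⟩ := hy
    have hdy' : (L.d (n + 1) (n + 1 + 1)).hom y' = 0 := by
      apply hL.smul_cancel
      rw [← map_smul, ← hy', d_hom_d_hom, smul_zero]
    obtain ⟨x', hx', hb⟩ := surj (n + 1) y' hdy'
    rw [isBoundary_succ] at hb
    obtain ⟨w, hw⟩ := hb
    -- A connecting class is killed by `q - 1`, and this can be tested in `L`; the primitive `v` of
    -- `(q - 1) x'` is then a cocycle modulo `q - 1` that lifts the class of `y` up to honest
    -- cocycles.
    have hb2 : IsBoundary K (n + 1) ((PowerSeries.X : R⟦X⟧) • x') := by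
      apply inj (n + 1) _ (by rw [map_smul, hx', smul_zero])
      refine ⟨n, y - (PowerSeries.X : R⟦X⟧) • w, ?_⟩
      rw [map_sub, map_smul, map_smul, hw, hy', smul_sub]
      abel
    rw [isBoundary_succ] at hb2
    obtain ⟨v, hv⟩ := hb2
    have hcl : (L.d n (n + 1)).hom (y - (PowerSeries.X : R⟦X⟧) • w - (f.f n).hom v) = 0 := by
      rw [map_sub, map_sub, map_smul, hom_comm_apply, hv, hw, hy', map_smul, smul_sub]
      abel
    obtain ⟨t, ht, hs⟩ := surj n _ hcl
    refine ⟨redMk K n (v + t), ?_, ?_⟩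
    · rw [reduction_d_redMk, redMk_eq_zero_iff]
      exact ⟨x', by rw [map_add, hv, ht, add_zero]⟩
    · rw [reduction_map_redMk, ← map_sub, isBoundary_redMk]
      refine ⟨_, w, hs, ?_⟩
      rw [map_add]
      abel

end Reduction

/-! ### Décalage preserves quasi-isomorphisms -/

section Eta
variable {R : Type u} [CommRing R] {K L : CochainComplex (ModuleCat.{v} R⟦X⟧) ℕ}

theorem eta_d_apply (n : ℕ) (x : etaSubmodule K n) :
    (((eta K).d n (n + 1)).hom x : etaSubmodule K (n + 1)).1 = (K.d n (n + 1)).hom x.1 := by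
  rw [eta_d]
  rfl

theorem TorsionFree.eta (hK : TorsionFree K) : TorsionFree (eta K) := fun n _ hx =>
  Subtype.ext (hK n _ (congrArg (Subtype.val (p := fun y => y ∈ etaSubmodule K n)) hx))

theorem isBoundary_eta_succ (n : ℕ) (x : etaSubmodule K (n + 1)) :
    IsBoundary (eta K) (n + 1) x ↔
      ∃ w ∈ etaSubmodule K n, (K.d n (n + 1)).hom w = x.1 := by
  refine (isBoundary_succ (eta K) n x).trans ?_
  constructor
  · rintro ⟨w, hw⟩
    exact ⟨w.1, w.2, (eta_d_apply n w).symm.trans (congrArg Subtype.val hw)⟩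
  · rintro ⟨w, hw, h⟩
    exact ⟨⟨w, hw⟩, Subtype.ext ((eta_d_apply n _).trans h)⟩

/-- Décalage preserves quasi-isomorphisms of complexes without torsion. -/
theorem quasiIso_etaMap (f : K ⟶ L) (hK : TorsionFree K) (hL : TorsionFree L)
    (hf : QuasiIso f) : QuasiIso (etaMap f) := by
  rw [quasiIso_iff_elementwise] at hf ⊢
  obtain ⟨inj, surj⟩ := hf
  constructor
  -- A cocycle of the décalage has the form `(q - 1)ⁿ y` with `y` a cocycle of `K`, and it bounds in
  -- the décalage exactly if `(q - 1) y` bounds in `K`. So the cohomology of the décalage is that of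
  -- `K` modulo its `(q - 1)`-torsion, which depends only on the cohomology of `K`. In degree zero
  -- there are no boundaries and the torsion vanishes.
  · intro n (x : etaSubmodule K n) hx hb
    obtain ⟨⟨y, hy⟩, -⟩ := x.2
    have hy' : (PowerSeries.X ^ n : R⟦X⟧) • y = x.1 := hy
    have hdx : (K.d n (n + 1)).hom x.1 = 0 := by
      rw [← eta_d_apply]
      exact congrArg Subtype.val hx
    have hdy : (K.d n (n + 1)).hom y = 0 := by
      apply hK.pow_smul_cancel n
      rw [← map_smul, hy', hdx, smul_zero]
    cases n with
    | zero =>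
      rw [isBoundary_zero] at hb
      refine (isBoundary_zero (eta K) x).2 ?_
      have hfx : (f.f 0).hom x.1 = 0 := congrArg Subtype.val hb
      have := inj 0 x.1 hdx (by rw [hfx]; exact IsBoundary.zero 0)
      rw [isBoundary_zero] at this
      exact Subtype.ext this
    | succ n =>
      have hb' := (isBoundary_eta_succ n (⟨(f.f (n + 1)).hom x.1,
        map_mem_etaSubmodule f _ _ x.2⟩ : etaSubmodule L (n + 1))).1 hb
      obtain ⟨w, hw, hdw⟩ := hb'
      obtain ⟨⟨v, hv⟩, -⟩ := hw
      have hv' : (PowerSeries.X ^ n : R⟦X⟧) • v = w := hv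
      have hdv : (L.d n (n + 1)).hom v = (f.f (n + 1)).hom ((PowerSeries.X : R⟦X⟧) • y) := by
        apply hL.pow_smul_cancel n
        rw [← map_smul, hv', hdw, ← map_smul, smul_smul, ← pow_succ]
        exact congrArg _ hy'.symm
      have hbx := inj (n + 1) ((PowerSeries.X : R⟦X⟧) • y) (by rw [map_smul, hdy, smul_zero])
        ⟨n, v, hdv⟩
      rw [isBoundary_succ] at hbx
      obtain ⟨t, ht⟩ := hbx
      refine (isBoundary_eta_succ n x).2 ?_
      have hdt : (K.d n (n + 1)).hom ((PowerSeries.X ^ n : R⟦X⟧) • t) = x.1 := by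
        rw [map_smul, ht, smul_smul, ← pow_succ, hy']
      exact ⟨(PowerSeries.X ^ n : R⟦X⟧) • t, ⟨⟨t, rfl⟩, ⟨y, by rw [hdt]; exact hy'⟩⟩, hdt⟩
  · intro n (y : etaSubmodule L n) hy
    obtain ⟨⟨z, hz⟩, -⟩ := y.2
    have hz' : (PowerSeries.X ^ n : R⟦X⟧) • z = y.1 := hz
    have hdy : (L.d n (n + 1)).hom y.1 = 0 := by
      rw [← eta_d_apply]
      exact congrArg Subtype.val hy
    have hdz : (L.d n (n + 1)).hom z = 0 := by
      apply hL.pow_smul_cancel n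
      rw [← map_smul, hz', hdy, smul_zero]
    obtain ⟨x, hx, hb⟩ := surj n z hdz
    have hmem : (PowerSeries.X ^ n : R⟦X⟧) • x ∈ etaSubmodule K n :=
      ⟨⟨x, rfl⟩, ⟨0, by rw [map_smul, hx, smul_zero, map_zero]⟩⟩
    refine ⟨(⟨_, hmem⟩ : etaSubmodule K n), ?_, ?_⟩
    · apply Subtype.ext
      rw [eta_d_apply]
      change (K.d n (n + 1)).hom ((PowerSeries.X ^ n : R⟦X⟧) • x) = 0
      rw [map_smul, hx, smul_zero]
    · have hdiff : y.1 - (f.f n).hom ((PowerSeries.X ^ n : R⟦X⟧) • x) =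
          (PowerSeries.X ^ n : R⟦X⟧) • (z - (f.f n).hom x) := by
        rw [map_smul, ← hz', smul_sub]
      cases n with
      | zero =>
        rw [isBoundary_zero] at hb
        refine (isBoundary_zero (eta L) _).2 ?_
        apply Subtype.ext
        refine hdiff.trans ?_
        rw [hb, smul_zero]
        rfl
      | succ n =>
        refine (isBoundary_eta_succ n _).2 ?_
        rw [isBoundary_succ] at hb
        obtain ⟨w, hw⟩ := hb
        have hdw : (L.d n (n + 1)).hom ((PowerSeries.X ^ (n + 1) : R⟦X⟧) • w) =
            (PowerSeries.X ^ (n + 1) : R⟦X⟧) • (z - (f.f (n + 1)).hom x) := by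
          rw [map_smul, hw]
        refine ⟨(PowerSeries.X ^ (n + 1) : R⟦X⟧) • w, ⟨⟨(PowerSeries.X : R⟦X⟧) • w, ?_⟩,
          ⟨z - (f.f (n + 1)).hom x, ?_⟩⟩, hdw.trans hdiff.symm⟩
        · change (PowerSeries.X ^ n : R⟦X⟧) • (PowerSeries.X : R⟦X⟧) • w = _
          rw [smul_smul, ← pow_succ]
        · exact hdw.symm

end Eta
end QDeRham
end

/-! ### The complexes attached to a framing -/

noncomputable section
namespace QDeRham

set_option linter.unusedSectionVars false

theorem isIso_of_bijective {S : Type u} [CommRing S] {K L : CochainComplex (ModuleCat.{v} S) ℕ}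
    (f : K ⟶ L) (h : ∀ n, Function.Bijective (f.f n).hom) : IsIso f := by
  have (n : ℕ) : IsIso (f.f n) := (ConcreteCategory.isIso_iff_bijective (f.f n)).2 (h n)
  exact HomologicalComplex.Hom.isIso_of_components f

namespace Framing
open KaehlerDifferential
variable {R A : Type u} [CommRing R] [CommRing A] [Algebra R A] [LambdaRing R] [LambdaRing A]
  (F : Framing R A)

theorem algebraMap_X_eq : algebraMap R⟦X⟧ A⟦X⟧ PowerSeries.X = PowerSeries.X :=
  PowerSeries.map_X _

theorem X_smul_qForms {n : ℕ} (x : QForms R A n) :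
    (PowerSeries.X : R⟦X⟧) • x = (PowerSeries.X : A⟦X⟧) • x := by
  rw [← algebraMap_smul A⟦X⟧, algebraMap_X_eq]

include F in
theorem X_smul_qForms_cancel {n : ℕ} (x : QForms R A n)
    (h : (PowerSeries.X : R⟦X⟧) • x = 0) : x = 0 := by
  rw [X_smul_qForms] at h
  apply (F.formBasis n).repr.injective
  ext I : 1
  have h2 := congr((F.formBasis n).repr $h I)
  rw [map_smul, map_zero, Finsupp.smul_apply, smul_eq_mul] at h2
  rw [map_zero]
  exact PowerSeries.X_mul_cancel (h2.trans (mul_zero _).symm)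

theorem evalForm_formBasis_sum {n : ℕ} (x : QForms R A n) :
    evalForm R A n x = ∑ I, PowerSeries.constantCoeff ((F.formBasis n).repr x I) •
      F.basis.exteriorPower n I := by
  conv_lhs => rw [← (F.formBasis n).sum_repr x]
  rw [map_sum]
  refine Finset.sum_congr rfl fun I _ => ?_
  rw [formBasis_apply, smul_qtmul, mul_one, evalForm_qtmul]

include F in
theorem evalForm_eq_zero_iff {n : ℕ} (x : QForms R A n) :
    evalForm R A n x = 0 ↔ ∃ y, x = (PowerSeries.X : R⟦X⟧) • y := by
  constructor
  · intro h
    rw [F.evalForm_formBasis_sum] at h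
    have h2 := Fintype.linearIndependent_iff.1 (F.basis.exteriorPower n).linearIndependent _ h
    have h3 (I) : ∃ g, (F.formBasis n).repr x I = PowerSeries.X * g :=
      PowerSeries.X_dvd_iff.2 (h2 I)
    choose g hg using h3
    refine ⟨∑ I, g I • F.formBasis n I, ?_⟩
    rw [X_smul_qForms, Finset.smul_sum]
    conv_lhs => rw [← (F.formBasis n).sum_repr x]
    refine Finset.sum_congr rfl fun I _ => ?_
    rw [hg, mul_smul]
  · rintro ⟨y, rfl⟩
    rw [evalForm_smul]
    simp

theorem evalForm_surjective (n : ℕ) : Function.Surjective (evalForm R A n) := fun ω =>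
  ⟨qtmul 1 ω, by rw [evalForm_qtmul]; simp⟩

theorem torsionFree_qHodge : TorsionFree F.qHodge := fun _ x hx =>
  ULift.down_injective (F.X_smul_qForms_cancel x.down (congrArg ULift.down hx))

theorem torsionFree_qOmega : TorsionFree F.qOmega := fun _ x hx =>
  ULift.down_injective (F.X_smul_qForms_cancel x.down (congrArg ULift.down hx))

theorem reduceHodge_redMk (n : ℕ) (x : ULift.{u + 1} (QForms R A n)) :
    (F.reduceHodge.f n).hom (redMk F.qHodge n x) = ULift.up.{u + 1} (evalForm R A n x.down) :=
  reductionHom_redMk (K := F.qHodge) (N := hodge R A) (fun n => evalULift R A n) _ n x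

theorem reduceDeRham_redMk (n : ℕ) (x : ULift.{u + 1} (QForms R A n)) :
    (F.reduceDeRham.f n).hom (redMk F.qOmega n x) = ULift.up.{u + 1} (evalForm R A n x.down) :=
  reductionHom_redMk (K := F.qOmega) (N := deRham R A) (fun n => evalULift R A n) _ n x

instance isIso_reduceHodge : IsIso F.reduceHodge := by
  refine isIso_of_bijective _ fun n => ⟨?_, ?_⟩
  · rw [injective_iff_map_eq_zero]
    intro x hx
    obtain ⟨x, rfl⟩ := redMk_surjective n x
    have h := congrArg ULift.down ((F.reduceHodge_redMk n x).symm.trans hx)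
    obtain ⟨y, hy⟩ := (F.evalForm_eq_zero_iff _).1 h
    rw [redMk_eq_zero_iff]
    exact ⟨ULift.up.{u + 1} y, ULift.down_injective hy⟩
  · rintro ⟨ω⟩
    obtain ⟨x, rfl⟩ := evalForm_surjective n ω
    exact ⟨redMk F.qHodge n (ULift.up.{u + 1} x), F.reduceHodge_redMk n (ULift.up.{u + 1} x)⟩

instance isIso_reduceDeRham : IsIso F.reduceDeRham := by
  refine isIso_of_bijective _ fun n => ⟨?_, ?_⟩
  · rw [injective_iff_map_eq_zero]
    intro x hx
    obtain ⟨x, rfl⟩ := redMk_surjective n x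
    have h := congrArg ULift.down ((F.reduceDeRham_redMk n x).symm.trans hx)
    obtain ⟨y, hy⟩ := (F.evalForm_eq_zero_iff _).1 h
    rw [redMk_eq_zero_iff]
    exact ⟨ULift.up.{u + 1} y, ULift.down_injective hy⟩
  · rintro ⟨ω⟩
    obtain ⟨x, rfl⟩ := evalForm_surjective n ω
    exact ⟨redMk F.qOmega n (ULift.up.{u + 1} x), F.reduceDeRham_redMk n (ULift.up.{u + 1} x)⟩

theorem toEta_f_apply (n : ℕ) (x : F.qOmega.X n) :
    ((F.toEta.f n).hom x : etaSubmodule F.qHodge n).1 =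
      (PowerSeries.X ^ n : R⟦X⟧) • (show F.qHodge.X n from x) := rfl

/-- The differential of `qHodge` is divisible by `q - 1`, so every element `(q - 1)ⁿ y` lies in the
décalage, and `y` is unique because there is no torsion. -/
instance isIso_toEta : IsIso F.toEta := by
  refine isIso_of_bijective _ fun n => ⟨?_, ?_⟩
  · intro x y hxy
    exact F.torsionFree_qHodge.pow_smul_cancel n (congrArg Subtype.val hxy)
  · rintro ⟨x, ⟨y, hy⟩, h⟩
    exact ⟨y, Subtype.ext hy⟩

end Framing

/-! ### Independence of the framing from a common section modulo `q - 1` -/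

section Assembly
variable {R A : Type u} [CommRing R] [CommRing A] [Algebra R A] [LambdaRing R] [LambdaRing A]

theorem hodge_d (i j : ℕ) : (hodge R A).d i j = 0 := by
  by_cases h : (ComplexShape.up ℕ).Rel i j
  · obtain rfl : i + 1 = j := h
    unfold hodge
    rw [moduleComplex_d]
    rfl
  · exact (hodge R A).shape _ _ h

/-- Maps to `(Ω^*, 0)` with a common section agree on cocycles, if one of them is a
quasi-isomorphism. -/
theorem eq_on_cocycles_of_section {M : CochainComplex (ModuleCat.{u + 1} R) ℕ}
    (ρ ρ' : M ⟶ hodge R A) (hρ : QuasiIso ρ) (s : hodge R A ⟶ M) (hs : s ≫ ρ = 𝟙 _)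
    (hs' : s ≫ ρ' = 𝟙 _) (n : ℕ) (x : M.X n) (hx : (M.d n (n + 1)).hom x = 0) :
    (ρ.f n).hom x = (ρ'.f n).hom x := by
  have happ (τ : M ⟶ hodge R A) (hτ : s ≫ τ = 𝟙 _) (y : (hodge R A).X n) :
      (τ.f n).hom ((s.f n).hom y) = y := congr((($hτ).f n).hom y)
  have hd (y : (hodge R A).X n) (j : ℕ) : ((hodge R A).d n j).hom y = 0 := by
    rw [hodge_d]
    rfl
  -- The quasi-isomorphism `ρ` kills the cocycle `x - s(ρ x)`, which is therefore a coboundary. Any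
  -- map to a complex without differential kills coboundaries, in particular `ρ'`.
  have h1 : IsBoundary M n (x - (s.f n).hom ((ρ.f n).hom x)) := by
    apply ((quasiIso_iff_elementwise ρ).1 hρ).1 n
    · rw [map_sub, hx, hom_comm_apply, hd, map_zero, sub_zero]
    · rw [map_sub, happ ρ hs, sub_self]
      exact IsBoundary.zero n
  obtain ⟨i, w, hw⟩ := h1.map ρ'
  rw [hodge_d, map_sub, happ ρ' hs'] at hw
  exact (sub_eq_zero.1 hw.symm).symm

/-- The main theorem follows from comparison maps out of a common complex `C`, that have a common
section modulo `q - 1`. -/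
theorem exists_comparison_of_section {C : CochainComplex (ModuleCat.{u + 1} R⟦X⟧) ℕ}
    (hC : TorsionFree C) (left : C ⟶ qDR R A) (hleft : QuasiIso left)
    (right : ∀ F : Framing R A, C ⟶ F.qHodge) (hright : ∀ F, QuasiIso (right F))
    (s : hodge R A ⟶ reduction.obj C)
    (hs : ∀ F, s ≫ reduction.map (right F) ≫ F.reduceHodge = 𝟙 _) (F₀ : Framing R A) :
    ∃ (e₀ : (derivedQ R).obj (reduction.obj (qDR R A)) ≅ (derivedQ R).obj (hodge R A))
      (e₁ : (derivedQ R).obj (reduction.obj (eta (qDR R A))) ≅ (derivedQ R).obj (deRham R A)),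
      ∀ F : Framing R A, ∃ (Z : F.Zigzag) (c : eta Z.L ⟶ F.qOmega),
        QuasiIso (etaMap Z.left) ∧ QuasiIso c ∧ c ≫ F.toEta = etaMap Z.right ∧
        QuasiIso (reduction.map Z.left) ∧
        QuasiIso (reduction.map Z.right ≫ F.reduceHodge) ∧
        QuasiIso (reduction.map (etaMap Z.left)) ∧
        QuasiIso (reduction.map c ≫ F.reduceDeRham) ∧
        (derivedQ R).map (reduction.map Z.left) ≫ e₀.hom =
          (derivedQ R).map (reduction.map Z.right ≫ F.reduceHodge) ∧
        (derivedQ R).map (reduction.map (etaMap Z.left)) ≫ e₁.hom =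
          (derivedQ R).map (reduction.map c ≫ F.reduceDeRham) := by
  let c (F : Framing R A) : eta C ⟶ F.qOmega := etaMap (right F) ≫ inv F.toEta
  have hcη (F : Framing R A) : c F ≫ F.toEta = etaMap (right F) := by simp [c]
  have hη (F : Framing R A) : QuasiIso (etaMap (right F)) :=
    quasiIso_etaMap _ hC F.torsionFree_qHodge (hright F)
  have hc (F : Framing R A) : QuasiIso (c F) := by
    have := hη F
    infer_instance
  have hηl : QuasiIso (etaMap left) := quasiIso_etaMap _ hC torsionFree_qDR hleft
  have hrl : QuasiIso (reduction.map left) := quasiIso_reduction_map _ hC torsionFree_qDR hleft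
  have hrηl : QuasiIso (reduction.map (etaMap left)) :=
    quasiIso_reduction_map _ hC.eta torsionFree_qDR.eta hηl
  have hρ (F : Framing R A) : QuasiIso (reduction.map (right F) ≫ F.reduceHodge) := by
    have := quasiIso_reduction_map _ hC F.torsionFree_qHodge (hright F)
    infer_instance
  have hκ (F : Framing R A) : QuasiIso (reduction.map (c F) ≫ F.reduceDeRham) := by
    have := quasiIso_reduction_map _ hC.eta F.torsionFree_qOmega (hc F)
    infer_instance
  have hQ {M N : CochainComplex (ModuleCat.{u + 1} R) ℕ} (f : M ⟶ N) (hf : QuasiIso f) :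
      IsIso ((derivedQ R).map f) := MorphismProperty.Q_inverts _ f hf
  -- independence of the framing
  have hind₀ (F : Framing R A) : (derivedQ R).map (reduction.map (right F) ≫ F.reduceHodge) =
      (derivedQ R).map (reduction.map (right F₀) ≫ F₀.reduceHodge) := by
    -- After localization the section `s` is inverse to one comparison map, hence is an isomorphism,
    -- and all comparison maps are its inverse.
    have hsq : IsIso ((derivedQ R).map s) := by
      have h1 := hQ _ (hρ F₀)
      have h2 : (derivedQ R).map s ≫
          (derivedQ R).map (reduction.map (right F₀) ≫ F₀.reduceHodge) = 𝟙 _ := by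
        rw [← Functor.map_comp, hs, CategoryTheory.Functor.map_id]
      exact IsIso.of_isIso_fac_right h2
    rw [← cancel_epi ((derivedQ R).map s), ← Functor.map_comp, ← Functor.map_comp, hs, hs]
  -- An element of the décalage is `(q - 1)ⁿ y`, and the identification of `qOmega` with the
  -- décalage divides by `(q - 1)ⁿ`. So the map to the de Rham complex is computed by the Hodge
  -- comparison at `y`.
  have hval (F : Framing R A) (n : ℕ) (x : etaSubmodule C n) (y : C.X n)
      (hy : (PowerSeries.X ^ n : R⟦X⟧) • y = x.1) :
      ((reduction.map (c F) ≫ F.reduceDeRham).f n).hom (redMk (eta C) n x) =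
        ((reduction.map (right F) ≫ F.reduceHodge).f n).hom (redMk C n y) := by
    have h1 : ((c F).f n).hom x = (show ULift.{u + 1} (QForms R A n) from
        ((right F).f n).hom y) := by
      have h2 : ((F.toEta.f n).hom (((c F).f n).hom x) : etaSubmodule F.qHodge n).1 =
          ((right F).f n).hom x.1 := congr((($(hcη F)).f n).hom x |>.1)
      rw [F.toEta_f_apply, ← hy, map_smul] at h2
      exact F.torsionFree_qHodge.pow_smul_cancel n h2
    refine Eq.trans ?_ (F.reduceHodge_redMk n _).symm
    refine (F.reduceDeRham_redMk n (((c F).f n).hom x)).trans ?_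
    rw [h1]
  have hind₁ (F : Framing R A) : reduction.map (c F) ≫ F.reduceDeRham =
      reduction.map (c F₀) ≫ F₀.reduceDeRham := by
    ext n x
    obtain ⟨x, rfl⟩ := redMk_surjective (K := eta C) n x
    obtain ⟨⟨y, hy⟩, ⟨z, hz⟩⟩ := (show etaSubmodule C n from x).2
    refine (hval F n x y hy).trans (Eq.trans ?_ (hval F₀ n x y hy).symm)
    -- The second condition in the definition of the décalage says that `y` is a cocycle modulo `q -
    -- 1`. Thus agreement on cocycles suffices for equality of the two maps of complexes, before any
    -- localization.
    have hdy : (C.d n (n + 1)).hom y = (PowerSeries.X : R⟦X⟧) • z := by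
      apply hC.pow_smul_cancel n
      rw [← map_smul, smul_smul, ← pow_succ]
      refine Eq.trans ?_ hz.symm
      exact congrArg (C.d n (n + 1)).hom hy
    refine eq_on_cocycles_of_section _ _ (hρ F) s (hs F) (hs F₀) n _ ?_
    rw [reduction_d_redMk, hdy, redMk_X_smul]
  have := hQ _ hrl
  have := hQ _ hrηl
  have := hQ _ (hρ F₀)
  have := hQ _ (hκ F₀)
  refine ⟨(asIso ((derivedQ R).map (reduction.map left))).symm ≪≫
    asIso ((derivedQ R).map (reduction.map (right F₀) ≫ F₀.reduceHodge)),
    (asIso ((derivedQ R).map (reduction.map (etaMap left)))).symm ≪≫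
    asIso ((derivedQ R).map (reduction.map (c F₀) ≫ F₀.reduceDeRham)), fun F => ?_⟩
  refine ⟨⟨C, hC, left, right F, hleft, hright F⟩, c F, hηl, hc F, hcη F, hrl, hρ F, hrηl, hκ F,
    ?_, ?_⟩
  · rw [hind₀ F]
    simp
  · rw [hind₁ F]
    simp

end Assembly
end QDeRham
end

/-! ### Double complexes with exact rows and contracted columns -/

noncomputable section
namespace QDeRham

/-- A double complex `K` whose rows resolve the terms of `L`, and whose columns are contracted by `h`
onto the terms of `Ω`. -/
structure BiResolution {S : Type u} [CommRing S] (L Ω : CochainComplex (ModuleCat.{v} S) ℕ) where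
  K : ℕ → ℕ → Type v
  [addCommGroup : ∀ m j, AddCommGroup (K m j)]
  [module : ∀ m j, Module S (K m j)]
  del : ∀ m j, K m j →ₗ[S] K (m + 1) j
  D : ∀ m j, K m j →ₗ[S] K m (j + 1)
  h : ∀ m j, K (m + 1) j →ₗ[S] K m j
  ε : ∀ j, K 0 j →ₗ[S] Ω.X j
  η : ∀ j, Ω.X j →ₗ[S] K 0 j
  a : ∀ m, L.X m →ₗ[S] K m 0
  D_D : ∀ m j k, D m (j + 1) (D m j k) = 0
  del_del : ∀ m j k, del (m + 1) j (del m j k) = 0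
  D_del : ∀ m j k, D (m + 1) j (del m j k) = del m (j + 1) (D m j k)
  del_h : ∀ m j k, del m j (h m j k) + h (m + 1) j (del (m + 1) j k) = k
  h_del : ∀ j k, h 0 j (del 0 j k) = k - η j (ε j k)
  ε_η : ∀ j x, ε j (η j x) = x
  η_d : ∀ j x, η (j + 1) ((Ω.d j (j + 1)).hom x) = D 0 j (η j x)
  del_η : ∀ j x, del 0 j (η j x) = 0
  a_d : ∀ m x, a (m + 1) ((L.d m (m + 1)).hom x) = del m 0 (a m x)
  D_a : ∀ m x, D m 0 (a m x) = 0
  a_injective : ∀ m, Function.Injective (a m)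
  exact_zero : ∀ m k, D m 0 k = 0 → ∃ x, a m x = k
  exact_succ : ∀ m j k, D m (j + 1) k = 0 → ∃ y, D m j y = k

namespace BiResolution
variable {S : Type u} [CommRing S] {L Ω : CochainComplex (ModuleCat.{v} S) ℕ}
  (B : BiResolution L Ω)

instance (m j : ℕ) : AddCommGroup (B.K m j) := B.addCommGroup m j
instance (m j : ℕ) : Module S (B.K m j) := B.module m j

/-- The iterated contraction `ε (D h)ⁿ`. -/
def contract : ∀ (n j N : ℕ), j + n = N → (B.K n j →ₗ[S] Ω.X N)
  | 0, j, _, rfl => B.ε j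
  | n + 1, j, N, e => contract n (j + 1) N (by omega) ∘ₗ B.D n j ∘ₗ B.h n j

theorem contract_zero (j : ℕ) (k : B.K 0 j) : B.contract 0 j j rfl k = B.ε j k := rfl

theorem contract_succ (n j N : ℕ) (e : j + (n + 1) = N) (k : B.K (n + 1) j) :
    B.contract (n + 1) j N e k = B.contract n (j + 1) N (by omega) (B.D n j (B.h n j k)) := by
  rw [contract]
  rfl

/-- In a column `h del = 1 - del h`, and the term with `del h` is treated by the induction
hypothesis for `D (h k)`, where `D D = 0` removes one summand. At the bottom `h del = 1 - η ε`, and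
the summand `η ε` produces the differential of `Ω`. -/
theorem contract_del (n j N : ℕ) (e : j + n = N) (k : B.K n j) :
    B.contract (n + 1) j (N + 1) (by omega) (B.del n j k) =
      B.contract n (j + 1) (N + 1) (by omega) (B.D n j k) +
        (-1 : ℤ) ^ (n + 1) • (Ω.d N (N + 1)).hom (B.contract n j N e k) := by
  induction n generalizing j with
  | zero =>
    obtain rfl : j = N := e
    rw [contract_succ, B.h_del, map_sub, ← B.η_d, map_sub, contract_zero, contract_zero,
      contract_zero, B.ε_η]
    simp [sub_eq_add_neg]
  | succ n ih =>
    rw [contract_succ, ← sub_eq_iff_eq_add'.2 (B.del_h n j k).symm, map_sub, map_sub, B.D_del, ih,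
      B.D_D, map_zero, zero_add, contract_succ, sub_eq_add_neg, pow_succ (-1 : ℤ) (n + 1)]
    · rw [B.contract_succ n j N e k]
      simp
    · omega

/-- The signs in the comparison map. -/
def sgn : ℕ → ℤ
  | 0 => 1
  | n + 1 => (-1) ^ (n + 1) * sgn n

theorem sgn_mul_self (n : ℕ) : sgn n * sgn n = 1 := by
  induction n with
  | zero => rfl
  | succ n ih =>
    rw [sgn, mul_mul_mul_comm, ih, ← pow_add, ← two_mul, pow_mul]
    simp

/-- The comparison map of a double complex that resolves `L` and contracts to `Ω`. -/
def comparison : L ⟶ Ω where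
  f n := ModuleCat.ofHom (sgn n • (B.contract n 0 n (by omega) ∘ₗ B.a n))
  comm' i j hij := by
    obtain rfl : i + 1 = j := hij
    ext x
    change (Ω.d i (i + 1)).hom (sgn i • B.contract i 0 i (by omega) (B.a i x)) =
      sgn (i + 1) • B.contract (i + 1) 0 (i + 1) (by omega) (B.a (i + 1) ((L.d i (i + 1)).hom x))
    -- Since `D` kills the image of `a`, the unsigned maps commute with the differentials up to the
    -- sign `(-1) ^ (i + 1)`, which is the ratio of `sgn (i + 1)` and `sgn i`.
    have hc := B.contract_del i 0 i (by omega) (B.a i x)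
    rw [B.D_a, map_zero] at hc
    rw [B.a_d, hc, map_zsmul]
    generalize (Ω.d i (i + 1)).hom _ = y
    simp only [zero_add]
    rw [smul_smul, sgn, mul_assoc, mul_comm (sgn i), ← mul_assoc, ← pow_add, ← two_mul, pow_mul]
    simp

theorem comparison_apply (n : ℕ) (x : L.X n) :
    (B.comparison.f n).hom x = sgn n • B.contract n 0 n (by omega) (B.a n x) := rfl

/-- This moves an element closed for both differentials along its antidiagonal to the edge that
comes from `L`. By exactness of the row it is `D v`, and `del v` is the next element; by
`contract_del` the two contractions differ by the coboundary of the contraction of `v`, up to sign.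
-/
theorem exists_contract_eq (j m N : ℕ) (e : j + m = N) (k : B.K m j) (h1 : B.del m j k = 0)
    (h2 : B.D m j k = 0) : ∃ g : L.X N, (L.d N (N + 1)).hom g = 0 ∧
      IsBoundary Ω N (B.contract m j N e k - B.contract N 0 N (by omega) (B.a N g)) := by
  induction j generalizing m with
  | zero =>
    obtain rfl : m = N := by omega
    obtain ⟨g, rfl⟩ := B.exact_zero m k h2
    refine ⟨g, B.a_injective _ ?_, ?_⟩
    · rw [B.a_d, h1, map_zero]
    · rw [sub_self]
      exact IsBoundary.zero _
  | succ j ih =>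
    obtain ⟨v, rfl⟩ := B.exact_succ m j k h2
    obtain ⟨g, hg, hb⟩ := ih (m + 1) (by omega) (B.del m j v) (B.del_del _ _ _)
      (by rw [B.D_del, h1])
    refine ⟨g, hg, ?_⟩
    obtain ⟨N, rfl⟩ : ∃ M, N = M + 1 := ⟨j + m, by omega⟩
    have hc := B.contract_del m j N (by omega) v
    rw [eq_comm, ← eq_sub_iff_add_eq] at hc
    rw [hc, sub_right_comm]
    exact hb.sub ⟨N, (-1 : ℤ) ^ (m + 1) • B.contract m j N (by omega) v, map_zsmul _ _ _⟩

/-- The obvious primitive `h k` need not be closed for `D`. Its image `D (h k)` is closed for both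
differentials and has the same contraction, but lies one step nearer to the edge `Ω`; there the
induction provides a primitive `x' = D x''` for it, and `h k - del x''` is closed. At the edge a
primitive in `Ω` of the contraction gives the correction through `η`. -/
theorem exists_del_eq (m j N : ℕ) (e : j + (m + 1) = N) (k : B.K (m + 1) j)
    (h1 : B.del (m + 1) j k = 0) (h2 : B.D (m + 1) j k = 0)
    (hb : IsBoundary Ω N (B.contract (m + 1) j N e k)) :
    ∃ x : B.K m j, B.del m j x = k ∧ B.D m j x = 0 := by
  have hdh (m j) (k : B.K (m + 1) j) (h1 : B.del (m + 1) j k = 0) :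
      B.del m j (B.h m j k) = k := by
    have := B.del_h m j k
    rwa [h1, map_zero, add_zero] at this
  have hk' : B.del m (j + 1) (B.D m j (B.h m j k)) = 0 := by
    rw [← B.D_del, hdh _ _ _ h1, h2]
  induction m generalizing j with
  | zero =>
    obtain rfl : j + 1 = N := e
    rw [contract_succ, contract_zero, isBoundary_succ] at hb
    obtain ⟨w, hw⟩ := hb
    have h3 := B.h_del (j + 1) (B.D 0 j (B.h 0 j k))
    rw [hk', map_zero, eq_comm, sub_eq_zero, ← hw, B.η_d] at h3
    refine ⟨B.h 0 j k - B.η j w, ?_, ?_⟩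
    · rw [map_sub, B.del_η, sub_zero, hdh _ _ _ h1]
    · rw [map_sub, h3, sub_self]
  | succ m ih =>
    rw [contract_succ] at hb
    obtain ⟨x', hx', hDx'⟩ := ih (j + 1) (by omega) _ hk' (B.D_D _ _ _) hb
      (by rw [← B.D_del, hdh _ _ _ hk', B.D_D])
    obtain ⟨x'', rfl⟩ := B.exact_succ m j x' hDx'
    refine ⟨B.h (m + 1) j k - B.del m j x'', ?_, ?_⟩
    · rw [map_sub, B.del_del, sub_zero, hdh _ _ _ h1]
    · rw [map_sub, B.D_del, hx', sub_self]

/-- A cocycle `y` of `Ω` is the contraction of `η y`, which is moved to the edge of `L` by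
`exists_contract_eq`. Conversely, if the image of a cocycle `x` bounds, then `exists_del_eq` gives a
primitive of `a x` that is closed for `D` and so comes from `L`. -/
theorem quasiIso_comparison : QuasiIso B.comparison := by
  rw [quasiIso_iff_elementwise]
  have hs (n : ℕ) (x : Ω.X n) : sgn n • sgn n • x = x := by
    rw [smul_smul, sgn_mul_self, one_smul]
  have hbs (n : ℕ) (x : Ω.X n) (hx : IsBoundary Ω n x) : IsBoundary Ω n (sgn n • x) := by
    obtain ⟨i, w, rfl⟩ := hx
    exact ⟨i, sgn n • w, map_zsmul _ _ _⟩
  constructor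
  · intro n x hx hb
    rw [comparison_apply] at hb
    have hb := hbs n _ hb
    rw [hs] at hb
    have h1 : B.del n 0 (B.a n x) = 0 := by rw [← B.a_d, hx, map_zero]
    cases n with
    | zero =>
      rw [contract_zero, isBoundary_zero] at hb
      rw [isBoundary_zero]
      have h3 := B.h_del 0 (B.a 0 x)
      rw [h1, map_zero, hb, map_zero, sub_zero] at h3
      exact B.a_injective 0 (h3.symm.trans (map_zero _).symm)
    | succ n =>
      obtain ⟨y, hy, hDy⟩ := B.exists_del_eq n 0 (n + 1) (by omega) _ h1 (B.D_a _ _) hb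
      obtain ⟨y, rfl⟩ := B.exact_zero n y hDy
      rw [isBoundary_succ]
      refine ⟨y, B.a_injective _ ?_⟩
      rw [B.a_d, hy]
  · intro n y hy
    obtain ⟨g, hg, hb⟩ := B.exists_contract_eq n 0 n (by omega) (B.η n y) (B.del_η n y)
      (by rw [← B.η_d, hy, map_zero])
    rw [contract_zero, B.ε_η] at hb
    refine ⟨sgn n • g, ?_, ?_⟩
    · rw [map_zsmul, hg, smul_zero]
    · rw [comparison_apply, map_zsmul, map_zsmul, hs]
      exact hb

end BiResolution
end QDeRham
end

/-! ### Rings complete along a principal ideal -/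

noncomputable section
namespace QDeRham

set_option linter.unusedSectionVars false

section Adic
variable {C : Type*} [CommRing C]

/-- Completeness along a principal ideal, in terms of series `∑ tⁱ cᵢ`. -/
theorem isAdicComplete_span_singleton_iff (t : C) : IsAdicComplete (Ideal.span {t}) C ↔
    (∀ b : C, (∀ n : ℕ, t ^ n ∣ b) → b = 0) ∧
    ∀ c : ℕ → C, ∃ l, ∀ n, t ^ n ∣ l - ∑ i ∈ Finset.range n, t ^ i * c i := by
  have hmem (n : ℕ) (x y : C) : x ≡ y [SMOD (Ideal.span {t} ^ n • ⊤ : Submodule C C)] ↔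
      t ^ n ∣ x - y := by
    rw [SModEq.sub_mem, Ideal.span_singleton_pow, smul_eq_mul, Ideal.mul_top,
      Ideal.mem_span_singleton]
  constructor
  · intro h
    refine ⟨fun b hb => h.haus' b fun n => (hmem n b 0).2 (by simpa using hb n), fun c => ?_⟩
    obtain ⟨l, hl⟩ := h.prec' (fun n => ∑ i ∈ Finset.range n, t ^ i * c i) (by
      intro m n hmn
      refine ((hmem m _ _).2 ?_)
      rw [← neg_sub, dvd_neg, ← Finset.sum_Ico_eq_sub _ hmn]
      exact Finset.dvd_sum fun i hi =>
        (pow_dvd_pow t (Finset.mem_Ico.1 hi).1).mul_right _)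
    exact ⟨l, fun n => (hmem n _ _).1 (hl n).symm⟩
  · rintro ⟨h1, h2⟩
    exact
      { haus' := fun b hb => h1 b fun n => by simpa using (hmem n b 0).1 (hb n)
        prec' := fun f hf => by
          have hd (n : ℕ) : ∃ c, f (n + 1) - f n = t ^ n * c := by
            have := (hmem n _ _).1 (hf (Nat.le_succ n)).symm
            exact this
          choose c hc using hd
          obtain ⟨l, hl⟩ := h2 c
          have hsum (n : ℕ) : ∑ i ∈ Finset.range n, t ^ i * c i = f n - f 0 := by
            rw [← Finset.sum_range_sub]
            exact Finset.sum_congr rfl fun i _ => (hc i).symm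
          refine ⟨l + f 0, fun n => ((hmem n _ _).2 ?_)⟩
          have := hl n
          rw [hsum] at this
          rw [← neg_sub, dvd_neg]
          convert this using 1
          ring }

/-- A Cauchy sequence converges. -/
theorem exists_limit {t : C} (h : IsAdicComplete (Ideal.span {t}) C) (c : ℕ → C)
    (hc : ∀ n, t ^ n ∣ c (n + 1) - c n) : ∃ l, ∀ n, t ^ n ∣ l - c n := by
  choose e he using hc
  obtain ⟨l, hl⟩ := ((isAdicComplete_span_singleton_iff t).1 h).2 e
  refine ⟨l + c 0, fun n => ?_⟩
  have := hl n
  rw [← Finset.sum_congr rfl fun i _ => he i, Finset.sum_range_sub] at this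
  convert this using 1
  ring

theorem eq_of_forall_pow_dvd_sub {t : C} (h : IsAdicComplete (Ideal.span {t}) C) {a b : C}
    (hab : ∀ n : ℕ, t ^ n ∣ a - b) : a = b :=
  sub_eq_zero.1 (((isAdicComplete_span_singleton_iff t).1 h).1 _ hab)

theorem isUnit_one_add_mul {t : C} (h : IsAdicComplete (Ideal.span {t}) C) (b : C) :
    IsUnit (1 + t * b) := by
  have := Ideal.mem_jacobson_bot.1 (IsAdicComplete.le_jacobson_bot (Ideal.span {t})
    (Ideal.mem_span_singleton_self t)) b
  rwa [add_comm] at this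

/-- A subring of a product that is the graph of a function defines a homomorphism. -/
def ringHomOfGraph {X Y : Type*} [CommRing X] [CommRing Y] (Γ : Subring (X × Y))
    (h : ∀ x, ∃ y, (x, y) ∈ Γ) (h0 : ∀ y, ((0 : X), y) ∈ Γ → y = 0) : X →+* Y :=
  have huniq {x : X} {y y' : Y} (hy : (x, y) ∈ Γ) (hy' : (x, y') ∈ Γ) : y = y' := by
    rw [← sub_eq_zero]
    exact h0 _ (by simpa using Γ.sub_mem hy hy')
  { toFun := fun x => (h x).choose
    map_one' := huniq (h 1).choose_spec Γ.one_mem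
    map_mul' := fun x y => huniq (h (x * y)).choose_spec
      (Γ.mul_mem (h x).choose_spec (h y).choose_spec)
    map_zero' := huniq (h 0).choose_spec Γ.zero_mem
    map_add' := fun x y => huniq (h (x + y)).choose_spec
      (Γ.add_mem (h x).choose_spec (h y).choose_spec) }

theorem ringHomOfGraph_eq_iff {X Y : Type*} [CommRing X] [CommRing Y] (Γ : Subring (X × Y))
    (h : ∀ x, ∃ y, (x, y) ∈ Γ) (h0 : ∀ y, ((0 : X), y) ∈ Γ → y = 0) (x : X) (y : Y) :
    ringHomOfGraph Γ h h0 x = y ↔ (x, y) ∈ Γ := by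
  constructor
  · rintro rfl
    exact (h x).choose_spec
  · intro hy
    have := Γ.sub_mem (h x).choose_spec hy
    rw [← sub_eq_zero]
    refine h0 _ ?_
    rwa [Prod.mk_sub_mk, sub_self] at this

/-- The map `i` exhibits its target as the completion of its source along `t`. -/
structure IsCompletion {S Ŝ : Type*} [CommRing S] [CommRing Ŝ] (i : S →+* Ŝ) (t : S) : Prop where
  complete : IsAdicComplete (Ideal.span {i t}) Ŝ
  dense : ∀ x n, ∃ s, i t ^ n ∣ x - i s
  strict : ∀ s n, i t ^ n ∣ i s → t ^ n ∣ s

namespace IsCompletion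
variable {S Ŝ : Type*} [CommRing S] [CommRing Ŝ] {i : S →+* Ŝ} {t : S} (hi : IsCompletion i t)
include hi

/-- Both maps take multiples of `(i t)ⁿ` to multiples of `cⁿ`, so continuity is automatic and
density gives agreement modulo every power of `c`. -/
theorem hom_ext {c : C} (hC : IsAdicComplete (Ideal.span {c}) C) {f g : Ŝ →+* C}
    (hf : c ∣ f (i t)) (hg : c ∣ g (i t)) (h : ∀ s, f (i s) = g (i s)) : f = g := by
  ext x
  refine eq_of_forall_pow_dvd_sub hC fun n => ?_
  obtain ⟨s, y, hs⟩ := hi.dense x n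
  have h1 : f x - g x = f (i t) ^ n * f y - g (i t) ^ n * g y := by
    have := congr($(congrArg f hs) - $(congrArg g hs))
    simp only [map_sub, h, map_mul, map_pow] at this
    rw [h]
    linear_combination this
  rw [h1]
  exact dvd_sub ((pow_dvd_pow_of_dvd hf n).mul_right _) ((pow_dvd_pow_of_dvd hg n).mul_right _)

/-- The closure of the graph of `f` is a subring, hence the extension is a ring homomorphism once
this closure is the graph of a function. It is total by density and completeness of the target, and
single-valued because `strict` turns divisibility by `(i t)ⁿ` into divisibility by `tⁿ` in the
source. -/
theorem exists_extend {c : C} (hC : IsAdicComplete (Ideal.span {c}) C) (f : S →+* C)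
    (hf : c ∣ f t) : ∃ g : Ŝ →+* C, ∀ s, g (i s) = f s := by
  let Γ : Subring (Ŝ × C) :=
    { carrier := {p | ∀ n, ∃ s, i t ^ n ∣ p.1 - i s ∧ c ^ n ∣ p.2 - f s}
      mul_mem' := by
        rintro ⟨x, y⟩ ⟨x', y'⟩ h h' n
        obtain ⟨s, h1, h2⟩ := h n
        obtain ⟨s', h1', h2'⟩ := h' n
        refine ⟨s * s', ?_, ?_⟩
        · have := dvd_add (h1.mul_right x') (h1'.mul_left (i s))
          rw [map_mul]
          convert this using 1
          simp only [Prod.mk_mul_mk]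
          ring
        · have := dvd_add (h2.mul_right y') (h2'.mul_left (f s))
          rw [map_mul]
          convert this using 1
          simp only [Prod.mk_mul_mk]
          ring
      one_mem' := fun n => ⟨1, by simp, by simp⟩
      add_mem' := by
        rintro ⟨x, y⟩ ⟨x', y'⟩ h h' n
        obtain ⟨s, h1, h2⟩ := h n
        obtain ⟨s', h1', h2'⟩ := h' n
        refine ⟨s + s', ?_, ?_⟩
        · convert dvd_add h1 h1' using 1
          simp; ring
        · convert dvd_add h2 h2' using 1
          simp; ring
      zero_mem' := fun n => ⟨0, by simp, by simp⟩
      neg_mem' := by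
        rintro ⟨x, y⟩ h n
        obtain ⟨s, h1, h2⟩ := h n
        refine ⟨-s, ?_, ?_⟩
        · convert (dvd_neg.2 h1) using 1
          simp; ring
        · convert (dvd_neg.2 h2) using 1
          simp; ring }
  have hdvd (s : S) (n : ℕ) (h : i t ^ n ∣ i s) : c ^ n ∣ f s := by
    obtain ⟨s', rfl⟩ := hi.strict s n h
    rw [map_mul, map_pow]
    exact (pow_dvd_pow_of_dvd hf n).mul_right _
  have htot : ∀ x, ∃ y, (x, y) ∈ Γ := by
    intro x
    choose s hs using hi.dense x
    obtain ⟨l, hl⟩ := exists_limit hC (fun n => f (s n)) (by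
      intro n
      rw [← map_sub]
      refine hdvd _ n ?_
      rw [map_sub]
      convert dvd_sub (hs n) (dvd_trans (pow_dvd_pow _ n.le_succ) (hs (n + 1))) using 1
      ring)
    exact ⟨l, fun n => ⟨s n, hs n, hl n⟩⟩
  have h0 : ∀ y, ((0 : Ŝ), y) ∈ Γ → y = 0 := by
    intro y hy
    refine eq_of_forall_pow_dvd_sub hC fun n => ?_
    obtain ⟨s, h1, h2⟩ := hy n
    have h1 : i t ^ n ∣ i s := by simpa using h1
    simpa using dvd_add h2 (hdvd s n h1)
  exact ⟨ringHomOfGraph Γ htot h0, fun s => (ringHomOfGraph_eq_iff Γ htot h0 _ _).2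
    fun n => ⟨s, by simp, by simp⟩⟩

end IsCompletion

/-- Multiples of `p` form a closed subset if `p` is a non-zero-divisor modulo `t`. -/
theorem dvd_of_forall_eq_add {t p v : C} (hC : IsAdicComplete (Ideal.span {t}) C)
    (htf : ∀ b, t * b = 0 → b = 0)
    (hp : ∀ b, t ∣ p * b → t ∣ b) (h : ∀ n : ℕ, ∃ u w, v = p * u + t ^ n * w) : p ∣ v := by
  choose u w huw using h
  have hp' (n : ℕ) (b : C) (hb : t ^ n ∣ p * b) : t ^ n ∣ b := by
    induction n generalizing b with
    | zero => simp
    | succ n ih =>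
      obtain ⟨b', rfl⟩ := hp b (dvd_trans (dvd_pow_self t n.succ_ne_zero) hb)
      obtain ⟨c, hc⟩ := hb
      have : t ^ n ∣ p * b' := ⟨c, by
        rw [← sub_eq_zero]
        apply htf
        linear_combination hc⟩
      rw [pow_succ']
      exact mul_dvd_mul_left t (ih b' this)
  -- The product of `p` with `u (n + 1) - u n` is divisible by `tⁿ`, and `p` is regular modulo `tⁿ`;
  -- so the approximate quotients form a Cauchy sequence.
  obtain ⟨l, hl⟩ := exists_limit hC u (fun n => hp' n _ ⟨w n - t * w (n + 1), by
    linear_combination (huw n) - (huw (n + 1))⟩)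
  refine ⟨l, eq_of_forall_pow_dvd_sub hC fun n => ?_⟩
  obtain ⟨e, he⟩ := hl n
  exact ⟨w n - p * e, by linear_combination huw n - p * he⟩

end Adic

/-! ### Frobenius congruences and complete `Λ`-rings over `ℤ[q]` -/

section Frobenius
variable {C : Type*} [CommRing C]

/-- The elements on which an endomorphism lifts the Frobenius endomorphism form a subring. -/
def frobeniusSubring (f : C →+* C) (p : ℕ) (hp : p.Prime) : Subring C where
  carrier := {x | (p : C) ∣ f x - x ^ p}
  mul_mem' {a b} ha hb := by
    have := dvd_add (ha.mul_right (f b)) (hb.mul_left (a ^ p))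
    change (p : C) ∣ f (a * b) - (a * b) ^ p
    rw [map_mul, mul_pow]
    convert this using 1
    ring
  one_mem' := by simp
  add_mem' {a b} ha hb := by
    obtain ⟨r, hr⟩ := exists_add_pow_prime_eq hp a b
    change (p : C) ∣ f (a + b) - (a + b) ^ p
    rw [map_add, hr]
    have := dvd_sub (dvd_add ha hb) (dvd_mul_right (p : C) (a * b * r))
    convert this using 1
    ring
  zero_mem' := by simp [zero_pow hp.ne_zero]
  neg_mem' {a} ha := by
    have h2 : (p : C) ∣ f (-1) - (-1) ^ p := by
      rcases hp.eq_two_or_odd' with rfl | h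
      · exact ⟨-1, by simp; ring⟩
      · simp [h.neg_one_pow]
    have := dvd_add (h2.mul_right (f a)) (ha.mul_left ((-1) ^ p))
    change (p : C) ∣ f (-a) - (-a) ^ p
    rw [neg_pow a, map_neg]
    convert this using 1
    rw [map_neg, map_one]
    ring

theorem mem_frobeniusSubring {f : C →+* C} {p : ℕ} {hp : p.Prime} {x : C} :
    x ∈ frobeniusSubring f p hp ↔ (p : C) ∣ f x - x ^ p := Iff.rfl

end Frobenius

/-- A complete `Λ`-ring over `ℤ[q]`, where `t = q - 1`, flat over `ℤ` modulo `t`. -/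
structure IsQRing (C : Type*) [CommRing C] [LambdaRing C] (t : C) : Prop where
  complete : IsAdicComplete (Ideal.span {t}) C
  torsionFree : ∀ b : C, t * b = 0 → b = 0
  dvd_of_dvd_int_mul : ∀ (n : ℤ) (b : C), n ≠ 0 → t ∣ n * b → t ∣ b
  psi_q : ∀ n : ℕ+, LambdaRing.psi n (1 + t) = (1 + t) ^ (n : ℕ)

namespace IsQRing
variable {C : Type*} [CommRing C] [LambdaRing C] {t : C} (h : IsQRing C t)
include h

theorem psi_t (n : ℕ+) : LambdaRing.psi n t = (1 + t) ^ (n : ℕ) - 1 := by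
  have := h.psi_q n
  rw [map_add, map_one] at this
  rw [← this]; ring

theorem dvd_psi (n : ℕ+) : t ∣ LambdaRing.psi n t := by
  rw [h.psi_t]
  convert sub_dvd_pow_sub_pow (1 + t) 1 (n : ℕ) using 1 <;> simp

theorem mul_left_cancel {a b : C} (hab : t * a = t * b) : a = b := by
  rw [← sub_eq_zero]
  exact h.torsionFree _ (by rw [mul_sub, hab, sub_self])

theorem pow_mul_left_cancel (n : ℕ) {a b : C} (hab : t ^ n * a = t ^ n * b) : a = b := by
  induction n with
  | zero => simpa using hab
  | succ n ih => exact ih (h.mul_left_cancel (by rw [← mul_assoc, ← mul_assoc, ← pow_succ', hab]))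

/-- The roles in a regular sequence are exchanged: `t` is regular and `p` is regular modulo `t`, so
`t` is regular modulo `p`. -/
theorem dvd_of_dvd_t_pow_mul {p : ℤ} (hp : p ≠ 0) (n : ℕ) {b : C} (hb : (p : C) ∣ t ^ n * b) :
    (p : C) ∣ b := by
  induction n with
  | zero => simpa using hb
  | succ n ih =>
    apply ih
    obtain ⟨c, hc⟩ := hb
    obtain ⟨d, rfl⟩ := h.dvd_of_dvd_int_mul p c hp ⟨t ^ n * b, by rw [← hc]; ring⟩
    exact ⟨d, h.mul_left_cancel (by linear_combination hc)⟩

/-- An element killed by `n` is divisible by `t` because `n` is regular modulo `t`, and the quotient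
is killed by `n` again; so the element is divisible by all powers of `t`. -/
theorem eq_zero_of_int_mul {n : ℤ} (hn : n ≠ 0) {b : C} (hb : (n : C) * b = 0) : b = 0 := by
  refine eq_of_forall_pow_dvd_sub h.complete fun m => ?_
  rw [sub_zero]
  induction m generalizing b with
  | zero => simp
  | succ m ih =>
    obtain ⟨c, rfl⟩ := h.dvd_of_dvd_int_mul n b hn (by rw [hb]; exact dvd_zero _)
    rw [pow_succ']
    refine mul_dvd_mul_left t (ih (h.torsionFree _ ?_))
    rw [← hb]; ring

theorem int_mul_cancel {n : ℤ} (hn : n ≠ 0) {a b : C} (hb : (n : C) * a = n * b) : a = b := by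
  rw [← sub_eq_zero]
  exact h.eq_zero_of_int_mul hn (by rw [mul_sub, hb, sub_self])

/-- Values at `t` of nonzero polynomials are non-zero-divisors. -/
theorem eq_zero_of_aeval_mul {N : Polynomial ℤ} (hN : N ≠ 0) {b : C}
    (hb : Polynomial.aeval t N * b = 0) : b = 0 := by
  -- After the powers of `t` are split off, the constant term is a nonzero integer, which is regular
  -- modulo `t`. Thus an element killed by the value of `M` is infinitely divisible by `t`.
  obtain ⟨M, hM, hM0⟩ := Polynomial.exists_eq_pow_rootMultiplicity_mul_and_not_dvd N hN 0
  rw [map_zero, sub_zero, Polynomial.X_dvd_iff] at hM0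
  rw [map_zero, sub_zero] at hM
  replace hb : Polynomial.aeval t M * b = 0 := by
    rw [hM, map_mul, map_pow, Polynomial.aeval_X, mul_assoc] at hb
    exact h.pow_mul_left_cancel _ (hb.trans (mul_zero _).symm)
  obtain ⟨c, hc⟩ : t ∣ Polynomial.aeval t M - (M.coeff 0 : C) := by
    have := Polynomial.X_mul_divX_add M
    refine ⟨Polynomial.aeval t M.divX, ?_⟩
    conv_lhs => rw [← this]
    simp
  refine eq_of_forall_pow_dvd_sub h.complete fun m => ?_
  rw [sub_zero]
  induction m generalizing b with
  | zero => simp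
  | succ m ih =>
    obtain ⟨b', rfl⟩ := h.dvd_of_dvd_int_mul _ b hM0 ⟨- (c * b), by linear_combination hb - b * hc⟩
    rw [pow_succ']
    exact mul_dvd_mul_left t (ih (h.torsionFree _ (by rw [← hb]; ring)))

/-- Values at `t` of polynomials that do not vanish modulo `p` are non-zero-divisors modulo `p`. -/
theorem dvd_of_dvd_aeval_mul {p : ℕ} (hp : p.Prime) {N : Polynomial ℤ}
    (hN : ¬ Polynomial.C (p : ℤ) ∣ N) {b : C}
    (hb : (p : C) ∣ Polynomial.aeval t N * b) : (p : C) ∣ b := by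
  have hp0 : (p : ℤ) ≠ 0 := by exact_mod_cast hp.ne_zero
  have hcl (b : C) (hb : ∀ n : ℕ, ∃ u w, b = p * u + t ^ n * w) : (p : C) ∣ b :=
    dvd_of_forall_eq_add h.complete h.torsionFree
      (fun b hb => h.dvd_of_dvd_int_mul p b hp0 (by exact_mod_cast hb)) hb
  -- If `p` divides the constant term, that term can be dropped and a factor `t` cancelled, which
  -- lowers the degree. Otherwise the constant term is invertible modulo `p`, and solving for `b`
  -- modulo `p` repeatedly exhibits `b` as a multiple of `p` up to `tᵐ`, for all `m`.
  induction hd : N.natDegree using Nat.strong_induction_on generalizing N with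
  | _ n ih =>
    have hdec := Polynomial.X_mul_divX_add N
    have hev : Polynomial.aeval t N = t * Polynomial.aeval t N.divX + (N.coeff 0 : C) := by
      conv_lhs => rw [← hdec]
      simp
    by_cases h0 : (p : ℤ) ∣ N.coeff 0
    · have hN' : ¬ Polynomial.C (p : ℤ) ∣ N.divX := by
        intro h1
        apply hN
        rw [← hdec]
        exact dvd_add (h1.mul_left _) (map_dvd Polynomial.C h0)
      have hn : N.natDegree ≠ 0 := by
        intro h1
        apply hN'
        rw [Polynomial.divX_eq_zero_iff.2 (Polynomial.eq_C_of_natDegree_eq_zero h1)]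
        exact dvd_zero _
      refine ih N.divX.natDegree ?_ hN' ?_ rfl
      · rw [Polynomial.natDegree_divX_eq_natDegree_tsub_one]; omega
      · obtain ⟨c, hc⟩ := h0
        obtain ⟨d, hd⟩ := hb
        have := h.dvd_of_dvd_t_pow_mul hp0 1 (b := Polynomial.aeval t N.divX * b)
          ⟨d - c * b, by
            rw [hev, hc] at hd
            push_cast at hd ⊢
            linear_combination hd⟩
        exact_mod_cast this
    · have hco : IsCoprime (N.coeff 0) (p : ℤ) := by
        have := (Nat.prime_iff_prime_int.1 hp).coprime_iff_not_dvd.2 h0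
        exact this.symm
      obtain ⟨r, s, hrs⟩ := hco
      have hrs' : (r : C) * (N.coeff 0 : C) + s * p = 1 := by exact_mod_cast congr(($hrs : C))
      apply hcl
      intro m
      clear ih
      induction m generalizing b with
      | zero => exact ⟨0, b, by simp⟩
      | succ m ihm =>
        obtain ⟨d, hd⟩ := hb
        have hb2 : b = p * (s * b + r * d) + t * (- r * Polynomial.aeval t N.divX * b) := by
          rw [hev] at hd
          linear_combination (- b) * hrs' + r * hd
        have h3 : (p : C) ∣ Polynomial.aeval t N * (- r * Polynomial.aeval t N.divX * b) := by
          have := h.dvd_of_dvd_t_pow_mul hp0 1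
            (b := Polynomial.aeval t N * (- r * Polynomial.aeval t N.divX * b))
            ⟨d - Polynomial.aeval t N * (s * b + r * d), by
              push_cast
              have := congrArg (fun z => Polynomial.aeval t N * z) hb2
              rw [hd] at this
              linear_combination -this⟩
          exact_mod_cast this
        obtain ⟨u, w, huw⟩ := ihm h3
        refine ⟨s * b + r * d + t * u, w, ?_⟩
        conv_lhs => rw [hb2]
        rw [huw, pow_succ']
        ring

end IsQRing
end QDeRham
end

noncomputable section
namespace QDeRham

set_option linter.unusedSectionVars false

/-! ### Newton's identities and the existence of `q`-divided powers -/

section Newton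
variable {C : Type*} [CommRing C]

/-- The Euler operator `s d/ds` on power series in `s`. -/
def euler (f : C⟦X⟧) : C⟦X⟧ := PowerSeries.X * PowerSeries.derivative C f

theorem coeff_euler (f : C⟦X⟧) (n : ℕ) :
    PowerSeries.coeff n (euler f) = n * PowerSeries.coeff n f := by
  rcases n with _ | n
  · simp [euler]
  · rw [euler, PowerSeries.coeff_succ_X_mul, PowerSeries.coeff_derivative]
    push_cast
    ring

theorem euler_mul (f g : C⟦X⟧) : euler (f * g) = euler f * g + f * euler g := by
  rw [euler, Derivation.leibniz, euler, euler, smul_eq_mul, smul_eq_mul]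
  ring

theorem euler_sub (f g : C⟦X⟧) : euler (f - g) = euler f - euler g := by
  rw [euler, map_sub, mul_sub, euler, euler]

theorem euler_one_add (a : C) :
    euler (1 + PowerSeries.C a * PowerSeries.X) = PowerSeries.C a * PowerSeries.X := by
  ext n
  rw [coeff_euler]
  rcases n with _ | _ | n
  · simp
  · simp [PowerSeries.coeff_one]
  · simp [PowerSeries.coeff_one]

theorem euler_rescale (q : C) (f : C⟦X⟧) :
    euler (PowerSeries.rescale q f) = PowerSeries.rescale q (euler f) := by
  ext n
  rw [coeff_euler, PowerSeries.coeff_rescale, PowerSeries.coeff_rescale, coeff_euler]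
  ring

/-- The geometric series `1 / (1 + a s)`. -/
theorem geometric_mul (a : C) :
    (PowerSeries.mk fun i => (-a) ^ i) * (1 + PowerSeries.C a * PowerSeries.X) = 1 := by
  ext n
  rw [mul_add, mul_one, mul_left_comm, map_add, PowerSeries.coeff_C_mul]
  rcases n with _ | n
  · simp
  · rw [PowerSeries.coeff_succ_mul_X]
    simp [PowerSeries.coeff_one, pow_succ]
    ring

/-- The generating series of the power sums `zᵢ`. -/
def powerSumSeries (z : ℕ → C) : C⟦X⟧ :=
  PowerSeries.X * PowerSeries.mk fun i => (-1) ^ i * z (i + 1)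

/-- This is the image under the logarithmic derivative `s d/ds log` of the functional equation
`Λ(qs) (1 + as) = Λ(s) (1 + bs)`, which characterises the generating series of the `q`-divided
powers up to its constant term when the factors `qᵏ - 1` are regular. -/
theorem rescale_powerSumSeries {q a b : C} {z : ℕ → C}
    (hz : ∀ i, (q ^ (i + 1) - 1) * z (i + 1) = b ^ (i + 1) - a ^ (i + 1)) :
    PowerSeries.rescale q (powerSumSeries z) - powerSumSeries z =
      PowerSeries.C b * PowerSeries.X * (PowerSeries.mk fun i => (-b) ^ i) -
        PowerSeries.C a * PowerSeries.X * (PowerSeries.mk fun i => (-a) ^ i) := by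
  ext n
  rw [map_sub, map_sub, PowerSeries.coeff_rescale, mul_assoc, mul_assoc, PowerSeries.coeff_C_mul,
    PowerSeries.coeff_C_mul, powerSumSeries]
  rcases n with _ | n
  · simp
  · simp only [PowerSeries.coeff_succ_X_mul, PowerSeries.coeff_mk]
    rw [neg_pow b, neg_pow a]
    linear_combination (-1) ^ n * hz n

/-- `Δ` is the defect of the `q`-recursion for the coefficients of `Λ`, and `M` is the defect of
Newton's identity relating `Λ` to the power sums. The equation shows that the second defect is
controlled by the first, which makes it possible to pass from the recursion in low degrees to
Newton's identity one degree further. -/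
theorem newton_functional_equation {q a b : C} {z : ℕ → C}
    (hz : ∀ i, (q ^ (i + 1) - 1) * z (i + 1) = b ^ (i + 1) - a ^ (i + 1)) (Λ Δ M : C⟦X⟧)
    (hΔ : Δ = PowerSeries.rescale q Λ * (1 + PowerSeries.C a * PowerSeries.X) -
      Λ * (1 + PowerSeries.C b * PowerSeries.X))
    (hM : M = euler Λ - Λ * powerSumSeries z) :
    PowerSeries.rescale q M * (1 + PowerSeries.C a * PowerSeries.X) -
      M * (1 + PowerSeries.C b * PowerSeries.X) =
    euler Δ - Δ * PowerSeries.rescale q (powerSumSeries z) -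
      Δ * (PowerSeries.C a * PowerSeries.X * PowerSeries.mk fun i => (-a) ^ i) := by
  have h1 := rescale_powerSumSeries hz
  have ha := geometric_mul a
  have hb := geometric_mul b
  subst hΔ hM
  rw [euler_sub, euler_mul, euler_mul, euler_one_add, euler_one_add, euler_rescale]
  simp only [map_sub, map_mul]
  generalize PowerSeries.rescale q (powerSumSeries z) = rZ at *
  generalize powerSumSeries z = Z at *
  generalize (PowerSeries.mk fun i => (-a) ^ i) = α at *
  generalize (PowerSeries.mk fun i => (-b) ^ i) = β at *
  generalize PowerSeries.rescale q Λ = rΛ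
  generalize PowerSeries.rescale q (euler Λ) = rE
  generalize PowerSeries.C a * PowerSeries.X = x at *
  generalize PowerSeries.C b * PowerSeries.X = y at *
  linear_combination (- Λ * (1 + y)) * h1 + (rΛ * x) * ha - Λ * y * hb

/-- One step of Newton's recursion for `L k = ∏_{i<k} (b - qⁱ a) / (qⁱ⁺¹ - 1)`. -/
theorem newton_step {q a b : C} {z : ℕ → C}
    (hz : ∀ i, (q ^ (i + 1) - 1) * z (i + 1) = b ^ (i + 1) - a ^ (i + 1)) (L : ℕ → C) (k : ℕ)
    (hL : ∀ j < k, (q ^ (j + 1) - 1) * L (j + 1) = (b - q ^ j * a) * L j)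
    (hk : k * L k = PowerSeries.coeff k (PowerSeries.mk L * powerSumSeries z)) (h0 : L (k + 1) = 0) :
    (q ^ (k + 1) - 1) * PowerSeries.coeff (k + 1) (PowerSeries.mk L * powerSumSeries z) =
      (k + 1) * ((b - q ^ k * a) * L k) := by
  have key := newton_functional_equation hz (PowerSeries.mk L) _ _ rfl rfl
  set Δ := PowerSeries.rescale q (PowerSeries.mk L) * (1 + PowerSeries.C a * PowerSeries.X) -
      PowerSeries.mk L * (1 + PowerSeries.C b * PowerSeries.X) with hΔdef
  have hco (c : C) (f : C⟦X⟧) (n : ℕ) : PowerSeries.coeff (n + 1)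
      (f * (1 + PowerSeries.C c * PowerSeries.X)) =
        PowerSeries.coeff (n + 1) f + c * PowerSeries.coeff n f := by
    rw [mul_add, mul_one, mul_left_comm, map_add, PowerSeries.coeff_C_mul,
      PowerSeries.coeff_succ_mul_X]
  have hco0 (c : C) (f : C⟦X⟧) : PowerSeries.coeff 0
      (f * (1 + PowerSeries.C c * PowerSeries.X)) = PowerSeries.coeff 0 f := by
    simp
  have hΔ (n : ℕ) : PowerSeries.coeff (n + 1) Δ =
      (q ^ (n + 1) - 1) * L (n + 1) - (b - q ^ n * a) * L n := by
    rw [hΔdef, map_sub, hco, hco]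
    simp only [PowerSeries.coeff_rescale, PowerSeries.coeff_mk]
    ring
  -- The recursion holds below `k`, so `Δ` starts in degree `k + 1`; its products with series
  -- without constant term do not contribute there.
  have hX : PowerSeries.X ^ (k + 1) ∣ Δ := by
    rw [PowerSeries.X_pow_dvd_iff]
    rintro (_ | m) hm
    · rw [hΔdef, map_sub, hco0, hco0]
      simp [PowerSeries.coeff_rescale]
    · rw [hΔ, hL m (by omega), sub_self]
  have hΔX (f : C⟦X⟧) : PowerSeries.coeff (k + 1) (Δ * (PowerSeries.X * f)) = 0 := by
    obtain ⟨g, hg⟩ := hX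
    have : Δ * (PowerSeries.X * f) = PowerSeries.X ^ (k + 2) * (g * f) := by rw [hg]; ring
    rw [this, PowerSeries.coeff_X_pow_mul', if_neg (by omega)]
  -- In degree `k + 1` only the Euler term of `Δ` remains on the right. On the left the coefficient
  -- of `M` in degree `k` vanishes by `hk`, and in degree `k + 1` it is minus the coefficient of the
  -- product of `L` with the power sums, as `L (k + 1) = 0`.
  have h3 := congr(PowerSeries.coeff (k + 1) $key)
  have e1 : Δ * PowerSeries.rescale q (powerSumSeries z) = Δ * (PowerSeries.X *
      (PowerSeries.C q * PowerSeries.rescale q (PowerSeries.mk fun i => (-1) ^ i * z (i + 1)))) := by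
    rw [powerSumSeries, map_mul, PowerSeries.rescale_X]
    ring
  have e2 : Δ * (PowerSeries.C a * PowerSeries.X * PowerSeries.mk fun i => (-a) ^ i) =
      Δ * (PowerSeries.X * (PowerSeries.C a * PowerSeries.mk fun i => (-a) ^ i)) := by ring
  rw [e1, e2, map_sub, hco, hco, map_sub (PowerSeries.coeff (k + 1)) (euler Δ - _),
    map_sub (PowerSeries.coeff (k + 1)) (euler Δ), hΔX, hΔX, coeff_euler, hΔ, h0] at h3
  simp only [PowerSeries.coeff_rescale, map_sub, coeff_euler, PowerSeries.coeff_mk, h0, hk] at h3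
  push_cast at h3
  linear_combination -h3

end Newton

namespace IsQRing
variable {C : Type*} [CommRing C] [LambdaRing C] {t : C} (h : IsQRing C t)
include h

theorem aeval_pow_sub_one (k : ℕ) :
    Polynomial.aeval t ((1 + Polynomial.X) ^ k - 1 : Polynomial ℤ) = (1 + t) ^ k - 1 := by
  simp

omit h in
theorem monic_pow_sub_one {k : ℕ} (hk : k ≠ 0) :
    ((1 + Polynomial.X) ^ k - 1 : Polynomial ℤ).Monic := by
  have h1 : ((1 + Polynomial.X : Polynomial ℤ) ^ k).Monic := by
    have := (Polynomial.monic_X_add_C (1 : ℤ)).pow k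
    rwa [map_one, add_comm] at this
  refine h1.sub_of_left ?_
  rw [Polynomial.degree_one, Polynomial.degree_pow, add_comm]
  have : (Polynomial.X + 1 : Polynomial ℤ).degree = 1 := by
    simpa using Polynomial.degree_X_add_C (1 : ℤ)
  rw [this]
  simp only [nsmul_eq_mul, mul_one]
  exact_mod_cast Nat.pos_of_ne_zero hk

theorem pow_sub_one_mul_cancel {k : ℕ} (hk : k ≠ 0) {a b : C}
    (hab : ((1 + t) ^ k - 1) * a = ((1 + t) ^ k - 1) * b) : a = b := by
  rw [← sub_eq_zero]
  refine h.eq_zero_of_aeval_mul (monic_pow_sub_one hk).ne_zero ?_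
  rw [h.aeval_pow_sub_one, mul_sub, hab, sub_self]

/-- As a polynomial in `q - 1` the element `qᵏ - 1` is monic, so it does not vanish modulo any prime
and is regular modulo `p`. Composite `m` are treated one prime factor at a time. -/
theorem dvd_of_dvd_pow_sub_one_mul {k : ℕ} (hk : k ≠ 0) (m : ℕ) (hm : m ≠ 0) {u : C}
    (hu : (m : C) ∣ ((1 + t) ^ k - 1) * u) : (m : C) ∣ u := by
  induction m using induction_on_primes generalizing u with
  | zero => exact absurd rfl hm
  | one => simp
  | prime_mul p m hp ih =>
    have h1 : (p : C) ∣ u := by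
      refine h.dvd_of_dvd_aeval_mul hp (N := (1 + Polynomial.X) ^ k - 1) ?_ ?_
      · intro h2
        have := (Polynomial.C_dvd_iff_dvd_coeff _ _).1 h2
          ((1 + Polynomial.X) ^ k - 1 : Polynomial ℤ).natDegree
        rw [Polynomial.coeff_natDegree, (monic_pow_sub_one hk).leadingCoeff] at this
        have h3 := Int.natAbs_dvd_natAbs.2 this
        simp at h3
        exact hp.one_lt.ne' h3
      · rw [h.aeval_pow_sub_one]
        refine dvd_trans ?_ hu
        simp
    obtain ⟨u', rfl⟩ := h1
    push_cast
    refine mul_dvd_mul_left _ (ih (right_ne_zero_of_mul hm) ?_)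
    obtain ⟨c, hc⟩ := hu
    refine ⟨c, h.int_mul_cancel (n := p) (by exact_mod_cast hp.ne_zero) ?_⟩
    push_cast at hc ⊢
    linear_combination hc

/-- The `q`-divided powers exist in complete `Λ`-rings over `ℤ[q]`. -/
theorem exists_qDivided {a b : C} (ha : ∀ n : ℕ+, LambdaRing.psi n a = a ^ (n : ℕ))
    (hb : ∀ n : ℕ+, LambdaRing.psi n b = b ^ (n : ℕ)) (hab : t ∣ b - a) :
    ∃ L : ℕ → C, L 0 = 1 ∧
      ∀ j, ((1 + t) ^ (j + 1) - 1) * L (j + 1) = (b - (1 + t) ^ j * a) * L j := by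
  obtain ⟨y, hy⟩ := hab
  -- With `y = (b - a)/(q - 1)` the elements `ψⁱ(y)` are `(bⁱ - aⁱ)/(qⁱ - 1)`. These are the power
  -- sums that belong to the exterior powers of `y`, and the wanted sequence consists of these
  -- exterior powers. The value at `i = 0`, where `toPNat'` returns `1`, is never used.
  let z : ℕ → C := fun i => LambdaRing.psi i.toPNat' y
  have hz (i : ℕ) : ((1 + t) ^ (i + 1) - 1) * z (i + 1) = b ^ (i + 1) - a ^ (i + 1) := by
    have := congrArg (LambdaRing.psi (i + 1).toPNat') hy
    rw [map_sub, map_mul, ha, hb, h.psi_t, Nat.toPNat'_coe, if_pos (Nat.succ_pos i)] at this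
    exact this.symm
  -- The sequence is constructed up to the index `k` and is zero afterwards; Newton's identity in
  -- degree `k` is carried along because `newton_step` needs it.
  have main (k : ℕ) : ∃ L : ℕ → C, L 0 = 1 ∧ (∀ j > k, L j = 0) ∧
      (∀ j < k, ((1 + t) ^ (j + 1) - 1) * L (j + 1) = (b - (1 + t) ^ j * a) * L j) ∧
      k * L k = PowerSeries.coeff k (PowerSeries.mk L * powerSumSeries z) := by
    induction k with
    | zero => exact ⟨fun j => if j = 0 then 1 else 0, by simp, fun j hj => if_neg (by omega),
        by simp, by simp [powerSumSeries]⟩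
    | succ k ih =>
      obtain ⟨L, h0, h1, h2, h3⟩ := ih
      have hs := newton_step hz L k h2 h3 (h1 _ k.lt_succ_self)
      set u := PowerSeries.coeff (k + 1) (PowerSeries.mk L * powerSumSeries z) with hu
      -- Newton's formula prescribes `(k + 1) L (k + 1) = u`. The division is possible because
      -- `(qᵏ⁺¹ - 1) u` is a multiple of `k + 1`.
      obtain ⟨l, hl⟩ : ((k + 1 : ℕ) : C) ∣ u :=
        h.dvd_of_dvd_pow_sub_one_mul k.succ_ne_zero _ k.succ_ne_zero
          ⟨_, by rw [hs]; push_cast; rfl⟩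
      refine ⟨Function.update L (k + 1) l, ?_, ?_, ?_, ?_⟩
      · rw [Function.update_of_ne (by omega), h0]
      · intro j hj
        rw [Function.update_of_ne (by omega), h1 j (by omega)]
      · intro j hj
        rw [Function.update_of_ne (by omega : j ≠ k + 1)]
        rcases eq_or_ne j k with rfl | hjk
        · rw [Function.update_self]
          rw [hl] at hs
          refine h.int_mul_cancel (n := j + 1) (by omega) ?_
          push_cast at hs ⊢
          linear_combination hs
        · rw [Function.update_of_ne (by omega), h2 j (by omega)]
      · rw [Function.update_self, ← hl, hu]
        have (f : C⟦X⟧) : PowerSeries.coeff (k + 1) (f * powerSumSeries z) =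
            PowerSeries.coeff k (f * PowerSeries.mk fun i => (-1) ^ i * z (i + 1)) := by
          rw [powerSumSeries, mul_left_comm, PowerSeries.coeff_succ_X_mul]
        rw [this, this, PowerSeries.coeff_mul, PowerSeries.coeff_mul]
        refine Finset.sum_congr rfl fun p hp => ?_
        have := Finset.HasAntidiagonal.mem_antidiagonal.1 hp
        rw [PowerSeries.coeff_mk, PowerSeries.coeff_mk, PowerSeries.coeff_mk,
          Function.update_of_ne (by omega)]
  choose L h0 _ h2 _ using main
  -- The recursion determines the terms, since `qᵏ⁺¹ - 1` is regular; so the finite sequences are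
  -- compatible and the diagonal satisfies the recursion everywhere.
  have huniq (k : ℕ) : ∀ m n, k ≤ m → k ≤ n → L m k = L n k := by
    induction k with
    | zero => intro m n _ _; rw [h0, h0]
    | succ k ih =>
      intro m n hm hn
      refine h.pow_sub_one_mul_cancel k.succ_ne_zero ?_
      rw [h2 m k hm, h2 n k hn, ih m n (by omega) (by omega)]
  refine ⟨fun k => L k k, h0 0, fun j => ?_⟩
  rw [h2 (j + 1) j j.lt_succ_self, huniq j (j + 1) j (by omega) le_rfl]

end IsQRing

/-- A rank one element of a `Λ`-ring. -/
def IsRankOne {C : Type*} [CommRing C] [LambdaRing C] (a : C) : Prop :=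
  ∀ n : ℕ+, LambdaRing.psi n a = a ^ (n : ℕ)

open scoped Classical in
/-- The `q`-divided powers `∏_{i<k} (b - qⁱ a) / (qⁱ⁺¹ - 1)`, where `q = 1 + t`. -/
def qDivided {C : Type*} [CommRing C] (t a b : C) : ℕ → C :=
  if h : ∃ L : ℕ → C, L 0 = 1 ∧
    ∀ j, ((1 + t) ^ (j + 1) - 1) * L (j + 1) = (b - (1 + t) ^ j * a) * L j then h.choose else 0

namespace IsQRing
variable {C : Type*} [CommRing C] [LambdaRing C] {t : C} (h : IsQRing C t)
include h
variable {a b : C} (ha : IsRankOne a) (hb : IsRankOne b) (hab : t ∣ b - a)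
include ha hb hab

theorem qDivided_zero : qDivided t a b 0 = 1 := by
  have := h.exists_qDivided ha hb hab
  rw [qDivided, dif_pos this]
  exact this.choose_spec.1

theorem qDivided_succ (j : ℕ) : ((1 + t) ^ (j + 1) - 1) * qDivided t a b (j + 1) =
    (b - (1 + t) ^ j * a) * qDivided t a b j := by
  have := h.exists_qDivided ha hb hab
  rw [qDivided, dif_pos this]
  exact this.choose_spec.2 j

theorem qDivided_unique (L : ℕ → C) (h0 : L 0 = 1)
    (hL : ∀ j, ((1 + t) ^ (j + 1) - 1) * L (j + 1) = (b - (1 + t) ^ j * a) * L j) (k : ℕ) :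
    qDivided t a b k = L k := by
  induction k with
  | zero => rw [h0, h.qDivided_zero ha hb hab]
  | succ k ih =>
    refine h.pow_sub_one_mul_cancel k.succ_ne_zero ?_
    rw [hL, h.qDivided_succ ha hb hab, ih]

theorem map_qDivided {C' : Type*} [CommRing C'] [LambdaRing C'] {t' : C'} (h' : IsQRing C' t')
    (f : C →+* C') (hf : IsLambdaHom f) (hft : f t = t') (k : ℕ) :
    f (qDivided t a b k) = qDivided t' (f a) (f b) k := by
  have hr {c : C} (hc : IsRankOne c) : IsRankOne (f c) := fun n => by rw [← hf, hc n, map_pow]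
  refine (h'.qDivided_unique (hr ha) (hr hb) ?_ (fun k => f (qDivided t a b k)) ?_ ?_ k).symm
  · rw [← hft, ← map_sub]; exact map_dvd f hab
  · rw [h.qDivided_zero ha hb hab, map_one]
  · intro j
    have := congrArg f (h.qDivided_succ ha hb hab j)
    simpa [hft] using this

end IsQRing
end QDeRham
end

/-! ### The `Λ`-ring `ℤ[q - 1]` and the `q`-binomial coefficients -/

noncomputable section
namespace QDeRham

set_option linter.unusedSectionVars false

instance : LambdaRing ℤ where
  psi := 1
  frobenius_lift p hp a := by
    have := Fact.mk hp
    change (((p : ℕ) : ℤ)) ∣ a - a ^ (p : ℕ)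
    rw [← ZMod.intCast_zmod_eq_zero_iff_dvd]
    push_cast
    rw [ZMod.pow_card, sub_self]

section PolynomialLambda
variable (A : Type*) [CommRing A] [LambdaRing A]

/-- The operation `ψⁿ` on `A[q - 1]`, for `q` of rank one. -/
def polynomialPsi (n : ℕ+) : Polynomial A →+* Polynomial A :=
  Polynomial.eval₂RingHom (Polynomial.C.comp (LambdaRing.psi n)) ((1 + Polynomial.X) ^ (n : ℕ) - 1)

variable {A}
theorem polynomialPsi_C (n : ℕ+) (a : A) :
    polynomialPsi A n (Polynomial.C a) = Polynomial.C (LambdaRing.psi n a) := by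
  simp [polynomialPsi]

theorem polynomialPsi_X (n : ℕ+) :
    polynomialPsi A n Polynomial.X = (1 + Polynomial.X) ^ (n : ℕ) - 1 := by
  simp [polynomialPsi]

theorem polynomialPsi_q (n : ℕ+) :
    polynomialPsi A n (1 + Polynomial.X) = (1 + Polynomial.X) ^ (n : ℕ) := by
  rw [map_add, map_one, polynomialPsi_X]; ring

/-- The `Λ`-ring `A[q - 1]`, where `q` has rank one. -/
instance : LambdaRing (Polynomial A) where
  psi :=
    { toFun := polynomialPsi A
      map_one' := by
        apply Polynomial.ringHom_ext
        · intro a; simp [polynomialPsi_C]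
        · simp [polynomialPsi_X]
      map_mul' := fun m n => by
        apply Polynomial.ringHom_ext
        · intro a; simp [polynomialPsi_C]
        · rw [RingHom.mul_def, RingHom.comp_apply, polynomialPsi_X, polynomialPsi_X, map_sub, map_pow,
            polynomialPsi_q, map_one, PNat.mul_coe, pow_mul] }
  frobenius_lift p hp f := by
    change f ∈ frobeniusSubring (polynomialPsi A p) p hp
    have hX : (Polynomial.X : Polynomial A) ∈ frobeniusSubring (polynomialPsi A p) p hp := by
      have h1 : (1 + Polynomial.X : Polynomial A) ∈ frobeniusSubring (polynomialPsi A p) p hp := by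
        rw [mem_frobeniusSubring, polynomialPsi_q, sub_self]
        exact dvd_zero _
      simpa using sub_mem h1 (one_mem _)
    induction f using Polynomial.induction_on' with
    | add f g hf hg => exact add_mem hf hg
    | monomial n a =>
      rw [← Polynomial.C_mul_X_pow_eq_monomial]
      refine mul_mem ?_ (pow_mem hX n)
      rw [mem_frobeniusSubring, polynomialPsi_C, ← map_pow, ← map_sub]
      have := map_dvd Polynomial.C (LambdaRing.frobenius_lift p hp a)
      simpa using this

theorem psi_polynomial_C (n : ℕ+) (a : A) :
    LambdaRing.psi n (Polynomial.C a) = Polynomial.C (LambdaRing.psi n a) := polynomialPsi_C n a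

theorem psi_polynomial_q (n : ℕ+) : LambdaRing.psi n (1 + Polynomial.X : Polynomial A) =
    (1 + Polynomial.X) ^ (n : ℕ) := polynomialPsi_q n

/-- The polynomial `(1 + X)ⁿ - 1` is not constant, so its substitution is injective. Consequently
the operations `ψⁿ` take admissible denominators to admissible denominators. -/
theorem psi_polynomial_int_ne_zero (n : ℕ+) {N : Polynomial ℤ} (hN : N ≠ 0) :
    LambdaRing.psi n N ≠ 0 := by
  have h1 : LambdaRing.psi n N = N.comp ((1 + Polynomial.X) ^ (n : ℕ) - 1) := rfl
  rw [h1, Ne, Polynomial.comp_eq_zero_iff]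
  rintro (h | ⟨-, h⟩)
  · exact hN h
  · have h2 := Polynomial.eq_one_of_monic_natDegree_zero (IsQRing.monic_pow_sub_one n.ne_zero)
      (by rw [h, Polynomial.natDegree_C])
    have h3 := congrArg (Polynomial.eval 0) h2
    simp at h3

end PolynomialLambda

section QBinomial

/-- The `q`-binomial coefficients as polynomials in `q - 1`. -/
def qBinom : ℕ → ℕ → Polynomial ℤ
  | _, 0 => 1
  | 0, _ + 1 => 0
  | m + 1, k + 1 => qBinom m k + (1 + Polynomial.X) ^ (k + 1) * qBinom m (k + 1)

/-- The denominators `∏_{j<k} (qᵏ - qʲ)`. -/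
def qDenom : ℕ → Polynomial ℤ
  | 0 => 1
  | k + 1 => ((1 + Polynomial.X) ^ (k + 1) - 1) * (1 + Polynomial.X) ^ k * qDenom k

theorem qDenom_ne_zero (k : ℕ) : qDenom k ≠ 0 := by
  induction k with
  | zero => exact one_ne_zero
  | succ k ih =>
    have h1 : (1 + Polynomial.X : Polynomial ℤ) ≠ 0 := by
      rw [add_comm]
      simpa using Polynomial.X_add_C_ne_zero (1 : ℤ)
    exact mul_ne_zero (mul_ne_zero (IsQRing.monic_pow_sub_one k.succ_ne_zero).ne_zero
      (pow_ne_zero _ h1)) ih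

/-- The recursion that defines `qBinom` is the `q`-Pascal rule, and the product of the `qᵐ - qʲ`
obeys it up to the denominator. So these polynomials are the values at `y = qᵐ` of `∏ (y - qʲ)/(qᵏ -
qʲ)`. -/
theorem qBinom_mul_qDenom (m k : ℕ) : qBinom m k * qDenom k =
    ∏ j ∈ Finset.range k, ((1 + Polynomial.X) ^ m - (1 + Polynomial.X) ^ j) := by
  induction m generalizing k with
  | zero =>
    cases k with
    | zero => simp [qBinom, qDenom]
    | succ k => rw [Finset.prod_range_succ']; simp [qBinom]
  | succ m ih =>
    cases k with
    | zero => simp [qBinom, qDenom]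
    | succ k =>
      have h1 := ih k
      have h2 := ih (k + 1)
      have h3 : ∏ j ∈ Finset.range k, ((1 + Polynomial.X : Polynomial ℤ) ^ (m + 1) -
          (1 + Polynomial.X) ^ (j + 1)) = (1 + Polynomial.X) ^ k *
            ∏ j ∈ Finset.range k, ((1 + Polynomial.X) ^ m - (1 + Polynomial.X) ^ j) := by
        have h4 : (1 + Polynomial.X : Polynomial ℤ) ^ k =
            ∏ _j ∈ Finset.range k, (1 + Polynomial.X) := by simp
        rw [h4, ← Finset.prod_mul_distrib]
        exact Finset.prod_congr rfl fun j _ => by ring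
      rw [Finset.prod_range_succ', h3, ← h1]
      rw [Finset.prod_range_succ, ← h1, qDenom] at h2
      rw [qBinom, qDenom]
      linear_combination (1 + Polynomial.X) ^ (k + 1) * h2

theorem qBinom_succ (m k : ℕ) :
    qBinom m (k + 1) * (((1 + Polynomial.X) ^ (k + 1) - 1) * (1 + Polynomial.X) ^ k) =
      qBinom m k * ((1 + Polynomial.X) ^ m - (1 + Polynomial.X) ^ k) := by
  have h1 := qBinom_mul_qDenom m k
  have h2 := qBinom_mul_qDenom m (k + 1)
  rw [Finset.prod_range_succ, ← h1, qDenom] at h2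
  apply mul_right_cancel₀ (qDenom_ne_zero k)
  linear_combination h2

theorem qBinom_eq_zero {m k : ℕ} (h : m < k) : qBinom m k = 0 := by
  have h1 := qBinom_mul_qDenom m k
  rw [Finset.prod_eq_zero (Finset.mem_range.2 h) (sub_self _)] at h1
  exact (mul_eq_zero.1 h1).resolve_right (qDenom_ne_zero k)

theorem qBinom_self (k : ℕ) : qBinom k k = 1 := by
  induction k with
  | zero => rfl
  | succ k ih => rw [qBinom, ih, qBinom_eq_zero k.lt_succ_self, mul_zero, add_zero]

end QBinomial

/-! ### Functions on the points `qᵐ x` that are polynomial up to a denominator -/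

section QPoly
variable {ι : Type} [Finite ι] {P : Type} [CommRing P]

/-- The properties of the `ℤ[q - 1]`-algebra `ℤ[q - 1][xᵢ]` that are used below. -/
structure IsPolyBase (c : Polynomial ℤ →+* P) (x : ι → P) : Prop where
  isDomain : IsDomain P
  c_injective : Function.Injective c
  dvd_of_dvd_mul : ∀ N g (k : ι →₀ ℕ), c N ∣ g * k.prod (fun i n => x i ^ n) → c N ∣ g
  infinite : ∀ i, (Set.range fun n : ℕ => c ((1 + Polynomial.X) ^ n) * x i).Infinite

variable (c : Polynomial ℤ →+* P) (x : ι → P)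

/-- The point with coordinates `q ^ (m i) xᵢ`. -/
def qPoint (m : ι → ℕ) (i : ι) : P := c ((1 + Polynomial.X) ^ m i) * x i

/-- Pairs of a function `w` on the points `qᵐ x` and an element of a ring over `ℤ[q - 1][xᵢ]` that,
up to a common denominator, are the values of the same polynomial `f`. -/
def qGraph {C : Type*} [CommRing C] (φ : P →+* C) (b : ι → C) :
    Subring (((ι → ℕ) → P) × C) where
  carrier := {p | ∃ N : Polynomial ℤ, N ≠ 0 ∧ ∃ f : MvPolynomial ι P,
    (∀ m, c N * p.1 m = MvPolynomial.eval (qPoint c x m) f) ∧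
      φ (c N) * p.2 = MvPolynomial.eval₂Hom φ b f}
  mul_mem' := by
    rintro ⟨w, e⟩ ⟨w', e'⟩ ⟨N, hN, f, h1, h2⟩ ⟨N', hN', f', h1', h2'⟩
    refine ⟨N * N', mul_ne_zero hN hN', f * f', fun m => ?_, ?_⟩
    · rw [map_mul, map_mul, ← h1, ← h1']
      simp only [Prod.mk_mul_mk, Pi.mul_apply]
      ring
    · rw [map_mul, map_mul, map_mul, ← h2, ← h2']
      simp only [Prod.mk_mul_mk]
      ring
  one_mem' := ⟨1, one_ne_zero, 1, by simp, by simp⟩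
  add_mem' := by
    rintro ⟨w, e⟩ ⟨w', e'⟩ ⟨N, hN, f, h1, h2⟩ ⟨N', hN', f', h1', h2'⟩
    refine ⟨N * N', mul_ne_zero hN hN', MvPolynomial.C (c N') * f +
      MvPolynomial.C (c N) * f', fun m => ?_, ?_⟩
    · rw [map_add, map_mul, map_mul, map_mul, ← h1, ← h1']
      simp only [Prod.mk_add_mk, Pi.add_apply, MvPolynomial.eval_C]
      ring
    · rw [map_add, map_mul, map_mul, map_mul, map_mul, ← h2, ← h2']
      simp only [Prod.mk_add_mk, MvPolynomial.coe_eval₂Hom, MvPolynomial.eval₂_C]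
      ring
  zero_mem' := ⟨1, one_ne_zero, 0, by simp, by simp⟩
  neg_mem' := by
    rintro ⟨w, e⟩ ⟨N, hN, f, h1, h2⟩
    refine ⟨N, hN, -f, fun m => ?_, ?_⟩
    · rw [map_neg, ← h1]; exact mul_neg _ _
    · rw [map_neg, ← h2]; exact mul_neg _ _

/-- The homomorphism to the zero ring. -/
def toPUnit (S : Type*) [CommRing S] : S →+* PUnit.{1} where
  toFun _ := PUnit.unit
  map_one' := rfl
  map_mul' _ _ := rfl
  map_zero' := rfl
  map_add' _ _ := rfl

variable {c x}

/-- Functions on the points `qᵐ x` that are given by a polynomial after multiplication with a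
denominator from `ℤ[q - 1]`. -/
def QPoly (_ : IsPolyBase c x) : Subalgebra P ((ι → ℕ) → P) where
  -- With the zero ring as second factor, only the condition on the function is left from `qGraph`,
  -- so the verification that it is closed under the ring operations serves twice.
  __ := (qGraph c x (toPUnit P) (fun _ => PUnit.unit)).toSubsemiring.comap
    ((RingHom.id ((ι → ℕ) → P)).prod (toPUnit _))
  algebraMap_mem' p := ⟨1, one_ne_zero, MvPolynomial.C p, by simp, Subsingleton.elim _ _⟩

variable (hc : IsPolyBase c x)

theorem mem_QPoly {w : (ι → ℕ) → P} : w ∈ QPoly hc ↔ ∃ N : Polynomial ℤ, N ≠ 0 ∧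
    ∃ f : MvPolynomial ι P, ∀ m, c N * w m = MvPolynomial.eval (qPoint c x m) f :=
  ⟨fun ⟨N, hN, f, h, _⟩ => ⟨N, hN, f, h⟩,
    fun ⟨N, hN, f, h⟩ => ⟨N, hN, f, h, Subsingleton.elim _ _⟩⟩

/-- The coordinate functions `yᵢ`. -/
def qCoord (i : ι) : QPoly hc := ⟨fun m => qPoint c x m i, (mem_QPoly hc).2
  ⟨1, one_ne_zero, MvPolynomial.X i, by simp⟩⟩

theorem eval_qPoint (f : MvPolynomial ι P) (m : ι → ℕ) :
    (MvPolynomial.aeval (qCoord hc) f).1 m = MvPolynomial.eval (qPoint c x m) f := by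
  have : (((Pi.evalRingHom _ m).comp (QPoly hc).val.toRingHom).comp
      (MvPolynomial.aeval (qCoord hc)).toRingHom) = MvPolynomial.eval (qPoint c x m) := by
    apply MvPolynomial.ringHom_ext
    · intro p; simp
    · intro i; simp [qCoord]
  exact congr($this f)

theorem exists_mul_eq_aeval (w : QPoly hc) : ∃ N : Polynomial ℤ, N ≠ 0 ∧
    ∃ f : MvPolynomial ι P, algebraMap P (QPoly hc) (c N) * w =
      MvPolynomial.aeval (qCoord hc) f := by
  obtain ⟨N, hN, f, h⟩ := (mem_QPoly hc).1 w.2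
  refine ⟨N, hN, f, Subtype.ext (funext fun m => ?_)⟩
  rw [eval_qPoint, ← h]
  rfl

/-- Each element becomes a polynomial in the coordinates after multiplication with a denominator,
and denominators act injectively on the target. -/
theorem qPoly_hom_ext {C : Type*} [CommRing C] {g g' : QPoly hc →+* C}
    (hnz : ∀ N : Polynomial ℤ, N ≠ 0 → ∀ e, g (algebraMap P _ (c N)) * e = 0 → e = 0)
    (h : ∀ p, g (algebraMap P _ p) = g' (algebraMap P _ p))
    (hy : ∀ i, g (qCoord hc i) = g' (qCoord hc i)) : g = g' := by
  ext w
  obtain ⟨N, hN, f, hf⟩ := exists_mul_eq_aeval hc w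
  have h1 : g (MvPolynomial.aeval (qCoord hc) f) = g' (MvPolynomial.aeval (qCoord hc) f) := by
    have : g.comp (MvPolynomial.aeval (R := P) (qCoord hc)).toRingHom =
        g'.comp (MvPolynomial.aeval (R := P) (qCoord hc)).toRingHom := by
      apply MvPolynomial.ringHom_ext
      · intro p; simpa using h p
      · intro i; simpa using hy i
    exact congr($this f)
  rw [← sub_eq_zero]
  refine hnz N hN _ ?_
  rw [mul_sub, ← map_mul, h, ← map_mul, hf, h1, sub_self]

-- The points `qᵐ x` form a product of infinite subsets of a domain, so they detect polynomials.
-- This makes the polynomial in the definition of `qGraph` unique.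
include hc in
theorem eq_zero_of_eval_qPoint {f : MvPolynomial ι P}
    (hf : ∀ m, MvPolynomial.eval (qPoint c x m) f = 0) : f = 0 := by
  have := hc.isDomain
  refine MvPolynomial.funext_set _ hc.infinite fun y hy => ?_
  choose m hm using Set.mem_univ_pi.1 hy
  obtain rfl : qPoint c x m = y := funext hm
  rw [hf, map_zero]

end QPoly

section BasePoly
variable (ι : Type) [Finite ι]

theorem isPolyBase_mvPolynomial : IsPolyBase
    (MvPolynomial.C : Polynomial ℤ →+* MvPolynomial ι (Polynomial ℤ)) MvPolynomial.X where
  isDomain := inferInstance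
  c_injective := MvPolynomial.C_injective ι _
  dvd_of_dvd_mul N g k h := by
    rw [MvPolynomial.C_dvd_iff_dvd_coeff] at h ⊢
    intro s
    have h1 : k.prod (fun i n => (MvPolynomial.X i : MvPolynomial ι (Polynomial ℤ)) ^ n) =
        MvPolynomial.monomial k 1 := by
      rw [MvPolynomial.monomial_eq, map_one, one_mul]
    have := h (s + k)
    rwa [h1, MvPolynomial.coeff_mul_monomial, mul_one] at this
  infinite i := by
    refine Set.infinite_range_of_injective fun m n hmn => ?_
    have h1 : (1 + Polynomial.X : Polynomial ℤ) ^ m = (1 + Polynomial.X) ^ n :=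
      MvPolynomial.C_injective ι _ (mul_right_cancel₀ (MvPolynomial.X_ne_zero i) hmn)
    have h2 := congrArg Polynomial.natDegree h1
    rw [Polynomial.natDegree_pow, Polynomial.natDegree_pow, add_comm] at h2
    have : (Polynomial.X + 1 : Polynomial ℤ).natDegree = 1 := by
      simpa using Polynomial.natDegree_X_add_C (1 : ℤ)
    simpa [this] using h2

end BasePoly
end QDeRham
end

noncomputable section
namespace QDeRham

set_option linter.unusedSectionVars false

/-! ### The basis of `q`-binomial functions and the universal property -/

section QPolyBasis
variable {ι : Type} [Fintype ι] {P : Type} [CommRing P] {c : Polynomial ℤ →+* P} {x : ι → P}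
  (hc : IsPolyBase c x)

variable (c x) in
/-- The values `xᵏ ∏ᵢ [mᵢ choose kᵢ]_q` of the basis functions. -/
def qBasisVal (k m : ι → ℕ) : P := ∏ i, (c (qBinom (m i) (k i)) * x i ^ k i)

variable (c x) in
/-- The polynomial `∏ᵢ ∏_{j<kᵢ} (yᵢ - qʲ xᵢ)`. -/
def qNumerator (k : ι → ℕ) : MvPolynomial ι P :=
  ∏ i, ∏ j ∈ Finset.range (k i),
    (MvPolynomial.X i - MvPolynomial.C (c ((1 + Polynomial.X) ^ j) * x i))

variable (c x) in
theorem qDenom_mul_qBasisVal (k m : ι → ℕ) :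
    c (∏ i, qDenom (k i)) * qBasisVal c x k m =
      MvPolynomial.eval (qPoint c x m) (qNumerator c x k) := by
  rw [qBasisVal, map_prod, ← Finset.prod_mul_distrib, qNumerator, map_prod]
  refine Finset.prod_congr rfl fun i _ => ?_
  rw [map_prod, ← mul_assoc, ← map_mul, mul_comm (qDenom _), qBinom_mul_qDenom, map_prod]
  have h4 : x i ^ k i = ∏ _j ∈ Finset.range (k i), x i := by simp
  rw [h4, ← Finset.prod_mul_distrib]
  refine Finset.prod_congr rfl fun j _ => ?_
  simp only [map_sub, MvPolynomial.eval_X, MvPolynomial.eval_C, qPoint]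
  ring

/-- The basis `e_k = ∏ᵢ ∏_{j<kᵢ} (yᵢ - qʲ xᵢ) / (q^{kᵢ} - qʲ)`. -/
def qBasisFun (k : ι → ℕ) : QPoly hc := ⟨qBasisVal c x k, (mem_QPoly hc).2
  ⟨∏ i, qDenom (k i), Finset.prod_ne_zero_iff.2 fun _ _ => qDenom_ne_zero _, _,
    qDenom_mul_qBasisVal c x k⟩⟩

theorem qBasisFun_zero : qBasisFun hc 0 = 1 := by
  apply Subtype.ext
  funext m
  have h (m : ℕ) : qBinom m 0 = 1 := by cases m <;> rfl
  simp [qBasisFun, qBasisVal, h]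

-- The factor `yᵢ - q^{kᵢ} xᵢ` leads from one numerator to the next. The span of the `e_k` is
-- therefore stable under multiplication by the coordinates and contains all polynomials in them.
open scoped Classical in
theorem qCoord_mul_qBasisFun (i : ι) (k : ι → ℕ) : qBasisFun hc k * qCoord hc i =
    (c ((1 + Polynomial.X) ^ k i) * x i) • qBasisFun hc k +
      c (((1 + Polynomial.X) ^ (k i + 1) - 1) * (1 + Polynomial.X) ^ k i) •
        qBasisFun hc (Function.update k i (k i + 1)) := by
  apply Subtype.ext
  funext m
  change qBasisVal c x k m * qPoint c x m i = _ * qBasisVal c x k m + _ * qBasisVal c x _ m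
  rw [qBasisVal, qBasisVal, ← Finset.mul_prod_erase _ _ (Finset.mem_univ i),
    ← Finset.mul_prod_erase _ (fun j => c (qBinom (m j)
      (Function.update k i (k i + 1) j)) * x j ^ Function.update k i (k i + 1) j)
      (Finset.mem_univ i)]
  have hupd : ∏ j ∈ Finset.univ.erase i, (c (qBinom (m j)
      (Function.update k i (k i + 1) j)) * x j ^ Function.update k i (k i + 1) j) =
      ∏ j ∈ Finset.univ.erase i, (c (qBinom (m j) (k j)) * x j ^ k j) :=
    Finset.prod_congr rfl fun j hj => by
      rw [Function.update_of_ne (Finset.ne_of_mem_erase hj)]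
  rw [hupd]
  generalize ∏ j ∈ Finset.univ.erase i, (c (qBinom (m j) (k j)) * x j ^ k j) = Q
  rw [Function.update_self, qPoint]
  have := congrArg c (qBinom_succ (m i) (k i))
  rw [map_mul, map_mul c (qBinom (m i) (k i)), map_sub] at this
  rw [pow_succ (x i)]
  linear_combination (-x i ^ k i * x i * Q) * this

theorem aeval_qCoord_mem_span (f : MvPolynomial ι P) :
    MvPolynomial.aeval (qCoord hc) f ∈ Submodule.span P (Set.range (qBasisFun hc)) := by
  induction f using MvPolynomial.induction_on with
  | C p =>
    rw [MvPolynomial.aeval_C, Algebra.algebraMap_eq_smul_one, ← qBasisFun_zero]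
    exact Submodule.smul_mem _ _ (Submodule.subset_span ⟨_, rfl⟩)
  | add f g hf hg => rw [map_add]; exact add_mem hf hg
  | mul_X f i hf =>
    rw [map_mul, MvPolynomial.aeval_X]
    generalize MvPolynomial.aeval (qCoord hc) f = y at hf
    induction hf using Submodule.span_induction with
    | mem y hy =>
      classical
      obtain ⟨k, rfl⟩ := hy
      rw [qCoord_mul_qBasisFun]
      exact add_mem (Submodule.smul_mem _ _ (Submodule.subset_span ⟨_, rfl⟩))
        (Submodule.smul_mem _ _ (Submodule.subset_span ⟨_, rfl⟩))
    | zero => rw [zero_mul]; exact zero_mem _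
    | add y z _ _ hy hz => rw [add_mul]; exact add_mem hy hz
    | smul p y _ hy => rw [smul_mul_assoc]; exact Submodule.smul_mem _ _ hy

-- The system is triangular: `e_j` vanishes at `qᵏ x` unless `j ≤ k` in every coordinate, and the
-- value of `e_k` there is the monomial `xᵏ`, which can be cancelled. With `N = 0` this yields
-- linear independence. With general `N` it yields generation: if `N w` has coefficients `g k`, then
-- they are divisible by `N` already.
include hc in
theorem dvd_of_sum_qBasisVal {N : Polynomial ℤ} (g : (ι → ℕ) →₀ P) (w : (ι → ℕ) → P)
    (h : ∀ m, c N * w m = g.sum fun k p => p * qBasisVal c x k m) (k : ι → ℕ) : c N ∣ g k := by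
  induction hs : ∑ i, k i using Nat.strong_induction_on generalizing k with
  | _ s ih =>
    have hk := h k
    apply hc.dvd_of_dvd_mul _ _ (Finsupp.equivFunOnFinite.symm k)
    have hself : qBasisVal c x k k =
        (Finsupp.equivFunOnFinite.symm k).prod fun i n => x i ^ n := by
      rw [Finsupp.prod_fintype _ _ (by simp)]
      simp [qBasisVal, qBinom_self]
    rw [← hself]
    by_cases hkg : k ∈ g.support
    · rw [Finsupp.sum, ← Finset.add_sum_erase _ _ hkg, ← sub_eq_iff_eq_add] at hk
      rw [← hk]
      refine dvd_sub (dvd_mul_right _ _) (Finset.dvd_sum fun j hj => ?_)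
      by_cases hjk : ∀ i, j i ≤ k i
      · obtain ⟨i, hi⟩ := Function.ne_iff.1 (Finset.ne_of_mem_erase hj)
        exact (ih (∑ i, j i) (hs ▸ Finset.sum_lt_sum (fun i _ => hjk i)
          ⟨i, Finset.mem_univ i, lt_of_le_of_ne (hjk i) hi⟩) j rfl).mul_right _
      · push Not at hjk
        obtain ⟨i, hi⟩ := hjk
        rw [qBasisVal, Finset.prod_eq_zero (Finset.mem_univ i) (by simp [qBinom_eq_zero hi]),
          mul_zero]
        exact dvd_zero _
    · rw [Finsupp.notMem_support_iff.1 hkg, zero_mul]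
      exact dvd_zero _

theorem sum_qBasisFun_apply (g : (ι → ℕ) →₀ P) (m : ι → ℕ) :
    (g.sum fun k p => p • qBasisFun hc k).1 m = g.sum fun k p => p * qBasisVal c x k m := by
  rw [Finsupp.sum, AddSubmonoidClass.coe_finsetSum, Finset.sum_apply]
  rfl

theorem linearIndependent_qBasisFun : LinearIndependent P (qBasisFun hc) := by
  rw [linearIndependent_iff]
  intro g hg
  ext1 k
  have := dvd_of_sum_qBasisVal hc (N := 0) g 0 (fun m => by
    rw [← sum_qBasisFun_apply hc]
    rw [Finsupp.linearCombination_apply] at hg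
    rw [hg]
    simp) k
  rw [map_zero, zero_dvd_iff] at this
  simpa using this

theorem span_qBasisFun : ⊤ ≤ Submodule.span P (Set.range (qBasisFun hc)) := by
  intro w _
  obtain ⟨N, hN, f, hf⟩ := exists_mul_eq_aeval hc w
  obtain ⟨g, hg⟩ := Finsupp.mem_span_range_iff_exists_finsupp.1 (aeval_qCoord_mem_span hc f)
  have h1 (m : ι → ℕ) : c N * w.1 m = g.sum fun k p => p * qBasisVal c x k m := by
    rw [← sum_qBasisFun_apply hc, hg, ← hf]
    rfl
  choose e he using dvd_of_sum_qBasisVal hc g w.1 h1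
  have hw : w = ∑ k ∈ g.support, e k • qBasisFun hc k := by
    apply Subtype.ext
    funext m
    have := hc.isDomain
    apply mul_left_cancel₀ ((map_ne_zero_iff c hc.c_injective).2 hN)
    rw [h1, AddSubmonoidClass.coe_finsetSum, Finset.sum_apply, Finset.mul_sum]
    refine Finset.sum_congr rfl fun k _ => ?_
    change g k * _ = _ * (e k * qBasisVal c x k m)
    rw [he k]
    ring
  rw [hw]
  exact Submodule.sum_mem _ fun k _ => Submodule.smul_mem _ _ (Submodule.subset_span ⟨_, rfl⟩)

/-- The functions `e_k` form a basis. -/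
def qBasis : Module.Basis (ι → ℕ) P (QPoly hc) :=
  Module.Basis.mk (linearIndependent_qBasisFun hc) (span_qBasisFun hc)

theorem qBasis_apply (k : ι → ℕ) : qBasis hc k = qBasisFun hc k :=
  Module.Basis.mk_apply _ _ _

theorem qDenom_mul_qBasisFun (k : ι → ℕ) :
    algebraMap P (QPoly hc) (c (∏ i, qDenom (k i))) * qBasisFun hc k =
      ∏ i, ∏ j ∈ Finset.range (k i), (qCoord hc i -
        algebraMap P (QPoly hc) (c ((1 + Polynomial.X) ^ j) * x i)) := by
  have : algebraMap P (QPoly hc) (c (∏ i, qDenom (k i))) * qBasisFun hc k =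
      MvPolynomial.aeval (qCoord hc) (qNumerator c x k) := by
    apply Subtype.ext
    funext m
    rw [eval_qPoint, ← qDenom_mul_qBasisVal]
    rfl
  rw [this, qNumerator, map_prod]
  refine Finset.prod_congr rfl fun i _ => ?_
  rw [map_prod]
  refine Finset.prod_congr rfl fun j _ => ?_
  rw [map_sub, MvPolynomial.aeval_X, MvPolynomial.aeval_C]

/-- The universal property: a homomorphism is determined by the images `b i` of the `yᵢ`, and exists if
the `e_k` in one variable have images. -/
theorem exists_qPoly_hom {C : Type*} [CommRing C] (φ : P →+* C) (b : ι → C)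
    (hnz : ∀ N : Polynomial ℤ, N ≠ 0 → ∀ e, φ (c N) * e = 0 → e = 0)
    (he : ∀ i k, ∃ e, φ (c (qDenom k)) * e = ∏ j ∈ Finset.range k,
      (b i - φ (c ((1 + Polynomial.X) ^ j) * x i))) :
    ∃ g : QPoly hc →+* C, (∀ p, g (algebraMap _ _ p) = φ p) ∧ ∀ i, g (qCoord hc i) = b i := by
  -- The homomorphism is defined by its graph: a function is paired with an element of `C` if both
  -- come from one polynomial, up to a common denominator. The graph is total because it contains
  -- constants and basis elements, and single-valued because the zero function forces the polynomial
  -- to be zero.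
  let Γ : Subring (QPoly hc × C) := (qGraph c x φ b).comap
    (((QPoly hc).val.toRingHom.comp (RingHom.fst _ _)).prod (RingHom.snd _ _))
  have hmem (w : QPoly hc) (e : C) : (w, e) ∈ Γ ↔ (w.1, e) ∈ qGraph c x φ b := Iff.rfl
  have hP (p : P) : (algebraMap P (QPoly hc) p, φ p) ∈ Γ :=
    (hmem _ _).2 ⟨1, one_ne_zero, MvPolynomial.C p, by simp, by simp⟩
  have hE (k : ι → ℕ) : ∃ e, (qBasisFun hc k, e) ∈ Γ := by
    choose e he using he
    refine ⟨∏ i, e i (k i), (hmem _ _).2 ⟨∏ i, qDenom (k i),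
      Finset.prod_ne_zero_iff.2 fun i _ => qDenom_ne_zero _, _, qDenom_mul_qBasisVal c x k, ?_⟩⟩
    simp only
    rw [map_prod, map_prod, ← Finset.prod_mul_distrib, qNumerator, map_prod]
    refine Finset.prod_congr rfl fun i _ => ?_
    rw [he, map_prod]
    refine Finset.prod_congr rfl fun j _ => ?_
    simp
  have htot : ∀ w, ∃ e, (w, e) ∈ Γ := by
    intro w
    have hw : w ∈ Submodule.span P (Set.range (qBasisFun hc)) := span_qBasisFun hc trivial
    induction hw using Submodule.span_induction with
    | mem y hy => obtain ⟨k, rfl⟩ := hy; exact hE k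
    | zero => exact ⟨0, Γ.zero_mem⟩
    | add y z _ _ hy hz =>
      obtain ⟨e, he⟩ := hy
      obtain ⟨e', he'⟩ := hz
      exact ⟨e + e', Γ.add_mem he he'⟩
    | smul p y _ hy =>
      obtain ⟨e, he⟩ := hy
      refine ⟨φ p * e, ?_⟩
      rw [Algebra.smul_def]
      exact Γ.mul_mem (hP p) he
  have h0 : ∀ e, ((0 : QPoly hc), e) ∈ Γ → e = 0 := by
    intro e he
    obtain ⟨N, hN, f, h1, h2⟩ := (hmem 0 e).1 he
    have hf : f = 0 := eq_zero_of_eval_qPoint hc fun m => by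
      rw [← h1 m]
      exact mul_zero _
    rw [hf, map_zero] at h2
    exact hnz N hN e h2
  refine ⟨ringHomOfGraph Γ htot h0, fun p => (ringHomOfGraph_eq_iff Γ htot h0 _ _).2 (hP p),
    fun i => (ringHomOfGraph_eq_iff Γ htot h0 _ _).2 ((hmem _ _).2
      ⟨1, one_ne_zero, MvPolynomial.X i, by simp [qCoord], by simp⟩)⟩

end QPolyBasis

/-! ### The `Λ`-structure on functions on the points `qᵐ x` -/

section QPolyLambda
variable {ι : Type} [Finite ι]

theorem psi_mvPolynomial_X {S : Type*} [CommRing S] [LambdaRing S] (n : ℕ+) (i : ι) :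
    LambdaRing.psi n (MvPolynomial.X i : MvPolynomial ι S) = MvPolynomial.X i ^ (n : ℕ) := by
  change LambdaRing.mvPolynomialPsi ι _ n _ = _
  simp [LambdaRing.mvPolynomialPsi]

theorem psi_mvPolynomial_C {S : Type*} [CommRing S] [LambdaRing S] (n : ℕ+) (s : S) :
    LambdaRing.psi n (MvPolynomial.C s : MvPolynomial ι S) =
      MvPolynomial.C (LambdaRing.psi n s) := by
  change LambdaRing.mvPolynomialPsi ι _ n _ = _
  simp [LambdaRing.mvPolynomialPsi]

variable {P : Type} [CommRing P] [LambdaRing P] {c : Polynomial ℤ →+* P} {x : ι → P}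
  (hc : IsPolyBase c x) (hcψ : IsLambdaHom c) (hx : ∀ i, IsRankOne (x i))

include hcψ hx in
theorem psi_qPoint (n : ℕ+) (m : ι → ℕ) (i : ι) :
    LambdaRing.psi n (qPoint c x m i) = qPoint c x m i ^ (n : ℕ) := by
  rw [qPoint, map_mul, hx, ← hcψ, map_pow, psi_polynomial_q, mul_pow,
    ← map_pow, ← pow_mul, ← pow_mul, mul_comm (n : ℕ)]

-- The coordinates of the points have rank one, so applying `ψⁿ` to the values amounts to applying
-- `ψⁿ` to the polynomial and to its denominator.
include hcψ hx in
theorem comp_psi_mem_QPoly (n : ℕ+) {w : (ι → ℕ) → P} (hw : w ∈ QPoly hc) :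
    (fun m => LambdaRing.psi n (w m)) ∈ QPoly hc := by
  obtain ⟨N, hN, f, h⟩ := (mem_QPoly hc).1 hw
  refine (mem_QPoly hc).2 ⟨LambdaRing.psi n N, psi_polynomial_int_ne_zero n hN,
    LambdaRing.mvPolynomialPsi ι P n f, fun m => ?_⟩
  have h1 : (MvPolynomial.eval (qPoint c x m)).comp (LambdaRing.mvPolynomialPsi ι P n) =
      (LambdaRing.psi n).comp (MvPolynomial.eval (qPoint c x m)) := by
    apply MvPolynomial.ringHom_ext
    · intro p
      simp [LambdaRing.mvPolynomialPsi]
    · intro i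
      simp [LambdaRing.mvPolynomialPsi, psi_qPoint hcψ hx]
  have h2 := congr($h1 f)
  rw [RingHom.comp_apply, RingHom.comp_apply] at h2
  rw [h2, ← h, map_mul, ← hcψ]

/-- The operation `ψⁿ` on the ring of functions on the points `qᵐ x`. -/
def qPolyPsi (n : ℕ+) : QPoly hc →+* QPoly hc :=
  (((LambdaRing.psi n).compLeft (ι → ℕ)).comp (QPoly hc).val.toRingHom).codRestrict (QPoly hc)
    fun w => comp_psi_mem_QPoly hc hcψ hx n w.2

theorem qPolyPsi_apply (n : ℕ+) (w : QPoly hc) (m : ι → ℕ) :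
    (qPolyPsi hc hcψ hx n w).1 m = LambdaRing.psi n (w.1 m) := rfl

/-- The `Λ`-ring structure on the ring of functions on the points `qᵐ x`. -/
@[reducible] def qPolyLambda : LambdaRing (QPoly hc) where
  psi :=
    { toFun := qPolyPsi hc hcψ hx
      map_one' := by
        ext w : 2
        funext m
        rw [qPolyPsi_apply, map_one]
        rfl
      map_mul' := fun m n => by
        ext w : 2
        funext y
        rw [qPolyPsi_apply, map_mul]
        rfl }
  frobenius_lift p hp w := by
    have h (m : ι → ℕ) := LambdaRing.frobenius_lift p hp (w.1 m)
    choose e he using h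
    -- The division by `p` is done at each point. The quotient stays in the ring because `p` may be
    -- absorbed into the denominator.
    have hcm : e ∈ QPoly hc := by
      obtain ⟨N, hN, f, h⟩ := (mem_QPoly hc).1 (qPolyPsi hc hcψ hx p w - w ^ (p : ℕ)).2
      refine (mem_QPoly hc).2 ⟨N * (p : ℕ), mul_ne_zero hN (by exact_mod_cast hp.ne_zero), f,
        fun m => ?_⟩
      rw [← h, map_mul, mul_assoc]
      have : (qPolyPsi hc hcψ hx p w - w ^ (p : ℕ)).1 m = ((p : ℕ) : P) * e m := he m
      rw [this]
      simp
    refine ⟨⟨e, hcm⟩, Subtype.ext (funext fun m => ?_)⟩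
    refine (he m).trans ?_
    change _ = (((p : ℕ) : QPoly hc).1 * e) m
    simp

end QPolyLambda
end QDeRham
end

/-! ### Flatness, completions and tensor products of `Λ`-rings -/

noncomputable section
namespace QDeRham

set_option linter.unusedSectionVars false

section Flat

/-- Flatness of a reduction is preserved by flat extensions. -/
theorem flat_quotient_map {R B S : Type u} [CommRing R] [CommRing B] [CommRing S] [Algebra B S]
    [Module.Flat B S] (I : Ideal B) (f : R →+* B) (hf : ((Ideal.Quotient.mk I).comp f).Flat) :
    ((Ideal.Quotient.mk (I.map (algebraMap B S))).comp ((algebraMap B S).comp f)).Flat := by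
  let e := Algebra.TensorProduct.quotIdealMapEquivTensorQuot S I
  have h1 : (algebraMap (B ⧸ I) ((B ⧸ I) ⊗[B] S)).Flat := by
    rw [RingHom.flat_algebraMap_iff]
    infer_instance
  have h2 : (Algebra.TensorProduct.comm B (B ⧸ I) S).toRingEquiv.toRingHom.Flat :=
    RingHom.Flat.of_bijective (Algebra.TensorProduct.comm B (B ⧸ I) S).bijective
  have h3 : e.symm.toRingEquiv.toRingHom.Flat := RingHom.Flat.of_bijective e.symm.bijective
  have h4 := ((hf.comp h1).comp h2).comp h3
  convert h4 using 1
  ext r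
  simp only [RingHom.comp_apply]
  have : (algebraMap (B ⧸ I) ((B ⧸ I) ⊗[B] S)) (Ideal.Quotient.mk I (f r)) =
      algebraMap B ((B ⧸ I) ⊗[B] S) (f r) := rfl
  rw [this]
  change _ = e.symm (Algebra.TensorProduct.comm B (B ⧸ I) S (algebraMap B _ (f r)))
  rw [AlgEquiv.commutes, IsScalarTower.algebraMap_apply B S (S ⊗[B] (B ⧸ I)), AlgEquiv.commutes]
  rfl

end Flat

section Completion
variable {S : Type*} [CommRing S] (t : S)

/-- For a finitely generated ideal the kernel of the projection of the completion to level `n` is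
generated by `tⁿ`; all three properties can then be read off at the finite levels. -/
theorem isCompletion_adicCompletion :
    IsCompletion (algebraMap S (AdicCompletion (Ideal.span {t}) S)) t := by
  have hfg : (Ideal.span {t}).FG := ⟨{t}, by simp⟩
  have hker (x : AdicCompletion (Ideal.span {t}) S) (n : ℕ)
      (hx : AdicCompletion.eval (Ideal.span {t}) S n x = 0) :
      algebraMap S (AdicCompletion (Ideal.span {t}) S) t ^ n ∣ x := by
    have h1 : x ∈ (Ideal.span {t} ^ n • ⊤ : Submodule S (AdicCompletion (Ideal.span {t}) S)) := by
      rw [AdicCompletion.pow_smul_top_eq_ker_eval hfg]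
      exact hx
    rw [Ideal.span_singleton_pow, Submodule.ideal_span_singleton_smul,
      Submodule.mem_smul_pointwise_iff_exists] at h1
    obtain ⟨y, -, rfl⟩ := h1
    rw [← map_pow, Algebra.smul_def]
    exact dvd_mul_right _ _
  have hof (s : S) (n : ℕ) : AdicCompletion.eval (Ideal.span {t}) S n
      (algebraMap S (AdicCompletion (Ideal.span {t}) S) s) = Submodule.Quotient.mk s := rfl
  refine ⟨?_, fun x n => ?_, fun s n hs => ?_⟩
  · have := AdicCompletion.isAdicComplete_self (Ideal.span {t}) hfg
    rwa [Ideal.map_span, Set.image_singleton] at this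
  · obtain ⟨s, hs⟩ := Submodule.Quotient.mk_surjective _
      (AdicCompletion.eval (Ideal.span {t}) S n x)
    exact ⟨s, hker _ n (by rw [map_sub, hof, hs, sub_self])⟩
  · obtain ⟨y, hy⟩ := hs
    have h1 : AdicCompletion.eval (Ideal.span {t}) S n
        (algebraMap S (AdicCompletion (Ideal.span {t}) S) s) = 0 := by
      rw [hy, ← map_pow, ← Algebra.smul_def, map_smul]
      obtain ⟨s', hs'⟩ := Submodule.Quotient.mk_surjective _
        (AdicCompletion.eval (Ideal.span {t}) S n y)
      rw [← hs', ← Submodule.Quotient.mk_smul, Submodule.Quotient.mk_eq_zero,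
        Ideal.span_singleton_pow, smul_eq_mul, smul_eq_mul, Ideal.mul_top,
        Ideal.mem_span_singleton]
      exact dvd_mul_right _ _
    rw [hof, Submodule.Quotient.mk_eq_zero, Ideal.span_singleton_pow, smul_eq_mul, Ideal.mul_top,
      Ideal.mem_span_singleton] at h1
    exact h1

namespace IsCompletion
variable {Ŝ : Type*} [CommRing Ŝ] {i : S →+* Ŝ} {t} (hi : IsCompletion i t)
include hi

theorem eq_zero_of_mul (htf : ∀ s, t * s = 0 → s = 0) (x : Ŝ) (hx : i t * x = 0) : x = 0 := by
  refine eq_of_forall_pow_dvd_sub hi.complete fun n => ?_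
  rw [sub_zero]
  obtain ⟨s, y, hy⟩ := hi.dense x n
  have h1 : i t ^ (n + 1) ∣ i (t * s) := ⟨-y, by
    rw [map_mul]
    linear_combination hx - i t * hy⟩
  obtain ⟨s', hs'⟩ := hi.strict _ _ h1
  have h2 : s = t ^ n * s' := by
    rw [← sub_eq_zero]
    apply htf
    linear_combination hs'
  refine ⟨i s' + y, ?_⟩
  rw [h2, map_mul, map_pow] at hy
  linear_combination hy

theorem dvd_of_dvd_int_mul {n : ℤ} (hn : ∀ s, t ∣ n * s → t ∣ s) (x : Ŝ) (hx : i t ∣ n * x) :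
    i t ∣ x := by
  obtain ⟨s, y, hy⟩ := hi.dense x 1
  have h1 : i t ^ 1 ∣ i (n * s) := by
    rw [map_mul, map_intCast, pow_one]
    rw [pow_one] at hy
    have := dvd_sub hx (Dvd.intro (n * y) rfl : i t ∣ i t * (n * y))
    convert this using 1
    linear_combination (- n : Ŝ) * hy
  have h2 := hn s (by simpa using hi.strict _ _ h1)
  have h3 := dvd_add (Dvd.intro y rfl : i t ∣ i t * y) (map_dvd i h2)
  convert h3 using 1
  rw [pow_one] at hy
  linear_combination hy

variable [LambdaRing S] (hq : ∀ n : ℕ+, LambdaRing.psi n (1 + t) = (1 + t) ^ (n : ℕ))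
include hq

omit hi in
theorem dvd_psi (n : ℕ+) : t ∣ LambdaRing.psi n t := by
  have := hq n
  rw [map_add, map_one] at this
  have h2 := sub_dvd_pow_sub_pow (1 + t) 1 (n : ℕ)
  rw [← this] at h2
  simpa using h2

/-- The continuous extension of `ψⁿ`. -/
def psi (n : ℕ+) : Ŝ →+* Ŝ :=
  (hi.exists_extend hi.complete (i.comp (LambdaRing.psi n))
    (map_dvd i (IsCompletion.dvd_psi hq n))).choose

theorem psi_map (n : ℕ+) (s : S) : hi.psi hq n (i s) = i (LambdaRing.psi n s) :=
  (hi.exists_extend hi.complete (i.comp (LambdaRing.psi n))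
    (map_dvd i (IsCompletion.dvd_psi hq n))).choose_spec s

/-- The `Λ`-ring structure on a completion. -/
@[reducible] def lambdaRing (htf : ∀ s, t * s = 0 → s = 0)
    (hint : ∀ n : ℤ, n ≠ 0 → ∀ s, t ∣ n * s → t ∣ s) : LambdaRing Ŝ where
  psi :=
    { toFun := hi.psi hq
      map_one' := hi.hom_ext hi.complete
        (by rw [hi.psi_map]; exact map_dvd i (IsCompletion.dvd_psi hq 1)) dvd_rfl
        fun s => by rw [hi.psi_map, map_one]; rfl
      map_mul' := fun m n => hi.hom_ext hi.complete
        (by rw [hi.psi_map]; exact map_dvd i (IsCompletion.dvd_psi hq _))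
        (by
          rw [RingHom.mul_def, RingHom.comp_apply, hi.psi_map, hi.psi_map]
          exact map_dvd i ((IsCompletion.dvd_psi hq m).trans
            (map_dvd _ (IsCompletion.dvd_psi hq n))))
        fun s => by
          rw [RingHom.mul_def, RingHom.comp_apply, hi.psi_map, hi.psi_map, hi.psi_map, map_mul]
          rfl }
  frobenius_lift p hp x := by
    change ((p : ℕ) : Ŝ) ∣ hi.psi hq p x - x ^ (p : ℕ)
    have hp0 : ((p : ℕ) : ℤ) ≠ 0 := by exact_mod_cast hp.ne_zero
    -- The Frobenius congruence holds on the dense subring `S`, and multiples of `p` form a closed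
    -- set because `p` is regular modulo `t`.
    refine dvd_of_forall_eq_add hi.complete (hi.eq_zero_of_mul htf) (fun b hb => ?_) fun n => ?_
    · exact hi.dvd_of_dvd_int_mul (n := (p : ℕ)) (hint _ hp0) b (by exact_mod_cast hb)
    · obtain ⟨s, y, hy⟩ := hi.dense x n
      obtain ⟨u, hu⟩ := LambdaRing.frobenius_lift p hp s
      have hx : x = i s + i t ^ n * y := by linear_combination hy
      obtain ⟨v, hv⟩ := map_dvd i (IsCompletion.dvd_psi hq p)
      obtain ⟨w, hw⟩ := sub_dvd_pow_sub_pow x (i s) (p : ℕ)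
      have hu' := congrArg i hu
      rw [map_sub, map_pow, map_mul, map_natCast] at hu'
      refine ⟨i u, v ^ n * hi.psi hq p y - y * w, ?_⟩
      have e1 : hi.psi hq p x = i (LambdaRing.psi p s) + (i t * v) ^ n * hi.psi hq p y := by
        rw [hx, map_add, map_mul, map_pow, hi.psi_map, hi.psi_map, hv]
      rw [e1, mul_pow]
      linear_combination hu' - hw - w * hx

end IsCompletion
end Completion

section Tensor
variable {P B W : Type*} [CommRing P] [CommRing B] [CommRing W] [LambdaRing P] [LambdaRing B]
  [LambdaRing W] [Algebra P B] [Algebra P W] (hB : IsLambdaHom (algebraMap P B))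
  (hW : IsLambdaHom (algebraMap P W))

/-- The operation `ψⁿ` on a tensor product. -/
def tensorPsi (n : ℕ+) : B ⊗[P] W →+* B ⊗[P] W :=
  Algebra.TensorProduct.mapRingHom (LambdaRing.psi n) (LambdaRing.psi n) (LambdaRing.psi n)
    (RingHom.ext fun p => (hB n p).symm) (RingHom.ext fun p => (hW n p).symm)

theorem tensorPsi_tmul (n : ℕ+) (b : B) (w : W) :
    tensorPsi hB hW n (b ⊗ₜ w) = LambdaRing.psi n b ⊗ₜ LambdaRing.psi n w :=
  Algebra.TensorProduct.mapRingHom_tmul _ _ _ _ _ _ _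

theorem tensor_ringHom_ext {C : Type*} [CommRing C] {f g : B ⊗[P] W →+* C}
    (h1 : ∀ b, f (b ⊗ₜ 1) = g (b ⊗ₜ 1)) (h2 : ∀ w, f (1 ⊗ₜ w) = g (1 ⊗ₜ w)) : f = g := by
  refine RingHom.ext fun x => ?_
  induction x using TensorProduct.induction_on with
  | zero => simp
  | tmul b w =>
    have : (b ⊗ₜ w : B ⊗[P] W) = (b ⊗ₜ 1) * (1 ⊗ₜ w) := by simp
    rw [this, map_mul, map_mul, h1, h2]
  | add x y hx hy => rw [map_add, map_add, hx, hy]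

/-- The tensor product of `Λ`-rings. -/
@[reducible] def tensorLambda : LambdaRing (B ⊗[P] W) where
  psi :=
    { toFun := tensorPsi hB hW
      map_one' := tensor_ringHom_ext (fun b => by simp [tensorPsi_tmul])
        (fun w => by simp [tensorPsi_tmul])
      map_mul' := fun m n => tensor_ringHom_ext (fun b => by simp [tensorPsi_tmul])
        (fun w => by simp [tensorPsi_tmul]) }
  frobenius_lift p hp x := by
    change x ∈ frobeniusSubring (tensorPsi hB hW p) p hp
    induction x using TensorProduct.induction_on with
    | zero => exact zero_mem _
    | add x y hx hy => exact add_mem hx hy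
    | tmul b w =>
      have : (b ⊗ₜ w : B ⊗[P] W) = (b ⊗ₜ 1) * (1 ⊗ₜ w) := by simp
      rw [this]
      refine mul_mem ?_ ?_
      · rw [mem_frobeniusSubring, tensorPsi_tmul, map_one, Algebra.TensorProduct.tmul_pow, one_pow,
          ← TensorProduct.sub_tmul]
        have := map_dvd (Algebra.TensorProduct.includeLeftRingHom (R := P) (A := B) (B := W))
          (LambdaRing.frobenius_lift p hp b)
        simpa using this
      · rw [mem_frobeniusSubring, tensorPsi_tmul, map_one, Algebra.TensorProduct.tmul_pow, one_pow,
          ← TensorProduct.tmul_sub]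
        have := map_dvd (Algebra.TensorProduct.includeRight (R := P) (A := B) (B := W))
          (LambdaRing.frobenius_lift p hp w)
        simpa using this

end Tensor
end QDeRham
end

/-! ### Objects of the site, their morphisms, and lifts -/

noncomputable section
namespace QDeRham

set_option linter.unusedSectionVars false

namespace QStrat
variable {R A : Type u} [CommRing R] [CommRing A] [Algebra R A] [LambdaRing R] [LambdaRing A]

/-- The element `q - 1`. -/
def t (B : QStrat R A) : B := algebraMap R⟦X⟧ B PowerSeries.X

/-- The structure map of an object of the site. -/
def base (B : QStrat R A) : R →+* B := (algebraMap R⟦X⟧ B).comp PowerSeries.C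

theorem isLambdaHom_base (B : QStrat R A) : IsLambdaHom B.base :=
  fun n r => (B.psi_algebraMap_C n r).symm

/-- Flatness carries the regularity of `n` from `ℤ` to `R`, and from `R` to `B/(q - 1)`. -/
theorem dvd_of_dvd_int_mul [Module.Flat ℤ R] (B : QStrat R A) (n : ℤ) (b : B) (hn : n ≠ 0)
    (h : B.t ∣ n * b) : B.t ∣ b := by
  let _ : Algebra R (B ⧸ Ideal.span {B.t}) :=
    ((Ideal.Quotient.mk (Ideal.span {B.t})).comp B.base).toAlgebra
  have : Module.Flat R (B ⧸ Ideal.span {B.t}) := B.flat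
  have hr : IsSMulRegular R n := by
    have h1 : IsSMulRegular ℤ n := fun a b hab => by simpa [hn] using hab
    have := IsSMulRegular.of_flat (S := R) (x := n) h1
    intro a b hab
    exact this (by simpa using hab)
  have h2 := IsSMulRegular.of_flat (S := B ⧸ Ideal.span {B.t}) (x := (n : R)) (fun a b hab => hr
    (by simpa using hab))
  rw [← Ideal.mem_span_singleton, ← Ideal.Quotient.eq_zero_iff_mem] at h ⊢
  refine h2 ?_
  simpa using h

theorem isQRing [Module.Flat ℤ R] (B : QStrat R A) : IsQRing B B.t where
  complete := B.isAdicComplete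
  torsionFree := B.torsionFree
  dvd_of_dvd_int_mul := B.dvd_of_dvd_int_mul
  psi_q n := by simpa [t] using B.psi_q n

/-- The ring homomorphism underlying a morphism of the site. -/
def ringHom {B C : QStrat R A} (f : B ⟶ C) : B →+* C := f.toAlgHom.toRingHom

theorem isLambdaHom_ringHom {B C : QStrat R A} (f : B ⟶ C) : IsLambdaHom (ringHom f) :=
  f.isLambdaHom

theorem ringHom_algebraMap {B C : QStrat R A} (f : B ⟶ C) (s : R⟦X⟧) :
    ringHom f (algebraMap _ _ s) = algebraMap _ _ s := f.toAlgHom.commutes s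

theorem ringHom_smul {B C : QStrat R A} (f : B ⟶ C) (s : R⟦X⟧) (b : B) :
    ringHom f (s • b) = s • ringHom f b := map_smul f.toAlgHom s b

@[simp] theorem ringHom_t {B C : QStrat R A} (f : B ⟶ C) : ringHom f B.t = C.t :=
  ringHom_algebraMap f _

@[simp] theorem ringHom_base {B C : QStrat R A} (f : B ⟶ C) (r : R) :
    ringHom f (B.base r) = C.base r := ringHom_algebraMap f _

@[simp] theorem ringHom_id (B : QStrat R A) (b : B) : ringHom (𝟙 B) b = b := rfl

@[simp] theorem ringHom_comp {B C E : QStrat R A} (f : B ⟶ C) (g : C ⟶ E) (b : B) :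
    ringHom (f ≫ g) b = ringHom g (ringHom f b) := rfl

theorem hom_ext {B C : QStrat R A} {f g : B ⟶ C} (h : ringHom f = ringHom g) : f = g :=
  Hom.ext (AlgHom.ext fun b => congr($h b))

/-- The maps of `Λ`-rings that lift the given map modulo `q - 1`. -/
structure Lift (B : QStrat R A) where
  toRingHom : A →+* B
  isLambdaHom : IsLambdaHom toRingHom
  base' : ∀ r : R, toRingHom (algebraMap R A r) = B.base r
  point' : ∀ a, Ideal.Quotient.mk _ (toRingHom a) = B.point a

namespace Lift
variable {B C E : QStrat R A}

instance : FunLike (Lift B) A B where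
  coe ℓ := ℓ.toRingHom
  coe_injective := by
    rintro ⟨f, _, _, _⟩ ⟨g, _, _, _⟩ h
    obtain rfl : f = g := RingHom.ext fun a => congr($h a)
    rfl

instance : RingHomClass (Lift B) A B where
  map_add ℓ := map_add ℓ.toRingHom
  map_mul ℓ := map_mul ℓ.toRingHom
  map_zero ℓ := map_zero ℓ.toRingHom
  map_one ℓ := map_one ℓ.toRingHom

theorem ext {ℓ ℓ' : Lift B} (h : ∀ a, ℓ a = ℓ' a) : ℓ = ℓ' := DFunLike.ext _ _ h

@[simp] theorem coe_toRingHom (ℓ : Lift B) (a : A) : ℓ.toRingHom a = ℓ a := rfl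

theorem psi (ℓ : Lift B) (n : ℕ+) (a : A) :
    ℓ (LambdaRing.psi n a) = LambdaRing.psi n (ℓ a) := ℓ.isLambdaHom n a

@[simp] theorem base (ℓ : Lift B) (r : R) : ℓ (algebraMap R A r) = B.base r := ℓ.base' r

theorem isRankOne (ℓ : Lift B) {a : A} (ha : IsRankOne a) : IsRankOne (ℓ a) := fun n => by
  rw [← ℓ.psi, ha n, map_pow]

theorem t_dvd_sub (ℓ ℓ' : Lift B) (a : A) : B.t ∣ ℓ a - ℓ' a := by
  rw [← Ideal.mem_span_singleton, ← Ideal.Quotient.eq]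
  exact (ℓ.point' a).trans (ℓ'.point' a).symm

/-- A lift that is congruent to another one. -/
def ofCongr (ℓ₀ : Lift B) (f : A →+* B) (hf : IsLambdaHom f)
    (hb : ∀ r : R, f (algebraMap R A r) = B.base r) (h : ∀ a, B.t ∣ f a - ℓ₀ a) : Lift B where
  toRingHom := f
  isLambdaHom := hf
  base' := hb
  point' a := by
    rw [← ℓ₀.point' a, Ideal.Quotient.eq]
    exact Ideal.mem_span_singleton.2 (h a)

@[simp] theorem ofCongr_apply (ℓ₀ : Lift B) (f : A →+* B) (hf hb h) (a : A) :
    ofCongr ℓ₀ f hf hb h a = f a := rfl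

/-- Functoriality of lifts. -/
def map (f : B ⟶ C) (ℓ : Lift B) : Lift C where
  toRingHom := (ringHom f).comp ℓ.toRingHom
  isLambdaHom n a := by
    simp only [RingHom.comp_apply]
    rw [ℓ.isLambdaHom, isLambdaHom_ringHom]
  base' r := by simp
  point' a := f.point_comp a _ (ℓ.point' a)

@[simp] theorem map_apply (f : B ⟶ C) (ℓ : Lift B) (a : A) : ℓ.map f a = ringHom f (ℓ a) := rfl

@[simp] theorem map_id (ℓ : Lift B) : ℓ.map (𝟙 B) = ℓ := ext fun _ => rfl

@[simp] theorem map_comp (f : B ⟶ C) (g : C ⟶ E) (ℓ : Lift B) :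
    ℓ.map (f ≫ g) = (ℓ.map f).map g := ext fun _ => rfl

instance (B : QStrat R A) : Nonempty (Lift B) := by
  obtain ⟨β, h1, h2, h3⟩ := B.exists_lift
  exact ⟨⟨β, h1, h2, fun a => congr($h3 a)⟩⟩

end Lift

/-- A map of `Λ`-rings is a morphism of the site if it takes a lift to a lift. -/
def mkHom {B C : QStrat R A} (f : B →+* C) (hf : IsLambdaHom f)
    (hb : ∀ r, f (B.base r) = C.base r) (ht : f B.t = C.t) (ℓ : Lift B) (ℓ' : Lift C)
    (h : ∀ a, f (ℓ a) = ℓ' a) : B ⟶ C where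
  toAlgHom :=
    { f with
      commutes' := fun s => by
        -- Linearity over `R⟦q - 1⟧` is automatic: splitting off constant terms one after the other
        -- shows that the two maps agree modulo every power of `q - 1`.
        refine eq_of_forall_pow_dvd_sub C.isAdicComplete fun n => ?_
        change C.t ^ n ∣ f (algebraMap _ _ s) - _
        induction n generalizing s with
        | zero => simp
        | succ n ih =>
          obtain ⟨s', hs'⟩ : PowerSeries.X ∣ s - PowerSeries.C (PowerSeries.constantCoeff s) := by
            rw [PowerSeries.X_dvd_iff]; simp
          obtain ⟨c, hc⟩ := ih s'
          refine ⟨c, ?_⟩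
          rw [sub_eq_iff_eq_add'] at hs'
          rw [hs', map_add, map_add, map_mul, map_mul, map_add]
          have h1 : f (algebraMap R⟦X⟧ B (PowerSeries.C (PowerSeries.constantCoeff s))) =
            algebraMap R⟦X⟧ C (PowerSeries.C (PowerSeries.constantCoeff s)) := hb _
          have h2 : f (algebraMap R⟦X⟧ B PowerSeries.X) = C.t := ht
          have h3 : algebraMap R⟦X⟧ C PowerSeries.X = C.t := rfl
          rw [h1, map_mul, h2, h3]
          linear_combination C.t * hc }
  isLambdaHom := hf
  point_comp a b hab := by
    change Ideal.Quotient.mk _ (f b) = _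
    rw [← ℓ'.point' a]
    change _ = Ideal.Quotient.mk _ (ℓ' a)
    rw [← ℓ.point' a, Ideal.Quotient.eq] at hab
    rw [← h, Ideal.Quotient.eq, ← map_sub]
    change f _ ∈ Ideal.span {C.t}
    rw [Ideal.mem_span_singleton, ← ht]
    exact map_dvd f (Ideal.mem_span_singleton.1 hab)

@[simp] theorem ringHom_mkHom {B C : QStrat R A} (f : B →+* C) (hf hb ht) (ℓ : Lift B)
    (ℓ' : Lift C) (h) (b : B) : ringHom (mkHom f hf hb ht ℓ ℓ' h) b = f b := rfl

theorem Lift.map_mkHom {B C : QStrat R A} (f : B →+* C) (hf hb ht) (ℓ : Lift B)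
    (ℓ' : Lift C) (h) : ℓ.map (mkHom f hf hb ht ℓ ℓ' h) = ℓ' := Lift.ext h

section Extend
variable (B : QStrat R A) {C : Type u} [CommRing C] [LambdaRing C] (j : B →+* C)
  (hj : IsLambdaHom j) (hc : IsAdicComplete (Ideal.span {j B.t}) C)
  (htf : ∀ c, j B.t * c = 0 → c = 0)
  (hfl : ((Ideal.Quotient.mk (Ideal.span {j B.t})).comp (j.comp B.base)).Flat)

/-- The object of the site given by a `Λ`-ring over an object of the site. -/
def extend : QStrat R A :=
  let ℓ : Lift B := Classical.arbitrary _
  { carrier := C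
    algebra := (j.comp (algebraMap R⟦X⟧ B)).toAlgebra
    psi_algebraMap_C := fun n r => by
      change LambdaRing.psi n (j (B.base r)) = j (B.base _)
      rw [B.isLambdaHom_base, hj]
    psi_q := fun n => by
      change LambdaRing.psi n (j (algebraMap R⟦X⟧ B _)) = j (algebraMap R⟦X⟧ B _) ^ _
      rw [← hj, B.psi_q, map_pow]
    isAdicComplete := hc
    torsionFree := htf
    flat := hfl
    point := (Ideal.Quotient.mk (Ideal.span {j B.t})).comp (j.comp ℓ.toRingHom)
    exists_lift := ⟨j.comp ℓ.toRingHom, fun n a => by simp [ℓ.psi, hj n], fun r => by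
      change j (ℓ (algebraMap R A r)) = j (B.base r); simp, rfl⟩ }

/-- The structure morphism of an extension. -/
def extendHom : B ⟶ B.extend j hj hc htf hfl :=
  let ℓ : Lift B := Classical.arbitrary _
  mkHom j hj (fun _ => rfl) rfl ℓ
    { toRingHom := j.comp ℓ.toRingHom
      isLambdaHom := fun n a => by
        change j (ℓ _) = LambdaRing.psi n (j (ℓ a))
        rw [ℓ.psi, hj]
      base' := fun r => by
        change j (ℓ (algebraMap R A r)) = j (B.base r); simp
      point' := fun _ => rfl } fun _ => rfl

@[simp] theorem ringHom_extendHom (b : B) : ringHom (B.extendHom j hj hc htf hfl) b = j b := rfl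

end Extend

end QStrat

namespace Framing
variable {R A : Type u} [CommRing R] [CommRing A] [Algebra R A] [LambdaRing R] [LambdaRing A]
  (F : Framing R A)

theorem isRankOne_x (i : Fin F.dim) : IsRankOne (F.x i) := fun n => by
  have := F.isLambdaHom n (MvPolynomial.X i)
  rw [psi_mvPolynomial_X, map_pow] at this
  exact this.symm

/-- Uniqueness of lifts along a formally unramified map passes from nilpotent thickenings to the
limit because the powers of `t` have zero intersection. -/
theorem ringHom_ext {C : Type u} [CommRing C] {t : C} (hC : IsAdicComplete (Ideal.span {t}) C)
    {f g : A →+* C} (hR : ∀ r, f (algebraMap R A r) = g (algebraMap R A r))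
    (hx : ∀ i, f (F.x i) = g (F.x i)) (h0 : ∀ a, t ∣ f a - g a) : f = g := by
  let _ : Algebra (MvPolynomial (Fin F.dim) R) A := F.box.toRingHom.toAlgebra
  let _ : Algebra (MvPolynomial (Fin F.dim) R) C := (f.comp F.box.toRingHom).toAlgebra
  have hE : Algebra.FormallyEtale (MvPolynomial (Fin F.dim) R) A := F.formallyEtale
  have hfg : g.comp F.box.toRingHom = f.comp F.box.toRingHom := by
    apply MvPolynomial.ringHom_ext
    · intro r
      have : F.box (MvPolynomial.C r) = algebraMap R A r := F.box.commutes r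
      simpa [this] using (hR r).symm
    · intro i
      exact (hx i).symm
  let f' : A →ₐ[MvPolynomial (Fin F.dim) R] C := { f with commutes' := fun p => rfl }
  let g' : A →ₐ[MvPolynomial (Fin F.dim) R] C := { g with commutes' := fun p => congr($hfg p) }
  have key : f' = g' := Algebra.FormallyUnramified.ext_of_iInf (Ideal.span {t}) (by
    rw [eq_bot_iff]
    intro c hc
    rw [Ideal.mem_iInf] at hc
    rw [Ideal.mem_bot]
    refine eq_of_forall_pow_dvd_sub hC fun n => ?_
    rw [sub_zero]
    have := hc n
    rwa [Ideal.span_singleton_pow, Ideal.mem_span_singleton] at this)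
    fun a => Ideal.Quotient.eq.2 (Ideal.mem_span_singleton.2 (h0 a))
  ext1 a
  exact congr($key a)

/-- Sending `xᵢ` to `b i` makes `C` an algebra over the polynomial ring for which `f` modulo `t` is
linear. Formal smoothness lifts it to the complete ring `C`. -/
theorem exists_ringHom {C : Type u} [CommRing C] {t : C} (hC : IsAdicComplete (Ideal.span {t}) C)
    (f : A →+* C) (b : Fin F.dim → C) (hb : ∀ i, t ∣ b i - f (F.x i)) : ∃ g : A →+* C,
      (∀ r, g (algebraMap R A r) = f (algebraMap R A r)) ∧ (∀ i, g (F.x i) = b i) ∧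
      ∀ a, t ∣ g a - f a := by
  let φ : MvPolynomial (Fin F.dim) R →+* C :=
    MvPolynomial.eval₂Hom (f.comp (algebraMap R A)) b
  let _ : Algebra (MvPolynomial (Fin F.dim) R) A := F.box.toRingHom.toAlgebra
  let _ : Algebra (MvPolynomial (Fin F.dim) R) C := φ.toAlgebra
  have hE : Algebra.FormallyEtale (MvPolynomial (Fin F.dim) R) A := F.formallyEtale
  have hφ : ∀ p, Ideal.Quotient.mk (Ideal.span {t}) (φ p) = Ideal.Quotient.mk _ (f (F.box p)) := by
    intro p
    have : (Ideal.Quotient.mk (Ideal.span {t})).comp φ =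
        (Ideal.Quotient.mk (Ideal.span {t})).comp (f.comp F.box.toRingHom) := by
      apply MvPolynomial.ringHom_ext
      · intro r
        have : F.box (MvPolynomial.C r) = algebraMap R A r := F.box.commutes r
        simp [φ, this]
      · intro j
        simp only [φ, RingHom.comp_apply, MvPolynomial.coe_eval₂Hom, MvPolynomial.eval₂_X]
        exact Ideal.Quotient.eq.2 (Ideal.mem_span_singleton.2 (hb j))
    exact congr($this p)
  have := hC
  let g : A →ₐ[MvPolynomial (Fin F.dim) R] C ⧸ Ideal.span {t} :=
    { (Ideal.Quotient.mk _).comp f with commutes' := fun p => (hφ p).symm }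
  obtain ⟨τ, hτ⟩ := Algebra.FormallySmooth.exists_mkₐ_comp_eq_of_isAdicComplete g
  have hτP : ∀ p, τ (F.box p) = φ p := fun p => τ.commutes p
  refine ⟨τ.toRingHom, fun r => ?_, fun j => ?_, fun a => ?_⟩
  · have := hτP (algebraMap R _ r)
    rw [AlgHom.commutes] at this
    refine this.trans ?_
    change φ (MvPolynomial.C r) = _
    simp [φ]
  · refine (hτP (MvPolynomial.X j)).trans ?_
    simp [φ]
  · have := congr($hτ a)
    exact Ideal.mem_span_singleton.1 (Ideal.Quotient.eq.1 this)

theorem lift_ext {B : QStrat R A} {ℓ ℓ' : QStrat.Lift B} (h : ∀ i, ℓ (F.x i) = ℓ' (F.x i)) :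
    ℓ = ℓ' := by
  have := F.ringHom_ext B.isAdicComplete (f := ℓ.toRingHom) (g := ℓ'.toRingHom)
    (fun r => (ℓ.base r).trans (ℓ'.base r).symm) h (ℓ.t_dvd_sub ℓ')
  exact QStrat.Lift.ext fun a => congr($this a)

/-- Together with `lift_ext` this identifies lifts with families of rank one elements in given
classes modulo `q - 1`. The ring homomorphism `g` given by formal smoothness respects `ψⁿ`, because
`g ∘ ψⁿ` and `ψⁿ ∘ g` agree on `R`, on the coordinates, whose images have rank one, and modulo `q -
1`. -/
theorem exists_lift [Module.Flat ℤ R] (hRA : IsLambdaHom (algebraMap R A)) {B : QStrat R A}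
    (ℓ₀ : QStrat.Lift B) (b : Fin F.dim → B)
    (hb : ∀ i, IsRankOne (b i)) (hbt : ∀ i, B.t ∣ b i - ℓ₀ (F.x i)) :
    ∃ ℓ : QStrat.Lift B, ∀ i, ℓ (F.x i) = b i := by
  obtain ⟨g, hgR, hgx, hg0⟩ := F.exists_ringHom B.isAdicComplete ℓ₀.toRingHom b hbt
  refine ⟨ℓ₀.ofCongr g (fun n a => ?_) (fun r => (hgR r).trans (ℓ₀.base r)) hg0, hgx⟩
  have := F.ringHom_ext B.isAdicComplete (f := g.comp (LambdaRing.psi n))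
    (g := (LambdaRing.psi n).comp g) (fun r => ?_) (fun i => ?_) (fun a => ?_)
  · exact congr($this a)
  · simp only [RingHom.comp_apply]
    rw [hgR, ← hRA, hgR, hRA]
    exact (ℓ₀.isLambdaHom n _)
  · simp only [RingHom.comp_apply]
    rw [F.isRankOne_x, map_pow, hgx, hb i n]
  · simp only [RingHom.comp_apply]
    have h1 := hg0 (LambdaRing.psi n a)
    have h2 := (B.isQRing.dvd_psi n).trans (map_dvd (LambdaRing.psi n) (hg0 a))
    rw [map_sub] at h2
    have h3 : ℓ₀.toRingHom (LambdaRing.psi n a) = LambdaRing.psi n (ℓ₀.toRingHom a) :=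
      ℓ₀.isLambdaHom n a
    rw [h3] at h1
    have := dvd_sub h1 h2
    rwa [sub_sub_sub_cancel_right] at this

end Framing
end QDeRham
end

/-! ### Universal extensions of objects of the site -/

noncomputable section
namespace QDeRham

set_option linter.unusedSectionVars false

namespace QStrat
variable {R A : Type u} [CommRing R] [CommRing A] [Algebra R A] [LambdaRing R] [LambdaRing A]

theorem span_map_includeLeft {P : Type} {B : Type u} {W : Type} [CommRing P] [CommRing B]
    [CommRing W] [Algebra P B] [Algebra P W] (b : B) :
    (Ideal.span {b}).map (algebraMap B (B ⊗[P] W)) = Ideal.span {b ⊗ₜ[P] (1 : W)} := by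
  rw [Ideal.map_span, Set.image_singleton]
  rfl

theorem tmul_one_dvd_iff {P : Type} {B : Type u} {W : Type} [CommRing P] [CommRing B]
    [CommRing W] [Algebra P B] [Algebra P W] {κ : Type} (bas : Module.Basis κ P W) (b : B)
    (s : B ⊗[P] W) : b ⊗ₜ[P] (1 : W) ∣ s ↔ ∀ k, b ∣ (bas.baseChange B).repr s k := by
  have hmul (s : B ⊗[P] W) : b ⊗ₜ[P] (1 : W) * s = b • s := by
    rw [Algebra.smul_def]; rfl
  constructor
  · rintro ⟨s, rfl⟩ k
    rw [hmul, map_smul]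
    exact ⟨_, rfl⟩
  · intro h
    rw [← (bas.baseChange B).linearCombination_repr s, Finsupp.linearCombination_apply]
    refine Finset.dvd_sum fun k _ => ?_
    obtain ⟨e, he⟩ := h k
    rw [he]
    exact ⟨e • (bas.baseChange B) k, by rw [hmul, smul_smul]⟩

/-- The universal extension of an object of the site by a free algebra. -/
theorem exists_freeExtension [Module.Flat ℤ R] (B : QStrat R A) {P W κ : Type} [CommRing P]
    [LambdaRing P] [CommRing W] [LambdaRing W] [Algebra P W] [Algebra P B]
    (hB : IsLambdaHom (algebraMap P B)) (hW : IsLambdaHom (algebraMap P W))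
    (bas : Module.Basis κ P W) :
    ∃ (E : QStrat R A) (j : B ⟶ E) (w : W →+* E), IsLambdaHom w ∧
      (∀ p, w (algebraMap P W p) = ringHom j (algebraMap P B p)) ∧
      (∀ (C : QStrat R A) (f : B ⟶ C) (v : W →+* C), IsLambdaHom v →
        (∀ p, v (algebraMap P W p) = ringHom f (algebraMap P B p)) →
        ∃ g : E ⟶ C, j ≫ g = f ∧ ∀ x, ringHom g (w x) = v x) ∧
      (∀ (C : QStrat R A) (g g' : E ⟶ C), j ≫ g = j ≫ g' →
        (∀ x, ringHom g (w x) = ringHom g' (w x)) → g = g') ∧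
      (∀ e : E, ∃ s : κ →₀ B, E.t ∣ e - s.sum fun k b => ringHom j b * w (bas k)) ∧
      (∀ s : κ →₀ B, (E.t ∣ s.sum fun k b => ringHom j b * w (bas k)) → ∀ k, B.t ∣ s k) := by
  let _ : LambdaRing (B ⊗[P] W) := tensorLambda hB hW
  have hpsi (n : ℕ+) (b : B) (x : W) : LambdaRing.psi n (b ⊗ₜ[P] x) =
    LambdaRing.psi n b ⊗ₜ[P] LambdaRing.psi n x := tensorPsi_tmul hB hW n b x
  let τ : B ⊗[P] W := B.t ⊗ₜ 1
  have hfree : Module.Free P W := Module.Free.of_basis bas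
  have hτ : τ = algebraMap B (B ⊗[P] W) B.t := rfl
  have htf (s : B ⊗[P] W) (hs : τ * s = 0) : s = 0 := by
    apply (bas.baseChange B).ext_elem
    intro k
    have : τ * s = B.t • s := by rw [Algebra.smul_def]; rfl
    rw [this] at hs
    have h2 : B.t * (bas.baseChange B).repr s k = 0 := by
      have := congr((bas.baseChange B).repr $hs k)
      simpa using this
    rw [B.torsionFree _ h2]; simp
  have hint (n : ℤ) (hn : n ≠ 0) (s : B ⊗[P] W) (hs : τ ∣ n * s) : τ ∣ s := by
    rw [tmul_one_dvd_iff bas] at hs ⊢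
    intro k
    refine B.dvd_of_dvd_int_mul n _ hn ?_
    have := hs k
    rw [← zsmul_eq_mul, map_zsmul] at this
    simpa using this
  have hq (n : ℕ+) : LambdaRing.psi n (1 + τ) = (1 + τ) ^ (n : ℕ) := by
    have : (1 + τ) = (1 + B.t) ⊗ₜ[P] (1 : W) := by
      rw [TensorProduct.add_tmul]; rfl
    rw [this, hpsi, B.isQRing.psi_q, map_one, Algebra.TensorProduct.tmul_pow, one_pow]
  -- The extension is the completion of `B ⊗ W`. As `B ⊗ W` is free over `B`, regularity of `q - 1`
  -- and of integers modulo `q - 1` can be checked on coefficients.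
  have hi := isCompletion_adicCompletion τ
  let _ : LambdaRing (AdicCompletion (Ideal.span {τ}) (B ⊗[P] W)) := hi.lambdaRing hq htf hint
  have hipsi (n : ℕ+) (s : B ⊗[P] W) : LambdaRing.psi n
      (algebraMap (B ⊗[P] W) (AdicCompletion (Ideal.span {τ}) (B ⊗[P] W)) s) =
      algebraMap _ _ (LambdaRing.psi n s) := hi.psi_map hq n s
  set i := algebraMap (B ⊗[P] W) (AdicCompletion (Ideal.span {τ}) (B ⊗[P] W)) with hi'
  let j : B →+* AdicCompletion (Ideal.span {τ}) (B ⊗[P] W) := i.comp (algebraMap B (B ⊗[P] W))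
  have hj : IsLambdaHom j := fun n b => by
    change i (_ ⊗ₜ 1) = LambdaRing.psi n (i (b ⊗ₜ 1))
    rw [hipsi, hpsi, map_one]
    rfl
  have hjt : j B.t = i τ := rfl
  have hflat : ((Ideal.Quotient.mk (Ideal.span {j B.t})).comp (j.comp B.base)).Flat := by
    have h1 := flat_quotient_map (S := B ⊗[P] W) (Ideal.span {B.t}) B.base B.flat
    rw [span_map_includeLeft] at h1
    let q : (B ⊗[P] W) ⧸ Ideal.span {τ} →+*
        AdicCompletion (Ideal.span {τ}) (B ⊗[P] W) ⧸ Ideal.span {i τ} :=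
      Ideal.quotientMap _ i (by
        rw [Ideal.span_le, Set.singleton_subset_iff]
        exact Ideal.subset_span rfl)
    -- Completion does not change the quotient by `q - 1`, so flatness need only be known for `B ⊗
    -- W`.
    have hq : Function.Bijective q := by
      constructor
      · rw [injective_iff_map_eq_zero]
        intro x hx
        obtain ⟨s, rfl⟩ := Ideal.Quotient.mk_surjective x
        change Ideal.Quotient.mk _ (i s) = 0 at hx
        rw [Ideal.Quotient.eq_zero_iff_mem, Ideal.mem_span_singleton] at hx ⊢
        have := hi.strict s 1
        rw [pow_one, pow_one] at this
        exact this hx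
      · intro x
        obtain ⟨e, rfl⟩ := Ideal.Quotient.mk_surjective x
        obtain ⟨s, hs⟩ := hi.dense e 1
        refine ⟨Ideal.Quotient.mk _ s, ?_⟩
        change Ideal.Quotient.mk _ (i s) = _
        rw [pow_one] at hs
        rw [eq_comm, Ideal.Quotient.eq, Ideal.mem_span_singleton]
        exact hs
    have h2 := RingHom.Flat.comp h1 (RingHom.Flat.of_bijective hq)
    exact h2
  let E : QStrat R A := B.extend j hj hi.complete (hi.eq_zero_of_mul htf) hflat
  let jE : B ⟶ E := B.extendHom j hj hi.complete (hi.eq_zero_of_mul htf) hflat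
  let w : W →+* E := i.comp Algebra.TensorProduct.includeRight.toRingHom
  have hsum (s : κ →₀ B) : (s.sum fun k b => ringHom jE b * w (bas k)) =
      i (s.sum fun k b => b • (bas.baseChange B) k) := by
    rw [Finsupp.sum, Finsupp.sum, map_sum]
    refine Finset.sum_congr rfl fun k _ => ?_
    change i (_ ⊗ₜ 1) * i (1 ⊗ₜ _) = _
    rw [← map_mul, Module.Basis.baseChange_apply, Algebra.TensorProduct.tmul_mul_tmul, mul_one,
      one_mul, TensorProduct.smul_tmul', smul_eq_mul, mul_one]
    rfl
  refine ⟨E, jE, w, fun n x => ?_, fun p => ?_, fun C f v hv hvf => ?_, fun C g g' hj' hw' => ?_,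
    fun e => ?_, fun s hs k => ?_⟩
  · change i (1 ⊗ₜ _) = LambdaRing.psi n (i (1 ⊗ₜ x))
    rw [hipsi, hpsi, map_one]
  · change i (1 ⊗ₜ _) = i (_ ⊗ₜ 1)
    refine congrArg i ?_
    have := TensorProduct.smul_tmul (R := P) p (1 : B) (1 : W)
    rw [← Algebra.algebraMap_eq_smul_one, ← Algebra.algebraMap_eq_smul_one] at this
    exact this.symm
  · let _ : Algebra P C := ((ringHom f).comp (algebraMap P B)).toAlgebra
    let f' : B →ₐ[P] C := { ringHom f with commutes' := fun _ => rfl }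
    let v' : W →ₐ[P] C := { v with commutes' := hvf }
    let g₀ : B ⊗[P] W →+* C := (Algebra.TensorProduct.productMap f' v').toRingHom
    have hg₀ (b : B) (x : W) : g₀ (b ⊗ₜ x) = ringHom f b * v x :=
      Algebra.TensorProduct.productMap_apply_tmul _ _ _ _
    have hg₀τ : g₀ τ = C.t := by rw [hg₀, ringHom_t, map_one, mul_one]
    obtain ⟨g, hg⟩ := hi.exists_extend C.isAdicComplete g₀ (by
      change C.t ∣ _
      rw [hg₀τ])
    have hgj (b : B) : g (j b) = ringHom f b := by
      refine (hg _).trans ((hg₀ b 1).trans ?_)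
      rw [map_one, mul_one]
    have hgΛ (n : ℕ+) : g.comp (LambdaRing.psi n) = (LambdaRing.psi n).comp g := by
      refine hi.hom_ext C.isAdicComplete ?_ ?_ ?_
      · change C.t ∣ g (LambdaRing.psi n (i τ))
        rw [hipsi, hg]
        have := map_dvd g₀ (IsCompletion.dvd_psi hq n)
        rwa [hg₀τ] at this
      · change C.t ∣ LambdaRing.psi n (g (i τ))
        rw [hg, hg₀τ]
        exact C.isQRing.dvd_psi n
      · intro s
        change g (LambdaRing.psi n (i s)) = LambdaRing.psi n (g (i s))
        rw [hipsi, hg, hg]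
        have : g₀.comp (LambdaRing.psi n) = (LambdaRing.psi n).comp g₀ := by
          refine tensor_ringHom_ext (fun b => ?_) fun x => ?_
          · simp only [RingHom.comp_apply]
            rw [hpsi, hg₀, hg₀]
            simp [isLambdaHom_ringHom f n b]
          · simp only [RingHom.comp_apply]
            rw [hpsi, hg₀, hg₀]
            simp [hv n x]
        exact congr($this s)
    let ℓ : Lift B := Classical.arbitrary _
    refine ⟨mkHom (B := E) g (fun n a => congr($(hgΛ n) a)) (fun r => (hgj _).trans (ringHom_base f r))
      ((hgj _).trans (ringHom_t f)) (ℓ.map jE) (ℓ.map f) (fun a => hgj _), ?_, ?_⟩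
    · exact hom_ext (RingHom.ext hgj)
    · intro x
      refine (hg _).trans ((hg₀ 1 x).trans ?_)
      rw [map_one, one_mul]
  · refine hom_ext (hi.hom_ext C.isAdicComplete ?_ ?_ ?_)
    · exact (ringHom_t g).symm.dvd
    · exact (ringHom_t g').symm.dvd
    · intro s
      have : (ringHom g).comp i = (ringHom g').comp i :=
        tensor_ringHom_ext (fun b => congr(ringHom $hj' b)) hw'
      exact congr($this s)
  · obtain ⟨s, hs⟩ := hi.dense e 1
    refine ⟨(bas.baseChange B).repr s, ?_⟩
    rw [hsum]
    have := (bas.baseChange B).linearCombination_repr s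
    rw [Finsupp.linearCombination_apply] at this
    rw [this]
    rw [pow_one] at hs
    exact hs
  · rw [hsum] at hs
    have h1 := hi.strict (s.sum fun k b => b • (bas.baseChange B) k) 1 (by
      rw [pow_one]; exact hs)
    rw [pow_one, tmul_one_dvd_iff bas] at h1
    have h2 := h1 k
    rwa [← Finsupp.linearCombination_apply, Module.Basis.repr_linearCombination] at h2

end QStrat
end QDeRham
end

noncomputable section
namespace QDeRham

set_option linter.unusedSectionVars false

/-- The products `∏ᵢ ∏_{j < kᵢ} (bᵢ - qʲ aᵢ) / (qʲ⁺¹ - 1)`. -/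
def qMonomial {ι C : Type*} [Fintype ι] [CommRing C] (t : C) (a b : ι → C) (k : ι → ℕ) : C :=
  ∏ i, qDivided t (a i) (b i) (k i)

theorem ringHom_int_polynomial_eq {C : Type*} [CommRing C] (f : Polynomial ℤ →+* C)
    (N : Polynomial ℤ) : f N = Polynomial.aeval (f Polynomial.X) N := by
  have : f = (Polynomial.aeval (R := ℤ) (f Polynomial.X)).toRingHom := by
    apply Polynomial.ringHom_ext
    · intro a; simp
    · simp
  exact congr($this N)

/-- The denominators `qᵏ - qʲ` of the basis functions and `qʲ⁺¹ - 1` of the `q`-divided powers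
differ by powers of `q`. Here `u` is the inverse of `q`, which is a unit by completeness. -/
theorem IsQRing.aeval_qDenom_mul {C : Type*} [CommRing C] [LambdaRing C] {t : C} (h : IsQRing C t)
    {a b : C} (ha : IsRankOne a) (hb : IsRankOne b) (hab : t ∣ b - a) {u : C}
    (hu : (1 + t) * u = 1) (k : ℕ) :
    Polynomial.aeval t (qDenom k) * (u ^ (∑ j ∈ Finset.range k, j) * qDivided t a b k) =
      ∏ j ∈ Finset.range k, (b - (1 + t) ^ j * a) := by
  induction k with
  | zero => simp [qDenom, h.qDivided_zero ha hb hab]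
  | succ k ih =>
    have h1 := h.qDivided_succ ha hb hab k
    have h2 : (1 + t) ^ k * u ^ k = 1 := by rw [← mul_pow, hu, one_pow]
    rw [Finset.prod_range_succ, ← ih, qDenom, Finset.sum_range_succ, pow_add]
    simp only [map_mul, map_sub, map_add, map_pow, map_one, Polynomial.aeval_X]
    linear_combination ((1 + t) ^ k * u ^ k * Polynomial.aeval t (qDenom k) *
      u ^ (∑ j ∈ Finset.range k, j)) * h1 + (Polynomial.aeval t (qDenom k) *
      u ^ (∑ j ∈ Finset.range k, j) * (b - (1 + t) ^ k * a) * qDivided t a b k) * h2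

theorem IsQRing.exists_inv {C : Type*} [CommRing C] [LambdaRing C] {t : C} (h : IsQRing C t) :
    ∃ u, (1 + t) * u = 1 := by
  have := isUnit_one_add_mul h.complete 1
  rw [mul_one] at this
  exact this.exists_right_inv

namespace QStrat
variable {R A : Type u} [CommRing R] [CommRing A] [Algebra R A] [LambdaRing R] [LambdaRing A]

/-- The free algebra to adjoin is `QPoly`. A rank one family congruent to `x` extends to it because
the required quotients exist in every object of the site as `q`-divided powers. The basis functions
differ from the `q`-divided monomials by powers of `q`, hence are congruent to them modulo `q - 1`,
which is all that the last two assertions need. -/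
theorem exists_qExtension_of_polyBase [Module.Flat ℤ R] (B : QStrat R A) {ι : Type} [Fintype ι]
    {P : Type} [CommRing P] [LambdaRing P] {c : Polynomial ℤ →+* P} {x : ι → P}
    (hc : IsPolyBase c x) (hcψ : IsLambdaHom c) (hx : ∀ i, IsRankOne (x i)) [Algebra P B]
    (hB : IsLambdaHom (algebraMap P B)) (hBt : algebraMap P B (c Polynomial.X) = B.t) :
    ∃ (E : QStrat R A) (j : B ⟶ E) (y : ι → E), (∀ i, IsRankOne (y i)) ∧
      (∀ i, E.t ∣ y i - ringHom j (algebraMap P B (x i))) ∧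
      (∀ (C : QStrat R A) (f : B ⟶ C) (b : ι → C), (∀ i, IsRankOne (b i)) →
        (∀ i, C.t ∣ b i - ringHom f (algebraMap P B (x i))) →
        ∃ g : E ⟶ C, j ≫ g = f ∧ ∀ i, ringHom g (y i) = b i) ∧
      (∀ (C : QStrat R A) (g g' : E ⟶ C), j ≫ g = j ≫ g' →
        (∀ i, ringHom g (y i) = ringHom g' (y i)) → g = g') ∧
      (∀ e : E, ∃ s : (ι → ℕ) →₀ B, E.t ∣ e - s.sum fun k b =>
        ringHom j b * qMonomial E.t (fun i => ringHom j (algebraMap P B (x i))) y k) ∧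
      (∀ s : (ι → ℕ) →₀ B, (E.t ∣ s.sum fun k b =>
        ringHom j b * qMonomial E.t (fun i => ringHom j (algebraMap P B (x i))) y k) →
          ∀ k, B.t ∣ s k) := by
  let _ : LambdaRing (QPoly hc) := qPolyLambda hc hcψ hx
  have hpsi (n : ℕ+) (w : QPoly hc) (m : ι → ℕ) :
    (LambdaRing.psi n w).1 m = LambdaRing.psi n (w.1 m) := qPolyPsi_apply hc hcψ hx n w m
  obtain ⟨E, j, w, hwΛ, hwP, hex, huniq, hspan, hind⟩ := B.exists_freeExtension (W := QPoly hc) hB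
    (fun n p => Subtype.ext (funext fun m => (hpsi n (algebraMap P (QPoly hc) p) m).symm))
    (qBasis hc)
  have hval {C : QStrat R A} (f : B ⟶ C) (N : Polynomial ℤ) :
      ringHom f (algebraMap P B (c N)) = Polynomial.aeval C.t N := by
    have := ringHom_int_polynomial_eq ((ringHom f).comp ((algebraMap P B).comp c)) N
    simpa [hBt] using this
  have hnz {C : QStrat R A} (f : B ⟶ C) (N : Polynomial ℤ) (hN : N ≠ 0) (e : C)
      (he : ringHom f (algebraMap P B (c N)) * e = 0) : e = 0 := by
    rw [hval] at he
    exact C.isQRing.eq_zero_of_aeval_mul hN he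
  have hq {C : QStrat R A} (f : B ⟶ C) (k : ℕ) (i : ι) :
      ringHom f (algebraMap P B (c ((1 + Polynomial.X) ^ k) * x i)) =
        (1 + C.t) ^ k * ringHom f (algebraMap P B (x i)) := by
    rw [map_mul, map_mul, hval]; simp
  have hxr {C : QStrat R A} (f : B ⟶ C) (i : ι) :
      IsRankOne (ringHom f (algebraMap P B (x i))) := fun n => by
    rw [← isLambdaHom_ringHom, ← hB, hx i n, map_pow, map_pow]
  have hyr (i : ι) : IsRankOne (w (qCoord hc i)) := fun n => by
    rw [← hwΛ, ← map_pow]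
    refine congrArg w (Subtype.ext (funext fun m => ?_))
    rw [hpsi]
    exact psi_qPoint hcψ hx n m i
  have hyx (i : ι) : E.t ∣ w (qCoord hc i) - ringHom j (algebraMap P B (x i)) := by
    -- For `k = 0` the multiplication rule reads `yᵢ = xᵢ + (q - 1) e`, where `e` is the basis
    -- function of degree one in the direction `i`.
    have h1 := qCoord_mul_qBasisFun hc i 0
    rw [qBasisFun_zero, Algebra.smul_def, Algebra.smul_def] at h1
    have h2 := congrArg w h1
    simp only [map_add, map_mul, hwP, one_mul, mul_one] at h2
    rw [hval, hval] at h2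
    simp only [Pi.zero_apply, pow_zero, zero_add, pow_one, map_one, Polynomial.aeval_X, one_mul,
      mul_one, add_sub_cancel_left] at h2
    rw [h2, add_sub_cancel_left]
    exact dvd_mul_right _ _
  obtain ⟨u, hu⟩ := E.isQRing.exists_inv
  have hmon (k : ι → ℕ) : ∃ N, w (qBasis hc k) = u ^ N *
      qMonomial E.t (fun i => ringHom j (algebraMap P B (x i))) (fun i => w (qCoord hc i)) k := by
    refine ⟨∑ i, ∑ j ∈ Finset.range (k i), j, ?_⟩
    have h1 := congrArg w (qDenom_mul_qBasisFun hc k)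
    rw [map_mul, hwP] at h1
    have h0 : (∏ i, qDenom (k i)) ≠ 0 := Finset.prod_ne_zero_iff.2 fun _ _ => qDenom_ne_zero _
    rw [← sub_eq_zero]
    refine hnz j _ h0 _ ?_
    rw [qBasis_apply, mul_sub, h1, sub_eq_zero, hval, qMonomial, map_prod, map_prod,
      ← Finset.prod_pow_eq_pow_sum,
      ← Finset.prod_mul_distrib, ← Finset.prod_mul_distrib]
    refine Finset.prod_congr rfl fun i _ => ?_
    rw [E.isQRing.aeval_qDenom_mul (hxr j i) (hyr i) (hyx i) hu, map_prod]
    refine Finset.prod_congr rfl fun m _ => ?_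
    rw [map_sub, hwP, hq]
  have hmon' (k : ι → ℕ) : E.t ∣ w (qBasis hc k) -
      qMonomial E.t (fun i => ringHom j (algebraMap P B (x i))) (fun i => w (qCoord hc i)) k := by
    obtain ⟨N, hN⟩ := hmon k
    rw [hN, ← sub_one_mul]
    refine Dvd.dvd.mul_right ?_ _
    have h1 : E.t ∣ u - 1 := ⟨-u, by linear_combination hu⟩
    have h2 := h1.trans (sub_dvd_pow_sub_pow u 1 N)
    rwa [one_pow] at h2
  have hsum (s : (ι → ℕ) →₀ B) : E.t ∣ (s.sum fun k b => ringHom j b * w (qBasis hc k)) -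
      s.sum fun k b => ringHom j b * qMonomial E.t (fun i => ringHom j (algebraMap P B (x i)))
        (fun i => w (qCoord hc i)) k := by
    rw [Finsupp.sum, Finsupp.sum, ← Finset.sum_sub_distrib]
    refine Finset.dvd_sum fun k _ => ?_
    rw [← mul_sub]
    exact (hmon' k).mul_left _
  refine ⟨E, j, fun i => w (qCoord hc i), hyr, hyx, fun C f b hb hbx => ?_, fun C g g' hj hy => ?_,
    fun e => ?_, fun s hs => ?_⟩
  · obtain ⟨u, hu⟩ := C.isQRing.exists_inv
    obtain ⟨v, hvP, hvy⟩ := exists_qPoly_hom hc ((ringHom f).comp (algebraMap P B)) b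
      (fun N hN e he => hnz f N hN e he) (fun i k => ⟨_, by
        have := C.isQRing.aeval_qDenom_mul (hxr f i) (hb i) (hbx i) hu k
        rw [RingHom.comp_apply, hval, this]
        exact Finset.prod_congr rfl fun m _ => by rw [RingHom.comp_apply, hq]⟩)
    have hvΛ : IsLambdaHom v := by
      intro n z
      have : v.comp (LambdaRing.psi n) = (LambdaRing.psi n).comp v := by
        have hP (p : P) : LambdaRing.psi n (algebraMap P (QPoly hc) p) =
          algebraMap P (QPoly hc) (LambdaRing.psi n p) :=
            Subtype.ext (funext fun m => hpsi n (algebraMap P (QPoly hc) p) m)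
        refine qPoly_hom_ext hc (fun N hN e he => ?_) (fun p => ?_) fun i => ?_
        · rw [RingHom.comp_apply, hP, hvP, ← hcψ, RingHom.comp_apply] at he
          exact hnz f _ (psi_polynomial_int_ne_zero n hN) e he
        · simp only [RingHom.comp_apply]
          rw [hP, hvP, hvP, RingHom.comp_apply, RingHom.comp_apply, hB, isLambdaHom_ringHom]
        · simp only [RingHom.comp_apply]
          rw [hvy, hb i n, ← hvy, ← map_pow]
          refine congrArg v (Subtype.ext (funext fun m => ?_))
          rw [hpsi]
          exact psi_qPoint hcψ hx n m i
      exact congr($this z)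
    obtain ⟨g, hg1, hg2⟩ := hex C f v hvΛ hvP
    exact ⟨g, hg1, fun i => (hg2 _).trans (hvy i)⟩
  · refine huniq C g g' hj fun z => ?_
    have : (ringHom g).comp w = (ringHom g').comp w := by
      have hgP (g : E ⟶ C) (p : P) : ringHom g (w (algebraMap P _ p)) =
          ringHom (j ≫ g) (algebraMap P B p) := by rw [hwP, ringHom_comp]
      refine qPoly_hom_ext hc (fun N hN e he => ?_) (fun p => ?_) hy
      · rw [RingHom.comp_apply, hgP] at he
        exact hnz _ N hN e he
      · simp only [RingHom.comp_apply]
        rw [hgP, hgP, hj]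
    exact congr($this z)
  · obtain ⟨s, hs⟩ := hspan e
    refine ⟨s, ?_⟩
    have := dvd_add hs (hsum s)
    rwa [sub_add_sub_cancel] at this
  · refine hind s ?_
    have := dvd_add (hsum s) hs
    rwa [sub_add_cancel] at this

/-- The universal extension by rank one elements `yᵢ` that are congruent to given rank one
elements `aᵢ` modulo `q - 1`. -/
theorem exists_qExtension [Module.Flat ℤ R] (B : QStrat R A) {d : ℕ} (a : Fin d → B)
    (ha : ∀ i, IsRankOne (a i)) :
    ∃ (E : QStrat R A) (j : B ⟶ E) (y : Fin d → E), (∀ i, IsRankOne (y i)) ∧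
      (∀ i, E.t ∣ y i - ringHom j (a i)) ∧
      (∀ (C : QStrat R A) (f : B ⟶ C) (b : Fin d → C), (∀ i, IsRankOne (b i)) →
        (∀ i, C.t ∣ b i - ringHom f (a i)) →
        ∃ g : E ⟶ C, j ≫ g = f ∧ ∀ i, ringHom g (y i) = b i) ∧
      (∀ (C : QStrat R A) (g g' : E ⟶ C), j ≫ g = j ≫ g' →
        (∀ i, ringHom g (y i) = ringHom g' (y i)) → g = g') ∧
      (∀ e : E, ∃ s : (Fin d → ℕ) →₀ B, E.t ∣ e - s.sum fun k b =>
        ringHom j b * qMonomial E.t (fun i => ringHom j (a i)) y k) ∧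
      (∀ s : (Fin d → ℕ) →₀ B, (E.t ∣ s.sum fun k b =>
        ringHom j b * qMonomial E.t (fun i => ringHom j (a i)) y k) → ∀ k, B.t ∣ s k) := by
  -- The general case is pulled back from the universal base `ℤ[q - 1][xᵢ]`, which maps to `B` by a
  -- map of `Λ`-rings because the elements `a i` have rank one.
  let φ : MvPolynomial (Fin d) (Polynomial ℤ) →+* B :=
    MvPolynomial.eval₂Hom (Polynomial.aeval (R := ℤ) B.t).toRingHom a
  let _ : Algebra (MvPolynomial (Fin d) (Polynomial ℤ)) B := φ.toAlgebra
  have hφ : IsLambdaHom φ := by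
    intro n p
    have : φ.comp (LambdaRing.psi n) = (LambdaRing.psi n).comp φ := by
      apply MvPolynomial.ringHom_ext
      · intro N
        simp only [RingHom.comp_apply]
        rw [psi_mvPolynomial_C]
        have h1 (N : Polynomial ℤ) : φ (MvPolynomial.C N) = Polynomial.aeval B.t N := by
          simp [φ]
        rw [h1, h1]
        have h2 : (Polynomial.aeval (R := ℤ) B.t).toRingHom.comp (LambdaRing.psi n) =
            (LambdaRing.psi n).comp (Polynomial.aeval (R := ℤ) B.t).toRingHom := by
          apply Polynomial.ringHom_ext
          · intro a; simp
          · have := B.isQRing.psi_t n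
            simp only [RingHom.comp_apply]
            have h3 : LambdaRing.psi n (Polynomial.X : Polynomial ℤ) =
              (1 + Polynomial.X) ^ (n : ℕ) - 1 := polynomialPsi_X n
            rw [h3]
            simp [this]
        exact congr($h2 N)
      · intro i
        simp only [RingHom.comp_apply]
        rw [psi_mvPolynomial_X, map_pow]
        simp only [φ, MvPolynomial.coe_eval₂Hom, MvPolynomial.eval₂_X]
        exact (ha i n).symm
    exact congr($this p)
  have := B.exists_qExtension_of_polyBase (isPolyBase_mvPolynomial (Fin d))
    (fun n N => (psi_mvPolynomial_C n N).symm) (fun i n => psi_mvPolynomial_X n i) hφ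
    (by change φ _ = _; simp [φ])
  have hx (i : Fin d) : algebraMap (MvPolynomial (Fin d) (Polynomial ℤ)) B (MvPolynomial.X i) =
      a i := by change φ _ = _; simp [φ]
  simp only [hx] at this
  exact this

end QStrat
end QDeRham
end

/-! ### Power series in `q - 1` and the object that classifies one lift -/

noncomputable section
namespace QDeRham

set_option linter.unusedSectionVars false

section SeriesEval
variable {A : Type*} [CommRing A]

theorem isCompletion_polynomial : IsCompletion (Polynomial.coeToPowerSeries.ringHom (R := A))
    Polynomial.X where
  complete := by
    rw [Polynomial.coeToPowerSeries.ringHom_apply, Polynomial.coe_X]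
    exact isAdicComplete_span_X A
  dense f n := by
    refine ⟨PowerSeries.trunc n f, ?_⟩
    rw [Polynomial.coeToPowerSeries.ringHom_apply, Polynomial.coeToPowerSeries.ringHom_apply,
      Polynomial.coe_X, PowerSeries.X_pow_dvd_iff]
    intro m hm
    rw [map_sub, Polynomial.coeff_coe, PowerSeries.coeff_trunc, if_pos hm, sub_self]
  strict p n h := by
    rw [Polynomial.coeToPowerSeries.ringHom_apply, Polynomial.coeToPowerSeries.ringHom_apply,
      Polynomial.coe_X, PowerSeries.X_pow_dvd_iff] at h
    rw [Polynomial.X_pow_dvd_iff]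
    intro m hm
    rw [← Polynomial.coeff_coe]
    exact h m hm

variable {C : Type*} [CommRing C] {t : C} (hC : IsAdicComplete (Ideal.span {t}) C)
  (f : A →+* C) (c : C) (hc : t ∣ c)

include hC hc in
theorem exists_seriesEval : ∃ g : A⟦X⟧ →+* C, ∀ p : Polynomial A,
    g p = Polynomial.eval₂RingHom f c p :=
  isCompletion_polynomial.exists_extend hC (Polynomial.eval₂RingHom f c) (by simpa using hc)

/-- The evaluation of power series at a topologically nilpotent element. -/
def seriesEval : A⟦X⟧ →+* C := (exists_seriesEval hC f c hc).choose

@[simp] theorem seriesEval_C (a : A) : seriesEval hC f c hc (PowerSeries.C a) = f a := by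
  have := (exists_seriesEval hC f c hc).choose_spec (Polynomial.C a)
  rw [Polynomial.coe_C] at this
  exact this.trans (by simp)

@[simp] theorem seriesEval_X : seriesEval hC f c hc PowerSeries.X = c := by
  have := (exists_seriesEval hC f c hc).choose_spec Polynomial.X
  rw [Polynomial.coe_X] at this
  exact this.trans (by simp)

include hC in
theorem series_ringHom_ext {g g' : A⟦X⟧ →+* C} (hg : t ∣ g PowerSeries.X)
    (hX : g PowerSeries.X = g' PowerSeries.X)
    (h : ∀ a, g (PowerSeries.C a) = g' (PowerSeries.C a)) : g = g' := by
  refine isCompletion_polynomial.hom_ext hC ?_ ?_ fun p => ?_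
  · simpa using hg
  · simpa [← hX] using hg
  · have : g.comp Polynomial.coeToPowerSeries.ringHom =
        g'.comp Polynomial.coeToPowerSeries.ringHom := by
      apply Polynomial.ringHom_ext
      · simpa using h
      · simpa using hX
    exact congr($this p)

end SeriesEval

section SeriesLambda
variable {A : Type*} [CommRing A] [LambdaRing A]

/-- The `Λ`-ring `A⟦q - 1⟧`, where `q` has rank one. -/
@[reducible] def seriesLambda (hA : ∀ (n : ℤ) (a : A), n ≠ 0 → n * a = 0 → a = 0) :
    LambdaRing A⟦X⟧ :=
  isCompletion_polynomial.lambdaRing (S := Polynomial A) psi_polynomial_q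
    (fun s hs => Polynomial.ext fun n => by simpa using congr(Polynomial.coeff $hs (n + 1)))
    (fun n hn s hs => by
      rw [Polynomial.X_dvd_iff] at hs ⊢
      refine hA n _ hn ?_
      simpa using hs)

theorem seriesLambda_psi (hA : ∀ (n : ℤ) (a : A), n ≠ 0 → n * a = 0 → a = 0) (n : ℕ+)
    (p : Polynomial A) : (seriesLambda hA).psi n (p : A⟦X⟧) =
      ((LambdaRing.psi n p : Polynomial A) : A⟦X⟧) :=
  isCompletion_polynomial.psi_map (S := Polynomial A) psi_polynomial_q n p

end SeriesLambda

theorem algebraMap_series_X {R A : Type*} [CommRing R] [CommRing A] [Algebra R A] :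
    algebraMap R⟦X⟧ A⟦X⟧ PowerSeries.X = PowerSeries.X :=
  PowerSeries.map_X (algebraMap R A)

theorem algebraMap_series_C {R A : Type*} [CommRing R] [CommRing A] [Algebra R A] (r : R) :
    algebraMap R⟦X⟧ A⟦X⟧ (PowerSeries.C r) = PowerSeries.C (algebraMap R A r) :=
  PowerSeries.map_C (algebraMap R A) r

namespace QStrat
variable {R A : Type u} [CommRing R] [CommRing A] [Algebra R A] [LambdaRing R] [LambdaRing A]

namespace Lift
variable {B C : QStrat R A}

/-- The extension of a lift to power series in `q - 1`. -/
def hat (ℓ : Lift B) : A⟦X⟧ →+* B := seriesEval B.isAdicComplete ℓ.toRingHom B.t dvd_rfl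

@[simp] theorem hat_C (ℓ : Lift B) (a : A) : ℓ.hat (PowerSeries.C a) = ℓ a := seriesEval_C _ _ _ _ _

@[simp] theorem hat_X (ℓ : Lift B) : ℓ.hat PowerSeries.X = B.t := seriesEval_X _ _ _ _

theorem hat_map (f : B ⟶ C) (ℓ : Lift B) (s : A⟦X⟧) :
    (ℓ.map f).hat s = ringHom f (ℓ.hat s) := by
  have : (ℓ.map f).hat = (ringHom f).comp ℓ.hat :=
    series_ringHom_ext C.isAdicComplete (hat_X _).symm.dvd (by simp) (by simp)
  exact congr($this s)

theorem hat_algebraMap (ℓ : Lift B) (s : R⟦X⟧) :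
    ℓ.hat (algebraMap R⟦X⟧ A⟦X⟧ s) = algebraMap R⟦X⟧ B s := by
  have : ℓ.hat.comp (algebraMap R⟦X⟧ A⟦X⟧) = algebraMap R⟦X⟧ B :=
    series_ringHom_ext B.isAdicComplete
      (by rw [RingHom.comp_apply, algebraMap_series_X, hat_X]; exact dvd_rfl)
      (by rw [RingHom.comp_apply, algebraMap_series_X, hat_X]; rfl)
      (fun r => by rw [RingHom.comp_apply, algebraMap_series_C, hat_C, base]; rfl)
  exact congr($this s)

theorem hat_sub_mem (ℓ ℓ' : Lift B) (s : A⟦X⟧) : B.t ∣ ℓ.hat s - ℓ'.hat s := by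
  obtain ⟨s', hs'⟩ : PowerSeries.X ∣ s - PowerSeries.C (PowerSeries.constantCoeff s) := by
    rw [PowerSeries.X_dvd_iff]; simp
  rw [sub_eq_iff_eq_add'] at hs'
  rw [hs', map_add, map_add, map_mul, map_mul, hat_C, hat_C, hat_X, hat_X, add_sub_add_comm,
    ← mul_sub]
  exact dvd_add (ℓ.t_dvd_sub ℓ' _) (dvd_mul_right _ _)

end Lift

section Series
variable (hRA : IsLambdaHom (algebraMap R A)) [Module.Flat ℤ R] [Module.Flat R A]

omit [LambdaRing R] [LambdaRing A] in
theorem eq_zero_of_int_mul_eq_zero (R : Type u) {A : Type u} [CommRing R] [CommRing A]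
    [Algebra R A] [Module.Flat ℤ R] [Module.Flat R A] (n : ℤ) (a : A) (hn : n ≠ 0)
    (h : n * a = 0) : a = 0 := by
  have : Module.Flat ℤ A := Module.Flat.trans ℤ R A
  have h1 : IsSMulRegular ℤ n := fun a b hab => by simpa [hn] using hab
  have := IsSMulRegular.of_flat (S := A) (x := n) h1
  exact this (by simpa using h)

/-- The object `A⟦q - 1⟧` of the site. -/
def series : QStrat R A :=
  let _ : LambdaRing A⟦X⟧ := seriesLambda (eq_zero_of_int_mul_eq_zero R)
  have hψ (n : ℕ+) (p : Polynomial A) : LambdaRing.psi n (p : A⟦X⟧) =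
      ((LambdaRing.psi n p : Polynomial A) : A⟦X⟧) := seriesLambda_psi _ n p
  have hψC (n : ℕ+) (a : A) : LambdaRing.psi n (PowerSeries.C a) =
      PowerSeries.C (LambdaRing.psi n a) := by
    rw [← Polynomial.coe_C, hψ, psi_polynomial_C, Polynomial.coe_C]
  have hX : algebraMap R⟦X⟧ A⟦X⟧ PowerSeries.X = PowerSeries.X := algebraMap_series_X
  have hCc (r : R) : algebraMap R⟦X⟧ A⟦X⟧ (PowerSeries.C r) =
      PowerSeries.C (algebraMap R A r) := algebraMap_series_C r
  { carrier := A⟦X⟧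
    psi_algebraMap_C := fun n r => by
      rw [hCc, hCc, hψC, hRA]
    psi_q := fun n => by
      rw [map_add, map_one, hX]
      have := hψ n (1 + Polynomial.X)
      rw [psi_polynomial_q] at this
      simpa using this
    isAdicComplete := by
      rw [hX]; exact isAdicComplete_span_X A
    torsionFree := fun b hb => by
      rw [hX] at hb
      exact PowerSeries.X_mul_cancel (hb.trans (mul_zero _).symm)
    flat := by
      let q : A →+* A⟦X⟧ ⧸ Ideal.span {algebraMap R⟦X⟧ A⟦X⟧ PowerSeries.X} :=
        (Ideal.Quotient.mk _).comp PowerSeries.C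
      have hq : Function.Bijective q := by
        constructor
        · rw [injective_iff_map_eq_zero]
          intro a ha
          change Ideal.Quotient.mk _ (PowerSeries.C a) = 0 at ha
          rw [Ideal.Quotient.eq_zero_iff_mem, Ideal.mem_span_singleton, hX,
            PowerSeries.X_dvd_iff] at ha
          simpa using ha
        · intro x
          obtain ⟨f, rfl⟩ := Ideal.Quotient.mk_surjective x
          refine ⟨PowerSeries.constantCoeff f, ?_⟩
          change Ideal.Quotient.mk _ (PowerSeries.C _) = _
          rw [Ideal.Quotient.eq, Ideal.mem_span_singleton, hX, PowerSeries.X_dvd_iff]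
          simp
      have h1 : (algebraMap R A).Flat := by
        rw [RingHom.flat_algebraMap_iff]; infer_instance
      have h2 := RingHom.Flat.comp h1 (RingHom.Flat.of_bijective hq)
      convert h2 using 1
      ext r
      simp only [RingHom.comp_apply, q, hCc]
    point := (Ideal.Quotient.mk _).comp PowerSeries.C
    exists_lift := ⟨PowerSeries.C, fun n a => (hψC n a).symm, fun r => (hCc r).symm, rfl⟩ }

/-- The inclusion of `A` into `A⟦q - 1⟧`. -/
def seriesLift : Lift (series hRA) where
  toRingHom := (PowerSeries.C : A →+* A⟦X⟧)
  isLambdaHom n a := by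
    let _ : LambdaRing A⟦X⟧ := seriesLambda (eq_zero_of_int_mul_eq_zero R)
    have := seriesLambda_psi (eq_zero_of_int_mul_eq_zero R) n (Polynomial.C a)
    rw [psi_polynomial_C, Polynomial.coe_C, Polynomial.coe_C] at this
    exact this.symm
  base' r := by
    exact (algebraMap_series_C r).symm
  point' _ := rfl

theorem series_t : (series hRA).t = (PowerSeries.X : A⟦X⟧) := algebraMap_series_X

theorem hat_seriesLift (s : A⟦X⟧) : (seriesLift hRA).hat s = s := by
  have : (seriesLift hRA).hat = RingHom.id A⟦X⟧ :=
    series_ringHom_ext (series hRA).isAdicComplete (Lift.hat_X _).symm.dvd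
      ((Lift.hat_X _).trans (series_t hRA)) (fun a => Lift.hat_C _ a)
  exact congr($this s)

/-- The morphism from `A⟦q - 1⟧` given by a lift. -/
def seriesHom {B : QStrat R A} (ℓ : Lift B) : series hRA ⟶ B :=
  mkHom (B := series hRA) (ℓ.hat : A⟦X⟧ →+* B) (by
    let _ : LambdaRing A⟦X⟧ := seriesLambda (eq_zero_of_int_mul_eq_zero R)
    intro n f
    have hX : LambdaRing.psi n (PowerSeries.X : A⟦X⟧) = (1 + PowerSeries.X) ^ (n : ℕ) - 1 := by
      have := seriesLambda_psi (A := A) (eq_zero_of_int_mul_eq_zero R) n Polynomial.X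
      have h3 : LambdaRing.psi n (Polynomial.X : Polynomial A) =
          (1 + Polynomial.X) ^ (n : ℕ) - 1 := polynomialPsi_X n
      rw [h3, Polynomial.coe_X] at this
      refine this.trans ?_
      simp
    have : ℓ.hat.comp (LambdaRing.psi n) = (LambdaRing.psi n).comp ℓ.hat := by
      have e1 : (LambdaRing.psi n) B.t = (1 + B.t) ^ (n : ℕ) - 1 := B.isQRing.psi_t n
      have e2 : B.t ∣ (1 + B.t) ^ (n : ℕ) - 1 := by
        rw [← e1]; exact B.isQRing.dvd_psi n
      refine series_ringHom_ext B.isAdicComplete ?_ ?_ fun a => ?_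
      · change B.t ∣ _
        simp only [RingHom.comp_apply, hX]
        simpa using e2
      · simp only [RingHom.comp_apply, hX]
        simpa using e1.symm
      · simp only [RingHom.comp_apply]
        have := (seriesLift hRA).psi n a
        change PowerSeries.C _ = LambdaRing.psi n (PowerSeries.C a) at this
        rw [← this, Lift.hat_C, Lift.hat_C, Lift.psi]
    exact congr($this f))
    (fun r => ℓ.hat_algebraMap (PowerSeries.C r))
    (ℓ.hat_algebraMap PowerSeries.X) (seriesLift hRA) ℓ (fun a => ℓ.hat_C a)

theorem map_seriesHom {B : QStrat R A} (ℓ : Lift B) :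
    (seriesLift hRA).map (seriesHom hRA ℓ) = ℓ := Lift.map_mkHom _ _ _ _ _ _ _

theorem series_hom_ext {B : QStrat R A} {f g : series hRA ⟶ B}
    (h : (seriesLift hRA).map f = (seriesLift hRA).map g) : f = g := by
  have hX (f : series hRA ⟶ B) : ringHom f (PowerSeries.X : A⟦X⟧) = B.t :=
    (congrArg (ringHom f) (series_t hRA).symm).trans (ringHom_t f)
  exact hom_ext (series_ringHom_ext (A := A) B.isAdicComplete (t := B.t) (hX f).symm.dvd
    ((hX f).trans (hX g).symm) fun a => congr($h a))

end Series

/-- A family of lifts is universal if every family of lifts is the image under a unique morphism. -/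
structure IsUniversal {J : Type} {U : QStrat R A} (υ : J → Lift U) : Prop where
  exists_hom : ∀ {B : QStrat R A} (ℓ : J → Lift B), ∃ f : U ⟶ B, ∀ k, (υ k).map f = ℓ k
  hom_ext : ∀ {B : QStrat R A} (f g : U ⟶ B), (∀ k, (υ k).map f = (υ k).map g) → f = g

theorem IsUniversal.of_series (hRA : IsLambdaHom (algebraMap R A)) [Module.Flat ℤ R]
    [Module.Flat R A] : IsUniversal fun _ : Fin 1 => seriesLift hRA where
  exists_hom ℓ := ⟨seriesHom hRA (ℓ 0), fun k => by
    rw [Subsingleton.elim k 0, map_seriesHom]⟩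
  hom_ext f g h := series_hom_ext hRA (h 0)

end QStrat
end QDeRham
end

/-! ### Natural functions of families of lifts -/

noncomputable section
namespace QDeRham

set_option linter.unusedSectionVars false

open QStrat

section NatFun
variable (R A : Type u) [CommRing R] [CommRing A] [Algebra R A] [LambdaRing R] [LambdaRing A]

/-- Natural functions of families of lifts, with values in the objects of the site. -/
def natFunAlgebra (J : Type) : Subalgebra R⟦X⟧ ((B : QStrat R A) → (J → Lift B) → B) where
  carrier := {g | ∀ (B C : QStrat R A) (f : B ⟶ C) (ℓ : J → Lift B),
    g C (fun k => (ℓ k).map f) = ringHom f (g B ℓ)}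
  mul_mem' h h' B C f ℓ := by simp only [Pi.mul_apply, map_mul, h B C f ℓ, h' B C f ℓ]
  add_mem' h h' B C f ℓ := by simp only [Pi.add_apply, map_add, h B C f ℓ, h' B C f ℓ]
  algebraMap_mem' s B C f ℓ := (ringHom_algebraMap f s).symm

/-- The type of natural functions of families of lifts. -/
def NatFun (J : Type) : Type (u + 1) := natFunAlgebra R A J

namespace NatFun
instance (J : Type) : CommRing (NatFun R A J) := inferInstanceAs (CommRing (natFunAlgebra R A J))
instance (J : Type) : Algebra R⟦X⟧ (NatFun R A J) :=
  inferInstanceAs (Algebra R⟦X⟧ (natFunAlgebra R A J))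

variable {R A} {J J' J'' : Type}

/-- The values of a natural function. -/
def val (g : NatFun R A J) (B : QStrat R A) (ℓ : J → Lift B) : B := Subtype.val g B ℓ

/-- A natural function is given by its values. -/
def mk (g : (B : QStrat R A) → (J → Lift B) → B) (h : ∀ (B C : QStrat R A) (f : B ⟶ C)
    (ℓ : J → Lift B), g C (fun k => (ℓ k).map f) = ringHom f (g B ℓ)) : NatFun R A J := ⟨g, h⟩

@[simp] theorem mk_val (g : (B : QStrat R A) → (J → Lift B) → B) (h) (B : QStrat R A)
    (ℓ : J → Lift B) : (mk g h).val B ℓ = g B ℓ := rfl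

theorem natural (g : NatFun R A J) {B C : QStrat R A} (f : B ⟶ C) (ℓ : J → Lift B) :
    g.val C (fun k => (ℓ k).map f) = ringHom f (g.val B ℓ) := g.2 B C f ℓ

@[ext] theorem ext {g g' : NatFun R A J} (h : ∀ B ℓ, g.val B ℓ = g'.val B ℓ) : g = g' :=
  Subtype.ext (funext fun B => funext fun ℓ => h B ℓ)

@[simp] theorem add_apply (g g' : NatFun R A J) (B : QStrat R A) (ℓ : J → Lift B) :
    (g + g').val B ℓ = g.val B ℓ + g'.val B ℓ := rfl
@[simp] theorem sub_apply (g g' : NatFun R A J) (B : QStrat R A) (ℓ : J → Lift B) :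
    (g - g').val B ℓ = g.val B ℓ - g'.val B ℓ := rfl
@[simp] theorem neg_apply (g : NatFun R A J) (B : QStrat R A) (ℓ : J → Lift B) :
    (-g).val B ℓ = -g.val B ℓ := rfl
@[simp] theorem mul_apply (g g' : NatFun R A J) (B : QStrat R A) (ℓ : J → Lift B) :
    (g * g').val B ℓ = g.val B ℓ * g'.val B ℓ := rfl
@[simp] theorem zero_apply (B : QStrat R A) (ℓ : J → Lift B) :
    (0 : NatFun R A J).val B ℓ = 0 := rfl
@[simp] theorem one_apply (B : QStrat R A) (ℓ : J → Lift B) :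
    (1 : NatFun R A J).val B ℓ = 1 := rfl
@[simp] theorem smul_apply (s : R⟦X⟧) (g : NatFun R A J) (B : QStrat R A) (ℓ : J → Lift B) :
    (s • g).val B ℓ = s • g.val B ℓ := rfl

/-- Evaluation of natural functions. -/
def eval (B : QStrat R A) (ℓ : J → Lift B) : NatFun R A J →ₐ[R⟦X⟧] B where
  toFun g := g.val B ℓ
  map_one' := rfl
  map_mul' _ _ := rfl
  map_zero' := rfl
  map_add' _ _ := rfl
  commutes' _ := rfl

theorem eval_apply (B : QStrat R A) (ℓ : J → Lift B) (g : NatFun R A J) :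
    eval B ℓ g = g.val B ℓ := rfl

/-- Change of the index set. -/
def pull (θ : J → J') : NatFun R A J →ₐ[R⟦X⟧] NatFun R A J' where
  toFun g := mk (fun B ℓ => g.val B (ℓ ∘ θ)) fun _ _ f ℓ => natural g f (ℓ ∘ θ)
  map_one' := rfl
  map_mul' _ _ := rfl
  map_zero' := rfl
  map_add' _ _ := rfl
  commutes' _ := rfl

@[simp] theorem pull_apply (θ : J → J') (g : NatFun R A J) (B : QStrat R A) (ℓ : J' → Lift B) :
    (pull θ g).val B ℓ = g.val B (ℓ ∘ θ) := rfl

theorem pull_pull (θ : J → J') (θ' : J' → J'') (g : NatFun R A J) :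
    pull θ' (pull θ g) = pull (θ' ∘ θ) g := rfl

theorem pull_id (g : NatFun R A J) : pull id g = g := rfl

/-- The constant function with value `q - 1`. -/
def τ : NatFun R A J := algebraMap R⟦X⟧ _ PowerSeries.X

@[simp] theorem τ_apply (B : QStrat R A) (ℓ : J → Lift B) : (τ : NatFun R A J).val B ℓ = B.t := rfl

@[simp] theorem τ_pow_apply (n : ℕ) (B : QStrat R A) (ℓ : J → Lift B) :
    (τ ^ n : NatFun R A J).val B ℓ = B.t ^ n := by
  rw [← eval_apply, map_pow]; rfl

@[simp] theorem pull_τ (θ : J → J') : pull θ (τ : NatFun R A J) = τ := rfl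

theorem X_smul (g : NatFun R A J) : (PowerSeries.X : R⟦X⟧) • g = τ * g := Algebra.smul_def _ _

theorem τ_mul_cancel {g g' : NatFun R A J} (h : τ * g = τ * g') : g = g' := by
  ext B ℓ
  rw [← sub_eq_zero]
  refine B.torsionFree _ ?_
  have := congr(($h).val B ℓ)
  change B.t * _ = 0
  rw [mul_sub, sub_eq_zero]
  exact this

/-- Quotients by `q - 1` are unique, hence natural when they are chosen at each family separately.
-/
theorem τ_dvd_iff (g : NatFun R A J) : τ ∣ g ↔ ∀ B ℓ, B.t ∣ g.val B ℓ := by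
  constructor
  · rintro ⟨g, rfl⟩ B ℓ
    exact ⟨_, rfl⟩
  · intro h
    choose g' hg' using h
    refine ⟨mk g' fun B C f ℓ => ?_, ext fun B ℓ => hg' B ℓ⟩
    rw [← sub_eq_zero]
    refine C.torsionFree _ ?_
    change C.t * _ = 0
    rw [mul_sub, ← hg', natural, hg', map_mul, ringHom_t, sub_self]

/-- Limits are formed at each family of lifts. They are natural because the objects are separated,
and so are the remainders because `q - 1` is regular. -/
theorem complete : IsAdicComplete (Ideal.span {(τ : NatFun R A J)}) (NatFun R A J) := by
  rw [isAdicComplete_span_singleton_iff]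
  constructor
  · intro g hg
    ext B ℓ
    refine eq_of_forall_pow_dvd_sub B.isAdicComplete fun n => ?_
    obtain ⟨g', rfl⟩ := hg n
    refine ⟨g'.val B ℓ, ?_⟩
    rw [mul_apply, τ_pow_apply, zero_apply, sub_zero]
    rfl
  · intro c
    have key (B : QStrat R A) (ℓ : J → Lift B) :=
      ((isAdicComplete_span_singleton_iff B.t).1 B.isAdicComplete).2 fun i => (c i).val B ℓ
    choose g hg using key
    choose e he using hg
    have hsum (n : ℕ) (B : QStrat R A) (ℓ : J → Lift B) :
        (∑ i ∈ Finset.range n, τ ^ i * c i).val B ℓ =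
          ∑ i ∈ Finset.range n, B.t ^ i * (c i).val B ℓ := by
      rw [← eval_apply, map_sum]
      simp [eval_apply]
    have hnat (B C : QStrat R A) (f : B ⟶ C) (ℓ : J → Lift B) :
        g C (fun k => (ℓ k).map f) = ringHom f (g B ℓ) := by
      refine eq_of_forall_pow_dvd_sub C.isAdicComplete fun n => ?_
      have h1 := he C (fun k => (ℓ k).map f) n
      have h2 := congrArg (ringHom f) (he B ℓ n)
      rw [map_sub, map_mul, map_pow, ringHom_t, ← hsum, ← natural, hsum] at h2
      refine ⟨e C (fun k => (ℓ k).map f) n - ringHom f (e B ℓ n), ?_⟩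
      change _ = C.t ^ n * _
      linear_combination h1 - h2
    refine ⟨mk g hnat, fun n => ?_⟩
    refine ⟨mk (fun B ℓ => e B ℓ n) fun B C f ℓ => ?_, ext fun B ℓ => ?_⟩
    · have h1 := he C (fun k => (ℓ k).map f) n
      have h2 := congrArg (ringHom f) (he B ℓ n)
      rw [map_sub, map_mul, map_pow, ringHom_t, ← hsum, ← natural, hsum, ← hnat, h1] at h2
      rw [← sub_eq_zero] at h2 ⊢
      rw [← mul_sub] at h2
      clear h1
      induction n with
      | zero => simpa using h2
      | succ n ih =>
        rw [pow_succ', mul_assoc] at h2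
        have h3 := C.torsionFree _ h2
        generalize e C (fun k => (ℓ k).map f) (n + 1) - ringHom f (e B ℓ (n + 1)) = z at h3
        clear ih h2
        induction n with
        | zero => simpa using h3
        | succ n ih => exact ih (C.torsionFree _ (by rw [pow_succ', mul_assoc] at h3; exact h3))
    · rw [sub_apply, hsum, mul_apply, τ_pow_apply]
      exact he B ℓ n

theorem eq_of_forall_dvd {g g' : NatFun R A J} (h : ∀ n, τ ^ n ∣ g - g') : g = g' :=
  eq_of_forall_pow_dvd_sub complete h

/-- Linear maps preserve divisibility by powers of `q - 1`. -/
theorem τ_pow_dvd_map (f : NatFun R A J →ₗ[R⟦X⟧] NatFun R A J') (n : ℕ) {g : NatFun R A J}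
    (h : τ ^ n ∣ g) : τ ^ n ∣ f g := by
  obtain ⟨g', rfl⟩ := h
  refine ⟨f g', ?_⟩
  have (J : Type) (g : NatFun R A J) : τ ^ n * g = (PowerSeries.X ^ n : R⟦X⟧) • g := by
    rw [Algebra.smul_def, map_pow]; rfl
  rw [this, map_smul, this]

theorem map_τ_mul (f : NatFun R A J →ₗ[R⟦X⟧] NatFun R A J') (g : NatFun R A J) :
    f (τ * g) = τ * f g := by
  rw [← X_smul, map_smul, X_smul]

/-- Solving an equation by successive approximation. -/
theorem exists_map_eq (f : NatFun R A J →ₗ[R⟦X⟧] NatFun R A J') (P : Set (NatFun R A J'))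
    (Q : Submodule R⟦X⟧ (NatFun R A J)) (hQ : ∀ g, (∀ n, ∃ g' ∈ Q, τ ^ n ∣ g - g') → g ∈ Q)
    (h : ∀ y ∈ P, ∃ x ∈ Q, ∃ y' ∈ P, y = f x + τ * y') (y : NatFun R A J') (hy : y ∈ P) :
    ∃ x ∈ Q, f x = y := by
  choose! X hX Y hY hXY using h
  -- `s n` is the error that remains after `n` approximations, divided by `τⁿ`. It stays in `P`, so
  -- the corrections can be continued, and their sum lies in `Q` because `Q` is closed.
  let s : ℕ → NatFun R A J' := fun n => Y^[n] y
  have hs (n : ℕ) : s n ∈ P := by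
    induction n with
    | zero => exact hy
    | succ n ih => simp only [s, Function.iterate_succ_apply']; exact hY _ ih
  obtain ⟨x, hx⟩ := ((isAdicComplete_span_singleton_iff (τ : NatFun R A J)).1 complete).2
    fun n => X (s n)
  have hmem (n : ℕ) : ∑ i ∈ Finset.range n, τ ^ i * X (s i) ∈ Q := by
    refine Q.sum_mem fun i _ => ?_
    have : τ ^ i * X (s i) = (PowerSeries.X ^ i : R⟦X⟧) • X (s i) := by
      rw [Algebra.smul_def, map_pow]; rfl
    rw [this]
    exact Q.smul_mem _ (hX _ (hs i))
  have happrox (n : ℕ) : y = f (∑ i ∈ Finset.range n, τ ^ i * X (s i)) + τ ^ n * s n := by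
    induction n with
    | zero => simp [s]
    | succ n ih =>
      have h1 := hXY (s n) (hs n)
      have h2 : f (τ ^ n * X (s n)) = τ ^ n * f (X (s n)) := by
        have (J : Type) (g : NatFun R A J) : τ ^ n * g = (PowerSeries.X ^ n : R⟦X⟧) • g := by
          rw [Algebra.smul_def, map_pow]; rfl
        rw [this, map_smul, this]
      have h3 : s (n + 1) = Y (s n) := Function.iterate_succ_apply' _ _ _
      rw [Finset.sum_range_succ, map_add, h2, h3]
      linear_combination ih + τ ^ n * h1
  refine ⟨x, hQ x fun n => ⟨_, hmem n, hx n⟩, eq_of_forall_dvd fun n => ?_⟩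
  rw [happrox n, ← sub_sub, ← map_sub]
  exact dvd_sub (τ_pow_dvd_map f n (hx n)) (dvd_mul_right _ _)

end NatFun
end NatFun
end QDeRham
end

/-! ### Universal families of lifts and expansions in `q`-divided monomials -/

noncomputable section
namespace QDeRham

set_option linter.unusedSectionVars false

open QStrat

variable {R A : Type u} [CommRing R] [CommRing A] [Algebra R A] [LambdaRing R] [LambdaRing A]

namespace Framing
variable (F : Framing R A) [Module.Flat ℤ R] (hRA : IsLambdaHom (algebraMap R A))

/-- Adjoining one more lift to a universal family of lifts. -/
theorem exists_universal_option {J : Type} {U : QStrat R A} {υ : J → Lift U} (hυ : IsUniversal υ)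
    (hRA : IsLambdaHom (algebraMap R A)) (o : J) :
    ∃ (E : QStrat R A) (j : U ⟶ E) (υ' : Option J → Lift E), IsUniversal υ' ∧
      (∀ k, υ' (some k) = (υ k).map j) ∧
      (∀ e : E, ∃ s : (Fin F.dim → ℕ) →₀ U, E.t ∣ e - s.sum fun k b =>
        ringHom j b * qMonomial E.t (fun i => υ' (some o) (F.x i)) (fun i => υ' none (F.x i)) k) ∧
      (∀ s : (Fin F.dim → ℕ) →₀ U, (E.t ∣ s.sum fun k b =>
        ringHom j b * qMonomial E.t (fun i => υ' (some o) (F.x i)) (fun i => υ' none (F.x i)) k) →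
        ∀ k, U.t ∣ s k) := by
  -- A further lift is given by its coordinates, which are rank one elements congruent to the
  -- coordinates of `υ o`. So the extension of `U` by universal elements of this kind classifies it.
  obtain ⟨E, j, y, hy, hyt, hex, huniq, hspan, hind⟩ :=
    U.exists_qExtension (fun i => υ o (F.x i)) (fun i => (υ o).isRankOne (F.isRankOne_x i))
  obtain ⟨ℓ, hℓ⟩ := F.exists_lift hRA ((υ o).map j) y hy hyt
  obtain rfl : (fun i => ℓ (F.x i)) = y := funext hℓ
  refine ⟨E, j, fun k => k.elim ℓ fun k => (υ k).map j, ⟨fun {B} μ => ?_, fun {B} f g hfg => ?_⟩,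
    fun k => rfl, ?_, ?_⟩
  · obtain ⟨f, hf⟩ := hυ.exists_hom fun k => μ (some k)
    obtain ⟨g, hg, hgy⟩ := hex B f (fun i => μ none (F.x i))
      (fun i => (μ none).isRankOne (F.isRankOne_x i)) (fun i => by
        have : ringHom f (υ o (F.x i)) = μ (some o) (F.x i) := congr($(hf o) (F.x i))
        rw [this]
        exact (μ none).t_dvd_sub _ _)
    refine ⟨g, fun k => ?_⟩
    cases k with
    | none =>
      refine F.lift_ext fun i => ?_
      rw [← hgy]
      rfl
    | some k =>
      rw [← hf k, ← hg]
      rfl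
  · refine huniq B f g (hυ.hom_ext _ _ fun k => ?_) fun i => ?_
    · exact hfg (some k)
    · exact congr($(hfg none) (F.x i))
  · exact hspan
  · exact hind

end Framing

theorem QStrat.IsUniversal.reindex {J J' : Type} {U : QStrat R A} {υ : J → Lift U}
    (hυ : IsUniversal υ) (e : J' ≃ J) : IsUniversal fun k => υ (e k) where
  exists_hom ℓ := by
    obtain ⟨f, hf⟩ := hυ.exists_hom fun k => ℓ (e.symm k)
    exact ⟨f, fun k => by rw [hf, e.symm_apply_apply]⟩
  hom_ext f g h := hυ.hom_ext f g fun k => by simpa using h (e.symm k)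

/-- One lift is classified by `A⟦q - 1⟧`, and the remaining ones are adjoined one at a time. -/
theorem Framing.exists_universal_fin (F : Framing R A) [Module.Flat ℤ R] [Module.Flat R A]
    (hRA : IsLambdaHom (algebraMap R A)) (m : ℕ) :
    ∃ (U : QStrat R A) (υ : Fin (m + 1) → Lift U), IsUniversal υ := by
  induction m with
  | zero => exact ⟨_, _, IsUniversal.of_series hRA⟩
  | succ m ih =>
    obtain ⟨U, υ, hυ⟩ := ih
    obtain ⟨E, -, υ', hυ', -⟩ := F.exists_universal_option hυ hRA 0
    exact ⟨E, _, hυ'.reindex (finSuccEquiv (m + 1))⟩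

namespace NatFun
variable {J : Type} {U : QStrat R A} {υ : J → Lift U}

/-- The natural function with a given value on the universal family. -/
def ofUniversal (hυ : IsUniversal υ) (u : U) : NatFun R A J :=
  mk (fun _ ℓ => ringHom (hυ.exists_hom ℓ).choose u) fun B C f ℓ => by
    have : (hυ.exists_hom fun k => (ℓ k).map f).choose = (hυ.exists_hom ℓ).choose ≫ f :=
      hυ.hom_ext _ _ fun k => by
        rw [(hυ.exists_hom fun k => (ℓ k).map f).choose_spec, Lift.map_comp,
          (hυ.exists_hom ℓ).choose_spec]
    exact congr(ringHom $this u)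

theorem ofUniversal_apply (hυ : IsUniversal υ) (u : U) : (ofUniversal hυ u).val U υ = u := by
  have : (hυ.exists_hom υ).choose = 𝟙 U := hυ.hom_ext _ _ fun k => by
    rw [(hυ.exists_hom υ).choose_spec, Lift.map_id]
  change ringHom (hυ.exists_hom υ).choose u = u
  rw [this, ringHom_id]

theorem τ_dvd_of_universal (hυ : IsUniversal υ) {g : NatFun R A J} (h : U.t ∣ g.val U υ) :
    τ ∣ g := by
  rw [τ_dvd_iff]
  intro B ℓ
  obtain ⟨f, hf⟩ := hυ.exists_hom ℓ
  obtain rfl : (fun k => (υ k).map f) = ℓ := funext hf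
  rw [natural, ← ringHom_t f]
  exact map_dvd _ h

end NatFun

namespace Framing
variable (F : Framing R A) [Module.Flat ℤ R]

/-- The natural functions `∏ᵢ ∏_{j < kᵢ} (ℓ(xᵢ) - qʲ ℓₒ(xᵢ)) / (qʲ⁺¹ - 1)`. -/
def qMon {J : Type} (o : J) (k : Fin F.dim → ℕ) : NatFun R A (Option J) :=
  NatFun.mk (fun B ℓ =>
    qMonomial B.t (fun i => ℓ (some o) (F.x i)) (fun i => ℓ none (F.x i)) k)
    fun B C f ℓ => by
      simp only [qMonomial, map_prod]
      refine Finset.prod_congr rfl fun i _ => ?_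
      exact (B.isQRing.map_qDivided ((ℓ (some o)).isRankOne (F.isRankOne_x i))
        ((ℓ none).isRankOne (F.isRankOne_x i)) (Lift.t_dvd_sub _ _ _) C.isQRing (ringHom f)
        (isLambdaHom_ringHom f) (ringHom_t f) (k i)).symm

theorem qMon_apply {J : Type} (o : J) (k : Fin F.dim → ℕ) (B : QStrat R A)
    (ℓ : Option J → Lift B) : (F.qMon o k).val B ℓ =
      qMonomial B.t (fun i => ℓ (some o) (F.x i)) (fun i => ℓ none (F.x i)) k := rfl

variable {J : Type} (hJ : ∃ (U : QStrat R A) (υ : J → Lift U), IsUniversal υ)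
  (hRA : IsLambdaHom (algebraMap R A)) (o : J)
include hJ hRA

/-- Evaluation at the universal family turns this into the statement that the extension by one lift
is generated modulo `q - 1` by the `q`-divided monomials. Coefficients in `U` become natural
functions by `NatFun.ofUniversal`. With `τ_dvd_of_expansion` the natural functions of one more lift
are free over the others on these monomials, modulo `q - 1`. -/
theorem exists_expansion (g : NatFun R A (Option J)) :
    ∃ s : (Fin F.dim → ℕ) →₀ NatFun R A J,
      NatFun.τ ∣ g - s.sum fun k c => NatFun.pull some c * F.qMon o k := by
  classical
  obtain ⟨U, υ, hυ⟩ := hJ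
  obtain ⟨E, j, υ', hυ', hυυ, hspan, -⟩ := F.exists_universal_option hυ hRA o
  obtain ⟨s, hs⟩ := hspan (g.val E υ')
  refine ⟨s.support.sum fun k => Finsupp.single k (NatFun.ofUniversal hυ (s k)),
    NatFun.τ_dvd_of_universal hυ' ?_⟩
  rw [← Finsupp.sum_finsetSum_index (by simp) (by simp [add_mul])]
  have h1 (k : Fin F.dim → ℕ) (c : NatFun R A J) : (Finsupp.single k c).sum
      (fun k c => NatFun.pull some c * F.qMon o k) = NatFun.pull some c * F.qMon o k :=
    Finsupp.sum_single_index (by simp)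
  simp only [h1, NatFun.sub_apply]
  rw [← NatFun.eval_apply E υ' (∑ k ∈ s.support, _), map_sum]
  convert hs using 2
  refine Finset.sum_congr rfl fun k _ => ?_
  rw [map_mul, NatFun.eval_apply, NatFun.eval_apply, NatFun.pull_apply, qMon_apply]
  congr 1
  have h2 : υ' ∘ some = fun k => (υ k).map j := funext hυυ
  rw [h2, NatFun.natural, NatFun.ofUniversal_apply]

theorem τ_dvd_of_expansion (s : (Fin F.dim → ℕ) →₀ NatFun R A J)
    (h : NatFun.τ ∣ s.sum fun k c => NatFun.pull some c * F.qMon o k) (k : Fin F.dim → ℕ) :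
    NatFun.τ ∣ s k := by
  obtain ⟨U, υ, hυ⟩ := hJ
  obtain ⟨E, j, υ', hυ', hυυ, -, hind⟩ := F.exists_universal_option hυ hRA o
  refine NatFun.τ_dvd_of_universal hυ ?_
  have h1 := hind (s.mapRange (fun c => c.val U υ) (NatFun.zero_apply U υ)) (by
    rw [NatFun.τ_dvd_iff] at h
    have := h E υ'
    rw [← NatFun.eval_apply, Finsupp.sum, map_sum] at this
    rw [Finsupp.sum_mapRange_index (by simp), Finsupp.sum]
    convert this using 1
    refine Finset.sum_congr rfl fun k _ => ?_
    rw [map_mul, NatFun.eval_apply, NatFun.eval_apply, NatFun.pull_apply, qMon_apply]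
    congr 1
    have h2 : υ' ∘ some = fun k => (υ k).map j := funext hυυ
    rw [h2, NatFun.natural]) k
  simpa using h1

end Framing
end QDeRham
end

/-! ### The objects `B[ε]` with `ε² = y ε` -/

noncomputable section
namespace QDeRham

set_option linter.unusedSectionVars false

open QStrat

/-- The algebra `B[ε]` with `ε² = y ε`. -/
abbrev Eps {B : Type*} [CommRing B] (y : B) := QuadraticAlgebra B 0 y

namespace Eps
variable {B : Type*} [CommRing B] {y : B}

/-- The element `ε`. -/
def ε : Eps y := ⟨0, 1⟩

theorem pow_succ_ε (n : ℕ) : (ε : Eps y) ^ (n + 1) = ⟨0, y ^ n⟩ := by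
  induction n with
  | zero => simp [ε]
  | succ n ih =>
    rw [pow_succ, ih]
    ext <;> simp [ε, pow_succ]
    ring

/-- The specialisations `ε = 0` and `ε = y` take `y + (q - 1)ε` to `y` and `q y`, and the
coefficient of `ε` in a power is the corresponding difference quotient. Comparison with `ψⁿ(ε) =
yⁿ⁻¹ ε` shows that `y + (q - 1)ε` has rank one, see `isRankOne_eps`. -/
theorem pow_succ_mk (t : B) (n : ℕ) : (⟨y, t⟩ : Eps y) ^ (n + 1) =
    ⟨y ^ (n + 1), ((1 + t) ^ (n + 1) - 1) * y ^ n⟩ := by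
  induction n with
  | zero => simp
  | succ n ih =>
    rw [pow_succ, ih]
    ext
    · simp [pow_succ]
    · simp only [QuadraticAlgebra.im_mul]
      ring

variable [LambdaRing B] (hy : IsRankOne y)

/-- The operation `ψⁿ` on `B[ε]`, with `ψⁿ(ε) = εⁿ`. -/
def psi (hy : IsRankOne y) (n : ℕ+) : Eps y →+* Eps y where
  toFun z := ⟨LambdaRing.psi n z.re, LambdaRing.psi n z.im * y ^ ((n : ℕ) - 1)⟩
  map_one' := by ext <;> simp [QuadraticAlgebra.re_one, QuadraticAlgebra.im_one]
  map_zero' := by ext <;> simp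
  map_add' z w := by ext <;> simp [add_mul]
  map_mul' z w := by
    ext
    · simp
    · simp only [QuadraticAlgebra.im_mul, map_add, map_mul, hy n]
      have : (n : ℕ) - 1 + 1 = n := Nat.sub_add_cancel n.pos
      rw [← this, pow_succ, Nat.add_sub_cancel]
      ring

theorem psi_apply (n : ℕ+) (z : Eps y) :
    psi hy n z = ⟨LambdaRing.psi n z.re, LambdaRing.psi n z.im * y ^ ((n : ℕ) - 1)⟩ := rfl

/-- The `Λ`-ring structure on `B[ε]`. -/
@[reducible] def lambdaRing : LambdaRing (Eps y) where
  psi :=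
    { toFun := psi hy
      map_one' := by
        refine RingHom.ext fun z => ?_
        rw [psi_apply]
        ext <;> simp
      map_mul' := fun m n => by
        refine RingHom.ext fun z => ?_
        rw [RingHom.mul_def, RingHom.comp_apply, psi_apply, psi_apply, psi_apply]
        ext
        · simp
        · simp only [map_mul, map_pow, hy m, PNat.mul_coe, RingHom.mul_def, RingHom.comp_apply,
            mul_assoc]
          rw [← pow_mul, ← pow_add]
          congr 2
          have h1 := m.pos
          obtain ⟨k, hk⟩ : ∃ k, (n : ℕ) = k + 1 := ⟨_, (Nat.sub_add_cancel n.pos).symm⟩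
          rw [hk, Nat.add_sub_cancel, mul_add]
          omega }
  frobenius_lift p hp z := by
    have h1 (b : B) : (⟨b, 0⟩ : Eps y) ∈ frobeniusSubring (psi hy p) p hp := by
      rw [mem_frobeniusSubring]
      obtain ⟨c, hc⟩ := LambdaRing.frobenius_lift p hp b
      refine ⟨⟨c, 0⟩, ?_⟩
      have h2 : (⟨b, 0⟩ : Eps y) ^ (p : ℕ) = ⟨b ^ (p : ℕ), 0⟩ := (QuadraticAlgebra.C_pow _ _).symm
      rw [h2, psi_apply]
      ext <;> simp [hc]
    have h2 : (ε : Eps y) ∈ frobeniusSubring (psi hy p) p hp := by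
      rw [mem_frobeniusSubring]
      have h3 := pow_succ_ε (y := y) ((p : ℕ) - 1)
      rw [Nat.sub_add_cancel p.pos] at h3
      rw [h3, psi_apply]
      refine (congrArg _ ?_).mpr (dvd_zero _)
      ext <;> simp [ε]
    have h3 : z = ⟨z.re, 0⟩ + ⟨z.im, 0⟩ * ε := by ext <;> simp [ε]
    change ((p : ℕ) : Eps y) ∣ psi hy p z - z ^ (p : ℕ)
    rw [← mem_frobeniusSubring (hp := hp), h3]
    exact add_mem (h1 _) (mul_mem (h1 _) h2)

end Eps

namespace QStrat
variable {R A : Type u} [CommRing R] [CommRing A] [Algebra R A] [LambdaRing R] [LambdaRing A]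
variable (B : QStrat R A) (y : B) (hy : IsRankOne y)

theorem isAdicComplete_eps :
    IsAdicComplete (Ideal.span {algebraMap B (Eps y) B.t}) (Eps y) := by
  rw [isAdicComplete_span_singleton_iff]
  have hc := (isAdicComplete_span_singleton_iff B.t).1 B.isAdicComplete
  have hd (n : ℕ) (z : Eps y) : algebraMap B (Eps y) B.t ^ n ∣ z ↔
      B.t ^ n ∣ z.re ∧ B.t ^ n ∣ z.im := by
    rw [← map_pow, QuadraticAlgebra.algebraMap_dvd_iff]
  constructor
  · intro z hz
    ext
    · exact hc.1 _ fun n => ((hd n z).1 (hz n)).1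
    · exact hc.1 _ fun n => ((hd n z).1 (hz n)).2
  · intro c
    obtain ⟨a, ha⟩ := hc.2 fun i => (c i).re
    obtain ⟨b, hb⟩ := hc.2 fun i => (c i).im
    refine ⟨⟨a, b⟩, fun n => (hd n _).2 ?_⟩
    have hr (n : ℕ) : (∑ i ∈ Finset.range n, algebraMap B (Eps y) B.t ^ i * c i).re =
        ∑ i ∈ Finset.range n, B.t ^ i * (c i).re := by
      induction n with
      | zero => simp
      | succ n ih =>
        rw [Finset.sum_range_succ, Finset.sum_range_succ, ← ih, QuadraticAlgebra.re_add,
          ← map_pow _ _ n, QuadraticAlgebra.re_mul, QuadraticAlgebra.algebraMap_re]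
        ring
    have hi (n : ℕ) : (∑ i ∈ Finset.range n, algebraMap B (Eps y) B.t ^ i * c i).im =
        ∑ i ∈ Finset.range n, B.t ^ i * (c i).im := by
      induction n with
      | zero => simp
      | succ n ih =>
        rw [Finset.sum_range_succ, Finset.sum_range_succ, ← ih, QuadraticAlgebra.im_add,
          ← map_pow _ _ n, QuadraticAlgebra.im_mul, QuadraticAlgebra.algebraMap_re,
          QuadraticAlgebra.algebraMap_im]
        ring
    rw [QuadraticAlgebra.re_sub, QuadraticAlgebra.im_sub, hr, hi]
    exact ⟨ha n, hb n⟩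

theorem isLambdaHom_algebraMap_eps :
    @IsLambdaHom _ _ _ _ _ (Eps.lambdaRing hy) (algebraMap B (Eps y)) := fun n b => by
  change _ = Eps.psi hy n _
  rw [Eps.psi_apply]
  ext <;> simp

theorem eps_torsionFree (z : Eps y) (hz : algebraMap B (Eps y) B.t * z = 0) : z = 0 := by
  have h1 := QuadraticAlgebra.ext_iff.1 hz
  simp only [QuadraticAlgebra.re_mul, QuadraticAlgebra.im_mul,
    QuadraticAlgebra.algebraMap_re, QuadraticAlgebra.algebraMap_im, zero_mul, mul_zero,
    add_zero, QuadraticAlgebra.re_zero, QuadraticAlgebra.im_zero] at h1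
  ext
  · exact B.torsionFree _ h1.1
  · exact B.torsionFree _ h1.2

theorem flat_eps : ((Ideal.Quotient.mk (Ideal.span {algebraMap B (Eps y) B.t})).comp
    ((algebraMap B (Eps y)).comp B.base)).Flat := by
  have := flat_quotient_map (S := Eps y) (Ideal.span {B.t}) B.base B.flat
  rwa [Ideal.map_span, Set.image_singleton] at this

/-- The object `B[ε]` of the site, with `ε² = y ε` and `ψⁿ(ε) = εⁿ`. -/
def eps : QStrat R A :=
  @extend _ _ _ _ _ _ _ B _ _ (Eps.lambdaRing hy) (algebraMap B (Eps y))
    (B.isLambdaHom_algebraMap_eps y hy) (B.isAdicComplete_eps y) (B.eps_torsionFree y) (B.flat_eps y)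

/-- The inclusion of `B` into `B[ε]`. -/
def epsHom : B ⟶ B.eps y hy :=
  @extendHom _ _ _ _ _ _ _ B _ _ (Eps.lambdaRing hy) (algebraMap B (Eps y))
    (B.isLambdaHom_algebraMap_eps y hy) (B.isAdicComplete_eps y) (B.eps_torsionFree y) (B.flat_eps y)

/-- The elements of `B[ε]`. -/
def epsEquiv : B.eps y hy ≃+* Eps y := RingEquiv.refl (Eps y)

variable {B y hy}

@[simp] theorem epsEquiv_epsHom (b : B) :
    epsEquiv B y hy (ringHom (B.epsHom y hy) b) = ⟨b, 0⟩ := rfl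

@[simp] theorem epsEquiv_t : epsEquiv B y hy (B.eps y hy).t = ⟨B.t, 0⟩ := rfl

theorem epsEquiv_psi (n : ℕ+) (z : B.eps y hy) :
    epsEquiv B y hy (LambdaRing.psi n z) = Eps.psi hy n (epsEquiv B y hy z) := rfl

theorem epsEquiv_algebraMap (s : R⟦X⟧) :
    epsEquiv B y hy (algebraMap R⟦X⟧ _ s) = ⟨algebraMap R⟦X⟧ B s, 0⟩ := rfl

theorem t_dvd_eps_iff (z : B.eps y hy) : (B.eps y hy).t ∣ z ↔
    B.t ∣ (epsEquiv B y hy z).re ∧ B.t ∣ (epsEquiv B y hy z).im := by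
  rw [← map_dvd_iff (epsEquiv B y hy), epsEquiv_t]
  exact QuadraticAlgebra.algebraMap_dvd_iff

theorem epsEquiv_base (r : R) : epsEquiv B y hy ((B.eps y hy).base r) = ⟨B.base r, 0⟩ := rfl

theorem epsEquiv_smul (s : R⟦X⟧) (z : B.eps y hy) : epsEquiv B y hy (s • z) =
    ⟨s • (epsEquiv B y hy z).re, s • (epsEquiv B y hy z).im⟩ := by
  rw [Algebra.smul_def, map_mul, epsEquiv_algebraMap]
  ext <;> simp [Algebra.smul_def]

theorem isRankOne_eps [Module.Flat ℤ R] :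
    IsRankOne ((epsEquiv B y hy).symm ⟨y, B.t⟩) := fun n => by
  apply (epsEquiv B y hy).injective
  rw [epsEquiv_psi, map_pow, RingEquiv.apply_symm_apply, Eps.psi_apply]
  obtain ⟨k, hk⟩ : ∃ k, (n : ℕ) = k + 1 := ⟨_, (Nat.sub_add_cancel n.pos).symm⟩
  simp only [hy n, B.isQRing.psi_t]
  rw [hk, Eps.pow_succ_mk, Nat.add_sub_cancel]

/-- Functoriality of `B[ε]`. -/
def epsMap {C : QStrat R A} (f : B ⟶ C) {z : C} (hz : IsRankOne z) (hyz : ringHom f y = z) :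
    B.eps y hy ⟶ C.eps z hz :=
  let ℓ : Lift B := Classical.arbitrary _
  let φ : Eps y →+* Eps z :=
    { toFun := fun w => ⟨ringHom f w.re, ringHom f w.im⟩
      map_one' := by ext <;> simp [QuadraticAlgebra.re_one, QuadraticAlgebra.im_one]
      map_zero' := by ext <;> simp
      map_add' := fun _ _ => by ext <;> simp
      map_mul' := fun _ _ => by ext <;> simp [hyz] }
  mkHom (B := B.eps y hy) (C := C.eps z hz) (φ : Eps y →+* Eps z)
    (fun n w => by
      have key (w : Eps y) : φ (Eps.psi hy n w) = Eps.psi hz n (φ w) := by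
        rw [Eps.psi_apply, Eps.psi_apply]
        ext
        · exact isLambdaHom_ringHom f n _
        · change ringHom f (_ * _) = LambdaRing.psi n (ringHom f _) * _
          rw [map_mul, isLambdaHom_ringHom f n, map_pow, hyz]
      exact key w)
    (fun r => by
      apply (epsEquiv C z hz).injective
      rw [epsEquiv_base]
      change φ ⟨B.base r, 0⟩ = _
      ext <;> simp [φ])
    (by
      apply (epsEquiv C z hz).injective
      rw [epsEquiv_t]
      change φ ⟨B.t, 0⟩ = _
      ext <;> simp [φ])
    (ℓ.map (B.epsHom y hy)) ((ℓ.map f).map (C.epsHom z hz)) (fun a => by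
      apply (epsEquiv C z hz).injective
      change φ ⟨ℓ a, 0⟩ = ⟨ringHom f (ℓ a), 0⟩
      ext <;> simp [φ])

theorem epsEquiv_epsMap {C : QStrat R A} (f : B ⟶ C) {z : C} (hz : IsRankOne z)
    (hyz : ringHom f y = z) (w : B.eps y hy) :
    epsEquiv C z hz (ringHom (epsMap f hz hyz) w) =
      ⟨ringHom f (epsEquiv B y hy w).re, ringHom f (epsEquiv B y hy w).im⟩ := rfl

variable (B y hy) in
/-- The retraction of `B[ε]` to `B` with `ε ↦ 0`. -/
def epsRe : B.eps y hy ⟶ B :=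
  let ℓ : Lift B := Classical.arbitrary _
  let φ : Eps y →+* B :=
    { toFun := fun w => w.re
      map_one' := rfl
      map_zero' := rfl
      map_add' := fun _ _ => rfl
      map_mul' := fun _ _ => by simp }
  mkHom (B := B.eps y hy) φ (fun _ _ => rfl) (fun _ => rfl) rfl (ℓ.map (B.epsHom y hy)) ℓ
    (fun _ => rfl)

theorem ringHom_epsRe (w : B.eps y hy) :
    ringHom (B.epsRe y hy) w = (epsEquiv B y hy w).re := rfl

end QStrat

/-! ### The `q`-derivative as a coefficient of `ε` -/

namespace Framing
variable {R A : Type u} [CommRing R] [CommRing A] [Algebra R A] [LambdaRing R] [LambdaRing A]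
  (F : Framing R A) [Module.Flat ℤ R] (hRA : IsLambdaHom (algebraMap R A)) (i : Fin F.dim)

section EpsLift
variable {B C : QStrat R A} (ℓ : Lift B)

theorem isRankOne_lift_x (ℓ : Lift B) : IsRankOne (ℓ (F.x i)) := ℓ.isRankOne (F.isRankOne_x i)

include hRA in
theorem exists_epsLift : ∃ ℓ' : Lift (B.eps (ℓ (F.x i)) (F.isRankOne_lift_x i ℓ)),
    ∀ j, epsEquiv _ _ _ (ℓ' (F.x j)) = ⟨ℓ (F.x j), if j = i then B.t else 0⟩ := by
  obtain ⟨ℓ', hℓ'⟩ := F.exists_lift hRA (ℓ.map (B.epsHom (ℓ (F.x i)) (F.isRankOne_lift_x i ℓ)))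
    (fun j => (epsEquiv _ _ _).symm ⟨ℓ (F.x j), if j = i then B.t else 0⟩) (fun j => by
      by_cases h : j = i
      · subst h
        rw [if_pos rfl]
        exact isRankOne_eps
      · rw [if_neg h]
        exact (ℓ.map (B.epsHom (ℓ (F.x i)) (F.isRankOne_lift_x i ℓ))).isRankOne
          (F.isRankOne_x j)) (fun j => by
      rw [t_dvd_eps_iff, map_sub, RingEquiv.apply_symm_apply, Lift.map_apply, epsEquiv_epsHom]
      split_ifs <;> simp)
  exact ⟨ℓ', fun j => by rw [hℓ', RingEquiv.apply_symm_apply]⟩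

/-- The lift to `B[ε]` with `xᵢ ↦ xᵢ + (q - 1) ε` and `xⱼ ↦ xⱼ` for `j ≠ i`. -/
def epsLift : Lift (B.eps (ℓ (F.x i)) (F.isRankOne_lift_x i ℓ)) :=
  (F.exists_epsLift hRA i ℓ).choose

theorem epsLift_x (j : Fin F.dim) : epsEquiv _ _ _ (F.epsLift hRA i ℓ (F.x j)) =
    ⟨ℓ (F.x j), if j = i then B.t else 0⟩ := (F.exists_epsLift hRA i ℓ).choose_spec j

theorem map_epsLift (f : B ⟶ C) : (F.epsLift hRA i ℓ).map
    (epsMap f (F.isRankOne_lift_x i (ℓ.map f)) rfl) = F.epsLift hRA i (ℓ.map f) := by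
  refine F.lift_ext fun j => (epsEquiv _ _ _).injective ?_
  refine (epsEquiv_epsMap f _ rfl (F.epsLift hRA i ℓ (F.x j))).trans ?_
  refine Eq.trans ?_ (F.epsLift_x hRA i (ℓ.map f) j).symm
  rw [epsLift_x]
  ext
  · rfl
  · dsimp only
    split_ifs <;> simp

theorem map_epsLift_epsRe : (F.epsLift hRA i ℓ).map (B.epsRe _ _) = ℓ := by
  refine F.lift_ext fun j => ?_
  rw [Lift.map_apply, ringHom_epsRe, epsLift_x]

/-- By uniqueness of lifts the new lift is the Taylor expansion evaluated at `Y = (q - 1)ε`. In the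
part divisible by `Y` one factor `ε` is kept, and the relation `ε² = xᵢ ε` replaces all others by
`xᵢ`. This produces the series of `∇_{q,i}` in its Taylor form, without dividing by `xᵢ`. -/
theorem epsLift_apply (a : A) : epsEquiv _ _ _ (F.epsLift hRA i ℓ a) =
    ⟨ℓ a, B.t * ℓ.hat (PowerSeries.mk fun n => F.qDerCoeff i n a)⟩ := by
  set E := B.eps (ℓ (F.x i)) (F.isRankOne_lift_x i ℓ) with hE
  let e : E ≃+* Eps (ℓ (F.x i)) := epsEquiv _ _ _
  let c : E := e.symm ⟨0, B.t⟩
  have hc : E.t ∣ c := by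
    rw [t_dvd_eps_iff]
    exact ⟨dvd_zero _, dvd_rfl⟩
  let θ : A⟦X⟧ →+* E := seriesEval E.isAdicComplete (ℓ.map (B.epsHom _ _)).toRingHom c hc
  have hθC (a : A) : e (θ (PowerSeries.C a)) = ⟨ℓ a, 0⟩ :=
    congrArg e (seriesEval_C _ _ _ _ a)
  have hθX : θ PowerSeries.X = c := seriesEval_X _ _ _ _
  have heq : θ.comp (F.taylor i).toRingHom = (F.epsLift hRA i ℓ).toRingHom := by
    refine F.ringHom_ext E.isAdicComplete (fun r => ?_) (fun j => ?_) fun a => ?_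
    · change θ (F.taylor i _) = F.epsLift hRA i ℓ _
      rw [AlgHom.commutes, PowerSeries.algebraMap_apply, Lift.base]
      apply e.injective
      rw [hθC, Lift.base]
      rfl
    · change θ (F.taylor i _) = F.epsLift hRA i ℓ _
      apply e.injective
      rw [taylor_x, map_add, map_add, hθC]
      refine Eq.trans ?_ (F.epsLift_x hRA i ℓ j).symm
      split_ifs
      · rw [hθX, RingEquiv.apply_symm_apply]
        ext <;> simp
      · rw [map_zero, map_zero]
        ext <;> simp
    · change E.t ∣ θ (F.taylor i a) - F.epsLift hRA i ℓ a
      obtain ⟨s, hs⟩ : PowerSeries.X ∣ F.taylor i a - PowerSeries.C a := by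
        rw [PowerSeries.X_dvd_iff, map_sub, constantCoeff_taylor]; simp
      rw [sub_eq_iff_eq_add'] at hs
      rw [hs, map_add, map_mul, hθX]
      have h1 : θ (PowerSeries.C a) = ℓ.map (B.epsHom _ _) a := seriesEval_C _ _ _ _ _
      rw [h1, add_sub_right_comm]
      exact dvd_add (Lift.t_dvd_sub _ _ _) (hc.mul_right _)
  have h1 : e (F.epsLift hRA i ℓ a) = e (θ (F.taylor i a)) := congr(e ($heq.symm a))
  refine h1.trans ?_
  -- This is the specialisation of `ε` to `xᵢ`. Multiplication by `ε` takes `w` to `ev w` times `ε`,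
  -- so `ev` computes the coefficient of `ε` in `Y S(Y)`.
  let ev : E →+* B :=
    { toFun := fun w => (e w).re + ℓ (F.x i) * (e w).im
      map_one' := by simp [QuadraticAlgebra.re_one, QuadraticAlgebra.im_one]
      map_zero' := by simp
      map_add' := fun _ _ => by simp; ring
      map_mul' := fun _ _ => by simp; ring }
  have hev (s : A⟦X⟧) : ev (θ s) = ℓ.hat (PowerSeries.rescale (F.x i) s) := by
    have h3 : ev (θ PowerSeries.X) = ℓ (F.x i) * B.t := by
      rw [hθX]
      change (e (e.symm _)).re + _ * (e (e.symm _)).im = _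
      rw [RingEquiv.apply_symm_apply]
      simp
    have : ev.comp θ = ℓ.hat.comp (PowerSeries.rescale (F.x i)) := by
      refine series_ringHom_ext B.isAdicComplete ?_ ?_ fun a => ?_
      · rw [RingHom.comp_apply, h3]
        exact dvd_mul_left _ _
      · rw [RingHom.comp_apply, h3, RingHom.comp_apply, PowerSeries.rescale_X, map_mul,
          Lift.hat_X, Lift.hat_C]
      · rw [RingHom.comp_apply, RingHom.comp_apply]
        change (e _).re + _ * (e _).im = _
        rw [hθC]
        have : PowerSeries.rescale (F.x i) (PowerSeries.C a) = PowerSeries.C a := by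
          ext n; cases n <;> simp [PowerSeries.coeff_rescale, PowerSeries.coeff_C]
        rw [this, Lift.hat_C]
        simp
    exact congr($this s)
  let S : A⟦X⟧ := PowerSeries.mk fun n => PowerSeries.coeff (n + 1) (F.taylor i a)
  have hS : F.taylor i a = PowerSeries.C a + PowerSeries.X * S := by
    ext n
    cases n with
    | zero => simp [constantCoeff_taylor]
    | succ n => simp [S, PowerSeries.coeff_succ_X_mul]
  have hS' : PowerSeries.rescale (F.x i) S = PowerSeries.mk fun n => F.qDerCoeff i n a := by
    ext n
    simp [S, PowerSeries.coeff_rescale, qDerCoeff, hasse]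
  rw [hS, map_add, map_mul, hθX, map_add, hθC, map_mul, ← hS', ← hev, RingEquiv.apply_symm_apply]
  change _ = (⟨_, B.t * ((e (θ S)).re + ℓ (F.x i) * (e (θ S)).im)⟩ : Eps (ℓ (F.x i)))
  ext
  · simp
  · simp
    ring

end EpsLift
end Framing
end QDeRham
end

/-! ### The `q`-difference operators on natural functions -/

noncomputable section
namespace QDeRham

set_option linter.unusedSectionVars false

open QStrat

namespace Framing
variable {R A : Type u} [CommRing R] [CommRing A] [Algebra R A] [LambdaRing R] [LambdaRing A]
  (F : Framing R A) [Module.Flat ℤ R] (hRA : IsLambdaHom (algebraMap R A)) (i : Fin F.dim)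
  {J J' : Type}

/-- The family of lifts to `B[ε]` where the first lift is moved in the direction of `xᵢ`. -/
def epsFam {B : QStrat R A} (ℓ : Option J → Lift B) (k : Option J) :
    Lift (B.eps (ℓ none (F.x i)) (F.isRankOne_lift_x i (ℓ none))) :=
  k.elim (F.epsLift hRA i (ℓ none)) fun k => (ℓ (some k)).map (B.epsHom _ _)

theorem map_epsFam {B C : QStrat R A} (f : B ⟶ C) (ℓ : Option J → Lift B) :
    (fun k => (F.epsFam hRA i ℓ k).map
      (epsMap f (F.isRankOne_lift_x i ((ℓ none).map f)) rfl)) =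
      F.epsFam hRA i (fun k => (ℓ k).map f) := by
  funext k
  cases k with
  | none => exact F.map_epsLift hRA i (ℓ none) f
  | some k =>
    refine Lift.ext fun a => (epsEquiv _ _ _).injective ?_
    refine (epsEquiv_epsMap f _ rfl _).trans ?_
    change (⟨ringHom f _, ringHom f 0⟩ : Eps _) = ⟨_, 0⟩
    rw [map_zero]
    rfl

theorem map_epsFam_epsRe {B : QStrat R A} (ℓ : Option J → Lift B) :
    (fun k => (F.epsFam hRA i ℓ k).map (B.epsRe _ _)) = ℓ := by
  funext k
  cases k with
  | none => exact F.map_epsLift_epsRe hRA i (ℓ none)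
  | some k => rfl

/-- The value of a natural function on the lifts to `B[ε]`. -/
def epsVal (g : NatFun R A (Option J)) (B : QStrat R A) (ℓ : Option J → Lift B) :
    Eps (ℓ none (F.x i)) := epsEquiv _ _ _ (g.val _ (F.epsFam hRA i ℓ))

theorem epsVal_re (g : NatFun R A (Option J)) (B : QStrat R A) (ℓ : Option J → Lift B) :
    (F.epsVal hRA i g B ℓ).re = g.val B ℓ := by
  have := NatFun.natural g (B.epsRe _ _) (F.epsFam hRA i ℓ)
  rw [map_epsFam_epsRe] at this
  exact this.symm

theorem epsVal_add (g g' : NatFun R A (Option J)) (B : QStrat R A) (ℓ : Option J → Lift B) :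
    F.epsVal hRA i (g + g') B ℓ = F.epsVal hRA i g B ℓ + F.epsVal hRA i g' B ℓ := map_add _ _ _

theorem epsVal_mul (g g' : NatFun R A (Option J)) (B : QStrat R A) (ℓ : Option J → Lift B) :
    F.epsVal hRA i (g * g') B ℓ = F.epsVal hRA i g B ℓ * F.epsVal hRA i g' B ℓ := map_mul _ _ _

theorem epsVal_smul (s : R⟦X⟧) (g : NatFun R A (Option J)) (B : QStrat R A)
    (ℓ : Option J → Lift B) : F.epsVal hRA i (s • g) B ℓ =
      ⟨s • (F.epsVal hRA i g B ℓ).re, s • (F.epsVal hRA i g B ℓ).im⟩ := epsEquiv_smul s _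

/-- The `q`-difference operator in the direction of `xᵢ`, with respect to the first lift: the
coefficient of `ε` of the value on the lifts to `B[ε]`. -/
def dOp : NatFun R A (Option J) →ₗ[R⟦X⟧] NatFun R A (Option J) where
  toFun g := NatFun.mk (fun B ℓ => (F.epsVal hRA i g B ℓ).im) fun B C f ℓ => by
    have := NatFun.natural g (epsMap f (F.isRankOne_lift_x i ((ℓ none).map f)) rfl)
      (F.epsFam hRA i ℓ)
    rw [map_epsFam] at this
    exact congr(QuadraticAlgebra.im (epsEquiv _ _ _ $this))
  map_add' g g' := NatFun.ext fun B ℓ => by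
    simp only [NatFun.mk_val, NatFun.add_apply, epsVal_add, QuadraticAlgebra.im_add]
  map_smul' s g := NatFun.ext fun B ℓ => by
    simp only [NatFun.mk_val, RingHom.id_apply, NatFun.smul_apply, epsVal_smul]

theorem dOp_val (g : NatFun R A (Option J)) (B : QStrat R A) (ℓ : Option J → Lift B) :
    (F.dOp hRA i g).val B ℓ = (F.epsVal hRA i g B ℓ).im := rfl

theorem epsVal_eq (g : NatFun R A (Option J)) (B : QStrat R A) (ℓ : Option J → Lift B) :
    F.epsVal hRA i g B ℓ = ⟨g.val B ℓ, (F.dOp hRA i g).val B ℓ⟩ := by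
  ext
  · exact F.epsVal_re hRA i g B ℓ
  · rfl

theorem dOp_pull (θ : J → J') (g : NatFun R A (Option J)) :
    F.dOp hRA i (NatFun.pull (Option.map θ) g) = NatFun.pull (Option.map θ) (F.dOp hRA i g) := by
  ext B ℓ
  have : (F.epsFam hRA i ℓ) ∘ Option.map θ = F.epsFam hRA i (ℓ ∘ Option.map θ) := by
    funext k
    cases k <;> rfl
  exact congr(QuadraticAlgebra.im (epsEquiv _ _ _ (g.val _ $this)))

/-- Only the lift `none` is moved in `B[ε]`. The others are extended constantly, so the value of `c`
has no component along `ε`. -/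
theorem dOp_pull_some (c : NatFun R A J) : F.dOp hRA i (NatFun.pull some c) = 0 := by
  ext B ℓ
  have := NatFun.natural c (B.epsHom (ℓ none (F.x i)) (F.isRankOne_lift_x i (ℓ none))) (ℓ ∘ some)
  exact congr(QuadraticAlgebra.im (epsEquiv _ _ _ $this))

/-- The function `ℓ(xᵢ)`. -/
def coordFun : NatFun R A (Option J) := NatFun.mk (fun _ ℓ => ℓ none (F.x i)) fun _ _ _ _ => rfl

/-- The twisted Leibniz rule. -/
theorem dOp_mul (g g' : NatFun R A (Option J)) : F.dOp hRA i (g * g') =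
    g * F.dOp hRA i g' + F.dOp hRA i g * g' +
      F.coordFun i * F.dOp hRA i g * F.dOp hRA i g' := by
  ext B ℓ
  rw [dOp_val, epsVal_mul, epsVal_eq, epsVal_eq]
  simp only [QuadraticAlgebra.im_mul, NatFun.add_apply, NatFun.mul_apply]
  rfl

theorem dOp_pull_some_mul (c : NatFun R A J) (g : NatFun R A (Option J)) :
    F.dOp hRA i (NatFun.pull some c * g) = NatFun.pull some c * F.dOp hRA i g := by
  rw [dOp_mul, dOp_pull_some]
  simp

end Framing

/-- The function `ℓₒ(f)`, for a power series `f`. -/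
def NatFun.hat {R A : Type u} [CommRing R] [CommRing A] [Algebra R A] [LambdaRing R] [LambdaRing A]
    {J : Type} (o : J) : A⟦X⟧ →ₐ[R⟦X⟧] NatFun R A J where
  toFun f := NatFun.mk (fun _ ℓ => (ℓ o).hat f) fun _ _ g ℓ => (ℓ o).hat_map g f
  map_one' := by ext; simp
  map_mul' _ _ := by ext; simp
  map_zero' := by ext; simp
  map_add' _ _ := by ext; simp
  commutes' s := NatFun.ext fun _ ℓ => (ℓ o).hat_algebraMap s

namespace NatFun
variable {R A : Type u} [CommRing R] [CommRing A] [Algebra R A] [LambdaRing R] [LambdaRing A]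
  {J J' : Type}

@[simp] theorem hat_val (o : J) (f : A⟦X⟧) (B : QStrat R A) (ℓ : J → Lift B) :
    (hat o f : NatFun R A J).val B ℓ = (ℓ o).hat f := rfl

theorem pull_hat (θ : J → J') (o : J) (f : A⟦X⟧) :
    pull θ (hat o f : NatFun R A J) = hat (θ o) f := rfl

theorem hat_sub_hat_dvd (o o' : J) (f : A⟦X⟧) : (τ : NatFun R A J) ∣ hat o f - hat o' f := by
  rw [τ_dvd_iff]
  exact fun B ℓ => Lift.hat_sub_mem _ _ _

end NatFun

namespace Framing
variable {R A : Type u} [CommRing R] [CommRing A] [Algebra R A] [LambdaRing R] [LambdaRing A]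
  (F : Framing R A) [Module.Flat ℤ R] (hRA : IsLambdaHom (algebraMap R A)) (i : Fin F.dim)
  {J J' : Type}

theorem qDer_C (a : A) : F.qDer i (PowerSeries.C a) = PowerSeries.mk fun n => F.qDerCoeff i n a := by
  ext n
  simp only [qDer, seriesOp, LinearMap.coe_mk, AddHom.coe_mk, PowerSeries.coeff_mk]
  rw [Finset.sum_eq_single (0, n)]
  · simp
  · rintro ⟨p, q⟩ hpq hne
    have : p ≠ 0 := by
      rintro rfl
      rw [Finset.HasAntidiagonal.mem_antidiagonal] at hpq
      exact hne (by simp [← hpq])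
    simp [PowerSeries.coeff_C, this]
  · simp

/-- On constant series this is `epsLift_apply`. Both sides are linear over `R⟦q - 1⟧`, so removing
the constant term raises the power of `q - 1` modulo which they are known to agree. -/
theorem dOp_hat (f : A⟦X⟧) : F.dOp hRA i (NatFun.hat none f : NatFun R A (Option J)) =
    NatFun.τ * NatFun.hat none (F.qDer i f) := by
  have hC (a : A) : F.dOp hRA i (NatFun.hat none (PowerSeries.C a) : NatFun R A (Option J)) =
      NatFun.τ * NatFun.hat none (F.qDer i (PowerSeries.C a)) := by
    ext B ℓ
    rw [qDer_C]
    have h1 : ((F.epsFam hRA i ℓ) none).hat (PowerSeries.C a) = F.epsLift hRA i (ℓ none) a :=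
      Lift.hat_C _ a
    have h2 := F.epsLift_apply hRA i (ℓ none) a
    rw [← h1] at h2
    exact congr(QuadraticAlgebra.im $h2)
  refine NatFun.eq_of_forall_dvd fun n => ?_
  induction n generalizing f with
  | zero => simp
  | succ n ih =>
    obtain ⟨f', hf'⟩ : PowerSeries.X ∣ f - PowerSeries.C (PowerSeries.constantCoeff f) := by
      rw [PowerSeries.X_dvd_iff]; simp
    obtain ⟨e, he⟩ := ih f'
    have hX : PowerSeries.X * f' = (PowerSeries.X : R⟦X⟧) • f' := by
      rw [Algebra.smul_def, algebraMap_series_X]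
    rw [sub_eq_iff_eq_add', hX] at hf'
    rw [hf', map_add, map_add, map_add, hC, map_smul, map_smul, map_smul, map_add, map_smul,
      NatFun.X_smul, NatFun.X_smul]
    exact ⟨e, by linear_combination NatFun.τ * he⟩

/-- In `B[ε]` the `q`-divided powers of the moved coordinate are `Lₙ + Lₙ₋₁ ε`: these elements
satisfy the recursion, and its solution is unique. The operators are thus shifts of indices on the
monomials, which is the property that makes the `q`-Poincaré lemma work. -/
theorem dOp_qMon (o : J) (k : Fin F.dim → ℕ) : F.dOp hRA i (F.qMon o k) =
    if k i = 0 then 0 else F.qMon o (Function.update k i (k i - 1)) := by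
  ext B ℓ
  let L (j : Fin F.dim) (n : ℕ) : B := qDivided B.t (ℓ (some o) (F.x j)) (ℓ none (F.x j)) n
  have ha (j : Fin F.dim) := F.isRankOne_lift_x j (ℓ (some o))
  have hb (j : Fin F.dim) := F.isRankOne_lift_x j (ℓ none)
  have hab (j : Fin F.dim) := (ℓ none).t_dvd_sub (ℓ (some o)) (F.x j)
  set E := B.eps (ℓ none (F.x i)) (F.isRankOne_lift_x i (ℓ none)) with hE
  let e : E ≃+* Eps (ℓ none (F.x i)) := epsEquiv _ _ _
  let μ : Option J → Lift E := F.epsFam hRA i ℓ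
  have het : e E.t = algebraMap B _ B.t := rfl
  have hfac (j : Fin F.dim) (n : ℕ) : e (qDivided E.t (μ (some o) (F.x j)) (μ none (F.x j)) n) =
      ⟨L j n, if j = i then (if n = 0 then 0 else L j (n - 1)) else 0⟩ := by
    have h0 := E.isQRing.qDivided_unique (F.isRankOne_lift_x j (μ (some o)))
      (F.isRankOne_lift_x j (μ none)) ((μ none).t_dvd_sub (μ (some o)) (F.x j))
      (fun n => e.symm ⟨L j n, if j = i then (if n = 0 then 0 else L j (n - 1)) else 0⟩) ?_ ?_ n
    · rw [h0, RingEquiv.apply_symm_apply]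
    · apply e.injective
      rw [RingEquiv.apply_symm_apply, map_one]
      ext
      · simp only [L]
        rw [B.isQRing.qDivided_zero (ha j) (hb j) (hab j)]; rfl
      · simp [QuadraticAlgebra.im_one]
    · intro n
      apply e.injective
      have h1 : e (μ (some o) (F.x j)) = algebraMap B _ (ℓ (some o) (F.x j)) := rfl
      have h2 : e (μ none (F.x j)) = ⟨ℓ none (F.x j), if j = i then B.t else 0⟩ :=
        F.epsLift_x hRA i (ℓ none) j
      simp only [map_mul, map_sub, map_pow, map_add, map_one, RingEquiv.apply_symm_apply, h1, h2,
        het]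
      have h3 : (1 + algebraMap B (Eps (ℓ none (F.x i))) B.t) = algebraMap B _ (1 + B.t) := by
        rw [map_add, map_one]
      have h5 (b : B) : algebraMap B (Eps (ℓ none (F.x i))) b - 1 = algebraMap B _ (b - 1) := by
        rw [map_sub, map_one]
      rw [h3, ← map_pow, ← map_pow, ← map_mul, h5]
      have h4 := B.isQRing.qDivided_succ (ha j) (hb j) (hab j) n
      ext
      · simp only [QuadraticAlgebra.re_mul, QuadraticAlgebra.algebraMap_re,
          QuadraticAlgebra.algebraMap_im, QuadraticAlgebra.re_sub, zero_mul, add_zero]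
        exact h4
      · simp only [QuadraticAlgebra.im_mul, QuadraticAlgebra.algebraMap_re,
          QuadraticAlgebra.algebraMap_im, QuadraticAlgebra.re_sub, QuadraticAlgebra.im_sub,
          zero_mul, mul_zero, add_zero, sub_zero, n.succ_ne_zero, if_false, Nat.add_sub_cancel]
        split_ifs with hji hn
        · subst hji hn
          simp only [L]
          rw [B.isQRing.qDivided_zero (ha j) (hb j) (hab j)]
          ring
        · subst hji
          obtain ⟨n, rfl⟩ := Nat.exists_eq_succ_of_ne_zero hn
          have h5 := B.isQRing.qDivided_succ (ha j) (hb j) (hab j) n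
          simp only [L, Nat.succ_eq_add_one, Nat.add_sub_cancel]
          linear_combination (1 + B.t) * h5
        · ring
  have hval : F.epsVal hRA i (F.qMon o k) B ℓ = ∏ j, (⟨L j (k j),
      if j = i then (if k j = 0 then 0 else L j (k j - 1)) else 0⟩ : Eps (ℓ none (F.x i))) := by
    have h0 : F.epsVal hRA i (F.qMon o k) B ℓ = e (qMonomial E.t (fun j => μ (some o) (F.x j))
      (fun j => μ none (F.x j)) k) := rfl
    rw [h0, qMonomial, map_prod]
    exact Finset.prod_congr rfl fun j _ => hfac j (k j)
  rw [dOp_val, hval, ← Finset.mul_prod_erase _ _ (Finset.mem_univ i)]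
  have hrest : ∏ j ∈ Finset.univ.erase i, (⟨L j (k j),
      if j = i then (if k j = 0 then 0 else L j (k j - 1)) else 0⟩ : Eps (ℓ none (F.x i))) =
      algebraMap B _ (∏ j ∈ Finset.univ.erase i, L j (k j)) := by
    rw [map_prod]
    refine Finset.prod_congr rfl fun j hj => ?_
    rw [if_neg (Finset.ne_of_mem_erase hj)]
    rfl
  rw [hrest]
  simp only [QuadraticAlgebra.im_mul, QuadraticAlgebra.algebraMap_re,
    QuadraticAlgebra.algebraMap_im, mul_zero, if_true, zero_add, add_zero]
  split_ifs with hk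
  · simp
  · rw [qMon_apply, qMonomial, ← Finset.mul_prod_erase _ _ (Finset.mem_univ i),
      Function.update_self]
    congr 1
    refine Finset.prod_congr rfl fun j hj => ?_
    rw [Function.update_of_ne (Finset.ne_of_mem_erase hj)]

end Framing
end QDeRham
end

/-! ### The `q`-Poincaré lemma: constants and integration -/

noncomputable section
namespace QDeRham

set_option linter.unusedSectionVars false

open QStrat

namespace Framing
variable {R A : Type u} [CommRing R] [CommRing A] [Algebra R A] [LambdaRing R] [LambdaRing A]
  (F : Framing R A) [Module.Flat ℤ R] (hRA : IsLambdaHom (algebraMap R A))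
  {J : Type} (o : J)

/-- The linear combination of the `q`-divided monomials with given coefficients. -/
def expand : ((Fin F.dim → ℕ) →₀ NatFun R A J) →+ NatFun R A (Option J) :=
  Finsupp.liftAddHom fun k => (AddMonoidHom.mulRight (F.qMon o k)).comp
    (NatFun.pull (R := R) (A := A) some : NatFun R A J →ₐ[R⟦X⟧] _).toRingHom.toAddMonoidHom

theorem expand_apply (s : (Fin F.dim → ℕ) →₀ NatFun R A J) :
    F.expand o s = s.sum fun k c => NatFun.pull some c * F.qMon o k := rfl

theorem expand_single (k : Fin F.dim → ℕ) (c : NatFun R A J) :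
    F.expand o (Finsupp.single k c) = NatFun.pull some c * F.qMon o k := by
  rw [expand_apply, Finsupp.sum_single_index (by simp)]

/-- The effect of `dOp` on the coefficients of an expansion. -/
def shift (i : Fin F.dim) : ((Fin F.dim → ℕ) →₀ NatFun R A J) →+
    ((Fin F.dim → ℕ) →₀ NatFun R A J) :=
  Finsupp.liftAddHom fun k => if k i = 0 then 0 else
    Finsupp.singleAddHom (Function.update k i (k i - 1))

theorem shift_single (i : Fin F.dim) (k : Fin F.dim → ℕ) (c : NatFun R A J) :
    F.shift i (Finsupp.single k c) =
      if k i = 0 then 0 else Finsupp.single (Function.update k i (k i - 1)) c := by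
  rw [shift, Finsupp.liftAddHom_apply_single]
  split_ifs <;> rfl

theorem shift_apply (i : Fin F.dim) (s : (Fin F.dim → ℕ) →₀ NatFun R A J) (m : Fin F.dim → ℕ) :
    F.shift i s m = s (Function.update m i (m i + 1)) := by
  classical
  induction s using Finsupp.induction_linear with
  | zero => simp
  | add s s' hs hs' => rw [map_add, Finsupp.add_apply, hs, hs', Finsupp.add_apply]
  | single k c =>
    rw [shift_single, Finsupp.single_apply]
    split_ifs with h1 h2 h2
    · rw [h2] at h1
      simp at h1
    · rfl
    · subst h2
      simp
    · rw [Finsupp.single_eq_of_ne]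
      rintro rfl
      refine h2 ?_
      simp only [Function.update_self, Function.update_idem]
      rw [Nat.sub_add_cancel (Nat.one_le_iff_ne_zero.2 h1), Function.update_eq_self]

theorem dOp_expand (i : Fin F.dim) (s : (Fin F.dim → ℕ) →₀ NatFun R A J) :
    F.dOp hRA i (F.expand o s) = F.expand o (F.shift i s) := by
  induction s using Finsupp.induction_linear with
  | zero => simp
  | add s s' hs hs' => rw [map_add, map_add, hs, hs', map_add, map_add]
  | single k c =>
    rw [expand_single, dOp_pull_some_mul, dOp_qMon, shift_single]
    split_ifs
    · simp
    · rw [expand_single]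

theorem shift_comm (i j : Fin F.dim) (s : (Fin F.dim → ℕ) →₀ NatFun R A J) :
    F.shift i (F.shift j s) = F.shift j (F.shift i s) := by
  ext1 m
  simp only [shift_apply]
  rcases eq_or_ne i j with rfl | hij
  · rfl
  · rw [Function.update_of_ne hij.symm, Function.update_of_ne hij, Function.update_comm hij]

variable {o} (hJ : ∃ (U : QStrat R A) (υ : J → Lift U), IsUniversal υ)
include hJ hRA o

theorem exists_eq_expand (g : NatFun R A (Option J)) :
    ∃ (s : (Fin F.dim → ℕ) →₀ NatFun R A J) (g' : NatFun R A (Option J)),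
      g = F.expand o s + NatFun.τ * g' := by
  obtain ⟨s, g', h⟩ := F.exists_expansion hJ hRA o g
  exact ⟨s, g', by rw [expand_apply, ← h]; ring⟩

/-- On expansions the operators are shifts of indices, which commute. An arbitrary function is an
expansion up to a multiple of `q - 1`, so the commutator is divisible by all powers of `q - 1`. -/
theorem dOp_comm (i j : Fin F.dim) (g : NatFun R A (Option J)) :
    F.dOp hRA i (F.dOp hRA j g) = F.dOp hRA j (F.dOp hRA i g) := by
  refine NatFun.eq_of_forall_dvd fun n => ?_
  induction n generalizing g with
  | zero => simp
  | succ n ih =>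
    obtain ⟨s, g', rfl⟩ := F.exists_eq_expand hRA (o := o) hJ g
    obtain ⟨e, he⟩ := ih g'
    refine ⟨e, ?_⟩
    simp only [map_add, dOp_expand, NatFun.map_τ_mul, F.shift_comm i j]
    linear_combination NatFun.τ * he

theorem τ_dvd_of_dOp_expand (i : Fin F.dim) (s : (Fin F.dim → ℕ) →₀ NatFun R A J)
    (h : NatFun.τ ∣ F.dOp hRA i (F.expand o s)) (k : Fin F.dim → ℕ) (hk : k i ≠ 0) :
    NatFun.τ ∣ s k := by
  rw [dOp_expand] at h
  have := F.τ_dvd_of_expansion hJ hRA o _ h (Function.update k i (k i - 1))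
  rwa [shift_apply, Function.update_self, Function.update_idem,
    Nat.sub_add_cancel (Nat.one_le_iff_ne_zero.2 hk), Function.update_eq_self] at this

/-- If the operator in direction `j` kills `f`, uniqueness of expansions modulo `q - 1` shows that
the coefficients of monomials involving that direction are divisible by `q - 1`. They are moved to
the remainder, which is again killed since `q - 1` can be cancelled. This allows successive
approximation inside the common kernel. -/
theorem exists_reduced_expansion (P : Set (Fin F.dim)) (f : NatFun R A (Option J))
    (hf : ∀ j ∈ P, F.dOp hRA j f = 0) :
    ∃ (s : (Fin F.dim → ℕ) →₀ NatFun R A J) (f' : NatFun R A (Option J)),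
      f = F.expand o s + NatFun.τ * f' ∧ (∀ k, s k ≠ 0 → ∀ j ∈ P, k j = 0) ∧
      ∀ j ∈ P, F.dOp hRA j f' = 0 := by
  classical
  obtain ⟨s, g, hsg⟩ := F.exists_eq_expand hRA (o := o) hJ f
  let s' := s.filter fun k => ∀ j ∈ P, k j = 0
  have hs (k : Fin F.dim → ℕ) : NatFun.τ ∣ (s - s') k := by
    rw [Finsupp.sub_apply]
    by_cases hk : ∀ j ∈ P, k j = 0
    · rw [Finsupp.filter_apply_pos _ _ hk, sub_self]
      exact dvd_zero _
    · rw [Finsupp.filter_apply_neg _ _ hk, sub_zero]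
      push Not at hk
      obtain ⟨j, hj, hkj⟩ := hk
      refine F.τ_dvd_of_dOp_expand hRA (o := o) hJ j s ⟨-F.dOp hRA j g, ?_⟩ k hkj
      have := congrArg (F.dOp hRA j) hsg
      rw [hf j hj, map_add, NatFun.map_τ_mul] at this
      linear_combination -this
  obtain ⟨e, he⟩ : NatFun.τ ∣ F.expand o (s - s') := by
    rw [expand_apply]
    refine Finset.dvd_sum fun k _ => ?_
    obtain ⟨c, hc⟩ := hs k
    beta_reduce
    rw [hc, map_mul, NatFun.pull_τ, mul_assoc]
    exact dvd_mul_right _ _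
  rw [map_sub] at he
  have hs' (k : Fin F.dim → ℕ) (hk : s' k ≠ 0) : ∀ j ∈ P, k j = 0 := by
    by_contra hP
    exact hk (Finsupp.filter_apply_neg _ _ hP)
  have hf' : f = F.expand o s' + NatFun.τ * (e + g) := by linear_combination hsg + he
  refine ⟨s', e + g, hf', hs', fun j hj => ?_⟩
  have h0 : F.shift j s' = 0 := by
    ext1 m
    rw [shift_apply]
    by_contra hne
    have := hs' _ hne j hj
    simp at this
  have := congrArg (F.dOp hRA j) hf'
  rw [hf j hj, map_add, NatFun.map_τ_mul, dOp_expand, h0, map_zero, zero_add] at this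
  exact NatFun.τ_mul_cancel (by rw [← this, mul_zero])

omit hJ hRA in
theorem qMon_zero : F.qMon o (0 : Fin F.dim → ℕ) = 1 := by
  ext B ℓ
  rw [qMon_apply, qMonomial]
  refine Finset.prod_eq_one fun j _ => ?_
  exact B.isQRing.qDivided_zero (F.isRankOne_lift_x j (ℓ (some o))) (F.isRankOne_lift_x j (ℓ none))
    ((ℓ none).t_dvd_sub (ℓ (some o)) (F.x j))

/-- A function that is killed by all the `q`-difference operators does not depend on the first
lift. -/
theorem exists_pull_some_eq (f : NatFun R A (Option J)) (hf : ∀ j, F.dOp hRA j f = 0) :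
    ∃ c : NatFun R A J, NatFun.pull some c = f := by
  suffices h : ∃ c ∈ (⊤ : Submodule R⟦X⟧ (NatFun R A J)),
      (NatFun.pull (some : J → Option J) : NatFun R A J →ₐ[R⟦X⟧] _).toLinearMap c = f by
    obtain ⟨c, -, hc⟩ := h
    exact ⟨c, hc⟩
  refine NatFun.exists_map_eq _ {f | ∀ j, F.dOp hRA j f = 0} ⊤ (fun _ _ => trivial)
    (fun y hy => ?_) f hf
  obtain ⟨s, y', h, hs, hy'⟩ := F.exists_reduced_expansion hRA (o := o) hJ Set.univ y
    fun j _ => hy j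
  refine ⟨s 0, trivial, y', fun j => hy' j trivial, ?_⟩
  -- With all directions excluded only the monomial `1` is left, so the expansion is a function of
  -- the other lifts.
  have h1 : s = Finsupp.single 0 (s 0) := by
    ext1 k
    rcases eq_or_ne k 0 with rfl | hk
    · simp
    · rw [Finsupp.single_eq_of_ne hk]
      by_contra hne
      exact hk (funext fun j => hs k hne j trivial)
  rw [h1, expand_single, qMon_zero, mul_one] at h
  exact h

/-- Integration with respect to the coordinate `xᵣ`. -/
theorem exists_dOp_eq (r : Fin F.dim) (f : NatFun R A (Option J))
    (hf : ∀ j < r, F.dOp hRA j f = 0) :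
    ∃ g, F.dOp hRA r g = f ∧ ∀ j < r, F.dOp hRA j g = 0 := by
  let Q : Submodule R⟦X⟧ (NatFun R A (Option J)) := ⨅ j : Set.Iio r, (F.dOp hRA j).ker
  have hQ (g : NatFun R A (Option J)) : g ∈ Q ↔ ∀ j < r, F.dOp hRA j g = 0 := by
    simp [Q, Submodule.mem_iInf]
  suffices h : ∃ g ∈ Q, F.dOp hRA r g = f by
    obtain ⟨g, hg, h⟩ := h
    exact ⟨g, h, (hQ g).1 hg⟩
  refine NatFun.exists_map_eq (F.dOp hRA r) {f | ∀ j < r, F.dOp hRA j f = 0} Q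
    (fun g hg => ?_) (fun y hy => ?_) f hf
  · rw [hQ]
    refine fun j hj => NatFun.eq_of_forall_dvd fun n => ?_
    obtain ⟨g', hg', h⟩ := hg n
    have := NatFun.τ_pow_dvd_map (F.dOp hRA j) n h
    rwa [map_sub, (hQ g').1 hg' j hj] at this
  · obtain ⟨s, y', h, hs, hy'⟩ := F.exists_reduced_expansion hRA (o := o) hJ (Set.Iio r) y hy
    -- Raising the exponent of `xᵣ` by one integrates each monomial without denominators. It
    -- introduces no smaller variable, so the result stays in the kernel of the operators in the
    -- directions below `r`.
    refine ⟨s.sum fun k c => NatFun.pull some c * F.qMon o (Function.update k r (k r + 1)), ?_,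
      y', hy', ?_⟩
    · rw [hQ]
      intro j hj
      rw [map_finsuppSum]
      refine Finset.sum_eq_zero fun k hk => ?_
      beta_reduce
      rw [dOp_pull_some_mul, dOp_qMon, Function.update_of_ne hj.ne,
        if_pos (hs k (Finsupp.mem_support_iff.1 hk) j hj), mul_zero]
    · rw [h, map_finsuppSum, expand_apply]
      congr 1
      refine Finset.sum_congr rfl fun k _ => ?_
      beta_reduce
      rw [dOp_pull_some_mul, dOp_qMon]
      simp

end Framing
end QDeRham
end

/-! ### Koszul complexes of commuting operators -/

noncomputable section
namespace QDeRham

set_option linter.unusedSectionVars false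

namespace Koszul

/-- Index sets of the monomials in `d` anticommuting variables of degree `n`. -/
abbrev Idx (d n : ℕ) : Type := Set.powersetCard (Fin d) n

variable {d n : ℕ}

/-- The set of values of an injective family. -/
def valueSet (v : Fin n → Fin d) (hv : Function.Injective v) : Idx d n :=
  Set.powersetCard.ofFinEmbEquiv (OrderEmbedding.ofStrictMono (v ∘ Tuple.sort v)
    ((Tuple.monotone_sort v).strictMono_of_injective (hv.comp (Tuple.sort v).injective)))

theorem mem_valueSet (v : Fin n → Fin d) (hv : Function.Injective v) (k : Fin d) :
    k ∈ (valueSet v hv).1 ↔ k ∈ Set.range v := by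
  refine (Set.powersetCard.mem_ofFinEmbEquiv_iff_mem_range _ k).trans ?_
  change k ∈ Set.range (v ∘ Tuple.sort v) ↔ _
  rw [(Tuple.sort v).surjective.range_comp]

section Basis
variable {S M : Type*} [CommRing S] [AddCommGroup M] [Module S M] (b : Module.Basis (Fin d) S M)

theorem ιMulti_basis_comp (v : Fin n → Fin d) (hv : Function.Injective v) :
    exteriorPower.ιMulti S n (b ∘ v) =
      (Equiv.Perm.sign (Tuple.sort v) : ℤ) • b.exteriorPower n (valueSet v hv) := by
  have hI : b.exteriorPower n (valueSet v hv) =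
      exteriorPower.ιMulti S n ((b ∘ v) ∘ Tuple.sort v) := by
    rw [exteriorPower.basis_apply, exteriorPower.ιMulti_family, valueSet, Equiv.symm_apply_apply]
    rfl
  rw [AlternatingMap.map_perm] at hI
  rw [hI, Units.smul_def, smul_smul, ← Units.val_mul]
  simp

/-- The coefficients of `eᵢ ∧ e_I` with respect to the monomials `e_J`. -/
def coef (i : Fin d) (I : Idx d n) (J : Idx d (n + 1)) : ℤ :=
  open Classical in
  if h : Function.Injective (Fin.cons i (Set.powersetCard.ofFinEmbEquiv.symm I) : Fin (n + 1) → Fin d) then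
    if J = valueSet _ h then
      (Equiv.Perm.sign (Tuple.sort
        (Fin.cons i (Set.powersetCard.ofFinEmbEquiv.symm I) : Fin (n + 1) → Fin d)) : ℤ)
    else 0
  else 0

theorem ι_mul_basis (i : Fin d) (I : Idx d n) :
    ExteriorAlgebra.ι S (b i) * (b.exteriorPower n I : ExteriorAlgebra S M) =
      ∑ J, coef i I J • (b.exteriorPower (n + 1) J : ExteriorAlgebra S M) := by
  classical
  let v : Fin (n + 1) → Fin d := Fin.cons i (Set.powersetCard.ofFinEmbEquiv.symm I)
  have h1 : ExteriorAlgebra.ι S (b i) * (b.exteriorPower n I : ExteriorAlgebra S M) =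
      (exteriorPower.ιMulti S (n + 1) (b ∘ v) : ExteriorAlgebra S M) := by
    rw [exteriorPower.basis_apply, exteriorPower.ιMulti_family]
    change _ * ExteriorAlgebra.ιMulti S n _ = ExteriorAlgebra.ιMulti S (n + 1) _
    rw [ExteriorAlgebra.ιMulti_succ_apply]
    rfl
  rw [h1]
  by_cases h : Function.Injective v
  · rw [ιMulti_basis_comp b v h, Finset.sum_eq_single (valueSet v h)]
    · rw [coef, dif_pos h, if_pos rfl]
      rfl
    · intro J _ hJ
      rw [coef, dif_pos h, if_neg hJ, zero_smul]
    · simp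
  · rw [AlternatingMap.map_eq_zero_of_not_injective _ _ fun h' => h h'.of_comp]
    symm
    refine Finset.sum_eq_zero fun J _ => ?_
    rw [coef, dif_neg h, zero_smul]

theorem injective_cons_iff (i : Fin d) (I : Idx d n) :
    Function.Injective (Fin.cons i (Set.powersetCard.ofFinEmbEquiv.symm I) : Fin (n + 1) → Fin d) ↔
      i ∉ I.1 := by
  rw [Fin.cons_injective_iff]
  have := Set.powersetCard.mem_range_ofFinEmbEquiv_symm_iff_mem I i
  constructor
  · intro h hi
    exact h.1 (this.2 hi)
  · intro h
    exact ⟨fun hi => h (this.1 hi), (Set.powersetCard.ofFinEmbEquiv.symm I).injective⟩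

theorem eq_valueSet_cons_iff (i : Fin d) (I : Idx d n) (J : Idx d (n + 1)) (h) :
    J = valueSet (Fin.cons i (Set.powersetCard.ofFinEmbEquiv.symm I)) h ↔
      J.1 = insert i I.1 := by
  have (k : Fin d) : k ∈ (valueSet (Fin.cons i (Set.powersetCard.ofFinEmbEquiv.symm I)) h).1 ↔
      k ∈ insert i I.1 := by
    rw [mem_valueSet, Fin.range_cons, Set.mem_insert_iff, Finset.mem_insert]
    exact or_congr_right (Set.powersetCard.mem_range_ofFinEmbEquiv_symm_iff_mem I k)
  rw [Subtype.ext_iff]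
  constructor
  · intro hJ
    ext k
    rw [hJ, this]
  · intro hJ
    ext k
    rw [hJ, this]

theorem coef_eq_zero_of_ne {i : Fin d} {I : Idx d n} {J : Idx d (n + 1)}
    (h : J.1 ≠ insert i I.1) : coef i I J = 0 := by
  classical
  rw [coef]
  split_ifs with h1 h2
  · exact absurd ((eq_valueSet_cons_iff i I J h1).1 h2) h
  · rfl
  · rfl

theorem coef_mul_self {i : Fin d} {I : Idx d n} {J : Idx d (n + 1)} (hi : i ∉ I.1)
    (h : J.1 = insert i I.1) : coef i I J * coef i I J = 1 := by
  classical
  rw [coef, dif_pos ((injective_cons_iff i I).2 hi), if_pos ((eq_valueSet_cons_iff i I J _).2 h),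
    ← Units.val_mul]
  simp

end Basis

/-- The forms `eᵢ` anticommute. -/
theorem sum_coef_mul (i j : Fin d) (I : Idx d n) (K : Idx d (n + 1 + 1)) :
    ∑ J, coef i I J * coef j J K = -∑ J, coef j I J * coef i J K := by
  -- The coefficients are integers independent of the ring, so their identities can be read off in
  -- the exterior algebra over `ℤ`, where the monomials are linearly independent.
  let b := Pi.basisFun ℤ (Fin d)
  have h1 (i j : Fin d) : ExteriorAlgebra.ι ℤ (b j) * (ExteriorAlgebra.ι ℤ (b i) *
      (b.exteriorPower n I : ExteriorAlgebra ℤ (Fin d → ℤ))) =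
      ∑ K, (∑ J, coef i I J * coef j J K) •
        (b.exteriorPower (n + 1 + 1) K : ExteriorAlgebra ℤ (Fin d → ℤ)) := by
    simp only [ι_mul_basis, Finset.mul_sum, mul_smul_comm, Finset.smul_sum, smul_smul,
      Finset.sum_smul]
    exact Finset.sum_comm
  have h2 : ∑ K, (∑ J, coef i I J * coef j J K) • b.exteriorPower (n + 1 + 1) K =
      ∑ K, (-∑ J, coef j I J * coef i J K) • b.exteriorPower (n + 1 + 1) K := by
    apply Subtype.ext
    simp only [AddSubmonoidClass.coe_finsetSum, neg_smul, Finset.sum_neg_distrib, NegMemClass.coe_neg]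
    refine (h1 i j).symm.trans ?_
    refine Eq.trans ?_ (congrArg Neg.neg (h1 j i))
    rw [← mul_assoc, ← mul_assoc, ← neg_mul]
    congr 1
    rw [eq_neg_iff_add_eq_zero]
    exact ExteriorAlgebra.ι_add_mul_swap _ _
  have h3 (c : Idx d (n + 1 + 1) → ℤ) : (b.exteriorPower (n + 1 + 1)).repr
      (∑ K, c K • b.exteriorPower (n + 1 + 1) K) K = c K := by
    have := congrFun ((b.exteriorPower (n + 1 + 1)).repr_sum_self c) K
    exact this
  rw [← h3 (fun K => ∑ J, coef i I J * coef j J K), h2, h3]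

theorem sum_coef_mul_self (i : Fin d) (I : Idx d n) (K : Idx d (n + 1 + 1)) :
    ∑ J, coef i I J * coef i J K = 0 := by
  have := sum_coef_mul i i I K
  omega

section Complex
variable {S N : Type*} [CommRing S] [AddCommGroup N] [Module S N] (δ : Fin d → N →ₗ[S] N)

/-- The differential of the Koszul complex of a family of operators. -/
def D (n : ℕ) : (Idx d n → N) →ₗ[S] (Idx d (n + 1) → N) :=
  LinearMap.pi fun J => ∑ i, ∑ I, coef i I J • (δ i ∘ₗ LinearMap.proj I)

theorem D_apply (φ : Idx d n → N) (J : Idx d (n + 1)) :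
    D δ n φ J = ∑ i, ∑ I, coef i I J • δ i (φ I) := by
  simp [D]

variable (hcomm : ∀ i j x, δ i (δ j x) = δ j (δ i x))
include hcomm

theorem D_D (φ : Idx d n → N) : D δ (n + 1) (D δ n φ) = 0 := by
  ext K
  have h1 : D δ (n + 1) (D δ n φ) K =
      ∑ p : Fin d × Fin d, ∑ I, (∑ J, coef p.1 I J * coef p.2 J K) • δ p.2 (δ p.1 (φ I)) := by
    rw [D_apply, Fintype.sum_prod_type_right]
    simp only [D_apply, map_sum, map_zsmul, Finset.smul_sum, smul_smul, Finset.sum_smul]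
    refine Finset.sum_congr rfl fun j _ => ?_
    rw [Finset.sum_comm]
    refine Finset.sum_congr rfl fun i _ => ?_
    rw [Finset.sum_comm]
    refine Finset.sum_congr rfl fun I _ => ?_
    exact Finset.sum_congr rfl fun J _ => by rw [mul_comm]
  rw [h1]
  refine Finset.sum_involution (fun p _ => (p.2, p.1)) ?_ ?_ ?_ ?_
  · rintro ⟨i, j⟩ -
    rw [← Finset.sum_add_distrib]
    refine Finset.sum_eq_zero fun I _ => ?_
    simp only
    rw [sum_coef_mul i j, hcomm j i, neg_smul, neg_add_cancel]
  · rintro ⟨i, j⟩ - h hij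
    obtain rfl : j = i := congrArg Prod.fst hij
    exact h (Finset.sum_eq_zero fun I _ => by simp [sum_coef_mul_self])
  · simp
  · simp

/-- The Koszul complex of a regular family of surjective operators is exact in positive degrees. -/
theorem exists_D_eq (hint : ∀ (r : Fin d) (x : N), (∀ j < r, δ j x = 0) →
      ∃ y, δ r y = x ∧ ∀ j < r, δ j y = 0)
    (φ : Idx d (n + 1) → N) (hφ : D δ (n + 1) φ = 0) : ∃ ψ, D δ n ψ = φ := by
  classical
  -- After `r` corrections the rest has no component whose index set meets the first `r` directions,
  -- and all its components are killed by the first `r` operators. For `r = d` nothing is left,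
  -- because the index sets are nonempty.
  suffices h : ∀ r : ℕ, r ≤ d → ∃ ψ, (∀ J : Idx d (n + 1), (∃ s ∈ J.1, (s : ℕ) < r) →
      (φ - D δ n ψ) J = 0) ∧ ∀ s : Fin d, (s : ℕ) < r → ∀ J, δ s ((φ - D δ n ψ) J) = 0 by
    obtain ⟨ψ, h1, -⟩ := h d le_rfl
    refine ⟨ψ, (sub_eq_zero.1 (funext fun J => h1 J ?_)).symm⟩
    have hJ : J.1.card = n + 1 := J.2
    obtain ⟨s, hs⟩ := Finset.card_pos.1 (by omega : 0 < J.1.card)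
    exact ⟨s, hs, s.2⟩
  intro r
  induction r with
  | zero => exact fun _ => ⟨0, by simp, by simp⟩
  | succ r ih =>
    intro hr
    obtain ⟨ψ, h1, h2⟩ := ih (by omega)
    set φ' := φ - D δ n ψ with hφ'
    have hDφ' : D δ (n + 1) φ' = 0 := by rw [hφ', map_sub, hφ, D_D δ hcomm, sub_zero]
    let r' : Fin d := ⟨r, hr⟩
    have hf (I : Idx d n) : ∃ y, δ r' y = ∑ J, coef r' I J • φ' J ∧ ∀ j < r', δ j y = 0 := by
      refine hint r' _ fun j hj => ?_
      rw [map_sum]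
      exact Finset.sum_eq_zero fun J _ => by rw [map_zsmul, h2 j hj J, smul_zero]
    choose g' hg' hg'0 using hf
    -- The component with index set `I ∪ {r}` is integrated in the direction `r`; only sets `I`
    -- above `r` are needed, since components that meet earlier directions vanish already. The sign
    -- in `hg'` is undone by `coef_mul_self`.
    let g (I : Idx d n) : N := if ∀ s ∈ I.1, r' < s then g' I else 0
    have hg0 (I : Idx d n) (j) (hj : j < r') : δ j (g I) = 0 := by
      by_cases hI : ∀ s ∈ I.1, r' < s
      · simp only [g, if_pos hI]
        exact hg'0 I j hj
      · simp only [g, if_neg hI, map_zero]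
    have hgz (I : Idx d n) (s : Fin d) (hs : s ∈ I.1) (hsr : s ≤ r') : g I = 0 :=
      if_neg fun h => (h s hs).not_ge hsr
    have hA (J : Idx d (n + 1)) (s : Fin d) (hs : s ∈ J.1) (hsr : s < r') :
        D δ n g J = 0 := by
      rw [D_apply]
      refine Finset.sum_eq_zero fun i _ => Finset.sum_eq_zero fun I _ => ?_
      by_cases hc : J.1 = insert i I.1
      · rw [hc, Finset.mem_insert] at hs
        rcases hs with rfl | hs
        · rw [hg0 I s hsr, smul_zero]
        · rw [hgz I s hs hsr.le, map_zero, smul_zero]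
      · rw [coef_eq_zero_of_ne hc, zero_smul]
    have hB (J : Idx d (n + 1)) (hrJ : r' ∈ J.1) (hJ : ∀ s ∈ J.1, r' ≤ s) :
        D δ n g J = φ' J := by
      let I₀ : Idx d n := ⟨J.1.erase r', by
        have hc : J.1.card = n + 1 := J.2
        have := Finset.card_erase_of_mem hrJ
        change (J.1.erase r').card = n
        omega⟩
      have hI₀ : J.1 = insert r' I₀.1 := (Finset.insert_erase hrJ).symm
      have hrI₀ : r' ∉ I₀.1 := Finset.notMem_erase _ _
      rw [D_apply, Finset.sum_eq_single r', Finset.sum_eq_single I₀]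
      · have hlt : ∀ s ∈ I₀.1, r' < s := fun s hs =>
          lt_of_le_of_ne (hJ s (Finset.mem_of_mem_erase hs)) (Finset.ne_of_mem_erase hs).symm
        simp only [g, if_pos hlt]
        rw [hg', Finset.sum_eq_single J, smul_smul, coef_mul_self hrI₀ hI₀, one_smul]
        · intro J' _ hJ'
          rw [coef_eq_zero_of_ne, zero_smul]
          exact fun h => hJ' (Subtype.ext (h.trans hI₀.symm))
        · simp
      · intro I _ hI
        by_cases hc : J.1 = insert r' I.1
        · by_cases hrI : r' ∈ I.1
          · rw [hgz I r' hrI le_rfl, map_zero, smul_zero]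
          · refine absurd (Subtype.ext ?_) hI
            change I.1 = J.1.erase r'
            rw [hc, Finset.erase_insert hrI]
        · rw [coef_eq_zero_of_ne hc, zero_smul]
      · simp
      · intro i _ hi
        refine Finset.sum_eq_zero fun I _ => ?_
        by_cases hc : J.1 = insert i I.1
        · rw [hc, Finset.mem_insert] at hrJ
          rw [hgz I r' (hrJ.resolve_left hi.symm) le_rfl, map_zero, smul_zero]
        · rw [coef_eq_zero_of_ne hc, zero_smul]
      · simp
    have hsub : φ - D δ n (ψ + g) = φ' - D δ n g := by rw [map_add, hφ', sub_sub]
    refine ⟨ψ + g, ?_⟩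
    rw [hsub]
    have hvan (J : Idx d (n + 1)) (s : Fin d) (hs : s ∈ J.1) (hsr : (s : ℕ) < r + 1) :
        (φ' - D δ n g) J = 0 := by
      by_cases hlt : ∃ s ∈ J.1, s < r'
      · obtain ⟨s, hs, hsr⟩ := hlt
        rw [Pi.sub_apply, h1 J ⟨s, hs, hsr⟩, hA J s hs hsr, sub_zero]
      · push Not at hlt
        obtain rfl : s = r' := le_antisymm (Fin.le_def.2 (Nat.lt_succ_iff.1 hsr)) (hlt s hs)
        rw [Pi.sub_apply, hB J hs hlt, sub_self]
    refine ⟨fun J ⟨s, hs, hsr⟩ => hvan J s hs hsr, fun s hs J => ?_⟩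
    rcases Nat.lt_succ_iff_lt_or_eq.1 hs with hs | hs
    · rw [Pi.sub_apply, map_sub, h2 s hs J, zero_sub, neg_eq_zero, D_apply, map_sum]
      refine Finset.sum_eq_zero fun i _ => ?_
      rw [map_sum]
      refine Finset.sum_eq_zero fun I _ => ?_
      rw [map_zsmul, hcomm, hg0 I s hs, map_zero, smul_zero]
    -- The components that involve `r` vanish now. For `J` above `r`, the closedness of the rest at
    -- the index set `J ∪ {r}` involves only the operator in direction `r` applied to the component
    -- at `J`.
    · obtain rfl : s = r' := Fin.ext hs
      by_cases hJ : ∃ s ∈ J.1, s ≤ r'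
      · obtain ⟨s, hsJ, hsr⟩ := hJ
        rw [hvan J s hsJ (Nat.lt_succ_iff.2 hsr), map_zero]
      · push Not at hJ
        have hrJ : r' ∉ J.1 := fun h => (hJ _ h).false
        let K : Idx d (n + 1 + 1) := ⟨insert r' J.1, by
          have hc : J.1.card = n + 1 := J.2
          change (insert r' J.1).card = _
          rw [Finset.card_insert_of_notMem hrJ, hc]⟩
        have h0 : D δ (n + 1) (φ' - D δ n g) K = 0 := by
          rw [map_sub, hDφ', D_D δ hcomm, sub_zero]; rfl
        rw [D_apply, Finset.sum_eq_single r', Finset.sum_eq_single J] at h0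
        · have h3 := congrArg (coef r' J K • ·) h0
          simp only [smul_smul, smul_zero] at h3
          rwa [coef_mul_self hrJ rfl, one_smul] at h3
        · intro I _ hI
          by_cases hc : K.1 = insert r' I.1
          · by_cases hrI : r' ∈ I.1
            · rw [hvan I r' hrI (Nat.lt_succ_self r), map_zero, smul_zero]
            · refine absurd (Subtype.ext ?_) hI
              rw [← Finset.erase_insert hrI, ← hc, Finset.erase_insert hrJ]
          · rw [coef_eq_zero_of_ne hc, zero_smul]
        · simp
        · intro i _ hi
          refine Finset.sum_eq_zero fun I _ => ?_
          by_cases hc : K.1 = insert i I.1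
          · have hrK : r' ∈ insert i I.1 := hc ▸ Finset.mem_insert_self _ _
            rw [Finset.mem_insert] at hrK
            rw [hvan I r' (hrK.resolve_left hi.symm) (Nat.lt_succ_self r), map_zero, smul_zero]
          · rw [coef_eq_zero_of_ne hc, zero_smul]
        · simp

omit hcomm in
theorem D_zero_eq_zero_iff (φ : Idx d 0 → N) : D δ 0 φ = 0 ↔ ∀ i I, δ i (φ I) = 0 := by
  classical
  have hu (I I' : Idx d 0) : I = I' := Subtype.ext
    ((Finset.card_eq_zero.1 I.2).trans (Finset.card_eq_zero.1 I'.2).symm)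
  constructor
  · intro h i I
    have hI : i ∉ I.1 := by rw [Finset.card_eq_zero.1 I.2]; simp
    let J : Idx d 1 := ⟨insert i I.1, by
      change (insert i I.1).card = _
      rw [Finset.card_insert_of_notMem hI]
      exact congrArg (· + 1) I.2⟩
    have h0 := congrFun h J
    rw [D_apply, Finset.sum_eq_single i, Finset.sum_eq_single I] at h0
    · have h3 := congrArg (coef i I J • ·) h0
      simp only [smul_smul, Pi.zero_apply, smul_zero] at h3
      rwa [coef_mul_self hI rfl, one_smul] at h3
    · exact fun I' _ hI' => absurd (hu I' I) hI'
    · simp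
    · intro i' _ hi'
      refine Finset.sum_eq_zero fun I' _ => ?_
      rw [coef_eq_zero_of_ne, zero_smul]
      obtain rfl := hu I I'
      intro hc
      have : i ∈ insert i' I.1 := hc ▸ Finset.mem_insert_self _ _
      rw [Finset.mem_insert] at this
      exact this.elim (fun h => hi' h.symm) hI
    · simp
  · intro h
    ext J
    rw [D_apply]
    exact Finset.sum_eq_zero fun i _ => Finset.sum_eq_zero fun I _ => by rw [h i I, smul_zero]

end Complex
end Koszul
end QDeRham
end

/-! ### Extra degeneracies, the Čech complex and its cone -/

noncomputable section
namespace QDeRham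

set_option linter.unusedSectionVars false

open QStrat

namespace Cosimplicial
variable {S : Type u} [CommRing S] (Y : CosimplicialObject (ModuleCat.{v} S))

/-- The coface maps of a cosimplicial module. -/
def coface (n : ℕ) (i : Fin (n + 2)) : Y.obj (.mk n) →ₗ[S] Y.obj (.mk (n + 1)) := (Y.δ i).hom

/-- The alternating sum of the coface maps. -/
def altSum (n : ℕ) : Y.obj (.mk n) →ₗ[S] Y.obj (.mk (n + 1)) :=
  ∑ i : Fin (n + 2), (-1 : ℤ) ^ (i : ℕ) • coface Y n i

theorem altSum_apply (n : ℕ) (x : Y.obj (.mk n)) :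
    altSum Y n x = ∑ i : Fin (n + 2), (-1 : ℤ) ^ (i : ℕ) • coface Y n i x := by
  simp [altSum]

theorem hom_objD (n : ℕ) :
    (AlgebraicTopology.AlternatingCofaceMapComplex.objD Y n).hom = altSum Y n := by
  ext x
  simp [altSum, coface, AlgebraicTopology.AlternatingCofaceMapComplex.objD, ModuleCat.hom_sum]

theorem complex_d (n : ℕ) (x : Y.obj (.mk n)) :
    (((AlgebraicTopology.alternatingCofaceMapComplex _).obj Y).d n (n + 1)).hom x =
      altSum Y n x := by
  have h : ((AlgebraicTopology.alternatingCofaceMapComplex _).obj Y).d n (n + 1) =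
      AlgebraicTopology.AlternatingCofaceMapComplex.objD Y n :=
    CochainComplex.of_d (fun n => Y.obj (.mk n))
      (AlgebraicTopology.AlternatingCofaceMapComplex.objD Y) n
  exact (congrArg (fun f : Y.obj (.mk n) ⟶ Y.obj (.mk (n + 1)) => f.hom x) h).trans
    congr($(hom_objD Y n) x)

theorem altSum_altSum (n : ℕ) (x : Y.obj (.mk n)) : altSum Y (n + 1) (altSum Y n x) = 0 := by
  rw [← hom_objD, ← hom_objD, ← LinearMap.comp_apply, ← ModuleCat.hom_comp,
    AlgebraicTopology.AlternatingCofaceMapComplex.d_squared]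
  rfl

theorem map_altSum {Y Y' : CosimplicialObject (ModuleCat.{v} S)} (n : ℕ)
    (f : Y.obj (.mk n) →ₗ[S] Y'.obj (.mk n)) (f' : Y.obj (.mk (n + 1)) →ₗ[S] Y'.obj (.mk (n + 1)))
    (h : ∀ i x, f' (coface Y n i x) = coface Y' n i (f x)) (x : Y.obj (.mk n)) :
    f' (altSum Y n x) = altSum Y' n (f x) := by
  simp only [altSum_apply, map_sum, map_zsmul, h]

section ExtraDegeneracy
variable {Y} (h : ∀ n, Y.obj (.mk (n + 1)) →ₗ[S] Y.obj (.mk n))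
  (h0 : ∀ n x, h n (coface Y n 0 x) = x)
include h0

/-- An extra degeneracy cancels the first coface and exchanges each later one with its predecessor.
In `h ∂ + ∂ h` all terms but the first thus cancel in pairs. -/
theorem altSum_degeneracy (hs : ∀ n (i : Fin (n + 2)) x, h (n + 1) (coface Y (n + 1) i.succ x) =
    coface Y n i (h n x)) (n : ℕ) (x : Y.obj (.mk (n + 1))) :
    altSum Y n (h n x) + h (n + 1) (altSum Y (n + 1) x) = x := by
  have hd : altSum Y (n + 1) x =
      coface Y (n + 1) 0 x - ∑ i : Fin (n + 2), (-1 : ℤ) ^ (i : ℕ) • coface Y (n + 1) i.succ x := by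
    rw [altSum_apply, Fin.sum_univ_succ]
    simp [pow_succ, Finset.sum_neg_distrib, sub_eq_add_neg]
  rw [hd, map_sub, h0, map_sum, altSum_apply]
  simp only [map_zsmul, hs]
  abel

theorem degeneracy_altSum_zero (x : Y.obj (.mk 0)) :
    h 0 (altSum Y 0 x) = x - h 0 (coface Y 0 1 x) := by
  rw [altSum_apply, Fin.sum_univ_two, map_add]
  simp [h0, sub_eq_add_neg]

end ExtraDegeneracy
end Cosimplicial

open Cosimplicial

section Cech
variable (R A : Type u) [CommRing R] [CommRing A] [Algebra R A] [LambdaRing R] [LambdaRing A]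

/-- The cosimplicial module of natural functions of `n + 1` lifts. -/
def cechCosimplicial : CosimplicialObject (ModuleCat.{u + 1} R⟦X⟧) where
  obj n := ModuleCat.of R⟦X⟧ (NatFun R A (Fin (n.len + 1)))
  map θ := ModuleCat.ofHom (NatFun.pull θ.toOrderHom).toLinearMap
  map_id _ := rfl
  map_comp _ _ := rfl

/-- The Čech complex of the site. -/
def cech : CochainComplex (ModuleCat.{u + 1} R⟦X⟧) ℕ :=
  (AlgebraicTopology.alternatingCofaceMapComplex _).obj (cechCosimplicial R A)

theorem torsionFree_cech : TorsionFree (cech R A) := fun n x hx => by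
  have h : (PowerSeries.X : R⟦X⟧) • (show NatFun R A (Fin (n + 1)) from x) = 0 := hx
  rw [NatFun.X_smul] at h
  exact NatFun.τ_mul_cancel (h.trans (mul_zero _).symm)

/-- The cosimplicial module of families of natural functions of `n + 1` lifts and a further one. -/
def coneCosimplicial (ι : Type) : CosimplicialObject (ModuleCat.{u + 1} R⟦X⟧) where
  obj n := ModuleCat.of R⟦X⟧ (ι → NatFun R A (Option (Fin (n.len + 1))))
  map θ := ModuleCat.ofHom ((NatFun.pull (Option.map θ.toOrderHom)).toLinearMap.compLeft ι)
  map_id n := by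
    refine ModuleCat.hom_ext (LinearMap.ext fun φ => funext fun I => ?_)
    change NatFun.pull (Option.map id) (φ I) = φ I
    rw [Option.map_id]
    rfl
  map_comp {l m n} θ η := by
    refine ModuleCat.hom_ext (LinearMap.ext fun φ => funext fun I => ?_)
    change NatFun.pull (Option.map (η.toOrderHom ∘ θ.toOrderHom)) (φ I) = _
    rw [← Option.map_comp_map]
    rfl

variable {R A}

/-- The map of index sets which identifies the first vertex with the cone point. -/
def collapse (n : ℕ) : Option (Fin (n + 2)) → Option (Fin (n + 1)) :=
  fun k => k.elim none (Fin.cases none some)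

theorem collapse_comp_zero (n : ℕ) : collapse n ∘ Option.map (Fin.succAbove 0) = id := by
  funext k
  cases k <;> simp [collapse]

theorem collapse_comp_succ (n : ℕ) (i : Fin (n + 2)) :
    collapse (n + 1) ∘ Option.map (Fin.succAbove i.succ) =
      Option.map (Fin.succAbove i) ∘ collapse n := by
  funext k
  cases k with
  | none => rfl
  | some k =>
    refine Fin.cases ?_ (fun k => ?_) k <;> simp [collapse]

variable (R A) in
/-- The extra degeneracy of `coneCosimplicial`. -/
def coneContraction (ι : Type) (n : ℕ) :
    (coneCosimplicial R A ι).obj (.mk (n + 1)) →ₗ[R⟦X⟧] (coneCosimplicial R A ι).obj (.mk n) :=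
  (NatFun.pull (collapse n)).toLinearMap.compLeft ι

theorem coneContraction_coface_zero (ι : Type) (n : ℕ) (x : (coneCosimplicial R A ι).obj (.mk n)) :
    coneContraction R A ι n (coface _ n 0 x) = x := by
  funext I
  change NatFun.pull (collapse n ∘ Option.map (Fin.succAbove 0)) (x I) = x I
  rw [collapse_comp_zero, NatFun.pull_id]

theorem coneContraction_coface_succ (ι : Type) (n : ℕ) (i : Fin (n + 2))
    (x : (coneCosimplicial R A ι).obj (.mk (n + 1))) :
    coneContraction R A ι (n + 1) (coface _ (n + 1) i.succ x) =
      coface _ n i (coneContraction R A ι n x) := by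
  funext I
  change NatFun.pull (collapse (n + 1) ∘ Option.map (Fin.succAbove i.succ)) (x I) = _
  rw [collapse_comp_succ]
  rfl

end Cech

namespace Koszul
variable {S N N' : Type*} [CommRing S] [AddCommGroup N] [Module S N] [AddCommGroup N'] [Module S N']
  {d n : ℕ}

theorem D_compLeft (δ : Fin d → N →ₗ[S] N) (δ' : Fin d → N' →ₗ[S] N') (f : N →ₗ[S] N')
    (hf : ∀ i x, δ' i (f x) = f (δ i x)) (φ : Idx d n → N) :
    D δ' n (f.compLeft _ φ) = f.compLeft _ (D δ n φ) := by
  ext J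
  simp [D_apply, map_sum, hf]

end Koszul

namespace Framing
variable {R A : Type u} [CommRing R] [CommRing A] [Algebra R A] [LambdaRing R] [LambdaRing A]
  (F : Framing R A)

theorem wedge_basis (i : Fin F.dim) (n : ℕ) (I : Koszul.Idx F.dim n) :
    wedge (KaehlerDifferential.D R A (F.x i)) n (F.basis.exteriorPower n I) =
      ∑ J, Koszul.coef i I J • F.basis.exteriorPower (n + 1) J := by
  apply Subtype.ext
  rw [AddSubmonoidClass.coe_finsetSum]
  refine Eq.trans ?_ (Koszul.ι_mul_basis F.basis i I)
  rw [basis_apply]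
  rfl

/-- In the basis `dx_I` the `q`-connection is a Koszul differential, which allows a comparison with
the Koszul differential of the operators `dOp`. -/
theorem nablaQ_equivFun_symm (n : ℕ) (φ : Koszul.Idx F.dim n → A⟦X⟧) :
    F.nablaQ n ((F.formBasis n).equivFun.symm φ) =
      (F.formBasis (n + 1)).equivFun.symm (Koszul.D F.qDer n φ) := by
  have h (n : ℕ) (g : A⟦X⟧) (I : Koszul.Idx F.dim n) :
      g • F.formBasis n I = qtmul g (F.basis.exteriorPower n I) := by
    rw [formBasis_apply, smul_qtmul, mul_one]
  simp only [Module.Basis.equivFun_symm_apply, map_sum, h]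
  have h1 (I : Koszul.Idx F.dim n) : F.nablaQ n (qtmul (φ I) (F.basis.exteriorPower n I)) =
      ∑ i, ∑ J, Koszul.coef i I J • qtmul (F.qDer i (φ I)) (F.basis.exteriorPower (n + 1) J) := by
    rw [nablaQ, LinearMap.sum_apply]
    refine Finset.sum_congr rfl fun i _ => ?_
    rw [LinearMap.comp_apply, qDerForm_basis]
    change qwedge _ n _ = _
    rw [qwedge_qtmul, wedge_basis, map_sum]
    simp only [map_zsmul]
  have h2 (f : A⟦X⟧) (k : ℤ) (ω : Forms R A (n + 1)) : qtmul (k • f) ω = k • qtmul f ω := by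
    rw [← mul_one (k • f), smul_mul_assoc, mul_one, zsmul_eq_mul, ← smul_qtmul, Int.cast_smul_eq_zsmul]
  have h3 (J : Koszul.Idx F.dim (n + 1)) :
      qtmul (Koszul.D F.qDer n φ J) (F.basis.exteriorPower (n + 1) J) =
      ∑ i, ∑ I, Koszul.coef i I J •
        qtmul (F.qDer i (φ I)) (F.basis.exteriorPower (n + 1) J) := by
    rw [← h, Koszul.D_apply, Finset.sum_smul]
    refine Finset.sum_congr rfl fun i _ => ?_
    rw [Finset.sum_smul]
    refine Finset.sum_congr rfl fun I _ => ?_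
    rw [h, h2]
  simp only [h1, h3]
  rw [Finset.sum_comm, Finset.sum_comm (s := (Finset.univ : Finset (Koszul.Idx F.dim (n + 1))))]
  exact Finset.sum_congr rfl fun i _ => Finset.sum_comm

theorem equivFun_nablaQ (n : ℕ) (x : QForms R A n) :
    (F.formBasis (n + 1)).equivFun (F.nablaQ n x) =
      Koszul.D F.qDer n ((F.formBasis n).equivFun x) := by
  rw [← LinearEquiv.eq_symm_apply, ← nablaQ_equivFun_symm, LinearEquiv.symm_apply_apply]

end Framing
end QDeRham
end

/-! ### The double complex from the Čech complex to `(Ω^*⟦q - 1⟧, (q - 1)∇_q)` -/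

noncomputable section
namespace QDeRham

set_option linter.unusedSectionVars false

open QStrat Cosimplicial

section Cone
variable (R A : Type u) [CommRing R] [CommRing A] [Algebra R A] [LambdaRing R] [LambdaRing A]

/-- The differential of the Čech complex with a further lift. -/
def coneDiff (m : ℕ) : NatFun R A (Option (Fin (m + 1))) →ₗ[R⟦X⟧] NatFun R A (Option (Fin (m + 2))) :=
  ∑ i : Fin (m + 2), (-1 : ℤ) ^ (i : ℕ) • (NatFun.pull (Option.map (Fin.succAbove i))).toLinearMap

variable {R A} in
theorem altSum_cone (ι : Type) (m : ℕ) (φ : ι → NatFun R A (Option (Fin (m + 1)))) :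
    altSum (coneCosimplicial R A ι) m φ = (coneDiff R A m).compLeft ι φ := by
  refine (altSum_apply (coneCosimplicial R A ι) m φ).trans (funext fun I => ?_)
  refine (Finset.sum_apply I _ _).trans ?_
  simp only [coneDiff, LinearMap.compLeft_apply, Function.comp_apply, LinearMap.sum_apply]
  rfl

variable {R A}

theorem coneDiff_coneDiff (m : ℕ) (g : NatFun R A (Option (Fin (m + 1)))) :
    coneDiff R A (m + 1) (coneDiff R A m g) = 0 := by
  have := altSum_altSum (coneCosimplicial R A Unit) m fun _ => g
  rw [altSum_cone] at this
  have h := altSum_cone Unit (m + 1) fun _ => coneDiff R A m g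
  exact (congrFun h ()).symm.trans (congrFun this ())

theorem coneDiff_collapse (m : ℕ) (g : NatFun R A (Option (Fin (m + 2)))) :
    coneDiff R A m (NatFun.pull (collapse m) g) +
      NatFun.pull (collapse (m + 1)) (coneDiff R A (m + 1) g) = g := by
  have h := altSum_degeneracy (coneContraction R A Unit) (coneContraction_coface_zero _)
    (coneContraction_coface_succ _) m fun _ => g
  have h1 := altSum_cone Unit (m + 1) fun _ => g
  have h2 := altSum_cone Unit m fun _ => NatFun.pull (collapse m) g
  exact (congrArg₂ (fun x y => x + NatFun.pull (collapse (m + 1)) y) (congrFun h2 ())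
    (congrFun h1 ())).symm.trans (congrFun h ())

/-- Of the two cofaces, the first is undone by `collapse`, and the second leaves the function
evaluated at the further lift alone, repeated. This projection is what the columns are contracted
to. -/
theorem collapse_coneDiff_zero (g : NatFun R A (Option (Fin 1))) :
    NatFun.pull (collapse 0) (coneDiff R A 0 g) = g - NatFun.pull (fun _ => none) g := by
  have h1 : collapse 0 ∘ Option.map (Fin.succAbove 0) = id := collapse_comp_zero 0
  have h2 : collapse 0 ∘ Option.map (Fin.succAbove 1) = fun _ => none := by
    funext k
    rcases k with _ | k
    · rfl
    · obtain rfl : k = 0 := Subsingleton.elim _ _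
      rfl
  have h3 : coneDiff R A 0 g = NatFun.pull (Option.map (Fin.succAbove 0)) g -
      NatFun.pull (Option.map (Fin.succAbove 1)) g := by
    simp [coneDiff, Fin.sum_univ_two, sub_eq_add_neg]
  rw [h3, map_sub, NatFun.pull_pull, NatFun.pull_pull, h1, h2, NatFun.pull_id]

theorem coneDiff_hat (f : A⟦X⟧) : coneDiff R A 0 (NatFun.hat none f) = 0 := by
  simp [coneDiff, Fin.sum_univ_two, NatFun.pull_hat]

theorem pull_some_altSum (m : ℕ) (g : NatFun R A (Fin (m + 1))) :
    NatFun.pull some (altSum (cechCosimplicial R A) m g : NatFun R A (Fin (m + 2))) =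
      coneDiff R A m (NatFun.pull some g) := by
  have h := altSum_apply (cechCosimplicial R A) m g
  refine (congrArg (NatFun.pull some) h).trans ((map_sum (NatFun.pull some) (fun i : Fin (m + 2) =>
    (-1 : ℤ) ^ (i : ℕ) • NatFun.pull (Fin.succAbove i) g) Finset.univ).trans ?_)
  simp only [coneDiff, LinearMap.sum_apply]
  rfl

end Cone

namespace Framing
variable {R A : Type u} [CommRing R] [CommRing A] [Algebra R A] [LambdaRing R] [LambdaRing A]
  (F : Framing R A) [Module.Flat ℤ R] [Module.Flat R A] (hRA : IsLambdaHom (algebraMap R A))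

/-- The values of natural functions on the constant family of lifts to `A⟦q - 1⟧`. -/
def evalSeries {J : Type} : NatFun R A J →ₗ[R⟦X⟧] A⟦X⟧ where
  toFun g := (g.val (series hRA) fun _ => seriesLift hRA)
  map_add' _ _ := rfl
  map_smul' _ _ := rfl

/-- The object `A⟦q - 1⟧` classifies a single lift, so by naturality the values of a function at
repeated lifts are determined by its value there. -/
theorem hat_evalSeries {J J' : Type} (o : J') (g : NatFun R A J) :
    NatFun.hat o (evalSeries hRA g) = NatFun.pull (fun _ => o) g := by
  ext B ℓ
  have := NatFun.natural g (seriesHom hRA (ℓ o)) fun _ => seriesLift hRA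
  rw [map_seriesHom] at this
  exact this.symm

theorem evalSeries_hat {J : Type} (o : J) (f : A⟦X⟧) :
    evalSeries hRA (NatFun.hat o f : NatFun R A J) = f := hat_seriesLift hRA f

/-- Forms whose coefficients are functions of `m + 1` lifts and a further one. -/
abbrev CechForms (m j : ℕ) : Type (u + 1) :=
  Koszul.Idx F.dim j → NatFun R A (Option (Fin (m + 1)))

/-- The forms on `A⟦q - 1⟧` as functions of the further lift. -/
def cechForm (j : ℕ) : F.qHodge.X j →ₗ[R⟦X⟧] F.CechForms 0 j where
  toFun x I := NatFun.hat none ((F.formBasis j).equivFun (ULift.down x) I)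
  map_add' x y := funext fun I => by
    change NatFun.hat none ((F.formBasis j).equivFun (x.down + y.down) I) = _
    rw [map_add, Pi.add_apply, map_add]
    rfl
  map_smul' s x := funext fun I => by
    have h : (F.formBasis j).equivFun (s • x.down) = s • (F.formBasis j).equivFun x.down := by
      rw [← algebraMap_smul A⟦X⟧ s x.down, map_smul]
      ext1 I
      exact (Algebra.smul_def _ _).symm
    change NatFun.hat none ((F.formBasis j).equivFun (s • x.down) I) = _
    rw [h, Pi.smul_apply, map_smul]
    rfl

/-- Restriction of forms to `A⟦q - 1⟧`. -/
def evalCechForm (j : ℕ) : F.CechForms 0 j →ₗ[R⟦X⟧] F.qHodge.X j where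
  toFun φ := ULift.up ((F.formBasis j).equivFun.symm fun I => evalSeries hRA (φ I))
  map_add' φ ψ := ULift.down_injective (by
    change (F.formBasis j).equivFun.symm ((fun I => evalSeries hRA (φ I)) +
      fun I => evalSeries hRA (ψ I)) = _
    rw [map_add]
    rfl)
  map_smul' s φ := ULift.down_injective (by
    have h : (fun I => evalSeries hRA ((s • φ) I)) =
        (algebraMap R⟦X⟧ A⟦X⟧ s) • fun I => evalSeries hRA (φ I) := by
      ext1 I
      exact ((evalSeries hRA).map_smul s (φ I)).trans (Algebra.smul_def _ _)
    change (F.formBasis j).equivFun.symm (fun I => evalSeries hRA ((s • φ) I)) = _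
    rw [h, map_smul, algebraMap_smul]
    rfl)

omit [Module.Flat R A] in
theorem dOp_coneDiff (i : Fin F.dim) (m : ℕ) (g : NatFun R A (Option (Fin (m + 1)))) :
    F.dOp hRA i (coneDiff R A m g) = coneDiff R A m (F.dOp hRA i g) := by
  simp only [coneDiff, LinearMap.sum_apply, LinearMap.smul_apply, map_sum, map_zsmul]
  refine Finset.sum_congr rfl fun k _ => congrArg _ ?_
  exact F.dOp_pull hRA i _ g

/-- The differential of forms in the direction of the further lift. -/
def cechD (m j : ℕ) : F.CechForms m j →ₗ[R⟦X⟧] F.CechForms m (j + 1) :=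
  Koszul.D (fun i => F.dOp hRA i) j

theorem cechD_cechD (m j : ℕ) (φ : F.CechForms m j) :
    F.cechD hRA m (j + 1) (F.cechD hRA m j φ) = 0 := by
  obtain ⟨U, υ, h⟩ := F.exists_universal_fin hRA m
  exact Koszul.D_D _ (fun i k x => F.dOp_comm hRA (J := Fin (m + 1)) (o := 0) ⟨U, υ, h⟩ i k x) φ

/-- The rows satisfy the hypothesis of the Koszul criterion by the integration lemma
`exists_dOp_eq`, applied over the universal family of `m + 1` lifts. -/
theorem exists_cechD_eq (m j : ℕ) (φ : F.CechForms m (j + 1)) (h : F.cechD hRA m (j + 1) φ = 0) :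
    ∃ ψ, F.cechD hRA m j ψ = φ := by
  obtain ⟨U, υ, hυ⟩ := F.exists_universal_fin hRA m
  exact Koszul.exists_D_eq _
    (fun i k x => F.dOp_comm hRA (J := Fin (m + 1)) (o := 0) ⟨U, υ, hυ⟩ i k x)
    (fun r x => F.exists_dOp_eq hRA (J := Fin (m + 1)) (o := 0) ⟨U, υ, hυ⟩ r x) φ h

/-- The factor `q - 1` in the differential of `qHodge` is the one that `dOp_hat` produces on
functions of a single lift. -/
theorem cechForm_d (j : ℕ) (x : F.qHodge.X j) : F.cechForm (j + 1) ((F.qHodge.d j (j + 1)).hom x) =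
    F.cechD hRA 0 j (F.cechForm j x) := by
  refine (congrArg (F.cechForm (j + 1)) (F.qHodge_d_apply j x)).trans (funext fun J => ?_)
  change NatFun.hat none ((F.formBasis (j + 1)).equivFun ((PowerSeries.X : R⟦X⟧) •
    F.nablaQ j x.down) J) = _
  have h : (F.formBasis (j + 1)).equivFun ((PowerSeries.X : R⟦X⟧) • F.nablaQ j x.down) J =
      (PowerSeries.X : R⟦X⟧) • Koszul.D F.qDer j ((F.formBasis j).equivFun x.down) J := by
    rw [← equivFun_nablaQ, ← algebraMap_smul A⟦X⟧, map_smul]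
    exact (Algebra.smul_def _ _).symm
  rw [h, map_smul, NatFun.X_smul, cechD, Koszul.D_apply, Koszul.D_apply, map_sum, Finset.mul_sum]
  refine Finset.sum_congr rfl fun i _ => ?_
  rw [map_sum, Finset.mul_sum]
  refine Finset.sum_congr rfl fun I _ => ?_
  rw [map_zsmul, mul_smul_comm, ← F.dOp_hat hRA]
  rfl

/-- The double complex of Čech cochains with values in differential forms. -/
def cechResolution : BiResolution (cech R A) F.qHodge where
  K := F.CechForms
  del m j := (coneDiff R A m).compLeft _
  D m j := F.cechD hRA m j
  h m j := (NatFun.pull (collapse m)).toLinearMap.compLeft _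
  ε := F.evalCechForm hRA
  η := F.cechForm
  a m := LinearMap.pi fun _ => (NatFun.pull some).toLinearMap
  D_D := F.cechD_cechD hRA
  del_del m j φ := funext fun I => coneDiff_coneDiff m (φ I)
  D_del m j φ := Koszul.D_compLeft _ _ _ (fun r x => F.dOp_coneDiff hRA r m x) φ
  del_h m j φ := funext fun I => coneDiff_collapse m (φ I)
  h_del j φ := funext fun I => by
    refine (collapse_coneDiff_zero (φ I)).trans (congrArg (φ I - ·) ?_)
    change _ = NatFun.hat none ((F.formBasis j).equivFun
      ((F.formBasis j).equivFun.symm fun I => evalSeries hRA (φ I)) I)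
    rw [LinearEquiv.apply_symm_apply, hat_evalSeries]
  ε_η j x := ULift.down_injective (by
    change (F.formBasis j).equivFun.symm (fun I => evalSeries hRA (NatFun.hat none
      ((F.formBasis j).equivFun x.down I))) = x.down
    simp only [evalSeries_hat]
    exact LinearEquiv.symm_apply_apply _ _)
  η_d j x := F.cechForm_d hRA j x
  del_η j x := funext fun I => coneDiff_hat _
  a_d m x := funext fun _ => (congrArg (NatFun.pull some) (complex_d (cechCosimplicial R A) m x)).trans
    (pull_some_altSum m x)
  D_a m x := (Koszul.D_zero_eq_zero_iff _ _).2 fun i _ => F.dOp_pull_some hRA i x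
  a_injective m x y h := by
    have h1 : NatFun.pull some x = NatFun.pull some y := congrFun h ⟨∅, rfl⟩
    -- Letting the further lift coincide with the lift of index zero is a retraction of `pull some`.
    exact congrArg (NatFun.pull fun k : Option (Fin (m + 1)) => k.getD 0) h1
  exact_zero m φ h := by
    obtain ⟨U, υ, hυ⟩ := F.exists_universal_fin hRA m
    replace h := (Koszul.D_zero_eq_zero_iff _ _).1 h
    obtain ⟨c, hc⟩ := F.exists_pull_some_eq hRA (J := Fin (m + 1)) (o := 0) ⟨U, υ, hυ⟩
      (φ ⟨∅, rfl⟩) fun i => h i ⟨∅, rfl⟩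
    refine ⟨c, funext fun I => ?_⟩
    obtain rfl : I = ⟨∅, rfl⟩ := Subtype.ext (Finset.card_eq_zero.1 I.2)
    exact hc
  exact_succ := F.exists_cechD_eq hRA

end Framing
end QDeRham
end

/-! ### Functions of chains of objects and families of lifts -/

noncomputable section
namespace QDeRham

set_option linter.unusedSectionVars false

open QStrat Cosimplicial

section Chain
variable (R A : Type u) [CommRing R] [CommRing A] [Algebra R A] [LambdaRing R] [LambdaRing A]

/-- Functions of a chain of objects of the site and a family of lifts to its first object, with
values in its last object. -/
abbrev ChainFun (J : Type) (n : ℕ) : Type (u + 1) :=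
  (σ : ComposableArrows (QStrat R A) n) → (J → Lift (σ.obj 0)) → σ.obj (Fin.last n)

variable {R A}

/-- Restriction of chains. -/
abbrev chainRestrict {m n : SimplexCategory} (θ : m ⟶ n)
    (σ : ComposableArrows (QStrat R A) n.len) : ComposableArrows (QStrat R A) m.len :=
  σ.whiskerLeft (SimplexCategory.toCat.map θ).toFunctor

/-- Functions of chains are covariant in the simplex. -/
def chainMap (J : Type) {m n : SimplexCategory} (θ : m ⟶ n) :
    ChainFun R A J m.len →ₗ[R⟦X⟧] ChainFun R A J n.len where
  toFun φ σ ℓ := ringHom (σ.map (homOfLE (Fin.le_last (θ.toOrderHom (Fin.last m.len)))))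
    (φ (chainRestrict θ σ) fun k => (ℓ k).map (σ.map (homOfLE (Fin.zero_le (θ.toOrderHom 0)))))
  map_add' _ _ := funext fun _ => funext fun _ => map_add (ringHom _) _ _
  map_smul' _ _ := funext fun _ => funext fun _ => ringHom_smul _ _ _

theorem ringHom_map_congr {n : ℕ} (σ : ComposableArrows (QStrat R A) n) {i j k : Fin (n + 1)}
    (h₁ : i ⟶ j) (h₂ : j ⟶ k) (h₃ : i ⟶ k) (y : σ.obj i) :
    ringHom (σ.map h₃) y = ringHom (σ.map h₂) (ringHom (σ.map h₁) y) := by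
  rw [Subsingleton.elim h₃ (h₁ ≫ h₂), σ.map_comp, ringHom_comp]

theorem lift_map_congr {n : ℕ} (σ : ComposableArrows (QStrat R A) n) {i j k : Fin (n + 1)}
    (h₁ : i ⟶ j) (h₂ : j ⟶ k) (h₃ : i ⟶ k) (ℓ : Lift (σ.obj i)) :
    (ℓ.map (σ.map h₁)).map (σ.map h₂) = ℓ.map (σ.map h₃) := by
  rw [Subsingleton.elim h₃ (h₁ ≫ h₂), σ.map_comp, Lift.map_comp]

variable (R A) in
/-- The cosimplicial module of functions of chains. -/
def chainCosimplicial (J : Type) : CosimplicialObject (ModuleCat.{u + 1} R⟦X⟧) where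
  obj n := ModuleCat.of R⟦X⟧ (ChainFun R A J n.len)
  map θ := ModuleCat.ofHom (chainMap J θ)
  map_id n := by
    refine ModuleCat.hom_ext (LinearMap.ext fun φ => funext fun σ => funext fun ℓ => ?_)
    change ringHom (σ.map (𝟙 _)) (φ σ fun k => (ℓ k).map (σ.map (𝟙 _))) = φ σ ℓ
    simp only [σ.map_id, Lift.map_id, ringHom_id]
  map_comp {l m n} θ η := by
    refine ModuleCat.hom_ext (LinearMap.ext fun φ => funext fun σ => funext fun ℓ => ?_)
    refine (ringHom_map_congr σ (homOfLE (η.toOrderHom.monotone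
      (Fin.le_last (θ.toOrderHom (Fin.last l.len))))) (homOfLE (Fin.le_last _)) _ _).trans ?_
    refine congrArg (ringHom _) (congrArg (ringHom _) (congrArg (φ _) (funext fun k => ?_)))
    exact (lift_map_congr σ _ (homOfLE (η.toOrderHom.monotone (Fin.zero_le _))) _ (ℓ k)).symm

variable (R A) in
/-- The differential on functions of chains. -/
def chainD (J : Type) (n : ℕ) : ChainFun R A J n →ₗ[R⟦X⟧] ChainFun R A J (n + 1) :=
  ∑ i : Fin (n + 2), (-1 : ℤ) ^ (i : ℕ) •
    chainMap J (SimplexCategory.δ i : SimplexCategory.mk n ⟶ .mk (n + 1))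

theorem chainD_chainD (J : Type) (n : ℕ) (φ : ChainFun R A J n) :
    chainD R A J (n + 1) (chainD R A J n φ) = 0 := altSum_altSum (chainCosimplicial R A J) n φ

/-- Change of the family of lifts. -/
def chainPull {J J' : Type} (θ : J → J') (n : ℕ) : ChainFun R A J n →ₗ[R⟦X⟧] ChainFun R A J' n where
  toFun φ σ ℓ := φ σ (ℓ ∘ θ)
  map_add' _ _ := rfl
  map_smul' _ _ := rfl

theorem chainD_chainPull {J J' : Type} (θ : J → J') (n : ℕ) (φ : ChainFun R A J n) :
    chainD R A J' n (chainPull θ n φ) = chainPull θ (n + 1) (chainD R A J n φ) :=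
  (map_altSum (Y := chainCosimplicial R A J) (Y' := chainCosimplicial R A J') n (chainPull θ n)
    (chainPull θ (n + 1)) (fun _ _ => rfl) φ).symm

variable (R A) in
/-- The cosimplicial module of functions of chains of a fixed length. -/
def liftCosimplicial (n : ℕ) : CosimplicialObject (ModuleCat.{u + 1} R⟦X⟧) where
  obj m := ModuleCat.of R⟦X⟧ (ChainFun R A (Fin (m.len + 1)) n)
  map θ := ModuleCat.ofHom (chainPull θ.toOrderHom n)
  map_id _ := rfl
  map_comp _ _ := rfl

variable (R A) in
/-- The Čech differential on functions of chains. -/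
def chainDel (m n : ℕ) :
    ChainFun R A (Fin (m + 1)) n →ₗ[R⟦X⟧] ChainFun R A (Fin (m + 2)) n :=
  ∑ i : Fin (m + 2), (-1 : ℤ) ^ (i : ℕ) • chainPull (Fin.succAbove i) n

theorem chainDel_chainDel (m n : ℕ) (φ : ChainFun R A (Fin (m + 1)) n) :
    chainDel R A (m + 1) n (chainDel R A m n φ) = 0 := altSum_altSum (liftCosimplicial R A n) m φ

theorem chainD_chainDel (m n : ℕ) (φ : ChainFun R A (Fin (m + 1)) n) :
    chainD R A (Fin (m + 2)) n (chainDel R A m n φ) =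
      chainDel R A m (n + 1) (chainD R A (Fin (m + 1)) n φ) := by
  simp only [chainDel, LinearMap.sum_apply, LinearMap.smul_apply, map_sum, map_zsmul,
    chainD_chainPull]

variable (R A) in
/-- Insertion of a chosen lift. -/
def chainInsert (m n : ℕ) :
    ChainFun R A (Fin (m + 2)) n →ₗ[R⟦X⟧] ChainFun R A (Fin (m + 1)) n where
  -- The chosen lift cannot be natural in the object, but functions of chains are subject to no
  -- naturality, and the differential in the direction of the lifts keeps the chain fixed.
  toFun φ σ ℓ := φ σ (Fin.cons (Classical.arbitrary _) ℓ)
  map_add' _ _ := rfl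
  map_smul' _ _ := rfl

theorem chainInsert_zero (m n : ℕ) (φ : ChainFun R A (Fin (m + 1)) n) :
    chainInsert R A m n (chainPull (Fin.succAbove 0) n φ) = φ := by
  funext σ ℓ
  exact congrArg (φ σ) (funext fun k => by simp)

theorem chainInsert_succ (m n : ℕ) (i : Fin (m + 2)) (φ : ChainFun R A (Fin (m + 2)) n) :
    chainInsert R A (m + 1) n (chainPull (Fin.succAbove i.succ) n φ) =
      chainPull (Fin.succAbove i) n (chainInsert R A m n φ) := by
  funext σ ℓ
  refine congrArg (φ σ) (funext fun k => ?_)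
  refine Fin.cases ?_ (fun k => ?_) k <;> simp

theorem chainDel_chainInsert (m n : ℕ) (φ : ChainFun R A (Fin (m + 2)) n) :
    chainDel R A m n (chainInsert R A m n φ) +
      chainInsert R A (m + 1) n (chainDel R A (m + 1) n φ) = φ :=
  altSum_degeneracy (Y := liftCosimplicial R A n) (fun m => chainInsert R A m n)
    (fun m => chainInsert_zero m n) (fun m => chainInsert_succ m n) m φ

theorem chainInsert_chainDel_zero (n : ℕ) (φ : ChainFun R A (Fin 1) n) :
    chainInsert R A 0 n (chainDel R A 0 n φ) = φ - fun σ _ => φ σ fun _ => Classical.arbitrary _ := by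
  refine (degeneracy_altSum_zero (Y := liftCosimplicial R A n) (fun m => chainInsert R A m n)
    (fun m => chainInsert_zero m n) φ).trans (congrArg (φ - ·) (funext fun σ => funext fun ℓ => ?_))
  refine congrArg (φ σ) (funext fun k => ?_)
  obtain rfl : k = 0 := Subsingleton.elim (α := Fin 1) _ _
  rfl

end Chain
end QDeRham
end

/-! ### Contraction of chains by the universal object -/

noncomputable section
namespace QDeRham

set_option linter.unusedSectionVars false

open QStrat Cosimplicial

section Precomp
variable {C : Type*} [Category C]

theorem heq_map_fin {n : ℕ} (F : ComposableArrows C n) {a b a' b' : Fin (n + 1)} (ha : a = a')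
    (hb : b = b') (f : a ⟶ b) (f' : a' ⟶ b') : HEq (F.map f) (F.map f') := by
  subst ha hb
  rw [Subsingleton.elim f f']

theorem precomp_map_zero_succ {n : ℕ} (σ : ComposableArrows C n) {X : C} (f : X ⟶ σ.obj 0)
    (l : Fin (n + 1)) : (ComposableArrows.precomp σ f).map (homOfLE (Fin.zero_le l.succ)) =
      f ≫ σ.map (homOfLE (Fin.zero_le l)) := by
  obtain ⟨l, hl⟩ := l
  cases l with
  | zero =>
    refine Eq.trans ?_ (Category.comp_id f).symm |>.trans (congrArg (f ≫ ·) (σ.map_id 0).symm)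
    rfl
  | succ l => rfl

/-- Restriction of a chain with an additional first object. -/
theorem precomp_restrict {m n : ℕ} (θ : SimplexCategory.mk m ⟶ .mk n)
    (θ' : SimplexCategory.mk (m + 1) ⟶ .mk (n + 1)) (h0 : θ'.toOrderHom 0 = 0)
    (hs : ∀ k : Fin (m + 1), θ'.toOrderHom k.succ = (θ.toOrderHom k).succ)
    (σ : ComposableArrows C n) {X : C} (f : X ⟶ σ.obj 0) :
    (ComposableArrows.precomp σ f).whiskerLeft (SimplexCategory.toCat.map θ').toFunctor =
      ComposableArrows.precomp (σ.whiskerLeft (SimplexCategory.toCat.map θ).toFunctor)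
        (f ≫ σ.map (homOfLE (Fin.zero_le (θ.toOrderHom 0)))) := by
  set P := ComposableArrows.precomp σ f with hP
  refine CategoryTheory.Functor.hext (fun k => ?_) fun k l g => ?_
  · refine Fin.cases ?_ (fun k => ?_) k
    · exact congrArg P.obj h0
    · exact congrArg P.obj (hs k)
  · let T := (SimplexCategory.toCat.map θ').toFunctor
    have hg : (show Fin (m + 1 + 1) from k) ≤ l := leOfHom g
    change Fin (m + 1 + 1) at k l
    induction k using Fin.cases with
    | zero =>
      induction l using Fin.cases with
      | zero => exact heq_map_fin P h0 h0 (T.map g) (𝟙 0)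
      | succ l =>
        refine (heq_map_fin P h0 (hs l) (T.map g) (homOfLE (Fin.zero_le _))).trans
          (heq_of_eq ?_)
        refine (precomp_map_zero_succ σ f (θ.toOrderHom l)).trans ?_
        refine Eq.trans ?_ (precomp_map_zero_succ
          (σ.whiskerLeft (SimplexCategory.toCat.map θ).toFunctor)
          (f ≫ σ.map (homOfLE (Fin.zero_le (θ.toOrderHom 0)))) l).symm
        refine Eq.trans ?_ (Category.assoc f (σ.map (homOfLE (Fin.zero_le (θ.toOrderHom 0))))
          (σ.map (homOfLE (θ.toOrderHom.monotone (Fin.zero_le l))))).symm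
        refine congrArg (f ≫ ·) ?_
        exact (congrArg σ.map (Subsingleton.elim _ _)).trans (σ.map_comp (homOfLE (Fin.zero_le _))
          (homOfLE (θ.toOrderHom.monotone (Fin.zero_le l))))
    | succ k =>
      induction l using Fin.cases with
      | zero => exact absurd hg (by simp)
      | succ l =>
        have hkl : k ≤ l := Fin.succ_le_succ_iff.1 hg
        exact heq_map_fin P (hs k) (hs l) (T.map g)
          (homOfLE (Fin.succ_le_succ_iff.2 (θ.toOrderHom.monotone hkl)))

theorem precomp_restrict_zero {n : ℕ} (θ : SimplexCategory.mk n ⟶ .mk (n + 1))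
    (hs : ∀ k : Fin (n + 1), θ.toOrderHom k = k.succ)
    (σ : ComposableArrows C n) {X : C} (f : X ⟶ σ.obj 0) :
    (ComposableArrows.precomp σ f).whiskerLeft (SimplexCategory.toCat.map θ).toFunctor = σ := by
  set P := ComposableArrows.precomp σ f with hP
  refine CategoryTheory.Functor.hext (fun k => congrArg P.obj (hs k)) fun k l g => ?_
  exact heq_map_fin P (hs k) (hs l) ((SimplexCategory.toCat.map θ).toFunctor.map g)
    (homOfLE (Fin.succ_le_succ_iff.2 (leOfHom g)))

end Precomp

section Row
variable {R A : Type u} [CommRing R] [CommRing A] [Algebra R A] [LambdaRing R] [LambdaRing A]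
  {J : Type} {U : QStrat R A} {υ : J → Lift U} (hυ : IsUniversal υ)

/-- The morphism from the universal object that classifies a family of lifts. -/
def QStrat.IsUniversal.hom {B : QStrat R A} (ℓ : J → Lift B) : U ⟶ B := (hυ.exists_hom ℓ).choose

theorem QStrat.IsUniversal.map_hom {B : QStrat R A} (ℓ : J → Lift B) :
    (fun k => (υ k).map (hυ.hom ℓ)) = ℓ := funext (hυ.exists_hom ℓ).choose_spec

theorem QStrat.IsUniversal.hom_comp {B C : QStrat R A} (ℓ : J → Lift B) (f : B ⟶ C) :
    hυ.hom ℓ ≫ f = hυ.hom fun k => (ℓ k).map f := hυ.hom_ext _ _ fun k => by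
  rw [Lift.map_comp, congrFun (hυ.map_hom ℓ) k, congrFun (hυ.map_hom _) k]

/-- The contraction of the complex of functions of chains given by the universal object. -/
def chainContract (n : ℕ) : ChainFun R A J (n + 1) →ₗ[R⟦X⟧] ChainFun R A J n where
  -- The family of lifts to the first object is traded for an arrow from the universal object, which
  -- becomes the new first object and carries the universal family.
  toFun φ σ ℓ := φ (ComposableArrows.precomp σ (hυ.hom ℓ)) υ
  map_add' _ _ := rfl
  map_smul' _ _ := rfl

/-- Restrictions of a lengthened chain equal the expected chains as functors only propositionally.
The arrow to the last object and the lifts to the first one therefore have to be transported along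
heterogeneous equalities. -/
theorem chainFun_congr {n : ℕ} (φ : ChainFun R A J n) {σ σ' : ComposableArrows (QStrat R A) n}
    (h : σ = σ') {B : QStrat R A} (p : σ.obj (Fin.last n) ⟶ B) (p' : σ'.obj (Fin.last n) ⟶ B)
    (hp : HEq p p') (ℓ : J → Lift (σ.obj 0)) (ℓ' : J → Lift (σ'.obj 0)) (hℓ : HEq ℓ ℓ') :
    ringHom p (φ σ ℓ) = ringHom p' (φ σ' ℓ') := by
  subst h hp hℓ
  rfl

theorem heq_lift_map {n : ℕ} (σ : ComposableArrows (QStrat R A) n) {a : Fin (n + 1)} (ha : a = 0)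
    (h : 0 ⟶ a) (ℓ : J → Lift (σ.obj 0)) : HEq (fun k => (ℓ k).map (σ.map h)) ℓ := by
  subst ha
  rw [Subsingleton.elim h (𝟙 0), σ.map_id]
  simp

theorem chainContract_zero (n : ℕ) (φ : ChainFun R A J n) : chainContract hυ n (chainMap J
    (SimplexCategory.δ 0 : SimplexCategory.mk n ⟶ .mk (n + 1)) φ) = φ := by
  funext σ ℓ
  have hs (k : Fin (n + 1)) : (SimplexCategory.δ 0 : SimplexCategory.mk n ⟶
      .mk (n + 1)).toOrderHom k = k.succ := Fin.succAbove_zero_apply k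
  have e := precomp_restrict_zero (SimplexCategory.δ 0) hs σ (hυ.hom ℓ)
  have hl (a : Fin (n + 1 + 1)) (ha : a = Fin.succ 0) (h : 0 ⟶ a) :
      HEq (fun k => Lift.map (B := (ComposableArrows.precomp σ (hυ.hom ℓ)).obj 0)
        ((ComposableArrows.precomp σ (hυ.hom ℓ)).map h) (υ k)) ℓ := by
    subst ha
    have h1 := precomp_map_zero_succ σ (hυ.hom ℓ) 0
    have h2 : hυ.hom ℓ ≫ σ.map (homOfLE (Fin.zero_le 0)) = hυ.hom ℓ :=
      (congrArg (hυ.hom ℓ ≫ ·) (σ.map_id 0)).trans (Category.comp_id _)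
    exact heq_of_eq ((congrArg (fun (f : U ⟶ σ.obj 0) k => (υ k).map f) (h1.trans h2)).trans
      (hυ.map_hom ℓ))
  refine chainFun_congr φ e _ (𝟙 _) ?_ _ ℓ (hl _ (hs 0) _)
  refine (heq_map_fin (ComposableArrows.precomp σ (hυ.hom ℓ)) (hs (Fin.last n)) rfl _ (𝟙 _)).trans
    (heq_of_eq ((ComposableArrows.precomp σ (hυ.hom ℓ)).map_id _))

theorem chainContract_succ (n : ℕ) (i : Fin (n + 2)) (φ : ChainFun R A J (n + 1)) :
    chainContract hυ (n + 1) (chainMap J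
      (SimplexCategory.δ i.succ : SimplexCategory.mk (n + 1) ⟶ .mk (n + 1 + 1)) φ) =
    chainMap J (SimplexCategory.δ i : SimplexCategory.mk n ⟶ .mk (n + 1))
      (chainContract hυ n φ) := by
  funext σ ℓ
  have h0 : (SimplexCategory.δ i.succ : SimplexCategory.mk (n + 1) ⟶ .mk (n + 1 + 1)).toOrderHom 0 =
    0 := Fin.succ_succAbove_zero i
  have hs (k : Fin (n + 1)) : (SimplexCategory.δ i.succ : SimplexCategory.mk (n + 1) ⟶
      .mk (n + 1 + 1)).toOrderHom k.succ = ((SimplexCategory.δ i : SimplexCategory.mk n ⟶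
      .mk (n + 1)).toOrderHom k).succ := Fin.succ_succAbove_succ i k
  have e := precomp_restrict (SimplexCategory.δ i) (SimplexCategory.δ i.succ) h0 hs σ (hυ.hom ℓ)
  have e' := hυ.hom_comp ℓ (σ.map (homOfLE (Fin.zero_le ((SimplexCategory.δ i :
    SimplexCategory.mk n ⟶ .mk (n + 1)).toOrderHom 0))))
  refine chainFun_congr φ (e.trans (congrArg (ComposableArrows.precomp _) e')) _ _ ?_ _ _ ?_
  · exact heq_map_fin (ComposableArrows.precomp σ (hυ.hom ℓ)) (hs (Fin.last n)) rfl _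
      (homOfLE (Fin.succ_le_succ_iff.2 (Fin.le_last _)))
  · exact heq_lift_map (ComposableArrows.precomp σ (hυ.hom ℓ)) h0 _ υ

end Row
end QDeRham
end

/-! ### The double complex from the Čech complex to the homotopy limit -/

noncomputable section
namespace QDeRham

set_option linter.unusedSectionVars false

open QStrat Cosimplicial

section Row
variable {R A : Type u} [CommRing R] [CommRing A] [Algebra R A] [LambdaRing R] [LambdaRing A]
  {J : Type}

variable (R A) in
/-- A natural function as a function of chains. -/
def natChain (J : Type) : NatFun R A J →ₗ[R⟦X⟧] ChainFun R A J 0 where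
  toFun g σ ℓ := g.val (σ.obj 0) ℓ
  map_add' _ _ := rfl
  map_smul' _ _ := rfl

theorem chainD_natChain (g : NatFun R A J) : chainD R A J 0 (natChain R A J g) = 0 := by
  have h (θ : SimplexCategory.mk 0 ⟶ .mk 1) : chainMap J θ (natChain R A J g) =
      fun σ ℓ => ringHom (σ.map (homOfLE (Fin.zero_le (Fin.last 1)))) (g.val (σ.obj 0) ℓ) := by
    funext σ ℓ
    refine Eq.trans ?_ (ringHom_map_congr σ (homOfLE (Fin.zero_le (θ.toOrderHom 0)))
      (homOfLE (Fin.le_last _)) _ _).symm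
    exact congrArg (ringHom _) (NatFun.natural g _ ℓ)
  rw [chainD, Fin.sum_univ_two, LinearMap.add_apply, LinearMap.smul_apply, LinearMap.smul_apply,
    h, h]
  simp

variable {U : QStrat R A} {υ : J → Lift U} (hυ : IsUniversal υ)
include hυ

theorem exists_chainD_eq (n : ℕ) (φ : ChainFun R A J (n + 1)) (h : chainD R A J (n + 1) φ = 0) :
    ∃ ψ, chainD R A J n ψ = φ := by
  have h1 := altSum_degeneracy (Y := chainCosimplicial R A J) (fun n => chainContract hυ n)
    (fun n => chainContract_zero hυ n) (fun n => chainContract_succ hυ n) n φ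
  refine ⟨chainContract hυ n φ, Eq.trans ?_ h1⟩
  have h2 : chainContract hυ (n + 1) (chainD R A J (n + 1) φ) = 0 := by rw [h, map_zero]
  exact (add_zero _).symm.trans (congrArg (chainD R A J n (chainContract hυ n φ) + ·) h2.symm)

/-- The contraction shows that the value of a cocycle at a family of lifts is the image, under the
classifying morphism, of its value at the universal family. This is how natural functions arise. -/
theorem exists_natChain_eq (φ : ChainFun R A J 0) (h : chainD R A J 0 φ = 0) :
    ∃ g, natChain R A J g = φ := by
  have h1 := degeneracy_altSum_zero (Y := chainCosimplicial R A J) (fun n => chainContract hυ n)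
    (fun n => chainContract_zero hυ n) φ
  have h2 : chainContract hυ 0 (chainD R A J 0 φ) = 0 := by rw [h, map_zero]
  have h3 := sub_eq_zero.1 (h1.symm.trans h2)
  refine ⟨NatFun.ofUniversal hυ (φ (ComposableArrows.mk₀ U) υ), Eq.trans ?_ h3.symm⟩
  funext σ ℓ
  have h0 : (SimplexCategory.δ 1 : SimplexCategory.mk 0 ⟶ .mk 1).toOrderHom 0 = 0 := rfl
  let P := ComposableArrows.precomp σ (hυ.hom ℓ)
  have e : ComposableArrows.mk₀ U = chainRestrict (SimplexCategory.δ 1 :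
    SimplexCategory.mk 0 ⟶ .mk 1) P := ComposableArrows.ext₀ rfl
  refine chainFun_congr φ e (hυ.hom ℓ) _ ?_ υ _ (heq_lift_map P h0 _ υ).symm
  refine HEq.trans ?_ (heq_map_fin P (a := 0) rfl rfl (homOfLE (Fin.zero_le (Fin.last 1))) _)
  rfl

end Row

section Site
variable {R A : Type u} [CommRing R] [CommRing A] [Algebra R A] [LambdaRing R] [LambdaRing A]
  (F : Framing R A) [Module.Flat ℤ R] [Module.Flat R A] (hRA : IsLambdaHom (algebraMap R A))

variable (R A) in
/-- Cochains of the homotopy limit as functions which do not depend on the lifts. -/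
def constChain (J : Type) (n : ℕ) : (qDR R A).X n →ₗ[R⟦X⟧] ChainFun R A J n where
  toFun x σ _ := (show (σ.obj (Fin.last n) : QStrat R A) from x σ)
  map_add' _ _ := rfl
  map_smul' _ _ := rfl

variable (R A) in
/-- Evaluation of functions of chains at chosen lifts. -/
def evalChain (J : Type) (n : ℕ) : ChainFun R A J n →ₗ[R⟦X⟧] (qDR R A).X n where
  toFun φ := (fun σ => φ σ fun _ => Classical.arbitrary _ :
    (σ : ComposableArrows (QStrat R A) n) → σ.obj (Fin.last n))
  map_add' _ _ := rfl
  map_smul' _ _ := rfl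

theorem constChain_d (J : Type) (n : ℕ) (x : (qDR R A).X n) :
    constChain R A J (n + 1) (((qDR R A).d n (n + 1)).hom x) =
      chainD R A J n (constChain R A J n x) := by
  refine (congrArg (constChain R A J (n + 1))
    (complex_d (cosimplicialReplacement (QStrat.forget R A)) n x)).trans ?_
  exact map_altSum (Y := cosimplicialReplacement (QStrat.forget R A))
    (Y' := chainCosimplicial R A J) n (constChain R A J n) (constChain R A J (n + 1))
    (fun _ _ => rfl) x

theorem natChain_d (m : ℕ) (g : (cech R A).X m) :
    natChain R A (Fin (m + 2)) (((cech R A).d m (m + 1)).hom g) =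
      chainDel R A m 0 (natChain R A (Fin (m + 1)) g) := by
  refine (congrArg (natChain R A (Fin (m + 2))) (complex_d (cechCosimplicial R A) m g)).trans ?_
  exact map_altSum (Y := cechCosimplicial R A) (Y' := liftCosimplicial R A 0) m
    (natChain R A (Fin (m + 1))) (natChain R A (Fin (m + 2))) (fun _ _ => rfl) g

theorem chainDel_constChain (n : ℕ) (x : (qDR R A).X n) :
    chainDel R A 0 n (constChain R A (Fin 1) n x) = 0 := by
  rw [chainDel, Fin.sum_univ_two, LinearMap.add_apply, LinearMap.smul_apply, LinearMap.smul_apply]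
  change (1 : ℤ) • constChain R A (Fin 2) n x + (-1 : ℤ) ^ 1 • constChain R A (Fin 2) n x = 0
  simp

theorem natChain_injective (m : ℕ) : Function.Injective (natChain R A (Fin (m + 1))) := by
  intro g g' h
  ext B ℓ
  exact congrFun (congrFun h (ComposableArrows.mk₀ B)) ℓ

/-- The double complex of Čech cochains with values in functions of chains. -/
def siteResolution : BiResolution (cech R A) (qDR R A) where
  K m j := ChainFun R A (Fin (m + 1)) j
  del := chainDel R A
  D m j := chainD R A (Fin (m + 1)) j
  h := chainInsert R A
  ε := evalChain R A (Fin 1)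
  η := constChain R A (Fin 1)
  a m := natChain R A (Fin (m + 1))
  D_D m j := chainD_chainD (Fin (m + 1)) j
  del_del := chainDel_chainDel
  D_del := chainD_chainDel
  del_h := chainDel_chainInsert
  h_del := chainInsert_chainDel_zero
  ε_η _ _ := rfl
  η_d := constChain_d (Fin 1)
  del_η := chainDel_constChain
  a_d := natChain_d
  D_a _ := chainD_natChain
  a_injective := natChain_injective
  exact_zero m φ h := by
    obtain ⟨U, υ, hυ⟩ := F.exists_universal_fin hRA m
    exact exists_natChain_eq hυ φ h
  exact_succ m j φ h := by
    obtain ⟨U, υ, hυ⟩ := F.exists_universal_fin hRA m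
    exact exists_chainD_eq hυ j φ h

end Site
end QDeRham
end

/-! ### Cochains built from difference quotients -/

noncomputable section
namespace QDeRham

set_option linter.unusedSectionVars false

open QStrat Cosimplicial

namespace NatFun
variable {R A : Type u} [CommRing R] [CommRing A] [Algebra R A] [LambdaRing R] [LambdaRing A]
  {J J' : Type}

/-- The difference quotient `(ℓ_{o'}(b) - ℓ_o(b)) / (q - 1)`. -/
def diff (o o' : J) (b : A) : NatFun R A J :=
  (hat_sub_hat_dvd (R := R) (A := A) o' o (PowerSeries.C b)).choose

theorem τ_mul_diff (o o' : J) (b : A) : (τ * diff o o' b : NatFun R A J) =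
    hat o' (PowerSeries.C b) - hat o (PowerSeries.C b) :=
  (hat_sub_hat_dvd (R := R) (A := A) o' o (PowerSeries.C b)).choose_spec.symm

theorem pull_diff (θ : J → J') (o o' : J) (b : A) :
    pull θ (diff o o' b : NatFun R A J) = diff (θ o) (θ o') b := by
  apply τ_mul_cancel
  rw [τ_mul_diff, ← pull_τ θ, ← map_mul, τ_mul_diff, map_sub, pull_hat, pull_hat]

theorem diff_add_diff (o o' o'' : J) (b : A) :
    (diff o o' b + diff o' o'' b : NatFun R A J) = diff o o'' b := by
  apply τ_mul_cancel
  rw [mul_add, τ_mul_diff, τ_mul_diff, τ_mul_diff]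
  ring

theorem τ_dvd_hat_sub (o : J) (f : A⟦X⟧) : (τ : NatFun R A J) ∣
    hat o f - hat o (PowerSeries.C (PowerSeries.constantCoeff f)) := by
  obtain ⟨f', hf'⟩ : PowerSeries.X ∣ f - PowerSeries.C (PowerSeries.constantCoeff f) := by
    rw [PowerSeries.X_dvd_iff]; simp
  refine ⟨hat o f', ?_⟩
  have hX : PowerSeries.X * f' = (PowerSeries.X : R⟦X⟧) • f' := by
    rw [Algebra.smul_def, algebraMap_series_X]
  rw [← map_sub, hf', hX, map_smul, X_smul]

/-- The product of the difference quotients of `bₖ` with respect to the consecutive lifts. -/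
def cup : ∀ n : ℕ, (Fin n → A) → NatFun R A (Fin (n + 1))
  | 0, _ => 1
  | n + 1, b => diff 0 1 (b 0) * pull Fin.succ (cup n fun k => b k.succ)

theorem cup_succ (n : ℕ) (b : Fin (n + 1) → A) : (cup (n + 1) b : NatFun R A (Fin (n + 2))) =
    diff 0 1 (b 0) * pull Fin.succ (cup n fun k => b k.succ) := rfl

/-- The difference quotients are additive in the sense of `diff_add_diff`, that is, cocycles of
degree one, and `cup` is their product. In the induction the first two faces combine through this
additivity, and the others are a multiple of what the induction hypothesis provides. -/
theorem sum_pull_cup (n : ℕ) (b : Fin n → A) : ∑ i : Fin (n + 2), (-1 : ℤ) ^ (i : ℕ) •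
    pull (Fin.succAbove i) (cup n b : NatFun R A (Fin (n + 1))) = 0 := by
  induction n with
  | zero => simp [cup, Fin.sum_univ_two]
  | succ n ih =>
    have h := ih fun k => b k.succ
    rw [Fin.sum_univ_succ] at h
    have h' := congrArg (pull (R := R) (A := A) Fin.succ) h
    rw [map_add, map_zero, map_sum] at h'
    set P : NatFun R A (Fin (n + 1)) := cup n fun k => b k.succ
    have e0 : (Fin.succAbove 0 : Fin (n + 2) → Fin (n + 3)) = Fin.succ :=
      funext Fin.succAbove_zero_apply
    have h0 : pull (Fin.succAbove 0) (cup (n + 1) b) =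
        diff 1 2 (b 0) * pull (Fin.succ ∘ Fin.succ) P := by
      rw [cup_succ, map_mul, pull_diff, pull_pull, e0]
      rfl
    have h1 : pull (Fin.succAbove 1) (cup (n + 1) b) =
        diff 0 2 (b 0) * pull (Fin.succ ∘ Fin.succ) P := by
      have e1 : (Fin.succAbove (1 : Fin (n + 3)) ∘ Fin.succ : Fin (n + 1) → Fin (n + 3)) =
          Fin.succ ∘ Fin.succ := by
        funext k
        exact (Fin.succ_succAbove_succ 0 k).trans (by simp)
      rw [cup_succ, map_mul, pull_diff, pull_pull, e1]
      rfl
    have h2 (j : Fin (n + 1)) : pull (Fin.succAbove j.succ.succ) (cup (n + 1) b) =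
        diff 0 1 (b 0) * pull Fin.succ (pull (Fin.succAbove j.succ) P) := by
      have e2 : (Fin.succAbove j.succ.succ ∘ Fin.succ : Fin (n + 1) → Fin (n + 3)) =
          Fin.succ ∘ Fin.succAbove j.succ := funext fun k => Fin.succ_succAbove_succ _ _
      have e3 : Fin.succAbove j.succ.succ (1 : Fin (n + 2)) = 1 := by
        rw [← Fin.succ_zero_eq_one, Fin.succ_succAbove_succ, Fin.succ_succAbove_zero]
        rfl
      rw [cup_succ, map_mul, pull_diff, pull_pull, e2, e3, Fin.succ_succAbove_zero, pull_pull]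
    have h3 : ∑ j : Fin (n + 1), (-1 : ℤ) ^ ((j.succ : Fin (n + 2)) : ℕ) •
        pull Fin.succ (pull (Fin.succAbove j.succ) P) = -pull (Fin.succ ∘ Fin.succ) P := by
      have e4 : (Fin.succAbove 0 : Fin (n + 1) → Fin (n + 2)) = Fin.succ :=
        funext Fin.succAbove_zero_apply
      simp only [map_zsmul, pull_pull] at h' ⊢
      rw [e4] at h'
      refine eq_neg_of_add_eq_zero_right ?_
      simpa using h'
    rw [Fin.sum_univ_succ, Fin.sum_univ_succ]
    have h4 (j : Fin (n + 1)) : (-1 : ℤ) ^ ((j.succ.succ : Fin (n + 3)) : ℕ) •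
        pull (Fin.succAbove j.succ.succ) (cup (n + 1) b) = -(diff 0 1 (b 0) *
          ((-1 : ℤ) ^ ((j.succ : Fin (n + 2)) : ℕ) •
            pull Fin.succ (pull (Fin.succAbove j.succ) P))) := by
      rw [h2, mul_smul_comm, Fin.val_succ j.succ, pow_succ]
      simp
    simp only [h4]
    rw [Finset.sum_neg_distrib, ← Finset.mul_sum, h3, h0]
    have h5 := h1
    rw [← Fin.succ_zero_eq_one] at h5
    rw [h5, ← diff_add_diff 0 1 2]
    simp
    ring

/-- The product of the difference quotients is a cocycle. The coefficient `a` is evaluated at the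
lift of index zero, which only the first face changes, and two lifts of `a` agree modulo `q - 1`. -/
theorem τ_dvd_sum_pull (n : ℕ) (a : A) (b : Fin n → A) : (τ : NatFun R A (Fin (n + 2))) ∣
    ∑ i : Fin (n + 2), (-1 : ℤ) ^ (i : ℕ) •
      pull (Fin.succAbove i) (hat 0 (PowerSeries.C a) * cup n b) := by
  have h : ∑ i : Fin (n + 2), (-1 : ℤ) ^ (i : ℕ) •
      pull (Fin.succAbove i) (hat 0 (PowerSeries.C a) * cup n b) =
      ∑ i : Fin (n + 2), (hat (Fin.succAbove i 0) (PowerSeries.C a) - hat 0 (PowerSeries.C a)) *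
        (-1 : ℤ) ^ (i : ℕ) • pull (Fin.succAbove i) (cup n b : NatFun R A (Fin (n + 1))) := by
    simp only [sub_mul]
    rw [Finset.sum_sub_distrib, ← Finset.mul_sum, sum_pull_cup, mul_zero, sub_zero]
    refine Finset.sum_congr rfl fun i _ => ?_
    rw [map_mul, pull_hat, mul_smul_comm]
  rw [h]
  exact Finset.dvd_sum fun i _ => (hat_sub_hat_dvd _ _ _).mul_right _

end NatFun
end QDeRham
end

/-! ### The comparison maps modulo `q - 1` -/

noncomputable section
namespace QDeRham

set_option linter.unusedSectionVars false

open QStrat Cosimplicial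

namespace Framing
variable {R A : Type u} [CommRing R] [CommRing A] [Algebra R A] [LambdaRing R] [LambdaRing A]
  (F : Framing R A)

theorem repr_wedge_D (b : A) (j : ℕ) (ω : Forms R A j) (J : Koszul.Idx F.dim (j + 1)) :
    (F.basis.exteriorPower (j + 1)).repr (wedge (KaehlerDifferential.D R A b) j ω) J =
      ∑ i, ∑ I, Koszul.coef i I J • ((F.basis.exteriorPower j).repr ω I * F.hasse i 1 b) := by
  have h0 : wedge (KaehlerDifferential.D R A b) j ω = ∑ i, F.hasse i 1 b •
      wedge (KaehlerDifferential.D R A (F.x i)) j ω := by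
    apply Subtype.ext
    rw [AddSubmonoidClass.coe_finsetSum]
    change ExteriorAlgebra.ι A _ * ω.1 = ∑ i, F.hasse i 1 b • (ExteriorAlgebra.ι A _ * ω.1)
    rw [F.D_eq b, map_sum, Finset.sum_mul]
    refine Finset.sum_congr rfl fun i _ => ?_
    rw [map_smul, smul_mul_assoc]
  have h1 (i : Fin F.dim) : wedge (KaehlerDifferential.D R A (F.x i)) j ω =
      ∑ J', (∑ I, Koszul.coef i I J' • (F.basis.exteriorPower j).repr ω I) •
        F.basis.exteriorPower (j + 1) J' := by
    conv_lhs => rw [← (F.basis.exteriorPower j).sum_repr ω]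
    simp only [map_sum, map_smul, wedge_basis, Finset.smul_sum, Finset.sum_smul]
    rw [Finset.sum_comm]
    refine Finset.sum_congr rfl fun J' _ => Finset.sum_congr rfl fun I _ => ?_
    rw [smul_assoc, smul_comm]
  rw [h0, map_sum, Finsupp.finsetSum_apply]
  refine Finset.sum_congr rfl fun i _ => ?_
  rw [map_smul, Finsupp.smul_apply, h1, Module.Basis.repr_sum_self, smul_eq_mul, Finset.mul_sum]
  refine Finset.sum_congr rfl fun I _ => ?_
  rw [mul_smul_comm, mul_comm]

variable [Module.Flat ℤ R] [Module.Flat R A] (hRA : IsLambdaHom (algebraMap R A))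

theorem dOp_diff {J : Type} (i : Fin F.dim) (o : J) (b : A) :
    F.dOp hRA i (NatFun.diff none (some o) b : NatFun R A (Option J)) =
      -NatFun.hat none (F.qDer i (PowerSeries.C b)) := by
  apply NatFun.τ_mul_cancel
  have h : (NatFun.hat (some o) (PowerSeries.C b) : NatFun R A (Option J)) =
      NatFun.pull some (NatFun.hat o (PowerSeries.C b)) := (NatFun.pull_hat _ _ _).symm
  rw [← NatFun.X_smul, ← map_smul, NatFun.X_smul, NatFun.τ_mul_diff, map_sub, h, dOp_pull_some,
    dOp_hat, zero_sub, mul_neg]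

/-- Modulo `q - 1` the operator kills the factor `a`, whose `q`-difference is divisible by `q - 1`.
So the correction term of the twisted Leibniz rule disappears as well, and what remains is the
difference quotient, on which the operator gives minus the partial derivative of `b`. -/
theorem τ_dvd_dOp {J : Type} (i : Fin F.dim) (o : J) (a b : A) (c : NatFun R A J) :
    (NatFun.τ : NatFun R A (Option J)) ∣ F.dOp hRA i (NatFun.hat none (PowerSeries.C a) *
        (NatFun.diff none (some o) b * NatFun.pull some c)) +
      NatFun.hat none (PowerSeries.C (a * F.hasse i 1 b)) * NatFun.pull some c := by
  obtain ⟨y, hy⟩ := NatFun.τ_dvd_hat_sub (R := R) (none : Option J) (F.qDer i (PowerSeries.C b))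
  rw [constantCoeff_qDer, PowerSeries.constantCoeff_C] at hy
  have h : (NatFun.hat none (PowerSeries.C a) * (NatFun.diff none (some o) b * NatFun.pull some c) :
      NatFun R A (Option J)) = NatFun.pull some c *
        (NatFun.hat none (PowerSeries.C a) * NatFun.diff none (some o) b) := by ring
  rw [h, dOp_pull_some_mul, dOp_mul, dOp_diff, dOp_hat, sub_eq_iff_eq_add.1 hy, map_mul, map_mul]
  generalize (NatFun.hat none (F.qDer i (PowerSeries.C a)) : NatFun R A (Option J)) = u
  generalize (NatFun.hat none (PowerSeries.C (F.hasse i 1 b)) : NatFun R A (Option J)) = v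
  refine ⟨NatFun.pull some c * (-(NatFun.hat none (PowerSeries.C a) * y) +
    u * NatFun.diff none (some o) b - F.coordFun i * u * (NatFun.τ * y + v)), ?_⟩
  ring

/-- The cochain that represents the form `ω` times the product of the differentials of `bₖ`. -/
def symb (n j : ℕ) (ω : Forms R A j) (b : Fin n → A) : F.CechForms n j := fun I =>
  NatFun.hat none (PowerSeries.C ((F.basis.exteriorPower j).repr ω I)) *
    NatFun.pull some (NatFun.cup n b)

theorem pull_collapse_symb (n j : ℕ) (ω : Forms R A j) (b : Fin (n + 1) → A)
    (I : Koszul.Idx F.dim j) : NatFun.pull (collapse n) (F.symb (n + 1) j ω b I) =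
      NatFun.hat none (PowerSeries.C ((F.basis.exteriorPower j).repr ω I)) *
        (NatFun.diff none (some 0) (b 0) * NatFun.pull some (NatFun.cup n fun k => b k.succ)) := by
  rw [symb, NatFun.cup_succ, map_mul, map_mul, map_mul, NatFun.pull_hat, NatFun.pull_diff,
    NatFun.pull_diff, NatFun.pull_pull, NatFun.pull_pull]
  rfl

/-- This is one step `D h` of the iterated contraction modulo `q - 1`: the first difference quotient
is consumed, and minus its differential is multiplied to the form from the left. -/
theorem τ_dvd_cechD_symb (n j : ℕ) (ω : Forms R A j) (b : Fin (n + 1) → A)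
    (J : Koszul.Idx F.dim (j + 1)) : NatFun.τ ∣
      F.cechD hRA n j (fun I => NatFun.pull (collapse n) (F.symb (n + 1) j ω b I)) J +
        F.symb n (j + 1) (wedge (KaehlerDifferential.D R A (b 0)) j ω) (fun k => b k.succ) J := by
  rw [symb, repr_wedge_D, cechD, Koszul.D_apply]
  simp only [map_sum, map_zsmul, Finset.sum_mul, smul_mul_assoc]
  rw [← Finset.sum_add_distrib]
  refine Finset.dvd_sum fun i _ => ?_
  rw [← Finset.sum_add_distrib]
  refine Finset.dvd_sum fun I _ => ?_
  rw [← smul_add, pull_collapse_symb]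
  exact dvd_smul_of_dvd _ (F.τ_dvd_dOp hRA i 0 _ _ _)

theorem evalForm_contract_X_smul (n j N : ℕ) (e : j + n = N) (φ : F.CechForms n j) :
    evalForm R A N (ULift.down ((F.cechResolution hRA).contract n j N e
      ((PowerSeries.X : R⟦X⟧) • φ : F.CechForms n j))) = 0 := by
  have h : (F.cechResolution hRA).contract n j N e ((PowerSeries.X : R⟦X⟧) • φ : F.CechForms n j) =
    (PowerSeries.X : R⟦X⟧) • (F.cechResolution hRA).contract n j N e φ := map_smul _ _ _
  rw [h]
  refine (evalForm_smul (R := R) (A := A) N PowerSeries.X _).trans ?_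
  rw [PowerSeries.constantCoeff_X, zero_smul]

theorem evalForm_contract_congr (n j N : ℕ) (e : j + n = N) (φ ψ : F.CechForms n j)
    (h : ∀ I, NatFun.τ ∣ φ I - ψ I) :
    evalForm R A N (ULift.down ((F.cechResolution hRA).contract n j N e φ)) =
      evalForm R A N (ULift.down ((F.cechResolution hRA).contract n j N e ψ)) := by
  choose χ hχ using h
  have h1 : φ = ψ + (PowerSeries.X : R⟦X⟧) • (χ : F.CechForms n j) := by
    funext I
    rw [Pi.add_apply, Pi.smul_apply, NatFun.X_smul, ← hχ]
    ring
  have h2 : (F.cechResolution hRA).contract n j N e φ = (F.cechResolution hRA).contract n j N e ψ +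
      (F.cechResolution hRA).contract n j N e ((PowerSeries.X : R⟦X⟧) • χ : F.CechForms n j) :=
    (congrArg _ h1).trans (map_add _ _ _)
  rw [h2]
  refine (map_add (evalForm R A N) _ _).trans ?_
  rw [evalForm_contract_X_smul, add_zero]

theorem symb_neg (n j : ℕ) (ω : Forms R A j) (b : Fin n → A) (I : Koszul.Idx F.dim j) :
    F.symb n j (-ω) b I = -F.symb n j ω b I := by
  simp [symb]

/-- Each step of the contraction contributes a sign and puts the next differential in front of the
form, which accounts for the reversed order. The value does not involve the framing, although the
contraction does; this is the source of the independence. -/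
theorem evalForm_contract_symb (n j N : ℕ) (e : j + n = N) (ω : Forms R A j) (b : Fin n → A) :
    (evalForm R A N (ULift.down ((F.cechResolution hRA).contract n j N e (F.symb n j ω b))) :
        ExteriorAlgebra A Ω[A⁄R]) = (-1 : ℤ) ^ n •
      ((List.ofFn fun k => ExteriorAlgebra.ι A (KaehlerDifferential.D R A (b k))).reverse.prod *
        (ω : ExteriorAlgebra A Ω[A⁄R])) := by
  induction n generalizing j with
  | zero =>
    obtain rfl : j = N := e
    have h : evalForm R A j (ULift.down (F.evalCechForm hRA j (F.symb 0 j ω b))) = ω := by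
      change evalForm R A j ((F.formBasis j).equivFun.symm fun I =>
        evalSeries hRA (F.symb 0 j ω b I)) = ω
      have h1 (I : Koszul.Idx F.dim j) : F.symb 0 j ω b I =
          NatFun.hat none (PowerSeries.C ((F.basis.exteriorPower j).repr ω I)) := by
        rw [symb, NatFun.cup, map_one, mul_one]
      simp only [h1, evalSeries_hat]
      rw [Module.Basis.equivFun_symm_apply, map_sum]
      conv_rhs => rw [← (F.basis.exteriorPower j).sum_repr ω]
      refine Finset.sum_congr rfl fun I _ => ?_
      rw [formBasis_apply, smul_qtmul, mul_one, evalForm_qtmul, PowerSeries.constantCoeff_C]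
    refine (congrArg Subtype.val h).trans ?_
    simp
  | succ n ih =>
    refine (congrArg (fun y : ULift.{u + 1} (QForms R A N) => (evalForm R A N y.down).1)
      ((F.cechResolution hRA).contract_succ n j N e (F.symb (n + 1) j ω b))).trans ?_
    refine (congrArg Subtype.val (F.evalForm_contract_congr hRA n (j + 1) N (by omega) _
      (F.symb n (j + 1) (-wedge (KaehlerDifferential.D R A (b 0)) j ω) fun k => b k.succ)
      fun J => ?_)).trans ?_
    · rw [symb_neg, sub_neg_eq_add]
      exact F.τ_dvd_cechD_symb hRA n j ω b J
    · rw [ih, List.ofFn_succ, List.reverse_cons, List.prod_append, List.prod_singleton, pow_succ]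
      have h : ((-wedge (KaehlerDifferential.D R A (b 0)) j ω : Forms R A (j + 1)) :
          ExteriorAlgebra A Ω[A⁄R]) =
            -(ExteriorAlgebra.ι A (KaehlerDifferential.D R A (b 0)) * ω.1) := rfl
      rw [h, mul_neg, mul_assoc, smul_neg, mul_neg_one, neg_smul]

end Framing
end QDeRham
end

/-! ### The common section and the main theorem -/

noncomputable section
namespace QDeRham

set_option linter.unusedSectionVars false

open QStrat Cosimplicial

namespace Framing
variable {R A : Type u} [CommRing R] [CommRing A] [Algebra R A] [LambdaRing R] [LambdaRing A]
  (F : Framing R A) [Module.Flat ℤ R] [Module.Flat R A] (hRA : IsLambdaHom (algebraMap R A))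

/-- The comparison map modulo `q - 1`. -/
def evalComparison (n : ℕ) : NatFun R A (Fin (n + 1)) →+ Forms R A n where
  toFun x := evalForm R A n (ULift.down (((F.cechResolution hRA).comparison.f n).hom x))
  map_zero' := (congrArg (fun y : ULift.{u + 1} (QForms R A n) => evalForm R A n y.down)
    (map_zero ((F.cechResolution hRA).comparison.f n).hom)).trans (map_zero (evalForm R A n))
  map_add' x y := (congrArg (fun y : ULift.{u + 1} (QForms R A n) => evalForm R A n y.down)
    (map_add ((F.cechResolution hRA).comparison.f n).hom x y)).trans (map_add (evalForm R A n) _ _)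

/-- The coefficient `a` at the lift of index zero may be replaced modulo `q - 1` by `a` at the
further lift. The cochain then has the form treated in `evalForm_contract_symb`, with `a` regarded
as a form of degree zero. -/
theorem evalComparison_cup (n : ℕ) (a : A) (b : Fin n → A) :
    (F.evalComparison hRA n (NatFun.hat 0 (PowerSeries.C a) * NatFun.cup n b) :
        ExteriorAlgebra A Ω[A⁄R]) = (BiResolution.sgn n * (-1 : ℤ) ^ n) • a •
      (List.ofFn fun k => ExteriorAlgebra.ι A (KaehlerDifferential.D R A (b k))).reverse.prod := by
  let I₀ : Koszul.Idx F.dim 0 := ⟨∅, rfl⟩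
  let ω : Forms R A 0 := a • F.basis.exteriorPower 0 I₀
  have hω : (ω : ExteriorAlgebra A Ω[A⁄R]) = a • 1 := by
    change a • (F.basis.exteriorPower 0 I₀ : ExteriorAlgebra A Ω[A⁄R]) = _
    rw [exteriorPower.basis_apply, exteriorPower.ιMulti_family]
    simp [exteriorPower.ιMulti_apply_coe, ExteriorAlgebra.ιMulti_apply]
  have hI (I : Koszul.Idx F.dim 0) : (F.basis.exteriorPower 0).repr ω I = a := by
    obtain rfl : I = I₀ := Subtype.ext (Finset.card_eq_zero.1 I.2)
    simp [ω]
  have h1 : evalForm R A n (ULift.down ((F.cechResolution hRA).contract n 0 n (by omega)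
      ((F.cechResolution hRA).a n (NatFun.hat 0 (PowerSeries.C a) * NatFun.cup n b :
        NatFun R A (Fin (n + 1)))))) = _ :=
    F.evalForm_contract_congr hRA n 0 n (by omega) _ (F.symb n 0 ω b) fun I => by
      rw [symb, hI]
      change NatFun.τ ∣ NatFun.pull some (NatFun.hat 0 (PowerSeries.C a) * NatFun.cup n b) - _
      rw [map_mul, NatFun.pull_hat, ← sub_mul]
      exact (NatFun.hat_sub_hat_dvd _ _ _).mul_right _
  have h2 := (congrArg Subtype.val h1).trans (F.evalForm_contract_symb hRA n 0 n (by omega) ω b)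
  have h3 : F.evalComparison hRA n (NatFun.hat 0 (PowerSeries.C a) * NatFun.cup n b) =
      BiResolution.sgn n • evalForm R A n (ULift.down ((F.cechResolution hRA).contract n 0 n
        (by omega) ((F.cechResolution hRA).a n (NatFun.hat 0 (PowerSeries.C a) * NatFun.cup n b :
        NatFun R A (Fin (n + 1)))))) :=
    map_zsmul (evalForm R A n) _ _
  rw [h3]
  refine (congrArg (BiResolution.sgn n • ·) h2).trans ?_
  rw [hω, mul_smul_comm, mul_one, ← mul_smul]

/-- The cochain that represents a form modulo `q - 1`. -/
def formCochain (n : ℕ) : Forms R A n →+ NatFun R A (Fin (n + 1)) where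
  -- The indices are reversed by `k.rev` and the sign is inserted to compensate for the order and
  -- the sign in `evalComparison_cup`; the sign is its own inverse.
  toFun ω := ∑ I, (BiResolution.sgn n * (-1 : ℤ) ^ n) •
    (NatFun.hat 0 (PowerSeries.C ((F.basis.exteriorPower n).repr ω I)) *
      NatFun.cup n fun k => F.x (Set.powersetCard.ofFinEmbEquiv.symm I k.rev))
  map_zero' := by simp
  map_add' ω ω' := by simp [add_mul, Finset.sum_add_distrib]

theorem formCochain_apply (n : ℕ) (ω : Forms R A n) : F.formCochain n ω =
    ∑ I, (BiResolution.sgn n * (-1 : ℤ) ^ n) •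
    (NatFun.hat 0 (PowerSeries.C ((F.basis.exteriorPower n).repr ω I)) *
      NatFun.cup n fun k => F.x (Set.powersetCard.ofFinEmbEquiv.symm I k.rev)) := rfl

theorem formCochain_smul (n : ℕ) (r : R) (ω : Forms R A n) :
    F.formCochain n (r • ω) = (PowerSeries.C r : R⟦X⟧) • F.formCochain n ω := by
  rw [formCochain_apply, formCochain_apply, Finset.smul_sum]
  refine Finset.sum_congr rfl fun I _ => ?_
  have h : (PowerSeries.C ((F.basis.exteriorPower n).repr (r • ω) I) : A⟦X⟧) =
      (PowerSeries.C r : R⟦X⟧) • PowerSeries.C ((F.basis.exteriorPower n).repr ω I) := by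
    rw [← algebraMap_smul A r ω, map_smul, Algebra.smul_def, Finsupp.smul_apply, smul_eq_mul,
      map_mul]
    congr 1
    exact (PowerSeries.map_C (algebraMap R A) r).symm
  rw [h, map_smul, smul_mul_assoc, smul_comm]

theorem ofFn_rev_reverse {α : Type*} (n : ℕ) (f : Fin n → α) :
    (List.ofFn fun k => f k.rev).reverse = List.ofFn f := by
  apply List.ext_getElem <;> simp
  intro i h
  congr 1
  ext
  simp
  omega

/-- The cochain is written with the coordinates of `F`, but the comparison map of any other framing
`F'` is given on it by the same formula in terms of `a` and the differentials of `bₖ`. So one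
section serves all framings. -/
theorem evalComparison_formCochain (F' : Framing R A) (n : ℕ) (ω : Forms R A n) :
    F'.evalComparison hRA n (F.formCochain n ω) = ω := by
  rw [formCochain_apply, map_sum]
  conv_rhs => rw [← (F.basis.exteriorPower n).sum_repr ω]
  refine Finset.sum_congr rfl fun I _ => Subtype.ext ?_
  rw [map_zsmul]
  refine (congrArg (fun y : ExteriorAlgebra A Ω[A⁄R] => (BiResolution.sgn n * (-1 : ℤ) ^ n) • y)
    (F'.evalComparison_cup hRA n _ _)).trans ?_
  have h : (BiResolution.sgn n * (-1 : ℤ) ^ n) * (BiResolution.sgn n * (-1 : ℤ) ^ n) = 1 := by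
    rw [mul_mul_mul_comm, BiResolution.sgn_mul_self, one_mul, ← pow_add, ← two_mul, pow_mul]
    simp
  rw [ofFn_rev_reverse n fun k => ExteriorAlgebra.ι A (KaehlerDifferential.D R A
    (F.x (Set.powersetCard.ofFinEmbEquiv.symm I k))), smul_smul, h, one_smul]
  change _ = (F.basis.exteriorPower n).repr ω I • (F.basis.exteriorPower n I).1
  rw [exteriorPower.basis_apply, exteriorPower.ιMulti_family, exteriorPower.ιMulti_apply_coe,
    ExteriorAlgebra.ιMulti_apply]
  simp only [Function.comp_def, basis_apply]

theorem τ_dvd_altSum_formCochain (n : ℕ) (ω : Forms R A n) : (NatFun.τ : NatFun R A (Fin (n + 2))) ∣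
    ∑ i : Fin (n + 2), (-1 : ℤ) ^ (i : ℕ) • NatFun.pull (Fin.succAbove i) (F.formCochain n ω) := by
  simp only [formCochain_apply, map_sum, map_zsmul, Finset.smul_sum]
  rw [Finset.sum_comm]
  refine Finset.dvd_sum fun I _ => ?_
  simp only [smul_comm _ (BiResolution.sgn n * (-1 : ℤ) ^ n)]
  rw [← Finset.smul_sum]
  exact dvd_smul_of_dvd _ (NatFun.τ_dvd_sum_pull _ _ _)

/-- The common section of the comparison maps modulo `q - 1`, in degree `n`. -/
def hodgeSectionMap (n : ℕ) : ULift.{u + 1} (Forms R A n) →ₗ[R] (reduction.obj (cech R A)).X n where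
  toFun ω := redMk (cech R A) n (F.formCochain n ω.down)
  map_add' ω ω' := (congrArg (redMk (cech R A) n) (map_add (F.formCochain n) _ _)).trans
    (map_add (redMk (cech R A) n) _ _)
  map_smul' r ω := (congrArg (redMk (cech R A) n) (F.formCochain_smul n r ω.down)).trans
    ((redMk_smul (K := cech R A) n _ _).trans (by rw [PowerSeries.constantCoeff_C]; rfl))

/-- The common section of the comparison maps modulo `q - 1`, as a morphism in degree `n`. -/
def hodgeSectionHom (n : ℕ) : (hodge R A).X n ⟶ (reduction.obj (cech R A)).X n :=
  (ModuleCat.ofHom (F.hodgeSectionMap n) :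
    ModuleCat.of R (ULift.{u + 1} (Forms R A n)) ⟶ ModuleCat.of R ((reduction.obj (cech R A)).X n))

/-- The common section of the comparison maps modulo `q - 1`. -/
def hodgeSection : hodge R A ⟶ reduction.obj (cech R A) where
  f := F.hodgeSectionHom
  comm' i j hij := by
    obtain rfl : i + 1 = j := hij
    rw [hodge_d, Limits.zero_comp]
    ext ω
    obtain ⟨y, hy⟩ := F.τ_dvd_altSum_formCochain i ω.down
    have h : ((cech R A).d i (i + 1)).hom (F.formCochain i ω.down) =
        (PowerSeries.X : R⟦X⟧) • (y : NatFun R A (Fin (i + 2))) :=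
      (complex_d (cechCosimplicial R A) i _).trans ((altSum_apply (cechCosimplicial R A) i _).trans
        (hy.trans (NatFun.X_smul y).symm))
    refine (reduction_d_redMk (K := cech R A) i (i + 1) (F.formCochain i ω.down)).trans ?_
    exact (congrArg _ h).trans (redMk_X_smul _ _)

theorem hodgeSection_comp (F' : Framing R A) : F.hodgeSection ≫
    reduction.map (F'.cechResolution hRA).comparison ≫ F'.reduceHodge = 𝟙 _ := by
  ext n ω
  refine (congrArg (F'.reduceHodge.f n).hom (reduction_map_redMk (F'.cechResolution hRA).comparison
    n (F.formCochain n ω.down))).trans ?_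
  refine (F'.reduceHodge_redMk n _).trans ?_
  exact congrArg ULift.up (F.evalComparison_formCochain hRA F' n ω.down)

end Framing
end QDeRham
end

theorem mainTheorem3 {R A : Type u} [CommRing R] [CommRing A] [Algebra R A]
    [LambdaRing R] [LambdaRing A] (hRA : IsLambdaHom (algebraMap R A))
    [Module.Flat ℤ R] [Module.Flat R A] (hF : Nonempty (Framing R A)) :
    ∃ (e₀ : (derivedQ R).obj (reduction.obj (qDR R A)) ≅ (derivedQ R).obj (hodge R A))
      (e₁ : (derivedQ R).obj (reduction.obj (eta (qDR R A))) ≅ (derivedQ R).obj (deRham R A)),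
      ∀ F : Framing R A, ∃ (Z : F.Zigzag) (c : eta Z.L ⟶ F.qOmega),
        QuasiIso (etaMap Z.left) ∧ QuasiIso c ∧ c ≫ F.toEta = etaMap Z.right ∧
        QuasiIso (reduction.map Z.left) ∧
        QuasiIso (reduction.map Z.right ≫ F.reduceHodge) ∧
        QuasiIso (reduction.map (etaMap Z.left)) ∧
        QuasiIso (reduction.map c ≫ F.reduceDeRham) ∧
        (derivedQ R).map (reduction.map Z.left) ≫ e₀.hom =
          (derivedQ R).map (reduction.map Z.right ≫ F.reduceHodge) ∧
        (derivedQ R).map (reduction.map (etaMap Z.left)) ≫ e₁.hom =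
          (derivedQ R).map (reduction.map c ≫ F.reduceDeRham) := by
  obtain ⟨F₀⟩ := hF
  -- The framing `F₀` enters the map to `qDR` only through the proofs that the rows are exact. Its
  -- coordinates do enter the section, which is a section of the comparison maps of all framings.
  exact exists_comparison_of_section (torsionFree_cech R A) (siteResolution F₀ hRA).comparison
    (siteResolution F₀ hRA).quasiIso_comparison (fun F => (F.cechResolution hRA).comparison)
    (fun F => (F.cechResolution hRA).quasiIso_comparison) F₀.hodgeSection
    (fun F => F₀.hodgeSection_comp hRA F) F₀
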